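/- Let $X=\{a,b,c,d\}$, and let $\Gamma$ be the first Grigorchuk group, the group of permutations of $\{0,1\}^*$ (automorphisms of the binary rooted tree) generated under composition by $$a(0w)=1w,\ a(1w)=0w,\quad b(0w)=0a(w),\ b(1w)=1c(w),\quad c(0w)=0a(w),\ c(1w)=1d(w),\quad d(0w)=0w,\ d(1w)=1b(w),$$ all four fixing the empty string. Words over $X$ denote elements of $\Gamma$. Write $g=(g_0,g_1)$ if $g(0s)=0g_0(s)$ and $g(1s)=1g_1(s)$ for all $s$. For a word $w$, $\mathrm{red}(w)$ is its reduced form, obtained with $a^2=b^2=c^2=d^2=1$, $bc=cb=d$, $bd=db=c$, $cd=dc=b$. The word $w$ is even (odd) if it has an even (odd) number of letters $a$. Its components $w_0,w_1$ are the reduced words, read off letter by letter from $b=(a,c)$, $c=(a,d)$, $d=(1,b)$, $aba=(c,a)$, $aca=(d,a)$, $ada=(b,1)$, with $w=(w_0,w_1)$ if $w$ is even and $wa=(w_0,w_1)$ if $w$ is odd. The children of $w$ are $w_0,w_1$ if $w$ is even, and the single word $\mathrm{red}(w_0w_1)$ (written $w_0w_1$ below) if $w$ is odd. The splitting tree $T(w)$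 of a reduced word $w$ has root labelled $w$; it is a single vertex if $|w|\le1$, and otherwise the trees of the children of $w$ are attached to the root. Let $K$ be the normal closure of $abab$ in $\Gamma$. For $u,v\in\Gamma$ put $Q(u,v)=\{xK : u=x^{-1}vx\}\subseteq\Gamma/K$. For $S\subseteq\Gamma/K\times\Gamma/K$ put $\mathrm{lift}(S)=\{gK : g=(g_0,g_1),\ g,g_0,g_1\in\Gamma,\ (g_0K,g_1K)\in S\}$. **The algorithm.** Input: words $u,v$ over $X$. Reduce them; build $T(u)$ and $T(v)$; let $W$ be the set of all labels of both trees together with $\varepsilon,a,b,c,d$; sort $W$ in ascending shortlex order ($a<b<c<d$). Maintain, for every processed $w\in W$, a representative $w^*\in W$ and a set $Q(w,w^*)$, and a table whose rows are lists of representatives, labelled with pairs of words or with single words. Initially $\varepsilon,a,b,c,d$ are processed, each being its own representative with its (precomputed) set $Q(w,w)$, and the rows are $(\varepsilon,\varepsilon)\colon\varepsilon$; $\ \varepsilon\colon a$; $\ (a,c)\colon b$; $\ (a,d)\colon c$; $\ (\varepsilon,b)\colon d$. Go through the list and process each unprocessed $w$, after first processing in the same way those of its children that are unprocessed. For processed $x,y$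 set $Q(x,y)=Q(y,y^*)^{-1}Q(x,x^*)$ if $x^*=y^*$, and $Q(x,y)=\emptyset$ otherwise. To process $w$, take the row labelled $(w_0^*,w_1^*)$ or, if there is none, $(w_1^*,w_0^*)$ when $w$ is even, and the row labelled $(w_0w_1)^*$ when $w$ is odd; for the entries $w'$ of that row compute $$Q(w,w')=\mathrm{lift}[Q(w_0,w_0')\times Q(w_1,w_1')]\ \cup\ \mathrm{lift}[Q(w_1,w_0')\times Q(w_0,w_1')]\,a$$ if $w$ is even, and $$Q(w,w')=\mathrm{lift}\{(g,w_1'gw_1^{-1}) : g\in Q(w_0w_1,w_0'w_1')\}\ \cup\ \mathrm{lift}\{(gw_1^{-1},(w_0')^{-1}g) : g\in Q(w_0w_1,w_0'w_1')\}\,a$$ if $w$ is odd. If $Q(w,w')\neq\emptyset$ for some entry $w'$, set $w^*=w'$. Otherwise set $w^*=w$, compute $Q(w,w)$ by the same formula, and add $w$ to the row (to a new row labelled $(w_0^*,w_1^*)$, respectively $(w_0w_1)^*$, if there was none). At the end answer YES if $\mathrm{red}(u)^*=\mathrm{red}(v)^*$ and NO otherwise. **Proposition.** The algorithm is correct and runs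 in time $O(|u|+|v|)$. Precisely: 1. There are a random access machine program $P$ and a constant $C$ such that for all words $u,v$ the splitting trees $T(\mathrm{red}(u))$ and $T(\mathrm{red}(v))$ exist as finite trees, and $P$, started on $(u,v)$, halts after at most $C\,(|u|+|v|+1)$ steps, having output the data computed by the algorithm, namely for each $w\in W$ in shortlex order the word $w$, the coset $wK$, the children of $w$, the representative $w^*$ and the set $Q(w,w^*)$ (cosets of $K$ and sets of cosets being written by means of a fixed injective numbering), together with the algorithm's answer. Moreover every $w\in W$ gets a representative $w^*\in W$ conjugate to $w$ in $\Gamma$, the computed set is the true $Q(w,w^*)$, two words of $W$ get the same representative if and only if they are conjugate in $\Gamma$, and the answer is YES if and only if $u$ and $v$ are conjugate in $\Gamma$. 2. In particular, the conjugacy problem (given words $u,v$, are they conjugate in $\Gamma$?) is decidable in time $O(|u|+|v|)$, and the word problem (given a word $w$, is $w=1$ in $\Gamma$?) is decidable in time $O(|w|)$. Here a random access machine is a unit-cost machine with finitely many registers, indirectly addressed memory, an input tape and an output tape, whose only operations on numbers are loading a constant, copying, adding or subtracting one, and testing for equality. -/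

import Mathlib

open scoped Pointwise

/-! ## Random access machines

A unit-cost random access machine: finitely many named registers, an indirectly addressed memory,
a read-only input tape and a write-only output tape.  The only arithmetic is adding or subtracting
one, so after `t` steps every stored number exceeds those in the program and the input by at
most `t`: the unit-cost measure cannot be abused through long numbers. -/

namespace RAM

/-- Programs. Registers are named by natural numbers. -/
inductive Prog where
  | const (r k : ℕ)
  | move (r s : ℕ)
  | succ (r : ℕ)
  | pred (r : ℕ)
  | load (r s : ℕ)
  | store (r s : ℕ)
  | read (r : ℕ)
  | write (r : ℕ)
  | skip
  | seq (p q : Prog)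
  | ifEq (r s : ℕ) (p q : Prog)
  | whileNe (r s : ℕ) (p : Prog)

/-- Configurations: registers, memory, the unread part of the input, the output so far. -/
structure State where
  reg : ℕ → ℕ
  mem : ℕ → ℕ
  inp : List ℕ
  out : List ℕ

/-- The initial configuration on an input: all registers and memory cells are `0`. -/
def State.init (x : List ℕ) : State := ⟨fun _ => 0, fun _ => 0, x, []⟩

/-- Assignment to a register. -/
def State.set (σ : State) (r k : ℕ) : State := { σ with reg := Function.update σ.reg r k }

/-- `Exec p σ τ t`: started in `σ`, the program `p` halts in `τ` after exactly `t` steps.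
Every elementary instruction and every test costs one step. Reading beyond the end of the input
gives `0`. -/
inductive Exec : Prog → State → State → ℕ → Prop
  | const (r k : ℕ) (σ : State) : Exec (.const r k) σ (σ.set r k) 1
  | move (r s : ℕ) (σ : State) : Exec (.move r s) σ (σ.set r (σ.reg s)) 1
  | succ (r : ℕ) (σ : State) : Exec (.succ r) σ (σ.set r (σ.reg r + 1)) 1
  | pred (r : ℕ) (σ : State) : Exec (.pred r) σ (σ.set r (σ.reg r - 1)) 1
  | load (r s : ℕ) (σ : State) : Exec (.load r s) σ (σ.set r (σ.mem (σ.reg s))) 1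
  | store (r s : ℕ) (σ : State) :
      Exec (.store r s) σ { σ with mem := Function.update σ.mem (σ.reg r) (σ.reg s) } 1
  | read (r : ℕ) (σ : State) :
      Exec (.read r) σ { σ.set r (σ.inp.headD 0) with inp := σ.inp.tail } 1
  | write (r : ℕ) (σ : State) : Exec (.write r) σ { σ with out := σ.out ++ [σ.reg r] } 1
  | skip (σ : State) : Exec .skip σ σ 1
  | seq {p q : Prog} {σ τ υ : State} {t t' : ℕ} :
      Exec p σ τ t → Exec q τ υ t' → Exec (.seq p q) σ υ (t + t')
  | ifTrue {r s : ℕ} {p q : Prog} {σ τ : State} {t : ℕ} :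
      σ.reg r = σ.reg s → Exec p σ τ t → Exec (.ifEq r s p q) σ τ (t + 1)
  | ifFalse {r s : ℕ} {p q : Prog} {σ τ : State} {t : ℕ} :
      σ.reg r ≠ σ.reg s → Exec q σ τ t → Exec (.ifEq r s p q) σ τ (t + 1)
  | whileDone {r s : ℕ} {p : Prog} {σ : State} :
      σ.reg r = σ.reg s → Exec (.whileNe r s p) σ σ 1
  | whileStep {r s : ℕ} {p : Prog} {σ τ υ : State} {t t' : ℕ} :
      σ.reg r ≠ σ.reg s → Exec p σ τ t → Exec (.whileNe r s p) τ υ t' →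
      Exec (.whileNe r s p) σ υ (t + t' + 1)

/-- The set of instances `x` with `A x`, written on the input tape as `enc x`, is decided in time
`O(size x)`: the answer (`1` for yes, `0` for no) is left in register `0`. -/
def LinearTimeDecidable {α : Type} (enc : α → List ℕ) (size : α → ℕ) (A : α → Prop) : Prop :=
  ∃ (P : Prog) (C : ℕ), ∀ x : α, ∃ (σ : State) (t : ℕ),
    Exec P (State.init (enc x)) σ t ∧ t ≤ C * (size x + 1) ∧
      (A x → σ.reg 0 = 1) ∧ (¬ A x → σ.reg 0 = 0)

end RAM

namespace Grigorchuk

/-! ## The group -/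

/-- The alphabet `X = {a, b, c, d}`. -/
inductive Letter where
  | a | b | c | d
  deriving DecidableEq

/-- Words over `X`. -/
abbrev Word := List Letter

/-- The action of the generators on the vertices `{0,1}*` of the binary tree
(`false` is `0`, `true` is `1`). -/
def act : Letter → List Bool → List Bool
  | _, [] => []
  | .a, i :: s => (!i) :: s
  | .b, false :: s => false :: act .a s
  | .b, true :: s => true :: act .c s
  | .c, false :: s => false :: act .a s
  | .c, true :: s => true :: act .d s
  | .d, false :: s => false :: s
  | .d, true :: s => true :: act .b s

theorem act_act (x : Letter) (s : List Bool) : act x (act x s) = s := by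
  induction s generalizing x with
  | nil => cases x <;> simp [act]
  | cons i s ih => cases x <;> cases i <;> simp [act, ih]

/-- The generators as permutations of the vertices. -/
def gen (x : Letter) : Equiv.Perm (List Bool) where
  toFun := act x
  invFun := act x
  left_inv := act_act x
  right_inv := act_act x

/-- The first Grigorchuk group `Γ`, generated by `a, b, c, d` under composition. -/
abbrev Γ : Type := Subgroup.closure (Set.range gen)

/-- The generators as elements of `Γ`. -/
def genΓ (x : Letter) : Γ := ⟨gen x, Subgroup.subset_closure ⟨x, rfl⟩⟩

/-- The element of `Γ` represented by a word. -/
def ev (w : Word) : Γ := (w.map genΓ).prod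

/-- The normal closure `K` of `abab` in `Γ`. -/
abbrev K : Subgroup Γ := Subgroup.normalClosure {ev [.a, .b, .a, .b]}

/-- `g ∈ St(1)` with `ψ(g) = (g₀, g₁)`. -/
def IsSplit (g g₀ g₁ : Γ) : Prop :=
  ∀ s : List Bool, g.1 (false :: s) = false :: g₀.1 s ∧ g.1 (true :: s) = true :: g₁.1 s

/-- `lift(S) = {wK | w = (w₀, w₁), (w₀K, w₁K) ∈ S}`. -/
def lift (S : Set ((Γ ⧸ K) × (Γ ⧸ K))) : Set (Γ ⧸ K) :=
  {x | ∃ g g₀ g₁ : Γ, IsSplit g g₀ g₁ ∧ ((g₀ : Γ ⧸ K), (g₁ : Γ ⧸ K)) ∈ S ∧ x = (g : Γ ⧸ K)}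

/-- `Q(u, v) = {xK | u = x⁻¹ v x}`. -/
def Q (u v : Γ) : Set (Γ ⧸ K) :=
  {y | ∃ x : Γ, u = x⁻¹ * v * x ∧ y = (x : Γ ⧸ K)}

/-! ## Reduced words and splitting -/

/-- The product in `Γ` of two distinct letters among `b, c, d`; `none` if one of them is `a` or
they are equal. -/
def third : Letter → Letter → Option Letter
  | .b, .c => some .d
  | .c, .b => some .d
  | .b, .d => some .c
  | .d, .b => some .c
  | .c, .d => some .b
  | .d, .c => some .b
  | _, _ => none

/-- Put a letter in front of a reduced word and reduce. -/
def redCons (x : Letter) : Word → Word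
  | [] => [x]
  | y :: w => if x = y then w else
      match third x y with
      | some z => z :: w
      | none => x :: y :: w

/-- The reduced word `red(w)`. -/
def red (w : Word) : Word := w.foldr redCons []

/-- The number of occurrences of `a` is even. -/
def EvenA (w : Word) : Prop := Even (w.count Letter.a)

instance (w : Word) : Decidable (EvenA w) := inferInstanceAs (Decidable (Even _))

/-- `ψ(b) = (a, c)`, `ψ(c) = (a, d)`, `ψ(d) = (1, b)`. -/
def sec : Letter → Word × Word
  | .a => ([], [])
  | .b => ([.a], [.c])
  | .c => ([.a], [.d])
  | .d => ([], [.b])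

/-- The (unreduced) components of a word. The flag tells whether the number of letters `a` read
so far is odd; if it is, a letter `x` stands for `axa`, whose components are swapped. A final
letter `a` contributes nothing, so that a word `w` with an odd number of letters `a` has the
same components as `wa`. -/
def phi : Bool → Word → Word × Word
  | _, [] => ([], [])
  | p, .a :: w => phi (!p) w
  | p, x :: w =>
      ((if p then (sec x).2 else (sec x).1) ++ (phi p w).1,
       (if p then (sec x).1 else (sec x).2) ++ (phi p w).2)

/-- `w₀`, where `w = (w₀, w₁)` or `w = (w₀, w₁)a`. -/
def comp₀ (w : Word) : Word := red (phi false w).1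

/-- `w₁`, where `w = (w₀, w₁)` or `w = (w₀, w₁)a`. -/
def comp₁ (w : Word) : Word := red (phi false w).2

/-- The reduced form of `w₀w₁`. -/
def comp₀₁ (w : Word) : Word := red (comp₀ w ++ comp₁ w)

/-- The words into which a word splits. -/
def children (w : Word) : List Word := if EvenA w then [comp₀ w, comp₁ w] else [comp₀₁ w]

/-- Splitting trees: a term of this type is the (finite) splitting tree `T(w)`. -/
inductive SplittingTree : Word → Type
  | leaf (w : Word) (h : w.length ≤ 1) : SplittingTree w
  | even (w : Word) (h : 1 < w.length) (he : EvenA w)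
      (t₀ : SplittingTree (comp₀ w)) (t₁ : SplittingTree (comp₁ w)) : SplittingTree w
  | odd (w : Word) (h : 1 < w.length) (ho : ¬ EvenA w)
      (t : SplittingTree (comp₀₁ w)) : SplittingTree w

/-- The labels of the vertices of a splitting tree. -/
def SplittingTree.labels : {w : Word} → SplittingTree w → Set Word
  | _, .leaf w _ => {w}
  | _, .even w _ _ t₀ t₁ => {w} ∪ t₀.labels ∪ t₁.labels
  | _, .odd w _ _ t => {w} ∪ t.labels

/-! ## The table of representatives -/

/-- Labels of rows: a pair `(w₀*, w₁*)`, or a single word `(w₀w₁)*`. -/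
inductive RowLabel where
  | pair (r₀ r₁ : Word)
  | single (r : Word)
  deriving DecidableEq

/-- The data of the algorithm: `rep w = some w*` if `w` has been processed (and `none` otherwise),
`q w` is the computed set `Q(w, w*)`, and `rows ℓ` is the list of representatives in the row
labelled `ℓ` (empty if there is no such row). -/
structure Table where
  rep : Word → Option Word
  q : Word → Set (Γ ⧸ K)
  rows : RowLabel → List Word

open Classical in
/-- The initial table, for the words `ε, a, b, c, d`, with their precomputed sets `Q(w, w)`. -/
noncomputable def Table.initial : Table where
  rep w := if w.length ≤ 1 then some w else none
  q w := if w.length ≤ 1 then Q (ev w) (ev w) else ∅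
  rows
    | .pair [] [] => [[]]
    | .single [] => [[.a]]
    | .pair [.a] [.c] => [[.b]]
    | .pair [.a] [.d] => [[.c]]
    | .pair [] [.b] => [[.d]]
    | _ => []

/-- `Q(x, y)` for processed words, as `Q(y, y*)⁻¹ Q(x, x*)` if `x* = y*`; it is empty
otherwise. -/
noncomputable def Table.qOf (S : Table) (x y : Word) : Set (Γ ⧸ K) :=
  if S.rep x = S.rep y then (S.q y)⁻¹ * S.q x else ∅

/-- The coset `wK`. -/
def coset (w : Word) : Γ ⧸ K := (ev w : Γ ⧸ K)

/-- `Q(w, w')` computed from the children of `w` and `w'` (two words of the same parity). -/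
noncomputable def Table.qLift (S : Table) (w w' : Word) : Set (Γ ⧸ K) :=
  if EvenA w then
    lift (S.qOf (comp₀ w) (comp₀ w') ×ˢ S.qOf (comp₁ w) (comp₁ w')) ∪
    lift (S.qOf (comp₁ w) (comp₀ w') ×ˢ S.qOf (comp₀ w) (comp₁ w')) * {coset [.a]}
  else
    lift ((fun g => (g, coset (comp₁ w') * g * (coset (comp₁ w))⁻¹)) ''
      S.qOf (comp₀₁ w) (comp₀₁ w')) ∪
    lift ((fun g => (g * (coset (comp₁ w))⁻¹, (coset (comp₀ w'))⁻¹ * g)) ''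
      S.qOf (comp₀₁ w) (comp₀₁ w')) * {coset [.a]}

/-- The representative of a processed word. -/
def Table.repD (S : Table) (w : Word) : Word := (S.rep w).getD []

/-- The label of the row for a word whose children have been processed. For an even word it is
`(w₀*, w₁*)`, unless only the row `(w₁*, w₀*)` is present. -/
def Table.rowOf (S : Table) (w : Word) : RowLabel :=
  if EvenA w then
    let r₀ := S.repD (comp₀ w)
    let r₁ := S.repD (comp₁ w)
    if S.rows (.pair r₀ r₁) = [] ∧ S.rows (.pair r₁ r₀) ≠ [] then .pair r₁ r₀ else .pair r₀ r₁
  else .single (S.repD (comp₀₁ w))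

open Classical in
/-- Process a word whose children have been processed: look in its row for a `w'` with
`Q(w, w') ≠ ∅`; if there is one, then it becomes `w*`, otherwise `w` becomes a new
representative in that row. -/
noncomputable def Table.step (S : Table) (w : Word) : Table :=
  match (S.rows (S.rowOf w)).find? (fun w' => decide (S.qLift w w').Nonempty) with
  | some w' =>
      { S with
        rep := Function.update S.rep w (some w')
        q := Function.update S.q w (S.qLift w w') }
  | none =>
      { rep := Function.update S.rep w (some w)
        q := Function.update S.q w (S.qLift w w)
        rows := Function.update S.rows (S.rowOf w) (S.rows (S.rowOf w) ++ [w]) }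

/-- Process a word if this has not been done, after its unprocessed children, down to depth
`n`. -/
noncomputable def Table.visit : ℕ → Word → Table → Table
  | 0, _, S => S
  | n + 1, w, S =>
      if (S.rep w).isSome then S
      else ((children w).foldl (fun S' x => Table.visit n x S') S).step w

/-- Process a list of words from left to right. When the list is closed under children and in
shortlex order, a word `w` can have an unprocessed child `w'`, and that an unprocessed child
`w''`, but the children of `w''` are shorter than `w`, hence processed; so depth `3` suffices. -/
noncomputable def fillTable (L : List Word) : Table :=
  L.foldl (fun S w => Table.visit 3 w S) Table.initial

/-! ## Input and output -/

/-- Codes of the letters; they also give the order `a < b < c < d`. -/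
def Letter.code : Letter → ℕ
  | .a => 1
  | .b => 2
  | .c => 3
  | .d => 4

/-- The strict shortlex order. -/
def ShortlexLT : Word → Word → Prop := List.Shortlex (fun x y => x.code < y.code)

/-- A word followed by the end mark `0`. -/
def encodeWord (w : Word) : List ℕ := w.map Letter.code ++ [0]

/-- A pair of words on the input tape: `u`, the mark `0`, then `v`. -/
def encodePair (p : Word × Word) : List ℕ := encodeWord p.1 ++ p.2.map Letter.code

/-- `L` is the list of the labels of `T(u)` and `T(v)` and of `ε, a, b, c, d`, without
repetitions, in ascending shortlex order. -/
def IsSortedLabelList {u v : Word} (Tu : SplittingTree u) (Tv : SplittingTree v)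
    (L : List Word) : Prop :=
  L.Pairwise ShortlexLT ∧ ∀ w, w ∈ L ↔ w ∈ Tu.labels ∨ w ∈ Tv.labels ∨ w.length ≤ 1

/-- The data computed for one word: `w`, `wK`, its children, `w*` and `Q(w, w*)`. Here `κ` and `χ`
are codes for cosets and for sets of cosets. -/
def recordOf (κ : Γ ⧸ K → ℕ) (χ : Set (Γ ⧸ K) → ℕ) (S : Table) (w : Word) : List ℕ :=
  encodeWord w ++ [κ (coset w)] ++ (children w).flatMap encodeWord ++
    encodeWord (S.repD w) ++ [χ (S.q w)]

/-- The data computed by the algorithm for all words of a list. -/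
def record (κ : Γ ⧸ K → ℕ) (χ : Set (Γ ⧸ K) → ℕ) (S : Table) (L : List Word) : List ℕ :=
  L.flatMap (recordOf κ χ S)

end Grigorchuk

/-!
**Conjugation modulo `K`.** The subgroup `K` has finite index (`finite_quotient`) and contains
`K × K`: all pairs of elements of `K` are the components of an element of `K`
(`exists_isSplit_K`). Hence the coset `gK` of an element `g = (g₀, g₁)` is determined by `g₀K` and
`g₁K`, and comparing components in `u = x⁻¹vx` expresses `Q(u, v)` by the sets of the components of
`u` and `v`, with one case for `x` and one for `xa` being in the stabilizer of the first level
(`Q_even`, `Q_odd`). This needs only finitely much information, and `u` and `v` are conjugate if and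
only if `Q(u, v)` is not empty (`Q_nonempty`).

**Correctness.** A table is good (`Table.Good`) if, for all words processed so far, the sets are the
true ones and conjugate words have the same representative. Processing a word whose children have
been processed keeps it good (`Table.Good.step`): the representatives of its children, which are
conjugacy invariants of the word up to order, say in which row to look for a conjugate word. The
rows have bounded length, since a representative is determined within its row by its signature
(`Table.Good.signature_injOn`), a piece of information with finitely many possible values. So a
word is processed by a bounded number of set operations, all of them table lookups.

**Size of the trees.** The children of an even word have about half its length. The child of an
odd word is never longer than the word, but it may be as long. In the case of even length, however,
the weight in which `a, b, c, d` count `3, 3, 2, 1` contracts by the factor `5/6`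
(`Reduced.wt_comp₀₁_le`). Therefore three steps down in a splitting tree the words are shorter or
letters (`Reduced.depth`), and the lengths of all labels of the tree add up to `O(|w|)`
(`exists_splittingTree_cells_le`). When the words are processed in shortlex order, it follows that
a recursion of depth three is enough to process a word after its children (`Prefix.visit`). This
makes the call stack a fixed number of registers.

**Linear time.** The algorithm is written for a machine whose registers contain words and which
can put a letter in front of a word, remove it, copy and compare words, and use arrays indexed by
words, each in one step. It is compiled to a random access machine with constant overhead
(`WProg.compile_spec`). The memory holds a trie of all words that have come up; a word is
represented by the address of its node, and an array is a field of the nodes. On the word machine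
all steps are direct. A row is a sequence of array cells, addressed by a word that encodes its label
(`key`) with a counter in front. The labels are put into shortlex order without comparing them, by a
breadth-first search in the tree of their initial segments (`reaches_sortP`). The time of each phase
is bounded by the total length of the labels; the five phases `reaches_inputP`, `reaches_collectP`,
`reaches_sortP`, `reaches_fillP`, `reaches_outputP` are put together in `exec_conjugacyP_spec`. The
word problem is the case in which the second word is empty, since only the neutral element is
conjugate to it.
-/

namespace Grigorchuk

/-! ### Words as elements of the group -/

@[simp] theorem ev_nil : ev [] = 1 := rfl

@[simp] theorem ev_cons (x : Letter) (w : Word) : ev (x :: w) = genΓ x * ev w := by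
  simp [ev]

theorem ev_append (v w : Word) : ev (v ++ w) = ev v * ev w := by
  simp [ev]

theorem genΓ_mul_self (x : Letter) : genΓ x * genΓ x = 1 :=
  Subtype.ext (Equiv.ext fun s => act_act x s)

theorem genΓ_mul_self_assoc (x : Letter) (g : Γ) : genΓ x * (genΓ x * g) = g := by
  rw [← mul_assoc, genΓ_mul_self, one_mul]

theorem genΓ_inv (x : Letter) : (genΓ x)⁻¹ = genΓ x :=
  inv_eq_of_mul_eq_one_left (genΓ_mul_self x)

theorem act_third {x y z : Letter} (h : third x y = some z) (s : List Bool) :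
    act x (act y s) = act z s := by
  induction s generalizing x y z with
  | nil => cases x <;> cases y <;> simp_all [act]
  | cons i s ih =>
    cases x <;> cases y <;> simp only [third, Option.some.injEq, reduceCtorEq] at h <;> subst h <;>
      cases i <;> simp [act, act_act] <;> exact ih rfl

theorem genΓ_third {x y z : Letter} (h : third x y = some z) : genΓ x * genΓ y = genΓ z :=
  Subtype.ext (Equiv.ext fun s => act_third h s)

theorem ev_redCons (x : Letter) (w : Word) : ev (redCons x w) = genΓ x * ev w := by
  cases w with
  | nil => simp [redCons]
  | cons y w =>
    simp only [redCons]
    split_ifs with h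
    · rw [h, ev_cons, genΓ_mul_self_assoc]
    · split
      · rename_i z hz
        rw [ev_cons, ev_cons, ← mul_assoc, genΓ_third hz]
      · simp

theorem ev_red (w : Word) : ev (red w) = ev w := by
  induction w with
  | nil => rfl
  | cons x w ih =>
    change ev (redCons x (red w)) = _
    rw [ev_redCons, ih, ev_cons]

theorem ev_reverse (w : Word) : ev w.reverse = (ev w)⁻¹ := by
  induction w with
  | nil => simp
  | cons x w ih => simp [ev_append, ih, genΓ_inv]

theorem exists_word (g : Γ) : ∃ w, ev w = g := by
  obtain ⟨g, hg⟩ := g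
  suffices h : ∃ w, (ev w).1 = g from h.imp fun w hw => Subtype.ext hw
  induction hg using Subgroup.closure_induction with
  | mem x hx =>
    obtain ⟨y, rfl⟩ := hx
    exact ⟨[y], by simp [genΓ]⟩
  | one => exact ⟨[], rfl⟩
  | mul x y _ _ hx hy =>
    obtain ⟨v, rfl⟩ := hx
    obtain ⟨w, rfl⟩ := hy
    exact ⟨v ++ w, by rw [ev_append]; rfl⟩
  | inv x _ hx =>
    obtain ⟨v, rfl⟩ := hx
    exact ⟨v.reverse, by rw [ev_reverse]; rfl⟩

/-! ### Components of group elements -/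

theorem act_nil (x : Letter) : act x [] = [] := by cases x <;> rfl

theorem apply_nil (g : Γ) : g.1 [] = [] := by
  obtain ⟨w, rfl⟩ := exists_word g
  induction w with
  | nil => rfl
  | cons x w ih =>
    rw [ev_cons]
    change act x ((ev w).1 []) = []
    rw [ih, act_nil]

theorem IsSplit.ext {g h g₀ g₁ : Γ} (hg : IsSplit g g₀ g₁) (hh : IsSplit h g₀ g₁) : g = h := by
  refine Subtype.ext (Equiv.ext fun s => ?_)
  rcases s with _ | ⟨_ | _, s⟩
  · rw [apply_nil, apply_nil]
  · rw [(hg s).1, (hh s).1]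
  · rw [(hg s).2, (hh s).2]

theorem IsSplit.unique {g g₀ g₁ h₀ h₁ : Γ} (hg : IsSplit g g₀ g₁) (hh : IsSplit g h₀ h₁) :
    g₀ = h₀ ∧ g₁ = h₁ := by
  constructor <;> refine Subtype.ext (Equiv.ext fun s => ?_)
  · simpa using (hg s).1.symm.trans (hh s).1
  · simpa using (hg s).2.symm.trans (hh s).2

theorem IsSplit.one : IsSplit 1 1 1 := fun _ => ⟨rfl, rfl⟩

theorem IsSplit.mul {g g₀ g₁ h h₀ h₁ : Γ} (hg : IsSplit g g₀ g₁) (hh : IsSplit h h₀ h₁) :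
    IsSplit (g * h) (g₀ * h₀) (g₁ * h₁) := fun s => by
  change g.1 (h.1 _) = false :: g₀.1 (h₀.1 s) ∧ g.1 (h.1 _) = true :: g₁.1 (h₁.1 s)
  rw [(hh s).1, (hh s).2, (hg _).1, (hg _).2]
  exact ⟨rfl, rfl⟩

theorem IsSplit.inv {g g₀ g₁ : Γ} (hg : IsSplit g g₀ g₁) : IsSplit g⁻¹ g₀⁻¹ g₁⁻¹ := fun s => by
  constructor
  · refine (Equiv.symm_apply_eq g.1).2 ?_
    rw [(hg _).1]
    exact congrArg _ (Equiv.apply_symm_apply g₀.1 s).symm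
  · refine (Equiv.symm_apply_eq g.1).2 ?_
    rw [(hg _).2]
    exact congrArg _ (Equiv.apply_symm_apply g₁.1 s).symm

theorem IsSplit.conj_a {g g₀ g₁ : Γ} (hg : IsSplit g g₀ g₁) :
    IsSplit (genΓ .a * g * genΓ .a) g₁ g₀ := fun s => by
  change act .a (g.1 (act .a _)) = _ ∧ act .a (g.1 (act .a _)) = _
  simp [act, (hg s).1, (hg s).2]

theorem isSplit_genΓ {x : Letter} (hx : x ≠ .a) :
    IsSplit (genΓ x) (ev (sec x).1) (ev (sec x).2) := by
  intro s
  cases x <;> simp [sec, genΓ, gen, act] at hx ⊢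

theorem not_isSplit_a (g₀ g₁ : Γ) : ¬ IsSplit (genΓ .a) g₀ g₁ := fun h => by
  simpa [genΓ, gen, act] using (h []).1

/-- `1` or `a`, according to a parity. -/
def aPow (p : Bool) : Γ := if p then genΓ .a else 1

/-- The letters of `w` are read from left to right by an automaton; its state `p` is the parity of the
letters `a` read before. The factor `a ^ p` in front makes the statement inductive. -/
theorem isSplit_phi (p : Bool) (w : Word) :
    IsSplit (aPow p * ev w * aPow (p ^^ !decide (EvenA w))) (ev (phi p w).1) (ev (phi p w).2) := by
  induction w generalizing p with
  | nil =>
    cases p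
    · simpa [aPow, EvenA, phi] using IsSplit.one
    · simpa [aPow, EvenA, phi, genΓ_mul_self] using IsSplit.one
  | cons x w ih =>
    by_cases hx : x = .a
    · subst hx
      have h := ih (!p)
      have e : (!p ^^ !decide (EvenA w)) = (p ^^ !decide (EvenA (Letter.a :: w))) := by
        have : EvenA (Letter.a :: w) ↔ ¬ EvenA w := by simp [EvenA, Nat.even_add_one]
        by_cases h' : EvenA w <;> simp [this, h']
      rw [e] at h
      simp only [phi]
      convert h using 2
      rw [ev_cons, ← mul_assoc]
      cases p <;> simp [aPow, genΓ_mul_self]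
    · have hp : phi p (x :: w) = ((if p then (sec x).2 else (sec x).1) ++ (phi p w).1,
          (if p then (sec x).1 else (sec x).2) ++ (phi p w).2) := by
        cases x <;> simp_all [phi]
      have e : EvenA (x :: w) ↔ EvenA w := by
        simp [EvenA, hx]
      have h := ih p
      rw [hp, ev_append, ev_append]
      simp only [e]
      have h1 : IsSplit (aPow p * genΓ x * aPow p) (ev (if p then (sec x).2 else (sec x).1))
          (ev (if p then (sec x).1 else (sec x).2)) := by
        cases p
        · simpa [aPow] using isSplit_genΓ hx
        · simpa [aPow] using (isSplit_genΓ hx).conj_a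
      convert h1.mul h using 1
      cases p <;> simp [aPow, mul_assoc, genΓ_mul_self_assoc]

theorem isSplit_even {w : Word} (h : EvenA w) : IsSplit (ev w) (ev (comp₀ w)) (ev (comp₁ w)) := by
  simpa [comp₀, comp₁, ev_red, aPow, h] using isSplit_phi false w

theorem isSplit_odd {w : Word} (h : ¬ EvenA w) :
    IsSplit (ev w * genΓ .a) (ev (comp₀ w)) (ev (comp₁ w)) := by
  simpa [comp₀, comp₁, ev_red, aPow, h] using isSplit_phi false w

theorem ev_comp₀₁ (w : Word) : ev (comp₀₁ w) = ev (comp₀ w) * ev (comp₁ w) := by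
  rw [comp₀₁, ev_red, ev_append]

theorem exists_isSplit_or (g : Γ) :
    (∃ g₀ g₁, IsSplit g g₀ g₁) ∨ ∃ g₀ g₁, IsSplit (g * genΓ .a) g₀ g₁ := by
  obtain ⟨w, rfl⟩ := exists_word g
  by_cases h : EvenA w
  · exact .inl ⟨_, _, isSplit_even h⟩
  · exact .inr ⟨_, _, isSplit_odd h⟩

theorem not_isSplit_of_mul_a {g g₀ g₁ h₀ h₁ : Γ} (h : IsSplit (g * genΓ .a) g₀ g₁) :
    ¬ IsSplit g h₀ h₁ := fun h' => by
  apply not_isSplit_a (h₀⁻¹ * g₀) (h₁⁻¹ * g₁)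
  simpa using h'.inv.mul h

theorem evenA_iff {w : Word} : EvenA w ↔ ∃ g₀ g₁, IsSplit (ev w) g₀ g₁ := by
  refine ⟨fun h => ⟨_, _, isSplit_even h⟩, fun ⟨g₀, g₁, h⟩ => ?_⟩
  by_contra hw
  exact not_isSplit_of_mul_a (isSplit_odd hw) h

theorem exists_isSplit_conj {g : Γ} (x : Γ) (h : ∃ g₀ g₁, IsSplit g g₀ g₁) :
    ∃ g₀ g₁, IsSplit (x * g * x⁻¹) g₀ g₁ := by
  obtain ⟨g₀, g₁, h⟩ := h
  rcases exists_isSplit_or x with ⟨x₀, x₁, hx⟩ | ⟨x₀, x₁, hx⟩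
  · exact ⟨_, _, (hx.mul h).mul hx.inv⟩
  · have e : x * g * x⁻¹ =
        x * genΓ .a * (genΓ .a * g * genΓ .a) * (x * genΓ .a)⁻¹ := by
      simp [mul_assoc, genΓ_mul_self_assoc, genΓ_inv]
    rw [e]
    exact ⟨_, _, (hx.mul h.conj_a).mul hx.inv⟩

theorem evenA_congr {v w : Word} (h : IsConj (ev v) (ev w)) : EvenA v ↔ EvenA w := by
  suffices ∀ {v w : Word}, IsConj (ev v) (ev w) → EvenA v → EvenA w from ⟨this h, this h.symm⟩
  intro v w h hv
  obtain ⟨c, hc⟩ := isConj_iff.1 h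
  rw [evenA_iff] at hv ⊢
  rw [← hc]
  exact exists_isSplit_conj c hv

/-! ### The subgroup `K` -/

/-- The first projection of the stabilizer of the first level is onto `Γ`; here for the second
component. -/
theorem exists_isSplit_snd (g : Γ) : ∃ h h₀, IsSplit h h₀ g := by
  obtain ⟨w, rfl⟩ := exists_word g
  induction w with
  | nil => exact ⟨1, 1, IsSplit.one⟩
  | cons x w ih =>
    obtain ⟨h, h₀, hh⟩ := ih
    have hx : ∃ k k₀, IsSplit k k₀ (genΓ x) := by
      cases x
      · exact ⟨_, _, by simpa [sec] using (isSplit_genΓ (x := .b) (by simp)).conj_a⟩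
      · exact ⟨_, _, by simpa [sec] using isSplit_genΓ (x := .d) (by simp)⟩
      · exact ⟨_, _, by simpa [sec] using isSplit_genΓ (x := .b) (by simp)⟩
      · exact ⟨_, _, by simpa [sec] using isSplit_genΓ (x := .c) (by simp)⟩
    obtain ⟨k, k₀, hk⟩ := hx
    exact ⟨_, _, by simpa using hk.mul hh⟩

theorem abab_mem : ev [.a, .b, .a, .b] ∈ K :=
  Subgroup.subset_normalClosure rfl

/-- `1 × K ≤ K`. With `abab = (ca, ac)`, the element `(abab)⁻¹ d abab d` of `K` is
`(1, cabacb)`, and its conjugate by `b` is `(1, abab)`. -/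
theorem exists_isSplit_one_K {k : Γ} (hk : k ∈ K) : ∃ g ∈ K, IsSplit g 1 k := by
  let H : Subgroup Γ :=
    { carrier := {k | ∃ g ∈ K, IsSplit g 1 k}
      one_mem' := ⟨1, K.one_mem, IsSplit.one⟩
      mul_mem' := by
        rintro x y ⟨g, hg, h⟩ ⟨g', hg', h'⟩
        exact ⟨g * g', K.mul_mem hg hg', by simpa using h.mul h'⟩
      inv_mem' := by
        rintro x ⟨g, hg, h⟩
        exact ⟨g⁻¹, K.inv_mem hg, by simpa using h.inv⟩ }
  have hn : H.Normal := by
    constructor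
    rintro x ⟨g, hg, h⟩ y
    obtain ⟨z, z₀, hz⟩ := exists_isSplit_snd y
    exact ⟨z * g * z⁻¹, Subgroup.normalClosure_normal.conj_mem _ hg _,
      by simpa using (hz.mul h).mul hz.inv⟩
  suffices h : K ≤ H from h hk
  refine Subgroup.normalClosure_le_normal ?_
  rintro _ rfl
  let W : Word := [.b] ++ ([.b, .a, .b, .a] ++ ([.d] ++ [.a, .b, .a, .b] ++ [.d])) ++ [.b]
  refine ⟨ev W, ?_, ?_⟩
  · have e : ev W = genΓ .b * ((ev [.a, .b, .a, .b])⁻¹ *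
        (genΓ .d * ev [.a, .b, .a, .b] * (genΓ .d)⁻¹)) * (genΓ .b)⁻¹ := by
      simp [W, genΓ_inv, mul_assoc]
    rw [e]
    refine Subgroup.normalClosure_normal.conj_mem _ (K.mul_mem (K.inv_mem abab_mem) ?_) _
    exact Subgroup.normalClosure_normal.conj_mem _ abab_mem _
  · have h := isSplit_even (w := W) (by decide)
    have h0 : comp₀ W = [] := by decide
    have h1 : comp₁ W = [.a, .b, .a, .b] := by decide
    rwa [h0, h1] at h

theorem exists_isSplit_K {k₀ k₁ : Γ} (h₀ : k₀ ∈ K) (h₁ : k₁ ∈ K) : ∃ g ∈ K, IsSplit g k₀ k₁ := by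
  obtain ⟨g, hg, h⟩ := exists_isSplit_one_K h₀
  obtain ⟨g', hg', h'⟩ := exists_isSplit_one_K h₁
  refine ⟨_, K.mul_mem (Subgroup.normalClosure_normal.conj_mem _ hg (genΓ .a)) hg', ?_⟩
  rw [genΓ_inv]
  simpa using h.conj_a.mul h'

/-- If the cosets of `x₀` and `x₁` lift, then so does the pair `(x₀, x₁)`. -/
theorem exists_isSplit_of_coset {g g₀ g₁ x₀ x₁ : Γ} (hg : IsSplit g g₀ g₁)
    (h₀ : (g₀ : Γ ⧸ K) = x₀) (h₁ : (g₁ : Γ ⧸ K) = x₁) :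
    ∃ x, IsSplit x x₀ x₁ ∧ (g : Γ ⧸ K) = x := by
  rw [QuotientGroup.eq] at h₀ h₁
  obtain ⟨k, hk, hs⟩ := exists_isSplit_K h₀ h₁
  refine ⟨g * k, by simpa using hg.mul hs, ?_⟩
  rw [QuotientGroup.eq]
  simpa using hk

/-- The images of `b` and `a` in `Γ / K` commute, those of `b` and `d` do as well, and `(ad)⁴ = 1`.
Hence every element of the quotient is a product of a power of `b`, one of `ad` and one of `a`. -/
instance finite_quotient : Finite (Γ ⧸ K) := by
  let A : Γ ⧸ K := (genΓ .a : Γ)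
  let B : Γ ⧸ K := (genΓ .b : Γ)
  let D : Γ ⧸ K := (genΓ .d : Γ)
  have sq : ∀ x, ((genΓ x : Γ) : Γ ⧸ K) * (genΓ x : Γ) = 1 := fun x => by
    rw [← QuotientGroup.mk_mul, genΓ_mul_self]; rfl
  have hA : A * A = 1 := sq _
  have hB : B * B = 1 := sq _
  have hD : D * D = 1 := sq _
  have iA : A⁻¹ = A := inv_eq_of_mul_eq_one_left hA
  have iB : B⁻¹ = B := inv_eq_of_mul_eq_one_left hB
  have iD : D⁻¹ = D := inv_eq_of_mul_eq_one_left hD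
  have hAB : A * B * (A * B) = 1 := by
    have := (QuotientGroup.eq_one_iff (N := K) _).2 abab_mem
    simpa [A, B, mul_assoc] using this
  have cAB : A * B = B * A := by
    have := inv_eq_of_mul_eq_one_left hAB
    rw [mul_inv_rev, iA, iB] at this
    exact this.symm
  have hBD : B * D = D * B := by
    have h1 := genΓ_third (x := .b) (y := .d) (z := .c) rfl
    have h2 := genΓ_third (x := .d) (y := .b) (z := .c) rfl
    change ((genΓ .b : Γ) : Γ ⧸ K) * (genΓ .d : Γ) = (genΓ .d : Γ) * (genΓ .b : Γ)
    rw [← QuotientGroup.mk_mul, ← QuotientGroup.mk_mul, h1, h2]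
  let R := A * D
  have hR : R ^ 4 = 1 := by
    have h : ev [.a, .d, .a, .d, .a, .d, .a, .d] = 1 := by
      have h := isSplit_even (w := [.a, .d, .a, .d, .a, .d, .a, .d]) (by decide)
      have h0 : comp₀ [.a, .d, .a, .d, .a, .d, .a, .d] = [] := by decide
      have h1 : comp₁ [.a, .d, .a, .d, .a, .d, .a, .d] = [] := by decide
      rw [h0, h1] at h
      exact h.ext IsSplit.one
    have := congrArg (QuotientGroup.mk (s := K)) h
    simpa [R, A, D, pow_succ, mul_assoc] using this
  have cBR : Commute B R := by
    have h1 : Commute B A := cAB.symm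
    exact h1.mul_right hBD
  have cRA : ∀ j : ℤ, A * R ^ j = R ^ (-j) * A := fun j => by
    have : A * R * A⁻¹ = R⁻¹ := by simp only [R, mul_inv_rev, iA, iD]; rw [← mul_assoc, hA, one_mul]
    have h := conj_zpow (a := A) (b := R) (i := j)
    rw [this, inv_zpow'] at h
    rw [h]; simp
  -- The set `T` is finite, and multiplication by generators from the left maps it to itself.
  let T : Set (Γ ⧸ K) := (Subgroup.zpowers B : Set (Γ ⧸ K)) * (Subgroup.zpowers R : Set (Γ ⧸ K)) *
    (Subgroup.zpowers A : Set (Γ ⧸ K))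
  have hT : T.Finite := by
    have fin : ∀ x : Γ ⧸ K, ∀ n, 0 < n → x ^ n = 1 → (Subgroup.zpowers x : Set (Γ ⧸ K)).Finite :=
      fun x n hn hx => (isOfFinOrder_iff_pow_eq_one.2 ⟨n, hn, hx⟩).finite_zpowers
    exact ((fin B 2 (by simp) (by rw [pow_two, hB])).mul (fin R 4 (by simp) hR)).mul
      (fin A 2 (by simp) (by rw [pow_two, hA]))
  have mT : ∀ i j k : ℤ, B ^ i * R ^ j * A ^ k ∈ T := fun i j k =>
    Set.mul_mem_mul (Set.mul_mem_mul ⟨i, rfl⟩ ⟨j, rfl⟩) ⟨k, rfl⟩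
  have hTA : ∀ t ∈ T, A * t ∈ T := by
    rintro _ ⟨_, ⟨_, ⟨i, rfl⟩, _, ⟨j, rfl⟩, rfl⟩, _, ⟨k, rfl⟩, rfl⟩
    convert mT i (-j) (k + 1) using 1
    have h1 : A * B ^ i = B ^ i * A := (Commute.zpow_right (show Commute A B from cAB) i)
    dsimp only
    rw [← mul_assoc, ← mul_assoc, h1, mul_assoc (B ^ i), cRA, add_comm k 1, zpow_add, zpow_one]
    simp only [mul_assoc]
  have hTB : ∀ t ∈ T, B * t ∈ T := by
    rintro _ ⟨_, ⟨_, ⟨i, rfl⟩, _, ⟨j, rfl⟩, rfl⟩, _, ⟨k, rfl⟩, rfl⟩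
    convert mT (1 + i) j k using 1
    dsimp only
    rw [zpow_add, zpow_one]
    simp only [mul_assoc]
  have hTR : ∀ t ∈ T, R * t ∈ T := by
    rintro _ ⟨_, ⟨_, ⟨i, rfl⟩, _, ⟨j, rfl⟩, rfl⟩, _, ⟨k, rfl⟩, rfl⟩
    convert mT i (1 + j) k using 1
    have h1 : R * B ^ i = B ^ i * R := (cBR.symm.zpow_right i)
    dsimp only
    rw [← mul_assoc, ← mul_assoc, h1, zpow_add, zpow_one]
    simp only [mul_assoc]
  have hTD : ∀ t ∈ T, D * t ∈ T := fun t ht => by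
    have : D * t = A * (R * t) := by simp only [R]; rw [← mul_assoc, ← mul_assoc, hA, one_mul]
    rw [this]
    exact hTA _ (hTR _ ht)
  have hTC : ∀ t ∈ T, ((genΓ .c : Γ) : Γ ⧸ K) * t ∈ T := fun t ht => by
    have h : ((genΓ .c : Γ) : Γ ⧸ K) = B * D := by
      rw [← genΓ_third (x := .b) (y := .d) (z := .c) rfl]; rfl
    rw [h, mul_assoc]
    exact hTB _ (hTD _ ht)
  have hu : T = Set.univ := by
    refine Set.eq_univ_of_forall fun x => ?_
    induction x using QuotientGroup.induction_on with
    | H g =>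
      obtain ⟨w, rfl⟩ := exists_word g
      induction w with
      | nil => simpa using mT 0 0 0
      | cons x w ih =>
        rw [ev_cons, QuotientGroup.mk_mul]
        cases x
        · exact hTA _ ih
        · exact hTB _ ih
        · exact hTC _ ih
        · exact hTD _ ih
  exact Set.finite_univ_iff.1 (hu ▸ hT)

end Grigorchuk


namespace Grigorchuk

/-! ### Conjugating cosets -/

theorem mem_Q {u v x : Γ} (h : u = x⁻¹ * v * x) : (x : Γ ⧸ K) ∈ Q u v := ⟨x, h, rfl⟩

theorem Q_nonempty {u v : Γ} : (Q u v).Nonempty ↔ IsConj u v := by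
  constructor
  · rintro ⟨_, x, h, -⟩
    exact isConj_iff.2 ⟨x, by rw [h]; group⟩
  · intro h
    obtain ⟨x, h⟩ := isConj_iff.1 h
    exact ⟨x, mem_Q (by rw [← h]; group)⟩

theorem Q_inv_mul {u v r : Γ} (hv : IsConj v r) : (Q v r)⁻¹ * Q u r = Q u v := by
  ext y
  constructor
  · rintro ⟨a, ⟨x, hx, ha⟩, _, ⟨z, hz, rfl⟩, rfl⟩
    have : a = (x⁻¹ : Γ) := by
      rw [← inv_inv a, ha]; rfl
    rw [this]
    exact ⟨x⁻¹ * z, by rw [hz, hx]; group, rfl⟩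
  · rintro ⟨x, hx, rfl⟩
    obtain ⟨_, z, hz, -⟩ := Q_nonempty.2 hv
    refine ⟨(z⁻¹ : Γ), ⟨z, hz, rfl⟩, (z * x : Γ), ⟨z * x, by rw [hx, hz]; group, rfl⟩, ?_⟩
    dsimp only
    rw [← QuotientGroup.mk_mul, inv_mul_cancel_left]

/-- Conjugators of two elements that fix the first level: such a conjugator is `(x₀, x₁)` or
`(x₀, x₁)a`, and `K × K ≤ K` makes every pair of conjugators of the components liftable as soon
as its cosets are. -/
theorem Q_of_isSplit {g g₀ g₁ h h₀ h₁ : Γ} (hg : IsSplit g g₀ g₁) (hh : IsSplit h h₀ h₁) :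
    Q g h = lift (Q g₀ h₀ ×ˢ Q g₁ h₁) ∪
      lift (Q g₁ h₀ ×ˢ Q g₀ h₁) * {((genΓ .a : Γ) : Γ ⧸ K)} := by
  ext y
  constructor
  · rintro ⟨x, hx, rfl⟩
    rcases exists_isSplit_or x with ⟨x₀, x₁, hs⟩ | ⟨x₀, x₁, hs⟩
    · have h2 := (hs.inv.mul hh).mul hs
      rw [← hx] at h2
      obtain ⟨e₀, e₁⟩ := hg.unique h2
      exact .inl ⟨x, x₀, x₁, hs, ⟨mem_Q e₀, mem_Q e₁⟩, rfl⟩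
    · have h2 := (hs.inv.mul hh).mul hs
      have e : (x * genΓ .a)⁻¹ * h * (x * genΓ .a) = genΓ .a * g * genΓ .a := by
        rw [hx]; simp [mul_assoc, genΓ_inv]
      rw [e] at h2
      obtain ⟨e₁, e₀⟩ := hg.conj_a.unique h2
      refine .inr ⟨_, ⟨_, x₀, x₁, hs, ⟨mem_Q e₁, mem_Q e₀⟩, rfl⟩, _, rfl, ?_⟩
      dsimp only
      rw [← QuotientGroup.mk_mul, mul_assoc, genΓ_mul_self, mul_one]
  · rintro (⟨z, z₀, z₁, hz, ⟨⟨x₀, hx₀, e₀⟩, ⟨x₁, hx₁, e₁⟩⟩, rfl⟩ |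
      ⟨_, ⟨z, z₀, z₁, hz, ⟨⟨x₀, hx₀, e₀⟩, ⟨x₁, hx₁, e₁⟩⟩, rfl⟩, _, rfl, rfl⟩)
    · obtain ⟨x, hx, e⟩ := exists_isSplit_of_coset hz e₀ e₁
      refine ⟨x, hg.ext ?_, e⟩
      rw [hx₀, hx₁]
      exact (hx.inv.mul hh).mul hx
    · obtain ⟨x, hx, e⟩ := exists_isSplit_of_coset hz e₀ e₁
      refine ⟨x * genΓ .a, ?_, by dsimp only; rw [e]; rfl⟩
      have h1 := (hx.inv.mul hh).mul hx
      rw [← hx₀, ← hx₁] at h1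
      have h2 := hg.ext h1.conj_a
      rw [h2]; simp [mul_assoc, genΓ_inv]

/-- Conjugators of two elements that swap the first level. Here a conjugator is determined by one
of its components, which conjugates the products of the components. -/
theorem Q_of_isSplit_mul_a {g g₀ g₁ h h₀ h₁ : Γ} (hg : IsSplit (g * genΓ .a) g₀ g₁)
    (hh : IsSplit (h * genΓ .a) h₀ h₁) :
    Q g h =
      lift ((fun y : Γ ⧸ K => (y, (h₁ : Γ ⧸ K) * y * (g₁ : Γ ⧸ K)⁻¹)) '' Q (g₀ * g₁) (h₀ * h₁)) ∪
      lift ((fun y : Γ ⧸ K => (y * (g₁ : Γ ⧸ K)⁻¹, (h₀ : Γ ⧸ K)⁻¹ * y)) ''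
        Q (g₀ * g₁) (h₀ * h₁)) * {((genΓ .a : Γ) : Γ ⧸ K)} := by
  ext y
  constructor
  · rintro ⟨x, hx, rfl⟩
    rcases exists_isSplit_or x with ⟨x₀, x₁, hs⟩ | ⟨x₀, x₁, hs⟩
    · have h2 := (hs.inv.mul hh).mul hs.conj_a
      have e : x⁻¹ * (h * genΓ .a) * (genΓ .a * x * genΓ .a) = g * genΓ .a := by
        rw [hx]; simp [mul_assoc, genΓ_mul_self_assoc]
      rw [e] at h2
      obtain ⟨e₀, e₁⟩ := hg.unique h2
      refine .inl ⟨x, x₀, x₁, hs, ⟨(x₀ : Γ), ⟨x₀, ?_, rfl⟩, ?_⟩, rfl⟩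
      · rw [e₀, e₁]; group
      · refine Prod.ext rfl ?_
        dsimp only
        rw [← QuotientGroup.mk_mul, ← QuotientGroup.mk_inv, ← QuotientGroup.mk_mul, e₁]
        congr 1; group
    · have h2 := ((hs.inv.mul hh).mul hs.conj_a).conj_a
      have e : genΓ .a * ((x * genΓ .a)⁻¹ * (h * genΓ .a) * (genΓ .a * (x * genΓ .a) * genΓ .a)) *
          genΓ .a = g * genΓ .a := by
        rw [hx]; simp [mul_assoc, genΓ_mul_self_assoc, genΓ_inv, genΓ_mul_self]
      rw [e] at h2
      obtain ⟨e₀, e₁⟩ := hg.unique h2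
      refine .inr ⟨_, ⟨_, x₀, x₁, hs, ⟨(x₀ * g₁ : Γ), ⟨x₀ * g₁, ?_, rfl⟩, ?_⟩, rfl⟩, _, rfl, ?_⟩
      · rw [e₀, e₁]; group
      · refine Prod.ext ?_ ?_
        · dsimp only
          rw [← QuotientGroup.mk_inv, ← QuotientGroup.mk_mul, mul_inv_cancel_right]
        · dsimp only
          rw [← QuotientGroup.mk_inv, ← QuotientGroup.mk_mul, e₁]
          congr 1; group
      · dsimp only
        rw [← QuotientGroup.mk_mul, mul_assoc, genΓ_mul_self, mul_one]
  · rintro (⟨z, z₀, z₁, hz, ⟨_, ⟨x₀, hx₀, rfl⟩, e⟩, rfl⟩ |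
      ⟨_, ⟨z, z₀, z₁, hz, ⟨_, ⟨x₀, hx₀, rfl⟩, e⟩, rfl⟩, _, rfl, rfl⟩)
    · obtain ⟨e₀, e₁⟩ := Prod.ext_iff.1 e
      dsimp only at e₀ e₁
      rw [← QuotientGroup.mk_mul, ← QuotientGroup.mk_inv, ← QuotientGroup.mk_mul] at e₁
      obtain ⟨x, hx, e⟩ := exists_isSplit_of_coset hz e₀.symm e₁.symm
      refine ⟨x, ?_, e⟩
      have h1 := (hx.inv.mul hh).mul hx.conj_a
      have e2 : x₀⁻¹ * h₀ * (h₁ * x₀ * g₁⁻¹) = g₀ := by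
        rw [eq_mul_inv_of_mul_eq hx₀]; group
      have e3 : (h₁ * x₀ * g₁⁻¹)⁻¹ * h₁ * x₀ = g₁ := by group
      rw [e2, e3] at h1
      have h2 := hg.ext h1
      have h3 := congrArg (· * genΓ .a) h2
      simpa [mul_assoc, genΓ_mul_self_assoc, genΓ_mul_self] using h3
    · obtain ⟨e₀, e₁⟩ := Prod.ext_iff.1 e
      dsimp only at e₀ e₁
      rw [← QuotientGroup.mk_inv, ← QuotientGroup.mk_mul] at e₁ e₀
      obtain ⟨x, hx, e⟩ := exists_isSplit_of_coset hz e₀.symm e₁.symm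
      refine ⟨x * genΓ .a, ?_, by dsimp only; rw [e]; rfl⟩
      have h1 := ((hx.inv.mul hh).mul hx.conj_a).conj_a
      have e3 : (x₀ * g₁⁻¹)⁻¹ * h₀ * (h₀⁻¹ * x₀) = g₁ := by group
      have e2 : (h₀⁻¹ * x₀)⁻¹ * h₁ * (x₀ * g₁⁻¹) = g₀ := by
        rw [eq_mul_inv_of_mul_eq hx₀]; group
      rw [e2, e3] at h1
      have h2 := hg.ext h1
      have h3 := congrArg (· * genΓ .a) h2
      simpa [mul_assoc, genΓ_mul_self_assoc, genΓ_mul_self, genΓ_inv] using h3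

theorem Q_even {w w' : Word} (h : EvenA w) (h' : EvenA w') :
    Q (ev w) (ev w') =
      lift (Q (ev (comp₀ w)) (ev (comp₀ w')) ×ˢ Q (ev (comp₁ w)) (ev (comp₁ w'))) ∪
      lift (Q (ev (comp₁ w)) (ev (comp₀ w')) ×ˢ Q (ev (comp₀ w)) (ev (comp₁ w'))) *
        {coset [.a]} := by
  rw [Q_of_isSplit (isSplit_even h) (isSplit_even h')]
  simp [coset]

theorem Q_odd {w w' : Word} (h : ¬ EvenA w) (h' : ¬ EvenA w') :
    Q (ev w) (ev w') =
      lift ((fun g => (g, coset (comp₁ w') * g * (coset (comp₁ w))⁻¹)) ''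
        Q (ev (comp₀₁ w)) (ev (comp₀₁ w'))) ∪
      lift ((fun g => (g * (coset (comp₁ w))⁻¹, (coset (comp₀ w'))⁻¹ * g)) ''
        Q (ev (comp₀₁ w)) (ev (comp₀₁ w'))) * {coset [.a]} := by
  rw [Q_of_isSplit_mul_a (isSplit_odd h) (isSplit_odd h'), ev_comp₀₁, ev_comp₀₁]
  simp [coset]

theorem lift_nonempty {S : Set ((Γ ⧸ K) × (Γ ⧸ K))} (h : (lift S).Nonempty) : S.Nonempty := by
  obtain ⟨_, _, _, _, _, h, -⟩ := h
  exact ⟨_, h⟩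

theorem isConj_comp_of_even {w w' : Word} (he : EvenA w) (h : IsConj (ev w) (ev w')) :
    (IsConj (ev (comp₀ w)) (ev (comp₀ w')) ∧ IsConj (ev (comp₁ w)) (ev (comp₁ w'))) ∨
      (IsConj (ev (comp₁ w)) (ev (comp₀ w')) ∧ IsConj (ev (comp₀ w)) (ev (comp₁ w'))) := by
  have h1 := Q_nonempty.2 h
  rw [Q_even he ((evenA_congr h).1 he), Set.union_nonempty, Set.mul_nonempty] at h1
  rcases h1 with h1 | ⟨h1, -⟩
  · have := Set.prod_nonempty_iff.1 (lift_nonempty h1)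
    exact .inl ⟨Q_nonempty.1 this.1, Q_nonempty.1 this.2⟩
  · have := Set.prod_nonempty_iff.1 (lift_nonempty h1)
    exact .inr ⟨Q_nonempty.1 this.1, Q_nonempty.1 this.2⟩

theorem isConj_comp_of_odd {w w' : Word} (ho : ¬ EvenA w) (h : IsConj (ev w) (ev w')) :
    IsConj (ev (comp₀₁ w)) (ev (comp₀₁ w')) := by
  have h1 := Q_nonempty.2 h
  rw [Q_odd ho (mt (evenA_congr h).2 ho), Set.union_nonempty, Set.mul_nonempty] at h1
  rcases h1 with h1 | ⟨h1, -⟩ <;>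
    exact Q_nonempty.1 (Set.image_nonempty.1 (lift_nonempty h1))

/-! ### Short words are pairwise not conjugate -/

theorem genΓ_ne_one (x : Letter) : genΓ x ≠ 1 := by
  have key : ∀ {x y : Letter} (s : List Bool), act x s ≠ s → genΓ x ≠ 1 := fun {x _} s h e =>
    h (congrArg (fun g : Γ => g.1 s) e)
  cases x
  · exact key (y := .a) [false] (by decide)
  · exact key (y := .a) [false, false] (by decide)
  · exact key (y := .a) [false, false] (by decide)
  · exact key (y := .a) [true, false, false] (by decide)

theorem not_isConj_nil (x : Letter) : ¬ IsConj (ev [x]) (ev []) := fun h => by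
  obtain ⟨c, hc⟩ := isConj_iff.1 h.symm
  simp at hc
  exact genΓ_ne_one x hc.symm

theorem not_isConj_a {x : Letter} (hx : x ≠ .a) : ¬ IsConj (ev [x]) (ev [.a]) := fun h => by
  have := evenA_congr h
  revert this
  cases x <;> simp [EvenA] at hx ⊢

theorem not_isConj_d {x : Letter} (hx : x ≠ .d) : ¬ IsConj (ev [x]) (ev [.d]) := fun h => by
  have he : EvenA [x] := (evenA_congr h).2 (by decide)
  have key : ∀ y, comp₀ [x] = [.a] → comp₁ [x] = [y] → y ≠ .a → False := fun y h0 h1 hy => by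
    rcases isConj_comp_of_even he h with ⟨h, -⟩ | ⟨-, h⟩
    · rw [h0] at h
      exact not_isConj_nil _ h
    · rw [h0] at h
      exact not_isConj_a (x := .b) (by simp) h.symm
  cases x
  · exact absurd he (by decide)
  · exact key .c rfl rfl (by simp)
  · exact key .d rfl rfl (by simp)
  · exact hx rfl

theorem not_isConj_b_c : ¬ IsConj (ev [.b]) (ev [.c]) := fun h => by
  rcases isConj_comp_of_even (by decide) h with ⟨-, h⟩ | ⟨h, -⟩
  · exact not_isConj_d (x := .c) (by simp) h
  · exact not_isConj_a (x := .c) (by simp) h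

theorem eq_of_isConj_of_length_le_one {w w' : Word} (hw : w.length ≤ 1) (hw' : w'.length ≤ 1)
    (h : IsConj (ev w) (ev w')) : w = w' := by
  have key : ∀ x y : Letter, IsConj (ev [x]) (ev [y]) → x = y := by
    intro x y h
    by_contra hne
    cases x <;> cases y <;> first
      | exact hne rfl
      | exact not_isConj_a (by simp) h
      | exact not_isConj_a (by simp) h.symm
      | exact not_isConj_d (by simp) h
      | exact not_isConj_d (by simp) h.symm
      | exact not_isConj_b_c h
      | exact not_isConj_b_c h.symm
  rcases w with _ | ⟨x, _ | ⟨_, w⟩⟩ <;> rcases w' with _ | ⟨y, _ | ⟨_, w'⟩⟩ <;>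
    simp only [List.length_cons, List.length_nil] at hw hw' <;> try omega
  · rfl
  · exact absurd h.symm (not_isConj_nil y)
  · exact absurd h (not_isConj_nil x)
  · rw [key x y h]

end Grigorchuk


namespace Grigorchuk

/-! ### Invariants of the table of representatives -/

/-- The word `w` has been processed. -/
def Table.Done (S : Table) (w : Word) : Prop := (S.rep w).isSome

/-- `ℓ` is a possible label for the row of `w`, according to the representatives of the children
of `w`. -/
def Table.Labelled (S : Table) (w : Word) (ℓ : RowLabel) : Prop :=
  if EvenA w then
    ℓ = .pair (S.repD (comp₀ w)) (S.repD (comp₁ w)) ∨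
      ℓ = .pair (S.repD (comp₁ w)) (S.repD (comp₀ w))
  else ℓ = .single (S.repD (comp₀₁ w))

/-- The invariant of the algorithm. Rows exist if they are not empty, and by `row_swap` at most one of
the two orders of a pair is used as a label. -/
structure Table.Good (S : Table) : Prop where
  rep_spec : ∀ {w r}, S.rep w = some r →
    S.rep r = some r ∧ IsConj (ev w) (ev r) ∧ S.q w = Q (ev w) (ev r) ∧ r.length ≤ w.length
  inj : ∀ {w w' r r'}, S.rep w = some r → S.rep w' = some r' → IsConj (ev w) (ev w') → r = r'
  children_done : ∀ {w}, S.Done w → ∀ c ∈ children w, S.Done c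
  mem_row : ∀ {r}, S.rep r = some r → ∃ ℓ, r ∈ S.rows ℓ
  row_spec : ∀ {ℓ r}, r ∈ S.rows ℓ → S.rep r = some r ∧ S.Labelled r ℓ
  row_nodup : ∀ ℓ, (S.rows ℓ).Nodup
  row_swap : ∀ {x y}, S.rows (.pair x y) ≠ [] → S.rows (.pair y x) ≠ [] → x = y

theorem children_even {w : Word} (h : EvenA w) : children w = [comp₀ w, comp₁ w] := if_pos h

theorem children_odd {w : Word} (h : ¬ EvenA w) : children w = [comp₀₁ w] := if_neg h

theorem Table.repD_eq {S : Table} {w r : Word} (h : S.rep w = some r) : S.repD w = r := by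
  simp [Table.repD, h]

theorem Table.Done.rep_eq {S : Table} {w : Word} (h : S.Done w) : S.rep w = some (S.repD w) := by
  obtain ⟨r, hr⟩ := Option.isSome_iff_exists.1 h
  rw [Table.repD_eq hr, hr]

theorem Table.done_of_rep {S : Table} {w r : Word} (h : S.rep w = some r) : S.Done w := by
  simp [Table.Done, h]

theorem Table.Good.rep_eq_iff {S : Table} (hS : S.Good) {x y : Word} (hx : S.Done x)
    (hy : S.Done y) : S.rep x = S.rep y ↔ IsConj (ev x) (ev y) := by
  rw [hx.rep_eq, hy.rep_eq, Option.some_inj]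
  constructor
  · intro h
    have h1 := (hS.rep_spec hx.rep_eq).2.1
    have h2 := (hS.rep_spec hy.rep_eq).2.1
    rw [h] at h1
    exact h1.trans h2.symm
  · exact hS.inj hx.rep_eq hy.rep_eq

theorem Table.Good.repD_eq_of_isConj {S : Table} (hS : S.Good) {x y : Word} (hx : S.Done x)
    (hy : S.Done y) (h : IsConj (ev x) (ev y)) : S.repD x = S.repD y :=
  hS.inj hx.rep_eq hy.rep_eq h

theorem Table.Good.qOf_eq {S : Table} (hS : S.Good) {x y : Word} (hx : S.Done x)
    (hy : S.Done y) : S.qOf x y = Q (ev x) (ev y) := by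
  unfold Table.qOf
  split_ifs with h
  · have hx' := hS.rep_spec hx.rep_eq
    have hy' := hS.rep_spec hy.rep_eq
    have e : S.repD x = S.repD y := by rwa [hx.rep_eq, hy.rep_eq, Option.some_inj] at h
    rw [hx'.2.2.1, hy'.2.2.1, e]
    exact Q_inv_mul hy'.2.1
  · rw [hS.rep_eq_iff hx hy, ← Q_nonempty, Set.not_nonempty_iff_eq_empty] at h
    exact h.symm

theorem Table.Good.qLift_eq {S : Table} (hS : S.Good) {w w' : Word} (hp : EvenA w ↔ EvenA w')
    (hw : ∀ c ∈ children w, S.Done c) (hw' : ∀ c ∈ children w', S.Done c) :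
    S.qLift w w' = Q (ev w) (ev w') := by
  unfold Table.qLift
  split_ifs with h
  · simp only [children_even h, children_even (hp.1 h), List.mem_cons, List.not_mem_nil, or_false,
      forall_eq_or_imp, forall_eq] at hw hw'
    rw [hS.qOf_eq hw.1 hw'.1, hS.qOf_eq hw.2 hw'.1, hS.qOf_eq hw.1 hw'.2, hS.qOf_eq hw.2 hw'.2,
      Q_even h (hp.1 h)]
  · simp only [children_odd h, children_odd (mt hp.2 h), List.mem_singleton, forall_eq] at hw hw'
    rw [hS.qOf_eq hw hw', Q_odd h (mt hp.2 h)]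

theorem Table.labelled_rowOf (S : Table) (w : Word) : S.Labelled w (S.rowOf w) := by
  unfold Table.Labelled Table.rowOf
  split_ifs with h
  · dsimp only
    split_ifs
    · exact .inr rfl
    · exact .inl rfl
  · rfl

theorem Table.Good.rowOf_eq {S : Table} (hS : S.Good) {w : Word} {ℓ : RowLabel}
    (h : S.Labelled w ℓ) (hℓ : S.rows ℓ ≠ []) : S.rowOf w = ℓ := by
  unfold Table.Labelled at h
  unfold Table.rowOf
  split_ifs at h ⊢ with hw
  · dsimp only
    rcases h with rfl | rfl
    · rw [if_neg (fun h => hℓ h.1)]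
    · split_ifs with h1
      · rfl
      · rw [hS.row_swap (fun h => h1 ⟨h, hℓ⟩) hℓ]
  · exact h.symm

/-- Conjugate words have the same row labels. -/
theorem Table.Good.labelled_of_isConj {S : Table} (hS : S.Good) {w w' : Word} {ℓ : RowLabel}
    (h : IsConj (ev w) (ev w')) (hw : ∀ c ∈ children w, S.Done c)
    (hw' : ∀ c ∈ children w', S.Done c) (hℓ : S.Labelled w' ℓ) : S.Labelled w ℓ := by
  have hp := evenA_congr h
  unfold Table.Labelled at hℓ ⊢
  split_ifs at hℓ ⊢ with h2 h1 h1
  · simp only [children_even h1, children_even h2, List.mem_cons, List.not_mem_nil, or_false,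
      forall_eq_or_imp, forall_eq] at hw hw'
    rcases isConj_comp_of_even h2 h with ⟨a, b⟩ | ⟨a, b⟩
    · rw [hS.repD_eq_of_isConj hw.1 hw'.1 a, hS.repD_eq_of_isConj hw.2 hw'.2 b]
      exact hℓ
    · rw [hS.repD_eq_of_isConj hw.2 hw'.1 a, hS.repD_eq_of_isConj hw.1 hw'.2 b]
      exact hℓ.symm
  · exact absurd (hp.1 h2) h1
  · exact absurd (hp.2 h1) h2
  · simp only [children_odd h1, children_odd h2, List.mem_singleton, forall_eq] at hw hw'
    rw [hS.repD_eq_of_isConj hw hw' (isConj_comp_of_odd h2 h)]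
    exact hℓ

theorem Table.labelled_congr {S S' : Table} {w : Word} {ℓ : RowLabel}
    (h : ∀ c ∈ children w, S'.repD c = S.repD c) (hℓ : S.Labelled w ℓ) : S'.Labelled w ℓ := by
  unfold Table.Labelled at hℓ ⊢
  split_ifs at hℓ ⊢ with h1
  · simp only [children_even h1, List.mem_cons, List.not_mem_nil, or_false,
      forall_eq_or_imp, forall_eq] at h
    rwa [h.1, h.2]
  · simp only [children_odd h1, List.mem_singleton, forall_eq] at h
    rwa [h]

theorem Table.Labelled.evenA_iff {S : Table} {w w' : Word} {ℓ : RowLabel} (h : S.Labelled w ℓ)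
    (h' : S.Labelled w' ℓ) : EvenA w ↔ EvenA w' := by
  unfold Table.Labelled at h h'
  split_ifs at h h' with h1 h2 h2 <;> simp_all

section Step

variable {S : Table} {w : Word}

/-- The effect of processing a word, without the details of the search. -/
theorem Table.Good.step_cases (hS : S.Good) (hc : ∀ c ∈ children w, S.Done c) :
    (∃ r ∈ S.rows (S.rowOf w), IsConj (ev w) (ev r) ∧
      S.step w = { S with
        rep := Function.update S.rep w (some r)
        q := Function.update S.q w (Q (ev w) (ev r)) }) ∨
    ((∀ r ∈ S.rows (S.rowOf w), ¬ IsConj (ev w) (ev r)) ∧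
      S.step w =
        { rep := Function.update S.rep w (some w)
          q := Function.update S.q w (Q (ev w) (ev w))
          rows := Function.update S.rows (S.rowOf w) (S.rows (S.rowOf w) ++ [w]) }) := by
  have key : ∀ r ∈ S.rows (S.rowOf w), S.qLift w r = Q (ev w) (ev r) := fun r hr =>
    have h := hS.row_spec hr
    hS.qLift_eq ((S.labelled_rowOf w).evenA_iff h.2) hc (hS.children_done (done_of_rep h.1))
  unfold Table.step
  split
  · rename_i r hr
    have hm := List.mem_of_find?_eq_some hr
    have hq := List.find?_some hr
    simp only [decide_eq_true_eq, key r hm, Q_nonempty] at hq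
    exact .inl ⟨r, hm, hq, by rw [key r hm]⟩
  · rename_i hr
    refine .inr ⟨fun r hm => ?_, by rw [hS.qLift_eq Iff.rfl hc hc]⟩
    have hq := List.find?_eq_none.1 hr r hm
    simpa only [decide_eq_true_eq, key r hm, Q_nonempty] using hq

theorem Table.step_rep_of_ne {x : Word} (h : x ≠ w) : (S.step w).rep x = S.rep x := by
  unfold Table.step
  split <;> simp [h]

theorem Table.step_q_of_ne {x : Word} (h : x ≠ w) : (S.step w).q x = S.q x := by
  unfold Table.step
  split <;> simp [h]

theorem Table.done_step {x : Word} : (S.step w).Done x ↔ x = w ∨ S.Done x := by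
  by_cases h : x = w
  · subst h
    simp only [true_or, iff_true, Table.Done]
    unfold Table.step
    split <;> simp
  · simp [Table.Done, Table.step_rep_of_ne h, h]

/-- The word `w` may be processed after its children, if no longer word has been processed before. -/
theorem Table.Good.step (hS : S.Good) (hw : ¬ S.Done w) (hc : ∀ c ∈ children w, S.Done c)
    (hl : ∀ x, S.Done x → x.length ≤ w.length) : (S.step w).Good := by
  have hne : ∀ {x}, S.Done x → x ≠ w := fun h e => hw (e ▸ h)
  have hold : ∀ {x}, S.Done x → (S.step w).rep x = S.rep x := fun h => step_rep_of_ne (hne h)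
  have hold' : ∀ {x r}, S.rep x = some r → (S.step w).rep x = some r := fun h =>
    (hold (done_of_rep h)).trans h
  have hq : ∀ {x}, S.Done x → (S.step w).q x = S.q x := fun h => step_q_of_ne (hne h)
  have hrow : ∀ {x ℓ}, S.Done x → S.Labelled x ℓ → (S.step w).Labelled x ℓ := fun hx h =>
    labelled_congr (fun c hc => by
      rw [Table.repD, Table.repD, hold (hS.children_done hx c hc)]) h
  have hroww : ∀ {ℓ}, S.Labelled w ℓ → (S.step w).Labelled w ℓ := fun h =>
    labelled_congr (fun c h => by rw [Table.repD, Table.repD, hold (hc c h)]) h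
  have hch : ∀ {x}, (S.step w).Done x → ∀ c ∈ children x, (S.step w).Done c := by
    intro x hx c hcx
    rcases done_step.1 hx with rfl | hx
    · exact done_step.2 (.inr (hc c hcx))
    · exact done_step.2 (.inr (hS.children_done hx c hcx))
  rcases hS.step_cases hc with ⟨r, hr, hconj, e⟩ | ⟨hno, e⟩
  -- The word `w` is conjugate to the representative `r`, and the rows do not change.
  · have hrr := (hS.row_spec hr).1
    have hww : (S.step w).rep w = some r := by rw [e]; simp
    have hrows : ∀ ℓ, (S.step w).rows ℓ = S.rows ℓ := fun ℓ => by rw [e]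
    refine ⟨?_, ?_, hch, ?_, ?_, ?_, ?_⟩
    · intro x r' hx
      by_cases hxw : x = w
      · subst hxw
        rw [hww, Option.some_inj] at hx
        subst hx
        exact ⟨hold' hrr, hconj, by rw [e]; simp, hl _ (done_of_rep hrr)⟩
      · rw [step_rep_of_ne hxw] at hx
        have := hS.rep_spec hx
        exact ⟨hold' this.1, this.2.1, by rw [step_q_of_ne hxw, this.2.2.1], this.2.2.2⟩
    · intro x x' r₁ r₂ h₁ h₂ hx
      by_cases hxw : x = w <;> by_cases hxw' : x' = w
      · subst hxw hxw'; rw [h₁] at h₂; exact Option.some_inj.1 h₂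
      · subst hxw
        rw [hww, Option.some_inj] at h₁
        rw [step_rep_of_ne hxw'] at h₂
        subst h₁
        exact hS.inj hrr h₂ (hconj.symm.trans hx)
      · subst hxw'
        rw [hww, Option.some_inj] at h₂
        rw [step_rep_of_ne hxw] at h₁
        subst h₂
        exact hS.inj h₁ hrr (hx.trans hconj)
      · rw [step_rep_of_ne hxw] at h₁
        rw [step_rep_of_ne hxw'] at h₂
        exact hS.inj h₁ h₂ hx
    · intro x hx
      by_cases hxw : x = w
      · subst hxw
        rw [hww, Option.some_inj] at hx
        exact absurd (hx ▸ done_of_rep hrr) hw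
      · rw [step_rep_of_ne hxw] at hx
        simpa only [hrows] using hS.mem_row hx
    · intro ℓ x hx
      rw [hrows] at hx
      have := hS.row_spec hx
      exact ⟨hold' this.1, hrow (done_of_rep this.1) this.2⟩
    · intro ℓ
      rw [hrows]
      exact hS.row_nodup ℓ
    · intro x y
      rw [hrows, hrows]
      exact hS.row_swap
  -- The word `w` is a new representative: a processed word conjugate to `w` would have its
  -- representative in the row of `w`.
  · have hnoc : ∀ x, S.Done x → ¬ IsConj (ev w) (ev x) := by
      intro x hx hcx
      have h1 := hS.rep_spec hx.rep_eq
      have h2 := hcx.trans h1.2.1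
      obtain ⟨ℓ, hℓ⟩ := hS.mem_row h1.1
      have hlab := hS.labelled_of_isConj h2 hc (hS.children_done (done_of_rep h1.1))
        (hS.row_spec hℓ).2
      rw [← hS.rowOf_eq hlab (List.ne_nil_of_mem hℓ)] at hℓ
      exact hno _ hℓ h2
    have hww : (S.step w).rep w = some w := by rw [e]; simp
    have hrows : ∀ {ℓ x}, x ∈ (S.step w).rows ℓ ↔ x ∈ S.rows ℓ ∨ (ℓ = S.rowOf w ∧ x = w) := by
      intro ℓ x
      rw [e]
      by_cases h : ℓ = S.rowOf w
      · subst h; simp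
      · simp [h]
    refine ⟨?_, ?_, hch, ?_, ?_, ?_, ?_⟩
    · intro x r' hx
      by_cases hxw : x = w
      · subst hxw
        rw [hww, Option.some_inj] at hx
        subst hx
        exact ⟨hww, IsConj.refl _, by rw [e]; simp, le_rfl⟩
      · rw [step_rep_of_ne hxw] at hx
        have := hS.rep_spec hx
        exact ⟨hold' this.1, this.2.1, by rw [step_q_of_ne hxw, this.2.2.1], this.2.2.2⟩
    · intro x x' r₁ r₂ h₁ h₂ hx
      by_cases hxw : x = w <;> by_cases hxw' : x' = w
      · subst hxw hxw'; rw [h₁] at h₂; exact Option.some_inj.1 h₂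
      · subst hxw
        rw [step_rep_of_ne hxw'] at h₂
        exact absurd hx (hnoc _ (done_of_rep h₂))
      · subst hxw'
        rw [step_rep_of_ne hxw] at h₁
        exact absurd hx.symm (hnoc _ (done_of_rep h₁))
      · rw [step_rep_of_ne hxw] at h₁
        rw [step_rep_of_ne hxw'] at h₂
        exact hS.inj h₁ h₂ hx
    · intro x hx
      by_cases hxw : x = w
      · exact ⟨S.rowOf w, hrows.2 (.inr ⟨rfl, hxw⟩)⟩
      · rw [step_rep_of_ne hxw] at hx
        obtain ⟨ℓ, hℓ⟩ := hS.mem_row hx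
        exact ⟨ℓ, hrows.2 (.inl hℓ)⟩
    · intro ℓ x hx
      rcases hrows.1 hx with hx | ⟨rfl, rfl⟩
      · have := hS.row_spec hx
        exact ⟨hold' this.1, hrow (done_of_rep this.1) this.2⟩
      · exact ⟨hww, hroww (S.labelled_rowOf _)⟩
    · intro ℓ
      rw [e]
      by_cases h : ℓ = S.rowOf w
      · subst h
        simp only [Function.update_self]
        refine (hS.row_nodup _).append (List.nodup_singleton w) ?_
        intro x hx hx'
        rw [List.mem_singleton] at hx'
        subst hx'
        exact hw (done_of_rep (hS.row_spec hx).1)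
      · simpa [h] using hS.row_nodup ℓ
    · intro x y hx hy
      -- A swapped label of the row of `w` is again a possible label for `w`.
      have swap : ∀ {x y}, S.rowOf w = .pair x y → S.Labelled w (.pair y x) := by
        intro x y h
        have := S.labelled_rowOf w
        rw [h] at this
        unfold Table.Labelled at this ⊢
        split_ifs at this ⊢
        rcases this with h | h <;> injection h with h1 h2 <;> subst h1 h2 <;> simp
      by_cases h1 : RowLabel.pair x y = S.rowOf w
      · by_cases h2 : RowLabel.pair y x = S.rowOf w
        · rw [← h2] at h1; injection h1
        · have hy' : S.rows (.pair y x) ≠ [] := by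
            rw [e] at hy; simpa [h2] using hy
          exact absurd (hS.rowOf_eq (swap h1.symm) hy').symm h2
      · have hx' : S.rows (.pair x y) ≠ [] := by
          rw [e] at hx; simpa [h1] using hx
        by_cases h2 : RowLabel.pair y x = S.rowOf w
        · exact absurd (hS.rowOf_eq (swap h2.symm) hx').symm h1
        · have hy' : S.rows (.pair y x) ≠ [] := by
            rw [e] at hy; simpa [h2] using hy
          exact hS.row_swap hx' hy'

end Step

theorem Table.done_initial {w : Word} : Table.initial.Done w ↔ w.length ≤ 1 := by
  simp only [Table.Done, Table.initial]
  split_ifs with h <;> simp [h]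

theorem Table.rep_initial {w r : Word} : Table.initial.rep w = some r ↔ w.length ≤ 1 ∧ w = r := by
  simp only [Table.initial]
  split_ifs with h <;> simp [h]

theorem length_le_one_cases {w : Word} (h : w.length ≤ 1) :
    w = [] ∨ w = [.a] ∨ w = [.b] ∨ w = [.c] ∨ w = [.d] := by
  rcases w with _ | ⟨x, _ | ⟨y, w⟩⟩
  · simp
  · cases x <;> simp
  · simp at h

theorem length_children_of_length_le_one {w : Word} (h : w.length ≤ 1) :
    ∀ c ∈ children w, c.length ≤ 1 := by
  rcases length_le_one_cases h with rfl | rfl | rfl | rfl | rfl <;> decide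

/-- The rows of the initial table. -/
def initialRows : List (RowLabel × Word) :=
  [(.pair [] [], []), (.single [], [.a]), (.pair [.a] [.c], [.b]), (.pair [.a] [.d], [.c]),
    (.pair [] [.b], [.d])]

theorem Table.rows_initial (ℓ : RowLabel) : Table.initial.rows ℓ = [] ∨
    ∃ r, Table.initial.rows ℓ = [r] ∧ (ℓ, r) ∈ initialRows := by
  simp only [Table.initial]
  split <;> simp [initialRows]

theorem Table.good_initial : Table.initial.Good := by
  have hrep : ∀ {w}, w.length ≤ 1 → Table.initial.repD w = w := fun {w} h =>
    repD_eq (rep_initial.2 ⟨h, rfl⟩)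
  refine ⟨?_, ?_, ?_, ?_, ?_, ?_, ?_⟩
  · intro w r h
    obtain ⟨hl, e⟩ := rep_initial.1 h
    subst e
    exact ⟨h, IsConj.refl _, by simp [Table.initial, hl], le_rfl⟩
  · intro w w' r r' h h' hc
    obtain ⟨hl, e⟩ := rep_initial.1 h
    obtain ⟨hl', e'⟩ := rep_initial.1 h'
    subst e e'
    exact eq_of_isConj_of_length_le_one hl hl' hc
  · intro w h c hc
    rw [done_initial] at h ⊢
    exact length_children_of_length_le_one h c hc
  · intro r h
    rcases length_le_one_cases (rep_initial.1 h).1 with rfl | rfl | rfl | rfl | rfl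
    · exact ⟨.pair [] [], by simp [Table.initial]⟩
    · exact ⟨.single [], by simp [Table.initial]⟩
    · exact ⟨.pair [.a] [.c], by simp [Table.initial]⟩
    · exact ⟨.pair [.a] [.d], by simp [Table.initial]⟩
    · exact ⟨.pair [] [.b], by simp [Table.initial]⟩
  · intro ℓ r hr
    rcases Table.rows_initial ℓ with h | ⟨r', h, h'⟩
    · simp [h] at hr
    rw [h, List.mem_singleton] at hr
    subst hr
    simp only [initialRows, List.mem_cons, Prod.mk.injEq, List.not_mem_nil, or_false] at h'
    have key : ∀ {v : Word} {ℓ}, v.length ≤ 1 →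
        (if EvenA v then ℓ = RowLabel.pair (comp₀ v) (comp₁ v) else ℓ = .single (comp₀₁ v)) →
        Table.initial.rep v = some v ∧ Table.initial.Labelled v ℓ := by
      intro v ℓ hv hℓ
      refine ⟨rep_initial.2 ⟨hv, rfl⟩, ?_⟩
      have hc := length_children_of_length_le_one hv
      unfold Table.Labelled
      split_ifs at hℓ ⊢ with he
      · simp only [children_even he, List.mem_cons, List.not_mem_nil, or_false,
          forall_eq_or_imp, forall_eq] at hc
        left
        rw [hℓ, hrep hc.1, hrep hc.2]
      · simp only [children_odd he, List.mem_singleton, forall_eq] at hc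
        rw [hℓ, hrep hc]
    rcases h' with ⟨rfl, rfl⟩ | ⟨rfl, rfl⟩ | ⟨rfl, rfl⟩ | ⟨rfl, rfl⟩ | ⟨rfl, rfl⟩ <;>
      exact key (by simp) (by decide)
  · intro ℓ
    rcases Table.rows_initial ℓ with h | ⟨r', h, -⟩ <;> simp [h]
  · intro x y hx hy
    rcases Table.rows_initial (.pair x y) with h | ⟨r, -, h⟩
    · exact absurd h hx
    rcases Table.rows_initial (.pair y x) with h' | ⟨r', -, h'⟩
    · exact absurd h' hy
    simp only [initialRows, List.mem_cons, Prod.mk.injEq, List.not_mem_nil, or_false,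
      RowLabel.pair.injEq, reduceCtorEq, false_and, false_or] at h h'
    rcases h with ⟨⟨rfl, rfl⟩, -⟩ | ⟨⟨rfl, rfl⟩, -⟩ | ⟨⟨rfl, rfl⟩, -⟩ | ⟨⟨rfl, rfl⟩, -⟩ <;>
      simp at h' ⊢

/-! ### Rows have bounded length -/

/-- Information on a word `w` in the row with label `ℓ`: for an even word, whether `ℓ` lists the
representatives of its components in order, and the sets of the components; for an odd word, the set
of its child and the coset of its second component. The remaining entries are fillers. -/
noncomputable def Table.signature (S : Table) (ℓ : RowLabel) (w : Word) :
    Prop × Set (Γ ⧸ K) × Set (Γ ⧸ K) × (Γ ⧸ K) :=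
  if EvenA w then
    (ℓ = .pair (S.repD (comp₀ w)) (S.repD (comp₁ w)), S.q (comp₀ w), S.q (comp₁ w), 1)
  else (True, S.q (comp₀₁ w), ∅, coset (comp₁ w))

theorem one_mem_lift {X : Set ((Γ ⧸ K) × (Γ ⧸ K))} (h : ((1 : Γ ⧸ K), (1 : Γ ⧸ K)) ∈ X) :
    (1 : Γ ⧸ K) ∈ lift X :=
  ⟨1, 1, 1, IsSplit.one, h, rfl⟩

theorem Table.Good.one_mem_Q {S : Table} (hS : S.Good) {x y : Word} (hx : S.Done x)
    (hy : S.Done y) (hr : S.repD x = S.repD y) (hq : S.q x = S.q y) :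
    (1 : Γ ⧸ K) ∈ Q (ev x) (ev y) := by
  have h1 := hS.rep_spec hx.rep_eq
  have h2 := hS.rep_spec hy.rep_eq
  rw [← Q_inv_mul h2.2.1, ← h2.2.2.1, ← hq, ← hr, h1.2.2.1]
  obtain ⟨y, hy⟩ := Q_nonempty.2 h1.2.1
  exact ⟨y⁻¹, Set.inv_mem_inv.2 hy, y, hy, inv_mul_cancel y⟩

/-- If two words of a row have the same signature, then `1` is a solution modulo `K` for the
conjugation of their children, so that the words are conjugate and, being representatives, equal. -/
theorem Table.Good.signature_injOn {S : Table} (hS : S.Good) (ℓ : RowLabel) {w w' : Word}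
    (hw : w ∈ S.rows ℓ) (hw' : w' ∈ S.rows ℓ) (h : S.signature ℓ w = S.signature ℓ w') :
    w = w' := by
  obtain ⟨h1, l1⟩ := hS.row_spec hw
  obtain ⟨h2, l2⟩ := hS.row_spec hw'
  have hp := l1.evenA_iff l2
  have c1 := hS.children_done (done_of_rep h1)
  have c2 := hS.children_done (done_of_rep h2)
  refine hS.inj h1 h2 (Q_nonempty.1 ⟨1, ?_⟩)
  unfold Table.signature at h
  unfold Table.Labelled at l1 l2
  by_cases he : EvenA w
  · have he' := hp.1 he
    simp only [if_pos he, if_pos he', Prod.mk.injEq] at h l1 l2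
    simp only [children_even he, children_even he', List.mem_cons, List.not_mem_nil, or_false,
      forall_eq_or_imp, forall_eq] at c1 c2
    rw [Q_even he he']
    have e : S.repD (comp₀ w) = S.repD (comp₀ w') ∧ S.repD (comp₁ w) = S.repD (comp₁ w') := by
      by_cases hℓ : ℓ = .pair (S.repD (comp₀ w)) (S.repD (comp₁ w))
      · have h3 := h.1.mp hℓ
        rw [hℓ] at h3
        injection h3 with a b
        exact ⟨a, b⟩
      · have h3 := l1.resolve_left hℓ
        have h4 := l2.resolve_left (fun h' => hℓ (h.1.mpr h'))
        rw [h3] at h4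
        injection h4 with a b
        exact ⟨b, a⟩
    exact .inl (one_mem_lift ⟨hS.one_mem_Q c1.1 c2.1 e.1 h.2.1,
      hS.one_mem_Q c1.2 c2.2 e.2 h.2.2.1⟩)
  · have he' := mt hp.2 he
    simp only [if_neg he, if_neg he', Prod.mk.injEq] at h l1 l2
    simp only [children_odd he, children_odd he', List.mem_singleton, forall_eq] at c1 c2
    rw [Q_odd he he']
    rw [l1] at l2
    injection l2 with e
    refine .inl (one_mem_lift ⟨1, hS.one_mem_Q c1 c2 e h.2.1, ?_⟩)
    rw [h.2.2.2]
    simp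

/-- A bound for the length of the rows. -/
noncomputable def rowBound : ℕ :=
  Nat.card (Prop × Set (Γ ⧸ K) × Set (Γ ⧸ K) × (Γ ⧸ K))

theorem Table.Good.length_row_le {S : Table} (hS : S.Good) (ℓ : RowLabel) :
    (S.rows ℓ).length ≤ rowBound := by
  have hn : ((S.rows ℓ).map (S.signature ℓ)).Nodup :=
    List.Nodup.map_on (fun _ h _ h' e => hS.signature_injOn ℓ h h' e) (hS.row_nodup ℓ)
  have := Fintype.ofFinite (Prop × Set (Γ ⧸ K) × Set (Γ ⧸ K) × (Γ ⧸ K))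
  have h := hn.length_le_card
  rwa [List.length_map, ← Nat.card_eq_fintype_card] at h

/-! ### The order of processing -/

/-- All words that `w` leads to in at most `d` steps through words of length at least `m` have
length at most `m`, and all words that it leads to in `d` steps are shorter than `m` or letters. -/
def Depth (m : ℕ) : ℕ → Word → Prop
  | 0, w => w.length < m ∨ w.length ≤ 1
  | d + 1, w => (w.length < m ∨ w.length ≤ 1) ∨ (w.length ≤ m ∧ ∀ c ∈ children w, Depth m d c)

theorem Depth.succ {m d : ℕ} {w : Word} (h : Depth m d w) : Depth m (d + 1) w := by
  induction d generalizing w with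
  | zero => exact .inl h
  | succ d ih =>
    rcases h with h | ⟨h, h'⟩
    · exact .inl h
    · exact .inr ⟨h, fun c hc => ih (h' c hc)⟩

/-- The table while words of length `m` are processed; `R` is the set of all words to process. -/
structure Stage (R : Word → Prop) (m : ℕ) (S : Table) : Prop where
  good : S.Good
  small : ∀ x, x.length ≤ 1 → S.Done x
  short : ∀ x, R x → x.length < m → S.Done x
  sub : ∀ x, S.Done x → R x
  bound : ∀ x, S.Done x → x.length ≤ m ∨ x.length ≤ 1

theorem Stage.step {R : Word → Prop} {m : ℕ} {S : Table} (h : Stage R m S) {w : Word} (hR : R w)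
    (hw : ¬ S.Done w) (hm : w.length ≤ m) (hc : ∀ c ∈ children w, S.Done c) :
    Stage R m (S.step w) := by
  have h1 : ¬ w.length < m := fun h' => hw (h.short w hR h')
  have h2 : ¬ w.length ≤ 1 := fun h' => hw (h.small w h')
  refine ⟨h.good.step hw hc (fun x hx => ?_), ?_, ?_, ?_, ?_⟩
  · rcases h.bound x hx with h' | h' <;> omega
  · exact fun x hx => Table.done_step.2 (.inr (h.small x hx))
  · exact fun x hx hx' => Table.done_step.2 (.inr (h.short x hx hx'))
  · intro x hx
    rcases Table.done_step.1 hx with rfl | hx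
    · exact hR
    · exact h.sub x hx
  · intro x hx
    rcases Table.done_step.1 hx with rfl | hx
    · exact .inl hm
    · exact h.bound x hx

/-- `S'` is a later state of the table `S`; all words processed since satisfy `P`. -/
structure Later (P : Word → Prop) (S S' : Table) : Prop where
  rep : ∀ x, S.Done x → S'.rep x = S.rep x
  q : ∀ x, S.Done x → S'.q x = S.q x
  new : ∀ x, S'.Done x → S.Done x ∨ P x

theorem Later.refl {P : Word → Prop} (S : Table) : Later P S S :=
  ⟨fun _ _ => rfl, fun _ _ => rfl, fun _ h => .inl h⟩

theorem Later.done {P : Word → Prop} {S S' : Table} (h : Later P S S') {x : Word} (hx : S.Done x) :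
    S'.Done x := by
  rw [Table.Done, h.rep x hx]; exact hx

theorem Later.trans {P : Word → Prop} {S S' S'' : Table} (h : Later P S S') (h' : Later P S' S'') :
    Later P S S'' :=
  ⟨fun x hx => (h'.rep x (h.done hx)).trans (h.rep x hx),
    fun x hx => (h'.q x (h.done hx)).trans (h.q x hx),
    fun x hx => (h'.new x hx).elim (h.new x) .inr⟩

theorem Later.mono {P P' : Word → Prop} {S S' : Table} (h : Later P S S') (hP : ∀ x, P x → P' x) :
    Later P' S S' :=
  ⟨h.rep, h.q, fun x hx => (h.new x hx).imp_right (hP x)⟩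

theorem Later.step {P : Word → Prop} {S : Table} {w : Word} (hw : ¬ S.Done w) (hP : P w) :
    Later P S (S.step w) :=
  ⟨fun _ hx => Table.step_rep_of_ne (fun e => hw (e ▸ hx)),
    fun _ hx => Table.step_q_of_ne (fun e => hw (e ▸ hx)),
    fun _ hx => (Table.done_step.1 hx).elim (fun e => .inr (e ▸ hP)) .inl⟩

theorem Table.visit_of_done {S : Table} {w : Word} (h : S.Done w) (n : ℕ) :
    Table.visit n w S = S := by
  cases n with
  | zero => rfl
  | succ n => exact if_pos h

/-- Statement of `Stage.visit` for a list of words. -/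
theorem Stage.foldl_visit_aux {R : Word → Prop} {m d n : ℕ}
    (ih : ∀ {w : Word} {S : Table}, Stage R m S → R w → Depth m d w →
      Stage R m (Table.visit n w S) ∧ (Table.visit n w S).Done w ∧
        Later (Depth m d) S (Table.visit n w S)) :
    ∀ (l : List Word) {S : Table}, Stage R m S → (∀ w ∈ l, R w ∧ Depth m d w) →
      Stage R m (l.foldl (fun S' x => Table.visit n x S') S) ∧
        (∀ w ∈ l, (l.foldl (fun S' x => Table.visit n x S') S).Done w) ∧
        Later (Depth m d) S (l.foldl (fun S' x => Table.visit n x S') S)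
  | [], S, h, _ => ⟨h, by simp, Later.refl S⟩
  | w :: l, S, h, hl => by
    obtain ⟨h1, h2, h3⟩ := ih h (hl w (by simp)).1 (hl w (by simp)).2
    obtain ⟨h4, h5, h6⟩ := Stage.foldl_visit_aux ih l h1 fun x hx => hl x (by simp [hx])
    refine ⟨h4, ?_, h3.trans h6⟩
    intro x hx
    rcases List.mem_cons.1 hx with rfl | hx
    · exact h6.done h2
    · exact h5 x hx

/-- The recursion reaches only words of length `m` on its way, and it ends, after `d` steps, at words
that have been processed before. -/
theorem Stage.visit {R : Word → Prop} (hRc : ∀ w, R w → ∀ c ∈ children w, R c) {m d n : ℕ}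
    (hn : d ≤ n) {w : Word} {S : Table} (h : Stage R m S) (hR : R w)
    (hd : Depth m d w) : Stage R m (Table.visit n w S) ∧ (Table.visit n w S).Done w ∧
      Later (Depth m d) S (Table.visit n w S) := by
  induction d generalizing n w S with
  | zero =>
    have hw : S.Done w := hd.elim (h.short w hR) (h.small w)
    rw [Table.visit_of_done hw]
    exact ⟨h, hw, Later.refl S⟩
  | succ d ih =>
    by_cases hw : S.Done w
    · rw [Table.visit_of_done hw]
      exact ⟨h, hw, Later.refl S⟩
    by_cases hd' : Depth m d w
    · obtain ⟨h1, h2, h3⟩ := ih (n := n) (by omega) h hR hd'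
      exact ⟨h1, h2, h3.mono fun _ => Depth.succ⟩
    obtain ⟨n, rfl⟩ : ∃ k, n = k + 1 := ⟨n - 1, by omega⟩
    have e : Table.visit (n + 1) w S =
      ((children w).foldl (fun S' x => Table.visit n x S') S).step w := if_neg hw
    rcases hd with hd | ⟨hm, hc⟩
    · exact absurd (hd.elim (h.short w hR) (h.small w)) hw
    obtain ⟨h1, h2, h3⟩ := Stage.foldl_visit_aux (fun h hR hd => ih (n := n) (by omega) h hR hd)
      (children w) h fun c hc' => ⟨hRc w hR c hc', hc c hc'⟩
    -- `w` has not been processed as a descendant of itself, as `d` is less than its depth.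
    have hw' := fun h' => (h3.new w h').elim hw hd'
    rw [e]
    exact ⟨h1.step hR hw' hm h2, Table.done_step.2 (.inl rfl),
      (h3.mono fun _ => Depth.succ).trans (Later.step hw' (.inr ⟨hm, hc⟩))⟩

/-- The table after some words of a list have been processed in order of length. -/
structure Prefix (R : Word → Prop) (l : List Word) (S : Table) : Prop where
  good : S.Good
  small : ∀ x, x.length ≤ 1 → S.Done x
  mem : ∀ x ∈ l, S.Done x
  sub : ∀ x, S.Done x → R x
  bound : ∀ m, (∀ x ∈ l, x.length ≤ m) → ∀ x, S.Done x → x.length ≤ m ∨ x.length ≤ 1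

theorem Prefix.initial {R : Word → Prop} (hR : ∀ x, x.length ≤ 1 → R x) :
    Prefix R [] Table.initial :=
  ⟨Table.good_initial, fun _ => Table.done_initial.2, by simp,
    fun x hx => hR x (Table.done_initial.1 hx), fun _ _ _ hx => .inr (Table.done_initial.1 hx)⟩

theorem Prefix.stage {R : Word → Prop} {l l' : List Word} {S : Table} {w : Word}
    (h : Prefix R l S) (hR : ∀ x, R x ↔ x ∈ l ++ w :: l')
    (hs : (l ++ w :: l').Pairwise fun x y => x.length ≤ y.length) : Stage R w.length S := by
  rw [List.pairwise_append] at hs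
  refine ⟨h.good, h.small, fun x hx hxw => ?_, h.sub, h.bound _ fun x hx => hs.2.2 x hx w (by simp)⟩
  rcases List.mem_append.1 ((hR x).1 hx) with hx | hx
  · exact h.mem x hx
  · rcases List.mem_cons.1 hx with rfl | hx
    · omega
    · exact absurd ((List.pairwise_cons.1 hs.2.1).1 x hx) (by omega)

theorem Prefix.visit {R : Word → Prop} (hRc : ∀ w, R w → ∀ c ∈ children w, R c)
    {l l' : List Word} {S : Table} {w : Word}
    (h : Prefix R l S) (hR : ∀ x, R x ↔ x ∈ l ++ w :: l')
    (hs : (l ++ w :: l').Pairwise fun x y => x.length ≤ y.length) (hd : Depth w.length 3 w) :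
    Prefix R (l ++ [w]) (Table.visit 3 w S) ∧ Later (fun _ => True) S (Table.visit 3 w S) := by
  obtain ⟨h1, h2, h3⟩ := (h.stage hR hs).visit hRc le_rfl ((hR w).2 (by simp)) hd
  refine ⟨⟨h1.good, h1.small, ?_, h1.sub, ?_⟩, h3.mono fun _ _ => trivial⟩
  · intro x hx
    rcases List.mem_append.1 hx with hx | hx
    · exact h3.done (h.mem x hx)
    · rw [List.mem_singleton] at hx
      exact hx ▸ h2
  · intro m hm x hx
    have hwm := hm w (by simp)
    rcases h1.bound x hx with h | h
    · exact .inl (h.trans hwm)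
    · exact .inr h

end Grigorchuk


namespace Grigorchuk

instance : Fintype Letter := ⟨{.a, .b, .c, .d}, fun x => by cases x <;> decide⟩

/-! ### Reduced words -/

/-- The letter `a` alternates with the letters `b, c, d`. -/
def Reduced : Word → Prop
  | [] => True
  | [_] => True
  | x :: y :: w => (x = .a ↔ y ≠ .a) ∧ Reduced (y :: w)

theorem Reduced.tail {x : Letter} {w : Word} (h : Reduced (x :: w)) : Reduced w := by
  cases w with
  | nil => trivial
  | cons y w => exact h.2

theorem third_eq_none {x y : Letter} (h : third x y = none) (hxy : x ≠ y) :
    x = .a ↔ y ≠ .a := by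
  cases x <;> cases y <;> simp_all [third]

theorem third_ne_a {x y z : Letter} (h : third x y = some z) : x ≠ .a ∧ y ≠ .a ∧ z ≠ .a := by
  cases x <;> cases y <;> simp only [third, reduceCtorEq, Option.some.injEq] at h <;>
    subst h <;> simp

theorem Reduced.of_head {x y : Letter} {w : Word} (h : Reduced (x :: w)) (hxy : x = .a ↔ y = .a) :
    Reduced (y :: w) := by
  cases w with
  | nil => trivial
  | cons z w => exact ⟨hxy.symm.trans h.1, h.2⟩

theorem Reduced.redCons {w : Word} (h : Reduced w) (x : Letter) : Reduced (redCons x w) := by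
  cases w with
  | nil => trivial
  | cons y w =>
    simp only [Grigorchuk.redCons]
    split_ifs with hxy
    · exact h.tail
    · split
      · rename_i z hz
        exact h.of_head (by simp [third_ne_a hz])
      · rename_i hz
        exact ⟨third_eq_none hz hxy, h⟩

theorem Reduced.foldr {w : Word} (h : Reduced w) (v : Word) : Reduced (v.foldr Grigorchuk.redCons w) := by
  induction v with
  | nil => exact h
  | cons x v ih => exact ih.redCons x

theorem reduced_red (w : Word) : Reduced (red w) :=
  Reduced.foldr (w := []) trivial w

theorem Reduced.redCons_eq {x : Letter} {w : Word} (h : Reduced (x :: w)) :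
    Grigorchuk.redCons x w = x :: w := by
  cases w with
  | nil => rfl
  | cons y w =>
    have := h.1
    cases x <;> cases y <;> simp_all [Grigorchuk.redCons, third]

theorem red_of_reduced {w : Word} (h : Reduced w) : red w = w := by
  induction w with
  | nil => rfl
  | cons x w ih =>
    change redCons x (red w) = _
    rw [ih h.tail, h.redCons_eq]

theorem Reduced.redCons_redCons {w : Word} (h : Reduced w) (x : Letter) :
    Grigorchuk.redCons x (Grigorchuk.redCons x w) = w := by
  rcases w with _ | ⟨y, _ | ⟨z, w⟩⟩
  · simp [Grigorchuk.redCons]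
  · cases x <;> cases y <;> simp [Grigorchuk.redCons, third]
  · have := h.1
    cases x <;> cases y <;> cases z <;> simp_all [Grigorchuk.redCons, third]

theorem Reduced.redCons_third {w : Word} (h : Reduced w) {x y z : Letter}
    (hz : third x y = some z) :
    Grigorchuk.redCons x (Grigorchuk.redCons y w) = Grigorchuk.redCons z w := by
  rcases w with _ | ⟨u, _ | ⟨v, w⟩⟩
  · cases x <;> cases y <;> simp_all [Grigorchuk.redCons, third]
  · cases x <;> cases y <;> simp only [third, reduceCtorEq, Option.some.injEq] at hz <;>
      subst hz <;> cases u <;> simp [Grigorchuk.redCons, third]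
  · have := h.1
    cases x <;> cases y <;> simp only [third, reduceCtorEq, Option.some.injEq] at hz <;>
      subst hz <;> cases u <;> cases v <;> simp_all [Grigorchuk.redCons, third]

theorem foldr_redCons_redCons {R : Word} (hR : Reduced R) (x : Letter) (u : Word) :
    (redCons x u).foldr redCons R = redCons x (u.foldr redCons R) := by
  cases u with
  | nil => rfl
  | cons y u =>
    have h := hR.foldr u
    simp only [redCons]
    split_ifs with hxy
    · subst hxy
      exact (h.redCons_redCons x).symm
    · split
      · rename_i z hz
        exact (h.redCons_third hz).symm
      · rfl

theorem foldr_redCons_red {R : Word} (hR : Reduced R) (v : Word) :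
    (red v).foldr redCons R = v.foldr redCons R := by
  induction v with
  | nil => rfl
  | cons x v ih =>
    change (redCons x (red v)).foldr redCons R = _
    rw [foldr_redCons_redCons hR, ih]
    rfl

theorem red_append (v w : Word) : red (v ++ w) = (red v).foldr redCons (red w) := by
  rw [foldr_redCons_red (reduced_red w), red, List.foldr_append]
  rfl

theorem comp₀₁_eq (w : Word) : comp₀₁ w = (comp₀ w).foldr redCons (comp₁ w) := by
  rw [comp₀₁, red_append, comp₀, comp₁, red_of_reduced (reduced_red _),
    red_of_reduced (reduced_red _)]

theorem comp₀₁_eq_red (w : Word) : comp₀₁ w = red ((phi false w).1 ++ (phi false w).2) := by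
  rw [comp₀₁_eq, red_append]
  rfl

theorem reduced_of_mem_children {w c : Word} (h : c ∈ children w) : Reduced c := by
  unfold children at h
  split_ifs at h
  · rcases List.mem_pair.1 h with rfl | rfl <;> exact reduced_red _
  · rw [List.mem_singleton.1 h]
    exact reduced_red _

/-! ### Weights -/

/-- The total weight of a word. -/
def weight (f : Letter → ℕ) (w : Word) : ℕ := (w.map f).sum

/-- Reduction does not increase the weight. -/
def IsWeight (f : Letter → ℕ) : Prop := ∀ x y z, third x y = some z → f z ≤ f x + f y

section weight

variable {f : Letter → ℕ}

@[simp] theorem weight_nil : weight f [] = 0 := rfl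

@[simp] theorem weight_cons (x : Letter) (w : Word) : weight f (x :: w) = f x + weight f w := by
  simp [weight]

@[simp] theorem weight_append (v w : Word) : weight f (v ++ w) = weight f v + weight f w := by
  simp [weight]

theorem IsWeight.redCons_le (hf : IsWeight f) (x : Letter) (w : Word) :
    weight f (redCons x w) ≤ f x + weight f w := by
  cases w with
  | nil => simp [redCons]
  | cons y w =>
    simp only [redCons]
    split_ifs
    · simp; omega
    · split
      · rename_i z hz
        have := hf _ _ _ hz
        simp; omega
      · simp

theorem IsWeight.foldr_le (hf : IsWeight f) (v w : Word) :
    weight f (v.foldr redCons w) ≤ weight f v + weight f w := by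
  induction v with
  | nil => simp
  | cons x v ih =>
    have := hf.redCons_le x (v.foldr redCons w)
    simp only [List.foldr_cons, weight_cons]
    omega

theorem IsWeight.red_le (hf : IsWeight f) (w : Word) : weight f (red w) ≤ weight f w :=
  hf.foldr_le w []

/-- The weight of the two components of a letter. -/
def secWeight (f : Letter → ℕ) (x : Letter) : ℕ := weight f (sec x).1 + weight f (sec x).2

theorem weight_phi (p : Bool) (w : Word) :
    weight f (phi p w).1 + weight f (phi p w).2 = weight (secWeight f) w := by
  induction w generalizing p with
  | nil => rfl
  | cons x w ih =>
    cases x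
    · have := ih (!p)
      simpa [phi, secWeight, sec] using this
    all_goals
      have := ih p
      cases p <;> simp [phi, secWeight, sec] <;> omega

theorem IsWeight.comp_le (hf : IsWeight f) (w : Word) :
    weight f (comp₀ w) + weight f (comp₁ w) ≤ weight (secWeight f) w := by
  have h0 := hf.red_le (phi false w).1
  have h1 := hf.red_le (phi false w).2
  have := weight_phi (f := f) false w
  unfold comp₀ comp₁
  omega

theorem IsWeight.comp₀₁_le (hf : IsWeight f) (w : Word) :
    weight f (comp₀₁ w) ≤ weight (secWeight f) w := by
  have h := hf.red_le ((phi false w).1 ++ (phi false w).2)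
  rw [weight_append, weight_phi] at h
  rwa [comp₀₁_eq_red]

theorem weight_mono {g : Letter → ℕ} (h : ∀ x, f x ≤ g x) (w : Word) :
    weight f w ≤ weight g w := by
  induction w with
  | nil => rfl
  | cons x w ih => have := h x; simp; omega

theorem weight_add (g : Letter → ℕ) (w : Word) :
    weight (fun x => f x + g x) w = weight f w + weight g w := by
  induction w with
  | nil => rfl
  | cons x w ih => simp [ih]; omega

theorem weight_const_mul (k : ℕ) (w : Word) : weight (fun x => k * f x) w = k * weight f w := by
  induction w with
  | nil => rfl
  | cons x w ih => simp [ih, mul_add]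

end weight

theorem weight_one (w : Word) : weight (fun _ => 1) w = w.length := by
  simp [weight]

/-- Indicator of the letters `b, c, d`. -/
def isB : Letter → ℕ
  | .a => 0
  | _ => 1

/-- Indicator of the letter `a`. -/
def isA : Letter → ℕ
  | .a => 1
  | _ => 0

/-- The contracting weight: it satisfies `6 (|w₀| + |w₁|) ≤ 5 (|w| + 3)` for reduced words. -/
def wt : Letter → ℕ
  | .a => 3
  | .b => 3
  | .c => 2
  | .d => 1

theorem isWeight_isB : IsWeight isB := by
  intro x y z h
  cases x <;> cases y <;> simp only [third, reduceCtorEq, Option.some.injEq] at h <;>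
    subst h <;> decide

theorem isWeight_one : IsWeight (fun _ => 1) := fun _ _ _ _ => by dsimp only; omega

theorem isWeight_wt : IsWeight wt := by
  intro x y z h
  cases x <;> cases y <;> simp only [third, reduceCtorEq, Option.some.injEq] at h <;>
    subst h <;> decide

theorem weight_isA_add_isB (w : Word) : weight isA w + weight isB w = w.length := by
  rw [← weight_one, ← weight_add]
  congr 1
  funext x
  cases x <;> rfl

theorem evenA_iff_weight (w : Word) : EvenA w ↔ Even (weight isA w) := by
  have : w.count .a = weight isA w := by
    induction w with
    | nil => rfl
    | cons x w ih => cases x <;> simp [ih, isA, add_comm]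
  rw [EvenA, this]

theorem wt_eq (w : Word) : weight wt w ≤ 3 * w.length := by
  rw [← weight_one, ← weight_const_mul]
  exact weight_mono (fun x => by cases x <;> decide) w

theorem length_le_wt (w : Word) : w.length ≤ weight wt w := by
  rw [← weight_one]
  exact weight_mono (fun x => by cases x <;> decide) w

theorem three_isA_add_isB_le_wt (w : Word) : 3 * weight isA w + weight isB w ≤ weight wt w := by
  rw [← weight_const_mul, ← weight_add]
  exact weight_mono (fun x => by cases x <;> decide) w

theorem secWeight_wt_le (w : Word) :
    6 * weight (secWeight wt) w + 15 * weight isA w ≤ 5 * weight wt w + 15 * weight isB w := by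
  rw [← weight_const_mul, ← weight_const_mul, ← weight_const_mul, ← weight_const_mul,
    ← weight_add, ← weight_add]
  exact weight_mono (fun x => by cases x <;> decide) w

theorem secWeight_one_le (w : Word) : weight (secWeight fun _ => 1) w ≤ 2 * weight isB w := by
  rw [← weight_const_mul]
  exact weight_mono (fun x => by cases x <;> decide) w

theorem secWeight_isB (w : Word) : weight (secWeight isB) w = weight isB w := by
  congr 1
  funext x
  cases x <;> rfl

theorem length_phi_le (p : Bool) (w : Word) :
    (phi p w).1.length ≤ weight isB w ∧ (phi p w).2.length ≤ weight isB w := by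
  induction w generalizing p with
  | nil => simp [phi]
  | cons x w ih =>
    cases x
    · have := ih (!p)
      simpa [phi, isB] using this
    all_goals
      have := ih p
      cases p <;> simp [phi, isB, sec] <;> omega

theorem length_red_le (w : Word) : (red w).length ≤ w.length := by
  rw [← weight_one, ← weight_one]
  exact isWeight_one.red_le w

theorem length_comp₀_le (w : Word) : (comp₀ w).length ≤ weight isB w :=
  (length_red_le _).trans (length_phi_le false w).1

theorem length_comp₁_le (w : Word) : (comp₁ w).length ≤ weight isB w :=
  (length_red_le _).trans (length_phi_le false w).2

/-! ### Lengths of the children of a reduced word -/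

theorem isB_of_ne {x : Letter} (h : x ≠ .a) : isB x = 1 ∧ isA x = 0 := by
  cases x <;> simp_all [isB, isA]

theorem isB_of_iff {x y : Letter} (h : x = .a ↔ y ≠ .a) :
    isB x = isA y ∧ isA x = isB y := by
  cases x <;> cases y <;> simp_all [isB, isA]

/-- In an alternating word the numbers of letters `a` and of other letters are determined up to one
by the ends of the word. -/
theorem Reduced.count {x : Letter} {w : Word} (h : Reduced (x :: w)) :
    weight isB (x :: w) + 1 = weight isA (x :: w) + isB x + isB ((x :: w).getLast (by simp)) := by
  induction w generalizing x with
  | nil => cases x <;> rfl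
  | cons y w ih =>
    have h1 := ih h.2
    have h2 := isB_of_iff h.1
    have h3 : isA y + isB y = 1 := by cases y <;> rfl
    simp only [weight_cons] at h1 ⊢
    rw [List.getLast_cons (by simp)]
    omega

theorem Reduced.count_le {w : Word} (h : Reduced w) :
    weight isB w ≤ weight isA w + 1 ∧ weight isA w ≤ weight isB w + 1 := by
  cases w with
  | nil => simp
  | cons x w =>
    have := h.count
    have h1 : ∀ y, isB y ≤ 1 := fun y => by cases y <;> decide
    have h2 := h1 x
    have h3 := h1 ((x :: w).getLast (by simp))
    omega

theorem phi_append_singleton_fst {y : Letter} (hy : y ≠ .a) (u : Word) (p : Bool)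
    (hp : (p ^^ !decide (EvenA u)) = true) :
    ∃ l z, (phi p (u ++ [y])).1 = l ++ [z] ∧ z ≠ .a := by
  induction u generalizing p with
  | nil =>
    simp only [EvenA, List.count_nil, Even.zero, decide_true, Bool.not_true, Bool.xor_false] at hp
    subst hp
    cases y <;> simp at hy
    · exact ⟨[], .c, rfl, by simp⟩
    · exact ⟨[], .d, rfl, by simp⟩
    · exact ⟨[], .b, rfl, by simp⟩
  | cons x u ih =>
    by_cases hx : x = .a
    · subst hx
      have : EvenA (Letter.a :: u) ↔ ¬ EvenA u := by simp [EvenA, Nat.even_add_one]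
      have hp' : (!p ^^ !decide (EvenA u)) = true := by
        rw [← hp]
        by_cases h : EvenA u <;> simp [this, h]
      exact ih (!p) hp'
    · have : EvenA (x :: u) ↔ EvenA u := by simp [EvenA, hx]
      simp only [this] at hp
      obtain ⟨l, z, h, hz⟩ := ih p hp
      refine ⟨(if p then (sec x).2 else (sec x).1) ++ l, z, ?_, hz⟩
      rw [List.append_assoc, ← h]
      cases x <;> simp_all [phi]

theorem Reduced.isB_redCons_redCons_le {R : Word} (hR : Reduced R) {y z : Letter} (hy : y ≠ .a)
    (hz : z ≠ .a) : weight isB (Grigorchuk.redCons y (Grigorchuk.redCons z R)) ≤ weight isB R + 1 := by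
  by_cases hyz : y = z
  · subst hyz
    rw [hR.redCons_redCons]; omega
  · obtain ⟨t, ht⟩ : ∃ t, third y z = some t := by
      cases y <;> cases z <;> simp_all [third]
    rw [hR.redCons_third ht]
    have := isWeight_isB.redCons_le t R
    have h1 : isB t ≤ 1 := by cases t <;> decide
    omega

/-- If an odd word starts and ends with letters among `b, c, d`, then two such letters meet
where its components are concatenated. -/
theorem Reduced.isB_comp₀₁_lt {w : Word} (h : Reduced w) (ho : ¬ EvenA w)
    (hw : weight isB w = weight isA w + 1) : weight isB (comp₀₁ w) + 1 ≤ weight isB w := by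
  cases w with
  | nil => simp at hw
  | cons x w =>
    have hc := h.count
    have h1 : ∀ y, isB y ≤ 1 := fun y => by cases y <;> decide
    have h2 := h1 x
    have h3 := h1 ((x :: w).getLast (by simp))
    have hne : ∀ {y}, isB y = 1 → y ≠ .a := fun {y} h => by rintro rfl; simp [isB] at h
    have hx : x ≠ .a := hne (by omega)
    have hl : (x :: w).getLast (by simp) ≠ .a := hne (by omega)
    obtain ⟨l, z, hlz, hz⟩ : ∃ l z, (phi false (x :: w)).1 = l ++ [z] ∧ z ≠ .a := by
      have e := List.dropLast_append_getLast (l := x :: w) (by simp)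
      have ho' : ¬ EvenA (x :: w).dropLast := fun h' => ho (by
        rw [← e, EvenA, List.count_append, List.count_singleton]
        simpa [hl] using (show Even _ from h'))
      have := phi_append_singleton_fst hl (x :: w).dropLast false (by simpa using ho')
      rwa [e] at this
    obtain ⟨y, l', hyl, hy⟩ : ∃ y l', (phi false (x :: w)).2 = y :: l' ∧ y ≠ .a := by
      cases x <;> simp [phi, sec] at hx ⊢
    have hs := weight_phi (f := isB) false (x :: w)
    rw [secWeight_isB, hlz, hyl] at hs
    have e : comp₀₁ (x :: w) = l.foldr Grigorchuk.redCons
        (Grigorchuk.redCons z (Grigorchuk.redCons y (red l'))) := by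
      rw [comp₀₁_eq_red, hlz, hyl]
      simp [red]
    have h4 := isWeight_isB.foldr_le l
      (Grigorchuk.redCons z (Grigorchuk.redCons y (red l')))
    have h5 := (reduced_red l').isB_redCons_redCons_le hz hy
    have h6 := isWeight_isB.red_le l'
    rw [e]
    generalize weight isB (x :: w) = n at *
    simp only [weight_append, weight_cons, weight_nil, (isB_of_ne hz).1, (isB_of_ne hy).1] at hs
    omega

theorem Reduced.length_child_even {w : Word} (h : Reduced w) (he : EvenA w) :
    ∀ c ∈ children w, 2 * c.length ≤ w.length + 1 := by
  have h0 := length_comp₀_le w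
  have h1 := length_comp₁_le w
  have h2 := weight_isA_add_isB w
  have h3 := h.count_le
  rw [children_even he]
  simp only [List.mem_cons, List.not_mem_nil, or_false, forall_eq_or_imp, forall_eq]
  omega

/-- The child of an odd word is not longer than the word. In odd length, if no letter is lost, then
the child is even. -/
theorem Reduced.length_comp₀₁_le {w : Word} (h : Reduced w) (ho : ¬ EvenA w) :
    (comp₀₁ w).length ≤ w.length ∧
      ((comp₀₁ w).length = w.length → ¬ EvenA (comp₀₁ w) → Even w.length) := by
  have h1 : (comp₀₁ w).length ≤ 2 * weight isB w := by
    have := isWeight_one.comp₀₁_le w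
    rw [weight_one] at this
    exact this.trans (secWeight_one_le w)
  have h2 := weight_isA_add_isB w
  have h3 := h.count_le
  by_cases hw : weight isB w = weight isA w + 1
  · have h4 := h.isB_comp₀₁_lt ho hw
    have h5 : Reduced (comp₀₁ w) := reduced_red _
    have h6 := h5.count_le
    have h7 := weight_isA_add_isB (comp₀₁ w)
    refine ⟨by omega, fun he ho' => absurd ?_ ho'⟩
    rw [evenA_iff_weight] at ho ⊢
    have h8 : weight isA (comp₀₁ w) = weight isA w + 1 := by omega
    rw [h8, Nat.even_add_one]
    exact ho
  · refine ⟨by omega, fun he _ => ?_⟩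
    have : w.length = 2 * weight isB w := by omega
    rw [this]
    exact even_two_mul _

/-- In even length there are as many letters `a` as others, and concatenating the components
contracts the weight. -/
theorem Reduced.wt_comp₀₁_le {w : Word} (h : Reduced w) (he : Even w.length) :
    6 * weight wt (comp₀₁ w) ≤ 5 * weight wt w := by
  have h1 := isWeight_wt.comp₀₁_le w
  have h2 := secWeight_wt_le w
  have h3 := h.count_le
  have h4 := weight_isA_add_isB w
  obtain ⟨k, hk⟩ := he
  omega

theorem depth_of_lt {m : ℕ} {w : Word} (h : w.length < m) : Depth m 0 w := .inl h

/-- Three steps down in the splitting tree lead to shorter words, except perhaps for letters. -/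
theorem Reduced.depth {w : Word} (h : Reduced w) : Depth w.length 3 w := by
  -- The case of an even word.
  have even : ∀ {v : Word}, Reduced v → EvenA v → v.length = w.length → Depth w.length 1 v := by
    intro v hv he hl
    by_cases h1 : v.length ≤ 1
    · exact .inl (.inr h1)
    · refine .inr ⟨hl.le, fun c hc => ?_⟩
      have := hv.length_child_even he c hc
      exact depth_of_lt (by omega)
  -- The case of an odd word whose child has been dealt with.
  have odd : ∀ {v : Word} {d : ℕ}, Reduced v → ¬ EvenA v → v.length = w.length →
      ((comp₀₁ v).length = w.length → Depth w.length d (comp₀₁ v)) → Depth w.length (d + 1) v := by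
    intro v d hv ho hl hd
    refine .inr ⟨hl.le, fun c hc => ?_⟩
    rw [children_odd ho, List.mem_singleton] at hc
    subst hc
    have h1 := (hv.length_comp₀₁_le ho).1
    by_cases h2 : (comp₀₁ v).length = w.length
    · exact hd h2
    · have h0 : Depth w.length 0 (comp₀₁ v) := depth_of_lt (by omega)
      clear hd
      induction d with
      | zero => exact h0
      | succ d ih => exact ih.succ
  by_cases e0 : EvenA w
  · exact (even h e0 rfl).succ.succ
  refine odd h e0 rfl fun l1 => ?_
  have r1 : Reduced (comp₀₁ w) := reduced_red _
  by_cases e1 : EvenA (comp₀₁ w)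
  · exact (even r1 e1 l1).succ
  refine odd r1 e1 l1 fun l2 => ?_
  have r2 : Reduced (comp₀₁ (comp₀₁ w)) := reduced_red _
  by_cases e2 : EvenA (comp₀₁ (comp₀₁ w))
  · exact even r2 e2 l2
  refine odd r2 e2 l2 fun l3 => ?_
  -- Four words of the same even length `n`: the weight drops from at most `3n` by the factor
  -- `(5/6)³` but stays at least `2n`.
  have r3 : Reduced (comp₀₁ (comp₀₁ (comp₀₁ w))) := reduced_red _
  have hev := (h.length_comp₀₁_le e0).2 l1 e1
  have w1 := h.wt_comp₀₁_le hev
  have w2 := r1.wt_comp₀₁_le (l1 ▸ hev)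
  have w3 := r2.wt_comp₀₁_le (l2 ▸ hev)
  have w0 := wt_eq w
  have w4 := three_isA_add_isB_le_wt (comp₀₁ (comp₀₁ (comp₀₁ w)))
  have w5 := weight_isA_add_isB (comp₀₁ (comp₀₁ (comp₀₁ w)))
  have w6 := r3.count_le
  obtain ⟨k, hk⟩ := hev
  have : w.length = 0 := by omega
  exact .inr (by omega)

/-! ### Splitting trees -/

/-- The labels of the vertices, with multiplicity. -/
def SplittingTree.nodes : {w : Word} → SplittingTree w → List Word
  | _, .leaf w _ => [w]
  | _, .even w _ _ t₀ t₁ => w :: (t₀.nodes ++ t₁.nodes)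
  | _, .odd w _ _ t => w :: t.nodes

theorem SplittingTree.mem_nodes {w x : Word} (T : SplittingTree w) :
    x ∈ T.nodes ↔ x ∈ T.labels := by
  induction T with
  | leaf => simp [nodes, labels]
  | even w _ _ t₀ t₁ h₀ h₁ =>
    simp only [nodes, labels, List.mem_cons, List.mem_append, h₀, h₁, Set.mem_union,
      Set.mem_singleton_iff, or_assoc]
  | odd w _ _ t h =>
    simp only [nodes, labels, List.mem_cons, h, Set.mem_union, Set.mem_singleton_iff]

theorem SplittingTree.root_mem {w : Word} (T : SplittingTree w) : w ∈ T.labels := by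
  cases T <;> simp [labels]

theorem SplittingTree.children_mem {w : Word} (T : SplittingTree w) {x : Word}
    (hx : x ∈ T.labels) : ∀ c ∈ children x, c ∈ T.labels ∨ c.length ≤ 1 := by
  induction T with
  | leaf w h =>
    simp only [labels, Set.mem_singleton_iff] at hx
    subst hx
    exact fun c hc => .inr (length_children_of_length_le_one h c hc)
  | even w _ he t₀ t₁ h₀ h₁ =>
    simp only [labels, Set.mem_union, Set.mem_singleton_iff] at hx ⊢
    rcases hx with (rfl | hx) | hx
    · intro c hc
      rw [children_even he] at hc
      rcases List.mem_pair.1 hc with rfl | rfl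
      · exact .inl (.inl (.inr t₀.root_mem))
      · exact .inl (.inr t₁.root_mem)
    · exact fun c hc => (h₀ hx c hc).imp_left fun h => .inl (.inr h)
    · exact fun c hc => (h₁ hx c hc).imp_left fun h => .inr h
  | odd w _ ho t h =>
    simp only [labels, Set.mem_union, Set.mem_singleton_iff] at hx ⊢
    rcases hx with rfl | hx
    · intro c hc
      rw [children_odd ho, List.mem_singleton] at hc
      subst hc
      exact .inl (.inr t.root_mem)
    · exact fun c hc => (h hx c hc).imp_left fun h => .inr h

/-- The labels of `T(w)` are in every set that contains `w` and is closed under children. -/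
theorem SplittingTree.labels_subset {w : Word} (T : SplittingTree w) {R : Word → Prop}
    (hR : ∀ x, R x → ∀ c ∈ children x, R c) (hw : R w) : ∀ x ∈ T.labels, R x := by
  induction T with
  | leaf w h => simpa [labels] using hw
  | even w _ he t₀ t₁ h₀ h₁ =>
    have hc := hR w hw
    simp only [children_even he, List.mem_cons, List.not_mem_nil, or_false,
      forall_eq_or_imp, forall_eq] at hc
    simp only [labels, Set.mem_union, Set.mem_singleton_iff]
    rintro x ((rfl | hx) | hx)
    · exact hw
    · exact h₀ hc.1 x hx
    · exact h₁ hc.2 x hx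
  | odd w _ ho t h =>
    have hc := hR w hw
    simp only [children_odd ho, List.mem_singleton, forall_eq] at hc
    simp only [labels, Set.mem_union, Set.mem_singleton_iff]
    rintro x (rfl | hx)
    · exact hw
    · exact h hc x hx

theorem SplittingTree.reduced {w : Word} (T : SplittingTree w) (hw : Reduced w) :
    ∀ x ∈ T.labels, Reduced x :=
  T.labels_subset (fun _ _ _ hc => reduced_of_mem_children hc) hw

theorem nonempty_splittingTree {w : Word} (hw : Reduced w) : Nonempty (SplittingTree w) := by
  induction hm : w.length using Nat.strong_induction_on generalizing w with
  | _ m ih =>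
    have key : ∀ d {v : Word}, Reduced v → Depth m d v → Nonempty (SplittingTree v) := by
      intro d
      induction d with
      | zero =>
        intro v hv hd
        rcases hd with hd | hd
        · exact ih _ hd hv rfl
        · exact ⟨.leaf v hd⟩
      | succ d ihd =>
        intro v hv hd
        rcases hd with (hd | hd) | ⟨-, hd⟩
        · exact ih _ hd hv rfl
        · exact ⟨.leaf v hd⟩
        · by_cases h1 : v.length ≤ 1
          · exact ⟨.leaf v h1⟩
          have hc : ∀ c ∈ children v, Nonempty (SplittingTree c) := fun c hc =>
            ihd (reduced_of_mem_children hc) (hd c hc)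
          by_cases he : EvenA v
          · simp only [children_even he, List.mem_cons, List.not_mem_nil, or_false,
              forall_eq_or_imp, forall_eq] at hc
            exact ⟨.even v (by omega) he hc.1.some hc.2.some⟩
          · simp only [children_odd he, List.mem_singleton, forall_eq] at hc
            exact ⟨.odd v (by omega) he hc.some⟩
    exact key 3 hw (hm ▸ hw.depth)

/-- The number of cells needed for a list of words. -/
def cells (l : List Word) : ℕ := (l.map fun x => x.length + 1).sum

@[simp] theorem cells_nil : cells [] = 0 := rfl

@[simp] theorem cells_cons (w : Word) (l : List Word) :
    cells (w :: l) = w.length + 1 + cells l := by simp [cells]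

@[simp] theorem cells_append (l l' : List Word) : cells (l ++ l') = cells l + cells l' := by
  simp [cells]

theorem cells_le_of_nodup {l l' : List Word} (h : l.Nodup) (hs : ∀ x ∈ l, x ∈ l') :
    cells l ≤ cells l' := by
  obtain ⟨l₁, hp, hl⟩ := h.subperm hs
  rw [cells, ← (hp.map _).sum_eq]
  exact (hl.map _).sum_le_sum fun _ _ => Nat.zero_le _

/-- The splitting tree of a word has linear size: by the contraction of weights the total weight
decreases geometrically from level to level until only finitely many words remain. -/
theorem exists_splittingTree_cells_le :
    ∃ C, ∀ w, Reduced w → ∃ T : SplittingTree w, cells T.nodes ≤ C * (w.length + 1) := by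
  have T : ∀ w : {w // Reduced w}, SplittingTree w.1 := fun w => (nonempty_splittingTree w.2).some
  -- `c` bounds the trees of the words of weight less than `30`.
  obtain ⟨c, hc⟩ : ∃ c, ∀ w (hw : Reduced w), weight wt w < 30 → cells (T ⟨w, hw⟩).nodes ≤ c := by
    have hf : {w : {w // Reduced w} | w.1.length < 30}.Finite :=
      (List.finite_length_lt Letter 30).preimage Subtype.val_injective.injOn
    obtain ⟨c, hc⟩ := (hf.image fun w => cells (T w).nodes).bddAbove
    exact ⟨c, fun w hw h => hc ⟨⟨w, hw⟩, (length_le_wt w).trans_lt h, rfl⟩⟩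
  have key : ∀ n w, Reduced w → weight wt w = n →
      ∃ T : SplittingTree w, cells T.nodes ≤ 12 * (c + 2) * n + c := by
    intro n
    induction n using Nat.strong_induction_on with
    | _ n ih =>
      intro w hw hn
      by_cases hs : n < 30
      · exact ⟨_, (hc w hw (hn ▸ hs)).trans (Nat.le_add_left _ _)⟩
      have hl := length_le_wt w
      have hl' := wt_eq w
      have h1 := secWeight_wt_le w
      have h2 := hw.count_le
      by_cases he : EvenA w
      · have h3 := isWeight_wt.comp_le w
        obtain ⟨T₀, hT₀⟩ := ih (weight wt (comp₀ w)) (by omega) (comp₀ w) (reduced_red _) rfl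
        obtain ⟨T₁, hT₁⟩ := ih (weight wt (comp₁ w)) (by omega) (comp₁ w) (reduced_red _) rfl
        refine ⟨.even w (by omega) he T₀ T₁, ?_⟩
        simp only [SplittingTree.nodes, cells_cons, cells_append]
        have h4 : 6 * (weight wt (comp₀ w) + weight wt (comp₁ w)) ≤ 5 * n + 15 := by omega
        have h5 : w.length ≤ n := by omega
        have h6 := Nat.mul_le_mul_left (2 * (c + 2)) h4
        have h7 : c * 30 ≤ c * n := Nat.mul_le_mul_left c (by omega)
        ring_nf at h6 h7 hT₀ hT₁ ⊢
        omega
      · have h3 := isWeight_wt.comp₀₁_le w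
        obtain ⟨T₀, hT₀⟩ := ih (weight wt (comp₀₁ w)) (by omega) (comp₀₁ w) (reduced_red _) rfl
        refine ⟨.odd w (by omega) he T₀, ?_⟩
        simp only [SplittingTree.nodes, cells_cons]
        have h4 : 6 * weight wt (comp₀₁ w) ≤ 5 * n + 15 := by omega
        have h5 : w.length ≤ n := by omega
        have h6 := Nat.mul_le_mul_left (2 * (c + 2)) h4
        have h7 : c * 30 ≤ c * n := Nat.mul_le_mul_left c (by omega)
        ring_nf at h6 h7 hT₀ ⊢
        omega
  refine ⟨36 * (c + 2) + c, fun w hw => ?_⟩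
  obtain ⟨T, hT⟩ := key _ w hw rfl
  refine ⟨T, hT.trans ?_⟩
  have := wt_eq w
  nlinarith

end Grigorchuk


namespace Grigorchuk

open RAM

/-! ### The word machine -/

/-- Word registers. -/
inductive WReg where
  | rx | ry | rz | ru | rv | c₀ | c₁ | ri | rt | rk | rw | v₁ | v₂ | v₃ | rs | d₀ | d₁
  deriving DecidableEq

instance : Fintype WReg :=
  ⟨{.rx, .ry, .rz, .ru, .rv, .c₀, .c₁, .ri, .rt, .rk, .rw, .v₁, .v₂, .v₃, .rs,
    .d₀, .d₁},
    fun r => by cases r <;> decide⟩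

/-- Number registers. -/
inductive NReg where
  | flag | nf | ng | nh | par | ne | q₀ | q₁ | q₂ | q₃ | res
  deriving DecidableEq

instance : Fintype NReg :=
  ⟨{.flag, .nf, .ng, .nh, .par, .ne, .q₀, .q₁, .q₂, .q₃, .res},
    fun r => by cases r <;> decide⟩

/-- Arrays of words. -/
inductive WArr where
  | queue | fwd | ch₀ | ch₁ | rep | ent | bfs
  deriving DecidableEq

instance : Fintype WArr :=
  ⟨{.queue, .fwd, .ch₀, .ch₁, .rep, .ent, .bfs},
    fun r => by cases r <;> decide⟩

/-- Arrays of numbers. -/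
inductive NArr where
  | seen | pre | lab | par | kap | k₀ | k₁ | done | q | entF
  deriving DecidableEq

instance : Fintype NArr :=
  ⟨{.seen, .pre, .lab, .par, .kap, .k₀, .k₁, .done, .q, .entF},
    fun r => by cases r <;> decide⟩

/-- States of the word machine: registers that hold words or numbers, and arrays of words and of
numbers that are indexed by words. -/
structure WState where
  w : WReg → Word
  n : NReg → ℕ
  wa : WArr → Word → Word
  na : NArr → Word → ℕ
  inp : List ℕ
  out : List ℕ

namespace WState

/-- Assignment to a word register. -/
def setW (s : WState) (x : WReg) (u : Word) : WState := { s with w := Function.update s.w x u }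

/-- Assignment to a number register. -/
def setN (s : WState) (f : NReg) (k : ℕ) : WState := { s with n := Function.update s.n f k }

/-- Assignment to a cell of an array of words. -/
def putW (s : WState) (a : WArr) (u v : Word) : WState :=
  { s with wa := Function.update s.wa a (Function.update (s.wa a) u v) }

/-- Assignment to a cell of an array of numbers. -/
def putN (s : WState) (b : NArr) (u : Word) (k : ℕ) : WState :=
  { s with na := Function.update s.na b (Function.update (s.na b) u k) }

/-- The initial state on an input. -/
def init (l : List ℕ) : WState := ⟨fun _ => [], fun _ => 0, fun _ _ => [], fun _ _ => 0, l, []⟩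

end WState

/-- Elementary instructions of the word machine. -/
inductive WOp where
  | nil (x : WReg)
  | copy (x y : WReg)
  | push (x : WReg) (ℓ : Letter)
  | pop (x : WReg)
  | get (x : WReg) (a : WArr) (y : WReg)
  | put (a : WArr) (x y : WReg)
  | const (f : NReg) (k : ℕ)
  | ncopy (f g : NReg)
  | nget (f : NReg) (b : NArr) (y : WReg)
  | nput (b : NArr) (x : WReg) (f : NReg)
  | read (f : NReg)
  | write (f : NReg)

/-- The effect of an elementary instruction. -/
def WOp.eval : WOp → WState → WState
  | .nil x, s => s.setW x []
  | .copy x y, s => s.setW x (s.w y)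
  | .push x ℓ, s => s.setW x (ℓ :: s.w x)
  | .pop x, s => s.setW x (s.w x).tail
  | .get x a y, s => s.setW x (s.wa a (s.w y))
  | .put a x y, s => s.putW a (s.w x) (s.w y)
  | .const f k, s => s.setN f k
  | .ncopy f g, s => s.setN f (s.n g)
  | .nget f b y, s => s.setN f (s.na b (s.w y))
  | .nput b x f, s => s.putN b (s.w x) (s.n f)
  | .read f, s => { s.setN f (s.inp.headD 0) with inp := s.inp.tail }
  | .write f, s => { s with out := s.out ++ [s.n f] }

/-- Programs of the word machine: case distinctions on the first letter of a word, on a number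
less than `m`, and on the equality of two words, and loops over the letters of a word. -/
inductive WProg where
  | skip
  | op (o : WOp)
  | seq (p q : WProg)
  | caseW (x : WReg) (f : Option Letter → WProg)
  | caseN (f : NReg) (m : ℕ) (P : ℕ → WProg)
  | ifEq (x y : WReg) (p q : WProg)
  | each (x : WReg) (f : Letter → WProg)

namespace WProg

/-- The effect of a program. A loop is over the word that is in the register when it starts. -/
def ev : WProg → WState → WState
  | .skip, s => s
  | .op o, s => o.eval s
  | .seq p q, s => q.ev (p.ev s)
  | .caseW x f, s => (f (s.w x).head?).ev s
  | .caseN f m P, s => if s.n f < m then (P (s.n f)).ev s else s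
  | .ifEq x y p q, s => if s.w x = s.w y then p.ev s else q.ev s
  | .each x f, s => (s.w x).foldl (fun s ℓ => (f ℓ).ev s) s

/-- The cost of a loop over a word. -/
def loopCost (F : Letter → WState → WState) (c : Letter → WState → ℕ) : Word → WState → ℕ
  | [], _ => 1
  | ℓ :: l, s => 1 + c ℓ s + loopCost F c l (F ℓ s)

/-- The number of steps of a program. -/
def cost : WProg → WState → ℕ
  | .skip, _ => 1
  | .op _, _ => 1
  | .seq p q, s => p.cost s + q.cost (p.ev s)
  | .caseW x f, s => 1 + (f (s.w x).head?).cost s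
  | .caseN f m P, s => if s.n f < m then 1 + (P (s.n f)).cost s else 1
  | .ifEq x y p q, s => if s.w x = s.w y then 1 + p.cost s else 1 + q.cost s
  | .each x f, s => loopCost (fun ℓ => (f ℓ).ev) (fun ℓ => (f ℓ).cost) (s.w x) s

end WProg

/-! ### Simulation by a random access machine -/

section RAM

/-- `p` leads from `σ` to `τ` in at most `c` steps. -/
def Steps (p : Prog) (σ τ : State) (c : ℕ) : Prop := ∃ t ≤ c, Exec p σ τ t

theorem Steps.mono {p : Prog} {σ τ : State} {c c' : ℕ} (h : Steps p σ τ c) (hc : c ≤ c') :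
    Steps p σ τ c' := by
  obtain ⟨t, ht, h⟩ := h
  exact ⟨t, ht.trans hc, h⟩

theorem Steps.seq {p q : Prog} {σ τ υ : State} {c c' : ℕ} (h : Steps p σ τ c)
    (h' : Steps q τ υ c') : Steps (.seq p q) σ υ (c + c') := by
  obtain ⟨t, ht, h⟩ := h
  obtain ⟨t', ht', h'⟩ := h'
  exact ⟨t + t', by omega, .seq h h'⟩

theorem Steps.ifTrue {p q : Prog} {σ τ : State} {c r s : ℕ} (hr : σ.reg r = σ.reg s)
    (h : Steps p σ τ c) : Steps (.ifEq r s p q) σ τ (c + 1) := by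
  obtain ⟨t, ht, h⟩ := h
  exact ⟨t + 1, by omega, .ifTrue hr h⟩

theorem Steps.ifFalse {p q : Prog} {σ τ : State} {c r s : ℕ} (hr : σ.reg r ≠ σ.reg s)
    (h : Steps q σ τ c) : Steps (.ifEq r s p q) σ τ (c + 1) := by
  obtain ⟨t, ht, h⟩ := h
  exact ⟨t + 1, by omega, .ifFalse hr h⟩

theorem Steps.whileDone {p : Prog} {σ : State} {r s : ℕ} (hr : σ.reg r = σ.reg s) :
    Steps (.whileNe r s p) σ σ 1 := ⟨1, le_rfl, .whileDone hr⟩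

theorem Steps.whileStep {p : Prog} {σ τ υ : State} {c c' r s : ℕ} (hr : σ.reg r ≠ σ.reg s)
    (h : Steps p σ τ c) (h' : Steps (.whileNe r s p) τ υ c') :
    Steps (.whileNe r s p) σ υ (c + c' + 1) := by
  obtain ⟨t, ht, h⟩ := h
  obtain ⟨t', ht', h'⟩ := h'
  exact ⟨t + t' + 1, by omega, .whileStep hr h h'⟩

theorem State.set_set (σ : State) (r a b : ℕ) : (σ.set r a).set r b = σ.set r b := by
  simp [State.set]

@[simp] theorem State.set_reg_self (σ : State) (r a : ℕ) : (σ.set r a).reg r = a := by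
  simp [State.set]

theorem State.set_reg_ne (σ : State) {r r' : ℕ} (a : ℕ) (h : r' ≠ r) :
    (σ.set r a).reg r' = σ.reg r' := by
  simp [State.set, h]

@[simp] theorem State.set_mem (σ : State) (r a : ℕ) : (σ.set r a).mem = σ.mem := rfl

/-- Add a constant to a register. -/
def addConst (r : ℕ) : ℕ → Prog
  | 0 => .skip
  | k + 1 => .seq (.succ r) (addConst r k)

theorem steps_addConst (r k : ℕ) (σ : State) :
    Steps (addConst r k) σ (σ.set r (σ.reg r + k)) (k + 1) := by
  induction k generalizing σ with
  | zero =>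
    refine ⟨1, le_rfl, ?_⟩
    have : σ.set r (σ.reg r + 0) = σ := by simp [State.set]
    rw [this]
    exact .skip σ
  | succ k ih =>
    have h := ih (σ.set r (σ.reg r + 1))
    rw [State.set_set, State.set_reg_self] at h
    have := Steps.seq ⟨1, le_rfl, .succ r σ⟩ h
    refine (?_ : σ.reg r + 1 + k = σ.reg r + (k + 1)) ▸ this.mono (by omega)
    omega

/-- Branch on the value of a register, if it is less than `m`. Register `1` is overwritten. -/
def cascade (r : ℕ) (P : ℕ → Prog) : ℕ → Prog
  | 0 => .skip
  | m + 1 => .seq (.const 1 m) (.ifEq r 1 (P m) (cascade r P m))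

theorem steps_cascade {r : ℕ} (hr : r ≠ 1) (P : ℕ → Prog) {m : ℕ} {σ τ : State} {c : ℕ}
    (hm : σ.reg r < m) (h : Steps (P (σ.reg r)) (σ.set 1 (σ.reg r)) τ c) :
    Steps (cascade r P m) σ τ (c + 2 * m) := by
  -- The initial content of register `1` is irrelevant.
  suffices ∀ k, Steps (P (σ.reg r)) (σ.set 1 (σ.reg r)) τ c →
      Steps (cascade r P m) (σ.set 1 k) τ (c + 2 * m) by
    have h2 : σ.set 1 (σ.reg 1) = σ := by simp [State.set]
    rw [← h2]
    exact this _ h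
  clear h
  intro k h
  induction m generalizing k with
  | zero => omega
  | succ m ih =>
    have h1 : Steps (.const 1 m) (σ.set 1 k) (σ.set 1 m) 1 := by
      have := Exec.const 1 m (σ.set 1 k)
      rw [State.set_set] at this
      exact ⟨1, le_rfl, this⟩
    have hreg : (σ.set 1 m).reg r = σ.reg r := State.set_reg_ne _ _ hr
    by_cases he : σ.reg r = m
    · have h2 := Steps.ifTrue (q := cascade r P m) (r := r) (s := 1) (σ := σ.set 1 m)
        (by rw [hreg]; simpa using he) (he ▸ h)
      exact (h1.seq h2).mono (by omega)
    · have h2 := Steps.ifFalse (p := P m) (r := r) (s := 1) (σ := σ.set 1 m)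
        (by rw [hreg]; simpa using he) (ih (by omega) m)
      exact (h1.seq h2).mono (by omega)

theorem steps_cascade_of_le {r : ℕ} (hr : r ≠ 1) (P : ℕ → Prog) {m : ℕ} {σ : State}
    (hm : m ≤ σ.reg r) : ∃ k, Steps (cascade r P m) σ (σ.set 1 k) (2 * m + 1) := by
  suffices ∀ k, ∃ k', Steps (cascade r P m) (σ.set 1 k) (σ.set 1 k') (2 * m + 1) by
    have h2 : σ.set 1 (σ.reg 1) = σ := by simp [State.set]
    simpa only [h2] using this (σ.reg 1)
  intro k
  induction m generalizing k with
  | zero => exact ⟨k, 1, le_rfl, .skip _⟩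
  | succ m ih =>
    have h1 : Steps (.const 1 m) (σ.set 1 k) (σ.set 1 m) 1 := by
      have := Exec.const 1 m (σ.set 1 k)
      rw [State.set_set] at this
      exact ⟨1, le_rfl, this⟩
    have hreg : (σ.set 1 m).reg r = σ.reg r := State.set_reg_ne _ _ hr
    obtain ⟨k', h3⟩ := ih (by omega) m
    have h2 := Steps.ifFalse (p := P m) (r := r) (s := 1) (σ := σ.set 1 m)
        (by rw [hreg, State.set_reg_self]; omega) h3
    exact ⟨k', (h1.seq h2).mono (by omega)⟩

/-- The fields of a node: the first letter of the word and the pointer to the rest, the pointers to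
the words with one more letter in front, and the array cells with this index. -/
abbrev Field : Type := Unit ⊕ Unit ⊕ Letter ⊕ WArr ⊕ NArr

/-- The size of a node. -/
def width : ℕ := Fintype.card Field

/-- The position of a field in a node. -/
noncomputable def off (φ : Field) : ℕ := Fintype.equivFin Field φ

theorem off_lt (φ : Field) : off φ < width := (Fintype.equivFin Field φ).2

theorem addr_inj {i j : ℕ} {φ ψ : Field} :
    width * i + off φ = width * j + off ψ ↔ i = j ∧ φ = ψ := by
  constructor
  · intro h
    have hφ := off_lt φ
    have hψ := off_lt ψ
    have h1 := congrArg (· / width) h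
    have h2 := congrArg (· % width) h
    simp only [Nat.mul_add_div (by omega : 0 < width), Nat.div_eq_of_lt hφ,
      Nat.div_eq_of_lt hψ, Nat.mul_add_mod, Nat.mod_eq_of_lt hφ, Nat.mod_eq_of_lt hψ] at h1 h2
    exact ⟨by simpa using h1, (Fintype.equivFin Field).injective (Fin.ext h2)⟩
  · rintro ⟨rfl, rfl⟩; rfl

/-- The RAM register for a word register. Registers `0, 1, 2` are for temporary use, register `3`
holds `0` and register `4` the first free address. -/
noncomputable def wr (x : WReg) : ℕ := 5 + 3 * (Fintype.equivFin WReg x : ℕ)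

/-- The RAM register for a number register. -/
noncomputable def nr (f : NReg) : ℕ := 6 + 3 * (Fintype.equivFin NReg f : ℕ)

/-- The RAM register for a loop of nesting depth `d`. -/
def hid (d : ℕ) : ℕ := 7 + 3 * d

theorem wr_inj {x y : WReg} : wr x = wr y ↔ x = y := by
  refine ⟨fun h => ?_, fun h => h ▸ rfl⟩
  exact (Fintype.equivFin WReg).injective (Fin.ext (by unfold wr at h; omega))

theorem nr_inj {x y : NReg} : nr x = nr y ↔ x = y := by
  refine ⟨fun h => ?_, fun h => h ▸ rfl⟩
  exact (Fintype.equivFin NReg).injective (Fin.ext (by unfold nr at h; omega))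

theorem wr_ne_nr (x : WReg) (f : NReg) : wr x ≠ nr f := by unfold wr nr; omega

theorem wr_ne_hid (x : WReg) (d : ℕ) : wr x ≠ hid d := by unfold wr hid; omega

theorem nr_ne_hid (f : NReg) (d : ℕ) : nr f ≠ hid d := by unfold nr hid; omega

theorem five_le_wr (x : WReg) : 5 ≤ wr x := by unfold wr; omega

theorem five_le_nr (x : NReg) : 5 ≤ nr x := by unfold nr; omega

theorem five_le_hid (d : ℕ) : 5 ≤ hid d := by unfold hid; omega

/-- The address of the node of a word, if `E` is the list of all words that have a node. -/
def ptr (E : List Word) (u : Word) : ℕ := width * E.idxOf u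

/-- The code of the first letter of a word. -/
def headCode : Word → ℕ
  | [] => 0
  | ℓ :: _ => ℓ.code

/-- The content of a field of the node of `u`. -/
def fieldVal (E : List Word) (s : WState) (u : Word) : Field → ℕ
  | .inl _ => headCode u
  | .inr (.inl _) => ptr E u.tail
  | .inr (.inr (.inl ℓ)) => if ℓ :: u ∈ E then ptr E (ℓ :: u) else 0
  | .inr (.inr (.inr (.inl a))) => ptr E (s.wa a u)
  | .inr (.inr (.inr (.inr b))) => s.na b u

/-- The state `σ` of the RAM represents the state `s` of the word machine, where exactly the words
in `E` have a node. -/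
structure Rep (E : List Word) (s : WState) (σ : State) : Prop where
  nodup : E.Nodup
  root : E.idxOf [] = 0
  nil_mem : [] ∈ E
  tail_mem : ∀ u ∈ E, u.tail ∈ E
  w_mem : ∀ x, s.w x ∈ E
  wa_mem : ∀ a u, s.wa a u ∈ E
  wa_out : ∀ a u, u ∉ E → s.wa a u = []
  na_out : ∀ b u, u ∉ E → s.na b u = 0
  reg_w : ∀ x, σ.reg (wr x) = ptr E (s.w x)
  reg_n : ∀ f, σ.reg (nr f) = s.n f
  zero : σ.reg 3 = 0
  free : σ.reg 4 = width * E.length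
  mem : ∀ u ∈ E, ∀ φ, σ.mem (ptr E u + off φ) = fieldVal E s u φ
  fresh : ∀ p, width * E.length ≤ p → σ.mem p = 0
  inp : σ.inp = s.inp
  out : σ.out = s.out

theorem width_pos : 0 < width := (Nat.zero_le _).trans_lt (off_lt (.inl ()))

theorem ptr_prefix {E E' : List Word} (h : E <+: E') {u : Word} (hu : u ∈ E) :
    ptr E' u = ptr E u := by
  obtain ⟨l, rfl⟩ := h
  rw [ptr, List.idxOf_append_of_mem hu, ptr]

theorem ptr_inj {E : List Word} {u v : Word} (hu : u ∈ E) :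
    ptr E u = ptr E v ↔ u = v := by
  refine ⟨fun h => ?_, fun h => h ▸ rfl⟩
  exact (List.idxOf_inj hu).1 (Nat.eq_of_mul_eq_mul_left width_pos h)

theorem Rep.ptr_eq_zero {E : List Word} {s : WState} {σ : State} (h : Rep E s σ) {u : Word} :
    ptr E u = 0 ↔ u = [] := by
  have h0 : ptr E [] = 0 := by rw [ptr, h.root, mul_zero]
  rw [← h0]
  exact eq_comm.trans ((ptr_inj h.nil_mem).trans eq_comm)

/-- Fetch the address of a field into a register. -/
noncomputable def fetch (r r' : ℕ) (φ : Field) : Prog := .seq (.move r r') (addConst r (off φ))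

theorem steps_fetch (r r' : ℕ) (φ : Field) (σ : State) :
    Steps (fetch r r' φ) σ (σ.set r (σ.reg r' + off φ)) (width + 2) := by
  have h := Steps.seq ⟨1, le_rfl, .move r r' σ⟩ (steps_addConst r (off φ) _)
  rw [State.set_set, State.set_reg_self] at h
  exact h.mono (by have := off_lt φ; omega)

theorem steps_load (r r' : ℕ) (σ : State) :
    Steps (.load r r') σ (σ.set r (σ.mem (σ.reg r'))) 1 := ⟨1, le_rfl, .load r r' σ⟩

theorem steps_move (r r' : ℕ) (σ : State) :
    Steps (.move r r') σ (σ.set r (σ.reg r')) 1 := ⟨1, le_rfl, .move r r' σ⟩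

variable {E : List Word} {s : WState} {σ : State}

theorem Rep.set_tmp (h : Rep E s σ) {r : ℕ} (hr : r < 3) (k : ℕ) : Rep E s (σ.set r k) := by
  have e : ∀ r', 3 ≤ r' → (σ.set r k).reg r' = σ.reg r' := fun r' h' =>
    State.set_reg_ne _ _ (by omega)
  exact { h with
    reg_w := fun x => by rw [e _ (by have := five_le_wr x; omega), h.reg_w]
    reg_n := fun x => by rw [e _ (by have := five_le_nr x; omega), h.reg_n]
    zero := by rw [e _ (by omega), h.zero]
    free := by rw [e _ (by omega), h.free] }

theorem Rep.set_hid (h : Rep E s σ) (d k : ℕ) : Rep E s (σ.set (hid d) k) := by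
  have e : ∀ r', r' ≠ hid d → (σ.set (hid d) k).reg r' = σ.reg r' := fun r' h' =>
    State.set_reg_ne _ _ h'
  exact { h with
    reg_w := fun x => by rw [e _ (wr_ne_hid x d), h.reg_w]
    reg_n := fun x => by rw [e _ (nr_ne_hid x d), h.reg_n]
    zero := by rw [e _ (by unfold hid; omega), h.zero]
    free := by rw [e _ (by unfold hid; omega), h.free] }

theorem Rep.setW (h : Rep E s σ) (x : WReg) {u : Word} (hu : u ∈ E) :
    Rep E (s.setW x u) (σ.set (wr x) (ptr E u)) := by
  have e : ∀ r', r' ≠ wr x → (σ.set (wr x) (ptr E u)).reg r' = σ.reg r' := fun r' h' =>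
    State.set_reg_ne _ _ h'
  have h5 := five_le_wr x
  exact { h with
    w_mem := fun y => by
      by_cases hy : y = x
      · subst hy; simpa [WState.setW] using hu
      · simpa [WState.setW, hy] using h.w_mem y
    reg_w := fun y => by
      by_cases hy : y = x
      · subst hy; simp [WState.setW]
      · rw [e _ (fun h' => hy (wr_inj.1 h')), h.reg_w]; simp [WState.setW, hy]
    reg_n := fun f => by rw [e _ (wr_ne_nr x f).symm, h.reg_n]; rfl
    zero := by rw [e _ (by omega), h.zero]
    free := by rw [e _ (by omega), h.free] }

theorem Rep.setN (h : Rep E s σ) (f : NReg) (k : ℕ) :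
    Rep E (s.setN f k) (σ.set (nr f) k) := by
  have e : ∀ r', r' ≠ nr f → (σ.set (nr f) k).reg r' = σ.reg r' := fun r' h' =>
    State.set_reg_ne _ _ h'
  have h5 := five_le_nr f
  exact { h with
    reg_w := fun y => by rw [e _ (wr_ne_nr y f), h.reg_w]; rfl
    reg_n := fun y => by
      by_cases hy : y = f
      · subst hy; simp [WState.setN]
      · rw [e _ (fun h' => hy (nr_inj.1 h')), h.reg_n]; simp [WState.setN, hy]
    zero := by rw [e _ (by omega), h.zero]
    free := by rw [e _ (by omega), h.free] }

theorem mem_update {u v : Word} (hu : u ∈ E) {φ ψ : Field} {k : ℕ} :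
    Function.update σ.mem (ptr E u + off φ) k (ptr E v + off ψ) =
      if v = u ∧ ψ = φ then k else σ.mem (ptr E v + off ψ) := by
  have : ptr E v + off ψ = ptr E u + off φ ↔ v = u ∧ ψ = φ := by
    unfold ptr
    rw [addr_inj, eq_comm, List.idxOf_inj hu, eq_comm]
  simp only [Function.update_apply, this]

theorem Rep.fresh_update (h : Rep E s σ) {u : Word} (hu : u ∈ E) {φ : Field} {k : ℕ} :
    ∀ p, width * E.length ≤ p → Function.update σ.mem (ptr E u + off φ) k p = 0 := by
  intro p hp
  have h1 : ptr E u + width ≤ width * E.length := by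
    rw [ptr, ← Nat.mul_succ]
    exact Nat.mul_le_mul_left _ (List.idxOf_lt_length_iff.2 hu)
  have h2 := off_lt φ
  rw [Function.update_of_ne (by omega), h.fresh p hp]

/-- An array of words is a field of the nodes: writing a cell is a write to the memory. -/
theorem Rep.putW (h : Rep E s σ) (a : WArr) {u v : Word} (hu : u ∈ E) (hv : v ∈ E) :
    Rep E (s.putW a u v)
      { σ with mem :=
          Function.update σ.mem (ptr E u + off (.inr (.inr (.inr (.inl a))))) (ptr E v) } := by
  have e : ∀ a' u', (s.putW a u v).wa a' u' = if a' = a ∧ u' = u then v else s.wa a' u' := by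
    intro a' u'
    by_cases ha : a' = a
    · subst ha; simp [WState.putW, Function.update_apply]
    · simp [WState.putW, ha]
  exact { h with
    wa_mem := fun a' u' => by rw [e]; split_ifs; exacts [hv, h.wa_mem _ _]
    wa_out := fun a' u' hu' => by
      rw [e, if_neg (by rintro ⟨-, rfl⟩; exact hu' hu), h.wa_out _ _ hu']
    mem := fun u' hu' φ => by
      dsimp only
      rw [mem_update hu, h.mem u' hu']
      rcases φ with _ | _ | _ | a' | b
      · simp [fieldVal]
      · simp [fieldVal]
      · simp [fieldVal]
      · simp only [fieldVal, e, Sum.inr.injEq, Sum.inl.injEq, and_comm]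
        split_ifs <;> rfl
      · simp [fieldVal, WState.putW]
    fresh := h.fresh_update hu }

theorem Rep.putN (h : Rep E s σ) (b : NArr) {u : Word} (hu : u ∈ E) (k : ℕ) :
    Rep E (s.putN b u k)
      { σ with mem := Function.update σ.mem (ptr E u + off (.inr (.inr (.inr (.inr b))))) k } := by
  have e : ∀ b' u', (s.putN b u k).na b' u' = if b' = b ∧ u' = u then k else s.na b' u' := by
    intro a' u'
    by_cases ha : a' = b
    · subst ha; simp [WState.putN, Function.update_apply]
    · simp [WState.putN, ha]
  exact { h with
    na_out := fun a' u' hu' => by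
      rw [e, if_neg (by rintro ⟨-, rfl⟩; exact hu' hu), h.na_out _ _ hu']
    mem := fun u' hu' φ => by
      dsimp only
      rw [mem_update hu, h.mem u' hu']
      rcases φ with _ | _ | _ | a' | b'
      · simp [fieldVal]
      · simp [fieldVal]
      · simp [fieldVal]
      · simp [fieldVal, WState.putN]
      · simp only [fieldVal, e, Sum.inr.injEq, and_comm]
    fresh := h.fresh_update hu }

/-- Allocation of a node. -/
theorem Rep.alloc (h : Rep E s σ) {u : Word} (hu : u ∈ E) {ℓ : Letter} (hℓ : ℓ :: u ∉ E)
    {m : ℕ → ℕ} {σ' : State}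
    (hm : m = Function.update (Function.update (Function.update σ.mem
      (ptr E u + off (.inr (.inr (.inl ℓ)))) (width * E.length))
      (width * E.length + off (.inl ())) ℓ.code)
      (width * E.length + off (.inr (.inl ()))) (ptr E u))
    (hσ : σ' = { σ.set 4 (width * (E.length + 1)) with mem := m }) :
    Rep (E ++ [ℓ :: u]) s σ' := by
  have hpre : E <+: E ++ [ℓ :: u] := List.prefix_append _ _
  have hp : ∀ {v}, v ∈ E → ptr (E ++ [ℓ :: u]) v = ptr E v := ptr_prefix hpre
  have hnew : ptr (E ++ [ℓ :: u]) (ℓ :: u) = width * E.length := by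
    rw [ptr, List.idxOf_append_of_notMem hℓ]; simp
  have hr : ∀ r, r ≠ 4 → σ'.reg r = σ.reg r := fun r hr => by
    rw [hσ]; exact State.set_reg_ne _ _ hr
  have hold : ∀ {v ψ}, v ∈ E → m (ptr E v + off ψ) =
      if v = u ∧ ψ = .inr (.inr (.inl ℓ)) then width * E.length else σ.mem (ptr E v + off ψ) := by
    intro v ψ hv
    have hlt : ∀ φ, ptr E v + off ψ ≠ width * E.length + off φ := fun φ h' => by
      have := (addr_inj.1 h').1
      have := List.idxOf_lt_length_iff.2 hv
      omega
    rw [hm, Function.update_of_ne (hlt _), Function.update_of_ne (hlt _), mem_update hu]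
  have hnew' : ∀ ψ, m (width * E.length + off ψ) = fieldVal (E ++ [ℓ :: u]) s (ℓ :: u) ψ := by
    intro ψ
    have h1 : ∀ {φ}, width * E.length + off ψ = width * E.length + off φ ↔ ψ = φ := by
      intro φ; rw [addr_inj]; simp
    have h2 : Function.update σ.mem (ptr E u + off (.inr (.inr (.inl ℓ)))) (width * E.length)
        (width * E.length + off ψ) = 0 :=
      h.fresh_update hu _ (by omega)
    rw [hm, Function.update_apply, Function.update_apply, h2]
    simp only [h1]
    rcases ψ with _ | _ | ℓ' | a | b
    · simp [fieldVal, headCode]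
    · simp [fieldVal, hp hu]
    · have : ℓ' :: ℓ :: u ∉ E ++ [ℓ :: u] := by
        intro h'
        rcases List.mem_append.1 h' with h' | h'
        · exact hℓ (h.tail_mem _ h')
        · have := congrArg List.length (List.mem_singleton.1 h')
          simp at this
      simp only [fieldVal, if_neg this]
      simp
    · simp only [fieldVal, h.wa_out a _ hℓ]
      rw [ptr_prefix hpre h.nil_mem, h.ptr_eq_zero.2 rfl]
      simp
    · simp [fieldVal, h.na_out b _ hℓ]
  have hmem : σ'.mem = m := by rw [hσ]
  refine ⟨?_, ?_, ?_, ?_, ?_, ?_, ?_, ?_, ?_, ?_, ?_, ?_, ?_, ?_, ?_, ?_⟩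
  · exact h.nodup.append (List.nodup_singleton _) (by simpa using hℓ)
  · rw [List.idxOf_append_of_mem h.nil_mem, h.root]
  · simp [h.nil_mem]
  · intro v hv
    rcases List.mem_append.1 hv with hv | hv
    · exact List.mem_append_left _ (h.tail_mem v hv)
    · rw [List.mem_singleton.1 hv]; exact List.mem_append_left _ hu
  · exact fun x => List.mem_append_left _ (h.w_mem x)
  · exact fun a v => List.mem_append_left _ (h.wa_mem a v)
  · exact fun a v hv => h.wa_out a v fun h' => hv (List.mem_append_left _ h')
  · exact fun a v hv => h.na_out a v fun h' => hv (List.mem_append_left _ h')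
  · intro x
    rw [hr _ (by have := five_le_wr x; omega), hp (h.w_mem x), h.reg_w]
  · intro x
    rw [hr _ (by have := five_le_nr x; omega), h.reg_n]
  · rw [hr _ (by omega), h.zero]
  · rw [hσ]; simp
  · intro v hv ψ
    rw [hmem]
    by_cases hv' : v ∈ E
    · rw [hp hv', hold hv', h.mem v hv']
      rcases ψ with _ | _ | ℓ' | a | b
      · simp [fieldVal]
      · simp [fieldVal, hp (h.tail_mem v hv')]
      · by_cases h1 : v = u ∧ ℓ' = ℓ
        · obtain ⟨rfl, rfl⟩ := h1
          simp [fieldVal, hnew]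
        · have h2 : ¬ (v = u ∧ (Sum.inr (Sum.inr (Sum.inl ℓ')) : Field) =
              Sum.inr (Sum.inr (Sum.inl ℓ))) := by simpa using h1
          have h3 : ℓ' :: v ≠ ℓ :: u := by
            intro h'; injection h' with h' h''; exact h1 ⟨h'', h'⟩
          rw [if_neg h2]
          simp only [fieldVal, List.mem_append, List.mem_singleton, h3, or_false]
          split_ifs with h4
          · rw [hp h4]
          · rfl
      · simp [fieldVal, hp (h.wa_mem a v)]
      · simp [fieldVal]
    · have : v = ℓ :: u := by
        rcases List.mem_append.1 hv with hv | hv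
        · exact absurd hv hv'
        · exact List.mem_singleton.1 hv
      rw [this, hnew, hnew']
  · intro p hp'
    rw [List.length_append, List.length_singleton, Nat.mul_succ] at hp'
    have h1 := off_lt (.inl ())
    have h2 := off_lt (.inr (.inl ()))
    rw [hmem, hm, Function.update_of_ne (by omega), Function.update_of_ne (by omega)]
    exact h.fresh_update hu p (by omega)
  · rw [hσ]; exact h.inp
  · rw [hσ]; exact h.out

end RAM

end Grigorchuk


namespace Grigorchuk

open RAM

section Compile

/-- The program for an elementary instruction. To push a letter, the pointer to the longer word is
looked up, and a new node is made if there is none. -/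
noncomputable def WOp.compile : WOp → Prog
  | .nil x => .const (wr x) 0
  | .copy x y => .move (wr x) (wr y)
  | .push x ℓ =>
    .seq (fetch 0 (wr x) (.inr (.inr (.inl ℓ)))) <| .seq (.load 1 0) <|
      .ifEq 1 3
        (.seq (.store 0 4) <| .seq (fetch 0 4 (.inl ())) <| .seq (.const 1 ℓ.code) <|
          .seq (.store 0 1) <| .seq (fetch 0 4 (.inr (.inl ()))) <| .seq (.store 0 (wr x)) <|
          .seq (.move (wr x) 4) (addConst 4 width))
        (.move (wr x) 1)
  | .pop x => .seq (fetch 0 (wr x) (.inr (.inl ()))) (.load (wr x) 0)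
  | .get x a y => .seq (fetch 0 (wr y) (.inr (.inr (.inr (.inl a))))) (.load (wr x) 0)
  | .put a x y => .seq (fetch 0 (wr x) (.inr (.inr (.inr (.inl a))))) (.store 0 (wr y))
  | .const f k => .const (nr f) k
  | .ncopy f g => .move (nr f) (nr g)
  | .nget f b y => .seq (fetch 0 (wr y) (.inr (.inr (.inr (.inr b))))) (.load (nr f) 0)
  | .nput b x f => .seq (fetch 0 (wr x) (.inr (.inr (.inr (.inr b))))) (.store 0 (nr f))
  | .read f => .read (nr f)
  | .write f => .write (nr f)

/-- The letter with a given code, if any. -/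
def ofCode : ℕ → Option Letter
  | 1 => some .a
  | 2 => some .b
  | 3 => some .c
  | 4 => some .d
  | _ => none

theorem ofCode_headCode (u : Word) : ofCode (headCode u) = u.head? := by
  rcases u with _ | ⟨_ | _ | _ | _, u⟩ <;> rfl

theorem headCode_lt (u : Word) : headCode u < 5 := by
  rcases u with _ | ⟨_ | _ | _ | _, u⟩ <;> simp [headCode, Letter.code]

/-- The program for a program of the word machine inside `d` loops. -/
noncomputable def WProg.compile : ℕ → WProg → Prog
  | _, .skip => .skip
  | _, .op o => o.compile
  | d, .seq p q => .seq (p.compile d) (q.compile d)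
  | d, .caseW x f =>
    .seq (fetch 0 (wr x) (.inl ())) <| .seq (.load 0 0) <|
      cascade 0 (fun k => (f (ofCode k)).compile d) 5
  | d, .caseN f m P => cascade (nr f) (fun k => (P k).compile d) m
  | d, .ifEq x y p q => .ifEq (wr x) (wr y) (p.compile d) (q.compile d)
  | d, .each x f =>
    .seq (.move (hid d) (wr x)) <| .whileNe (hid d) 3 <|
      .seq (fetch 0 (hid d) (.inl ())) <| .seq (.load 0 0) <|
      .seq (fetch 1 (hid d) (.inr (.inl ()))) <| .seq (.load (hid d) 1) <|
      cascade 0 (fun k => (f ((ofCode k).getD .a)).compile (d + 1)) 5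

variable {E : List Word} {s : WState} {σ : State}

/-- The machine `σ` reaches by `p`, within `c` steps, a state that represents `s'`, without
changing the registers for the loops outside. -/
def Sim (p : Prog) (d : ℕ) (E : List Word) (σ : State) (s' : WState) (c : ℕ) : Prop :=
  ∃ E' σ', E <+: E' ∧ Steps p σ σ' c ∧ Rep E' s' σ' ∧ ∀ j < d, σ'.reg (hid j) = σ.reg (hid j)

theorem hid_ne_of_lt {d r : ℕ} (hr : r < 5) : hid d ≠ r := by
  have := five_le_hid d; omega

theorem steps_fetch_load {r r' r₀ : ℕ} (φ : Field) (σ : State) :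
    Steps (.seq (fetch r₀ r' φ) (.load r r₀)) σ
      ((σ.set r₀ (σ.reg r' + off φ)).set r (σ.mem (σ.reg r' + off φ))) (width + 3) := by
  have h := (steps_fetch r₀ r' φ σ).seq (steps_load r r₀ _)
  simpa using h

/-- Every operation takes a bounded number of steps, since a word is represented by the address of
its node. New nodes are needed only for putting a letter in front of a word. -/
theorem WOp.compile_spec (o : WOp) (d : ℕ) (h : Rep E s σ) :
    Sim o.compile d E σ (o.eval s) (4 * width + 20) := by
  cases o with
  | nil x =>
    refine ⟨E, _, List.prefix_rfl, Steps.mono ⟨1, le_rfl, .const (wr x) 0 σ⟩ (by omega), ?_,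
      fun j _ => State.set_reg_ne _ _ (wr_ne_hid x j).symm⟩
    have := h.setW x h.nil_mem
    rwa [h.ptr_eq_zero.2 rfl] at this
  | copy x y =>
    refine ⟨E, _, List.prefix_rfl, (steps_move (wr x) (wr y) σ).mono (by omega), ?_,
      fun j _ => State.set_reg_ne _ _ (wr_ne_hid x j).symm⟩
    rw [h.reg_w]
    exact h.setW x (h.w_mem y)
  | push x ℓ =>
    have hu := h.w_mem x
    have hm := h.mem _ hu (.inr (.inr (.inl ℓ)))
    have h1 := steps_fetch_load (r := 1) (r' := wr x) (r₀ := 0) (.inr (.inr (.inl ℓ))) σ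
    rw [h.reg_w, hm] at h1
    have hx5 := five_le_wr x
    by_cases hℓ : ℓ :: s.w x ∈ E
    · rw [show fieldVal E s (s.w x) (.inr (.inr (.inl ℓ))) = ptr E (ℓ :: s.w x) from if_pos hℓ]
        at h1
      set τ := (σ.set 0 (ptr E (s.w x) + off (.inr (.inr (.inl ℓ))))).set 1 (ptr E (ℓ :: s.w x))
      have hτ : Rep E s τ := (h.set_tmp (by omega) _).set_tmp (by omega) _
      have hτ1 : τ.reg 1 = ptr E (ℓ :: s.w x) := State.set_reg_self _ _ _
      refine ⟨E, τ.set (wr x) (ptr E (ℓ :: s.w x)), List.prefix_rfl, ?_, hτ.setW x hℓ, ?_⟩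
      · have hmv : Exec (.move (wr x) 1) τ (τ.set (wr x) (ptr E (ℓ :: s.w x))) 1 := by
          have := Exec.move (wr x) 1 τ
          rwa [hτ1] at this
        obtain ⟨t, ht, h1⟩ := h1
        cases h1 with
        | seq ha hb =>
          refine ⟨_, ?_, .seq ha (.seq hb (.ifFalse ?_ hmv))⟩
          · omega
          · rw [hτ1, hτ.zero]
            exact fun h' => by simpa using h.ptr_eq_zero.1 h'
      · intro j _
        rw [State.set_reg_ne _ _ (wr_ne_hid x j).symm, State.set_reg_ne _ _ (hid_ne_of_lt (by omega)),
          State.set_reg_ne _ _ (hid_ne_of_lt (by omega))]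
    · rw [show fieldVal E s (s.w x) (.inr (.inr (.inl ℓ))) = 0 from if_neg hℓ] at h1
      obtain ⟨t, ht, h1⟩ := h1
      cases h1 with
      | seq ha hb =>
        have hpre : E <+: E ++ [ℓ :: s.w x] := List.prefix_append _ _
        have hnew : ptr (E ++ [ℓ :: s.w x]) (ℓ :: s.w x) = width * E.length := by
          rw [ptr, List.idxOf_append_of_notMem hℓ]; simp
        set p₀ := ptr E (s.w x) + off (.inr (.inr (.inl ℓ)))
        set τ := (σ.set 0 p₀).set 1 0 with hτdef
        have hτ : Rep E s τ := (h.set_tmp (by omega) _).set_tmp (by omega) _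
        have hτ0 : τ.reg 0 = p₀ := by
          rw [hτdef, State.set_reg_ne _ _ (by omega), State.set_reg_self]
        let τ₁ : State := { τ with mem := Function.update τ.mem (τ.reg 0) (τ.reg 4) }
        obtain ⟨t₂, ht₂, s₂⟩ := steps_fetch 0 4 (.inl ()) τ₁
        set τ₂ := τ₁.set 0 (τ₁.reg 4 + off (.inl ()))
        let τ₃ := τ₂.set 1 ℓ.code
        let τ₄ : State := { τ₃ with mem := Function.update τ₃.mem (τ₃.reg 0) (τ₃.reg 1) }
        obtain ⟨t₅, ht₅, s₅⟩ := steps_fetch 0 4 (.inr (.inl ())) τ₄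
        set τ₅ := τ₄.set 0 (τ₄.reg 4 + off (.inr (.inl ())))
        let τ₆ : State := { τ₅ with mem := Function.update τ₅.mem (τ₅.reg 0) (τ₅.reg (wr x)) }
        let τ₇ := τ₆.set (wr x) (τ₆.reg 4)
        obtain ⟨t₈, ht₈, s₈⟩ := steps_addConst 4 width τ₇
        set τ₈ := τ₇.set 4 (τ₇.reg 4 + width)
        have r4 : τ.reg 4 = width * E.length := hτ.free
        have rx : τ.reg (wr x) = ptr E (s.w x) := hτ.reg_w x
        have h2 : wr x ≠ 0 := by omega
        have h3 : wr x ≠ 1 := by omega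
        have h4 : wr x ≠ 4 := by omega
        -- The state in which the new node is complete but the register not yet changed.
        have hrep := h.alloc (σ' := { σ.set 4 (width * (E.length + 1)) with mem := τ₈.mem })
          hu hℓ (m := τ₈.mem)
          (by
            change Function.update (Function.update (Function.update _ _ _) _ _) _ _ = _
            simp [τ₅, τ₄, τ₃, τ₂, τ₁, State.set, h2, h3, r4, rx, hτ0]
            rfl)
          rfl
        have hrep2 := ((hrep.setW x (u := ℓ :: s.w x) (by simp)).set_tmp
          (show 0 < 3 by omega) (τ₈.reg 0)).set_tmp (show 1 < 3 by omega) (τ₈.reg 1)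
        refine ⟨E ++ [ℓ :: s.w x], τ₈, hpre,
          ⟨_, ?_, .seq ha (.seq hb (.ifTrue ?_ (.seq (.store 0 4 τ) (.seq s₂ (.seq (.const 1 ℓ.code τ₂)
            (.seq (.store 0 1 τ₃) (.seq s₅ (.seq (.store 0 (wr x) τ₅) (.seq (.move (wr x) 4 τ₆)
              s₈)))))))))⟩, ?_, ?_⟩
        · omega
        · rw [hτ.zero]; exact State.set_reg_self _ _ _
        · have key : τ₈ = ((({ σ.set 4 (width * (E.length + 1)) with mem := τ₈.mem } : State).set
              (wr x) (ptr (E ++ [ℓ :: s.w x]) (ℓ :: s.w x))).set 0 (τ₈.reg 0)).set 1 (τ₈.reg 1) := by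
            have hreg : τ₈.reg = (((({ σ.set 4 (width * (E.length + 1)) with mem := τ₈.mem } :
                State).set (wr x) (ptr (E ++ [ℓ :: s.w x]) (ℓ :: s.w x))).set 0 (τ₈.reg 0)).set 1
                (τ₈.reg 1)).reg := by
              funext r
              by_cases e1 : r = 1
              · subst e1; exact (State.set_reg_self _ _ _).symm
              by_cases e0 : r = 0
              · subst e0
                exact ((State.set_reg_ne _ _ (by omega)).trans (State.set_reg_self _ _ _)).symm
              rw [State.set_reg_ne _ _ e1, State.set_reg_ne _ _ e0, hnew]
              simp only [State.set, τ₈, τ₇, τ₆, τ₅, τ₄, τ₃, τ₂, τ₁, Function.update_apply]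
              by_cases ex : r = wr x
              · subst ex
                simp [h4, r4]
              · by_cases e4 : r = 4
                · subst e4
                  simp [h4.symm, r4, mul_add]
                · simp [e0, e1, e4, ex, hτdef, State.set]
            exact congrArg (fun g => ({ reg := g, mem := τ₈.mem, inp := σ.inp, out := σ.out } :
              State)) hreg
          rw [key]
          exact hrep2
        · intro j _
          have a0 : hid j ≠ 0 := hid_ne_of_lt (by omega)
          have a1 : hid j ≠ 1 := hid_ne_of_lt (by omega)
          have a4 : hid j ≠ 4 := hid_ne_of_lt (by omega)
          have ax := (wr_ne_hid x j).symm
          simp [τ₈, τ₇, τ₆, τ₅, τ₄, τ₃, τ₂, τ₁, hτdef, State.set, a0, a1, a4, ax]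
  | pop x =>
    have h1 := steps_fetch_load (r := wr x) (r' := wr x) (r₀ := 0) (.inr (.inl ())) σ
    rw [h.reg_w, h.mem _ (h.w_mem x)] at h1
    refine ⟨E, _, List.prefix_rfl, h1.mono (by omega),
      (h.set_tmp (by omega) _).setW x (h.tail_mem _ (h.w_mem x)), fun j _ => ?_⟩
    rw [State.set_reg_ne _ _ (wr_ne_hid x j).symm, State.set_reg_ne _ _ (hid_ne_of_lt (by omega))]
  | get x a y =>
    have h1 := steps_fetch_load (r := wr x) (r' := wr y) (r₀ := 0) (.inr (.inr (.inr (.inl a)))) σ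
    rw [h.reg_w, h.mem _ (h.w_mem y)] at h1
    refine ⟨E, _, List.prefix_rfl, h1.mono (by omega),
      (h.set_tmp (by omega) _).setW x (h.wa_mem a (s.w y)), fun j _ => ?_⟩
    rw [State.set_reg_ne _ _ (wr_ne_hid x j).symm, State.set_reg_ne _ _ (hid_ne_of_lt (by omega))]
  | put a x y =>
    obtain ⟨t, ht, h1⟩ := steps_fetch 0 (wr x) (.inr (.inr (.inr (.inl a)))) σ
    rw [h.reg_w] at h1
    have h2 := h.set_tmp (show 0 < 3 by omega) (ptr E (s.w x) + off (.inr (.inr (.inr (.inl a)))))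
    refine ⟨E, _, List.prefix_rfl, ⟨_, ?_, .seq h1 (.store 0 (wr y) _)⟩, ?_, fun j _ => ?_⟩
    · omega
    · rw [State.set_reg_self, h2.reg_w]
      exact h2.putW a (h.w_mem x) (h.w_mem y)
    · exact State.set_reg_ne _ _ (hid_ne_of_lt (by omega))
  | const f k =>
    exact ⟨E, _, List.prefix_rfl, Steps.mono ⟨1, le_rfl, .const (nr f) k σ⟩ (by omega),
      h.setN f k, fun j _ => State.set_reg_ne _ _ (nr_ne_hid f j).symm⟩
  | ncopy f g =>
    refine ⟨E, _, List.prefix_rfl, (steps_move (nr f) (nr g) σ).mono (by omega), ?_,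
      fun j _ => State.set_reg_ne _ _ (nr_ne_hid f j).symm⟩
    rw [h.reg_n]
    exact h.setN f _
  | nget f b y =>
    have h1 := steps_fetch_load (r := nr f) (r' := wr y) (r₀ := 0) (.inr (.inr (.inr (.inr b)))) σ
    rw [h.reg_w, h.mem _ (h.w_mem y)] at h1
    refine ⟨E, _, List.prefix_rfl, h1.mono (by omega),
      (h.set_tmp (by omega) _).setN f (s.na b (s.w y)), fun j _ => ?_⟩
    rw [State.set_reg_ne _ _ (nr_ne_hid f j).symm, State.set_reg_ne _ _ (hid_ne_of_lt (by omega))]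
  | nput b x f =>
    obtain ⟨t, ht, h1⟩ := steps_fetch 0 (wr x) (.inr (.inr (.inr (.inr b)))) σ
    rw [h.reg_w] at h1
    have h2 := h.set_tmp (show 0 < 3 by omega) (ptr E (s.w x) + off (.inr (.inr (.inr (.inr b)))))
    refine ⟨E, _, List.prefix_rfl, ⟨_, ?_, .seq h1 (.store 0 (nr f) _)⟩, ?_, fun j _ => ?_⟩
    · omega
    · rw [State.set_reg_self, h2.reg_n]
      exact h2.putN b (h.w_mem x) _
    · exact State.set_reg_ne _ _ (hid_ne_of_lt (by omega))
  | read f =>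
    refine ⟨E, _, List.prefix_rfl, Steps.mono ⟨1, le_rfl, .read (nr f) σ⟩ (by omega), ?_,
      fun j _ => State.set_reg_ne _ _ (nr_ne_hid f j).symm⟩
    have h1 := h.setN f (s.inp.headD 0)
    rw [h.inp]
    exact { h1 with inp := by simp [WOp.eval] }
  | write f =>
    refine ⟨E, _, List.prefix_rfl, Steps.mono ⟨1, le_rfl, .write (nr f) σ⟩ (by omega), ?_,
      fun j _ => rfl⟩
    exact { h with out := by simp [WOp.eval, h.out, h.reg_n] }

theorem Sim.seq {p q : Prog} {d c c' : ℕ} {s' s'' : WState} (h : Sim p d E σ s' c)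
    (h' : ∀ E' σ', E <+: E' → Rep E' s' σ' → Sim q d E' σ' s'' c') :
    Sim (.seq p q) d E σ s'' (c + c') := by
  obtain ⟨E₁, σ₁, e₁, h₁, r₁, k₁⟩ := h
  obtain ⟨E₂, σ₂, e₂, h₂, r₂, k₂⟩ := h' E₁ σ₁ e₁ r₁
  exact ⟨E₂, σ₂, e₁.trans e₂, h₁.seq h₂, r₂, fun j hj => (k₂ j hj).trans (k₁ j hj)⟩

theorem Sim.mono {p : Prog} {d c c' : ℕ} {s' : WState} (h : Sim p d E σ s' c) (hc : c ≤ c') :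
    Sim p d E σ s' c' := by
  obtain ⟨E₁, σ₁, e₁, h₁, r₁, k₁⟩ := h
  exact ⟨E₁, σ₁, e₁, h₁.mono hc, r₁, k₁⟩

theorem exists_bound {α : Type*} [Finite α] {P : α → ℕ → Prop}
    (hm : ∀ a c c', c ≤ c' → P a c → P a c') (h : ∀ a, ∃ c, P a c) : ∃ c, ∀ a, P a c := by
  choose c hc using h
  have := Fintype.ofFinite α
  exact ⟨Finset.univ.sup c, fun a => hm a _ _ (Finset.le_sup (Finset.mem_univ a)) (hc a)⟩

/-- A loop body preceded by a step to the next letter. -/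
theorem Sim.each {x : WReg} {f : Letter → WProg} {d C : ℕ}
    (ih : ∀ ℓ {E s σ}, Rep E s σ →
      Sim ((f ℓ).compile (d + 1)) (d + 1) E σ ((f ℓ).ev s) (C * (f ℓ).cost s))
    (h : Rep E s σ) :
    Sim ((WProg.each x f).compile d) d E σ ((WProg.each x f).ev s)
      ((C + 2 * width + 30) * (WProg.each x f).cost s) := by
  have loop : ∀ (l : Word) {E s σ}, Rep E s σ → l ∈ E → σ.reg (hid d) = ptr E l →
      Sim (.whileNe (hid d) 3 <|
        .seq (fetch 0 (hid d) (.inl ())) <| .seq (.load 0 0) <|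
        .seq (fetch 1 (hid d) (.inr (.inl ()))) <| .seq (.load (hid d) 1) <|
        cascade 0 (fun k => (f ((ofCode k).getD .a)).compile (d + 1)) 5) d E σ
        (l.foldl (fun s ℓ => (f ℓ).ev s) s)
        ((C + 2 * width + 29) *
          WProg.loopCost (fun ℓ => (f ℓ).ev) (fun ℓ => (f ℓ).cost) l s) := by
    intro l
    induction l with
    | nil =>
      intro E s σ h _ hr
      refine ⟨E, σ, List.prefix_rfl, (Steps.whileDone ?_).mono ?_, h, fun _ _ => rfl⟩
      · rw [hr, h.zero, h.ptr_eq_zero]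
      · simp only [WProg.loopCost]; omega
    | cons ℓ l ihl =>
      intro E s σ h hl hr
      obtain ⟨t₁, ht₁, s₁⟩ := steps_fetch_load (r := 0) (r' := hid d) (r₀ := 0) (.inl ()) σ
      rw [hr, h.mem _ hl] at s₁
      set σ₁ := (σ.set 0 (ptr E (ℓ :: l) + off (.inl ()))).set 0 (fieldVal E s (ℓ :: l) (.inl ()))
        with hσ₁
      have r₁ : Rep E s σ₁ := (h.set_tmp (by omega) _).set_tmp (by omega) _
      have e₁ : ∀ j, σ₁.reg (hid j) = σ.reg (hid j) := fun j => by
        rw [hσ₁, State.set_reg_ne _ _ (hid_ne_of_lt (by omega)),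
          State.set_reg_ne _ _ (hid_ne_of_lt (by omega))]
      obtain ⟨t₂, ht₂, s₂⟩ :=
        steps_fetch_load (r := hid d) (r' := hid d) (r₀ := 1) (.inr (.inl ())) σ₁
      rw [e₁, hr, r₁.mem _ hl] at s₂
      set σ₂ := (σ₁.set 1 (ptr E (ℓ :: l) + off (.inr (.inl ())))).set (hid d)
        (fieldVal E s (ℓ :: l) (.inr (.inl ()))) with hσ₂
      have r₂ : Rep E s σ₂ := (r₁.set_tmp (by omega) _).set_hid _ _
      have e₂ : ∀ j < d, σ₂.reg (hid j) = σ.reg (hid j) := fun j hj => by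
        rw [hσ₂, State.set_reg_ne _ _ (by unfold hid; omega),
          State.set_reg_ne _ _ (hid_ne_of_lt (by omega)), e₁]
      have e₂d : σ₂.reg (hid d) = ptr E l := State.set_reg_self _ _ _
      have e₂0 : σ₂.reg 0 = ℓ.code := by
        rw [hσ₂, State.set_reg_ne _ _ (hid_ne_of_lt (by omega)).symm,
          State.set_reg_ne _ _ (by omega)]
        exact State.set_reg_self _ _ _
      have hof : (ofCode ℓ.code).getD .a = ℓ := by cases ℓ <;> rfl
      have hlt : ℓ.code < 5 := by cases ℓ <;> decide
      obtain ⟨E₃, σ₃, p₃, s₃, r₃, e₃⟩ := ih ℓ (r₂.set_tmp (show 1 < 3 by omega) (σ₂.reg 0))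
      have e₃' : ∀ j < d + 1, σ₃.reg (hid j) = σ₂.reg (hid j) := fun j hj => by
        rw [e₃ j hj, State.set_reg_ne _ _ (hid_ne_of_lt (by omega))]
      obtain ⟨t₃, ht₃, s₃'⟩ := steps_cascade (r := 0) (by omega)
        (fun k => (f ((ofCode k).getD .a)).compile (d + 1)) (m := 5) (by rw [e₂0]; exact hlt)
        (by rw [e₂0, hof]; rwa [e₂0] at s₃)
      obtain ⟨E₄, σ₄, p₄, s₄, r₄, e₄⟩ := ihl r₃ (p₃.subset (h.tail_mem _ hl))
        (by rw [e₃' d (by omega), e₂d]; exact (ptr_prefix p₃ (h.tail_mem _ hl)).symm)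
      refine ⟨E₄, σ₄, p₃.trans p₄, ?_, r₄, fun j hj => ?_⟩
      · cases s₁ with
        | seq s₁ s₁' =>
          cases s₂ with
          | seq s₂ s₂' =>
            refine (Steps.whileStep ?_ ⟨_, le_rfl, .seq s₁ (.seq s₁' (.seq s₂ (.seq s₂' s₃')))⟩
              s₄).mono ?_
            · rw [hr, h.zero]
              exact fun h' => by simpa using h.ptr_eq_zero.1 h'
            · simp only [WProg.loopCost, mul_add]
              have : C * (f ℓ).cost s ≤ (C + 2 * width + 29) * (f ℓ).cost s :=
                Nat.mul_le_mul_right _ (by omega)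
              omega
      · rw [e₄ j hj, e₃' j (by omega), e₂ j hj]
  have h0 := h.set_hid d (σ.reg (wr x))
  obtain ⟨E₄, σ₄, p₄, s₄, r₄, e₄⟩ := loop (s.w x) h0 (h.w_mem x)
    (by rw [State.set_reg_self, h.reg_w])
  refine ⟨E₄, σ₄, p₄, ((steps_move (hid d) (wr x) σ).seq s₄).mono ?_, r₄, fun j hj => ?_⟩
  · have : 1 ≤ (WProg.each x f).cost s := by
      simp only [WProg.cost]
      cases s.w x <;> simp only [WProg.loopCost] <;> omega
    have e : WProg.loopCost (fun ℓ => (f ℓ).ev) (fun ℓ => (f ℓ).cost) (s.w x) s =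
      (WProg.each x f).cost s := rfl
    have e' : (C + 2 * width + 30) * (WProg.each x f).cost s =
      (C + 2 * width + 29) * (WProg.each x f).cost s + (WProg.each x f).cost s := by ring
    rw [e, e']
    omega
  · rw [e₄ j hj, State.set_reg_ne _ _ (by unfold hid; omega)]

/-- The compiled program simulates the program of the word machine with constant overhead. -/
theorem WProg.compile_spec (p : WProg) (d : ℕ) :
    ∃ C, ∀ {E s σ}, Rep E s σ → Sim (p.compile d) d E σ (p.ev s) (C * p.cost s) := by
  induction p generalizing d with
  | skip =>
    exact ⟨1, fun {E s σ} h => ⟨E, σ, List.prefix_rfl, ⟨1, le_rfl, .skip σ⟩, h, fun _ _ => rfl⟩⟩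
  | op o => exact ⟨4 * width + 20, fun h => by rw [cost, mul_one]; exact o.compile_spec d h⟩
  | seq p q hp hq =>
    obtain ⟨C, hp⟩ := hp d
    obtain ⟨C', hq⟩ := hq d
    refine ⟨max C C', fun h => ((hp h).seq fun E' σ' _ h' => hq h').mono ?_⟩
    rw [cost, mul_add]
    exact add_le_add (Nat.mul_le_mul_right _ (le_max_left _ _))
      (Nat.mul_le_mul_right _ (le_max_right _ _))
  | caseW x f ih =>
    obtain ⟨C, hC⟩ := exists_bound (α := Option Letter)
      (P := fun o C => ∀ {E s σ}, Rep E s σ →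
        Sim ((f o).compile d) d E σ ((f o).ev s) (C * (f o).cost s))
      (fun o c c' h h' E s σ hr => (h' hr).mono (Nat.mul_le_mul_right _ h)) (fun o => ih o d)
    refine ⟨C + width + 15, fun {E s σ} h => ?_⟩
    obtain ⟨t₁, ht₁, s₁⟩ := steps_fetch_load (r := 0) (r' := wr x) (r₀ := 0) (.inl ()) σ
    rw [h.reg_w, h.mem _ (h.w_mem x)] at s₁
    set σ₁ := (σ.set 0 (ptr E (s.w x) + off (.inl ()))).set 0 (fieldVal E s (s.w x) (.inl ()))
      with hσ₁
    have r₁ : Rep E s σ₁ := (h.set_tmp (by omega) _).set_tmp (by omega) _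
    have e0 : σ₁.reg 0 = headCode (s.w x) := State.set_reg_self _ _ _
    obtain ⟨E₃, σ₃, p₃, s₃, r₃, e₃⟩ :=
      hC (s.w x).head? (r₁.set_tmp (show 1 < 3 by omega) (σ₁.reg 0))
    obtain ⟨t₃, ht₃, s₃'⟩ := steps_cascade (r := 0) (by omega)
        (fun k => (f (ofCode k)).compile d) (m := 5) (by rw [e0]; exact headCode_lt _)
        (by rw [e0, ofCode_headCode]; rwa [e0] at s₃)
    refine ⟨E₃, σ₃, p₃, ?_, r₃, fun j hj => ?_⟩
    · cases s₁ with
      | seq s₁ s₁' =>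
        refine Steps.mono ⟨_, le_rfl, .seq s₁ (.seq s₁' s₃')⟩ ?_
        have : C * (f (s.w x).head?).cost s ≤ (C + width + 15) * (f (s.w x).head?).cost s :=
          Nat.mul_le_mul_right _ (by omega)
        rw [cost, mul_add]
        omega
    · rw [e₃ j hj, State.set_reg_ne _ _ (hid_ne_of_lt (by omega)), hσ₁,
        State.set_reg_ne _ _ (hid_ne_of_lt (by omega)),
        State.set_reg_ne _ _ (hid_ne_of_lt (by omega))]
  | caseN f m P ih =>
    obtain ⟨C, hC⟩ := exists_bound (α := Fin m)
      (P := fun i C => ∀ {E s σ}, Rep E s σ →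
        Sim ((P i).compile d) d E σ ((P i).ev s) (C * (P i).cost s))
      (fun o c c' h h' E s σ hr => (h' hr).mono (Nat.mul_le_mul_right _ h)) (fun i => ih i d)
    have hn : nr f ≠ 1 := by have := five_le_nr f; omega
    refine ⟨C + 2 * m + 1, fun {E s σ} h => ?_⟩
    by_cases hm : s.n f < m
    · obtain ⟨E₃, σ₃, p₃, s₃, r₃, e₃⟩ :=
        hC ⟨s.n f, hm⟩ (h.set_tmp (show 1 < 3 by omega) (s.n f))
      have s₃' := steps_cascade (r := nr f) hn
          (fun k => (P k).compile d) (m := m) (σ := σ) (by rw [h.reg_n]; exact hm)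
          (by rw [h.reg_n]; exact s₃)
      refine ⟨E₃, σ₃, p₃, s₃'.mono ?_, ?_, fun j hj => ?_⟩
      · simp only [cost, if_pos hm, mul_add, mul_one]
        have : C * (P (s.n f)).cost s ≤ (C + 2 * m + 1) * (P (s.n f)).cost s :=
          Nat.mul_le_mul_right _ (by omega)
        omega
      · simpa only [ev, if_pos hm] using r₃
      · rw [e₃ j hj, State.set_reg_ne _ _ (hid_ne_of_lt (by omega))]
    · obtain ⟨k, hk⟩ := steps_cascade_of_le hn (fun k => (P k).compile d) (m := m) (σ := σ)
        (by rw [h.reg_n]; omega)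
      refine ⟨E, _, List.prefix_rfl, hk.mono ?_, ?_, fun j hj => ?_⟩
      · simp only [cost, if_neg hm]; omega
      · simpa only [ev, if_neg hm] using h.set_tmp (by omega) k
      · rw [State.set_reg_ne _ _ (hid_ne_of_lt (by omega))]
  | ifEq x y p q hp hq =>
    obtain ⟨C, hp⟩ := hp d
    obtain ⟨C', hq⟩ := hq d
    refine ⟨C + C' + 1, fun {E s σ} h => ?_⟩
    have hiff : σ.reg (wr x) = σ.reg (wr y) ↔ s.w x = s.w y := by
      rw [h.reg_w, h.reg_w, ptr_inj (h.w_mem x)]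
    by_cases hxy : s.w x = s.w y
    · obtain ⟨E₃, σ₃, p₃, s₃, r₃, e₃⟩ := hp h
      refine ⟨E₃, σ₃, p₃, (s₃.ifTrue (hiff.2 hxy)).mono ?_, by simpa only [ev, if_pos hxy], e₃⟩
      simp only [cost, if_pos hxy]
      have : C * p.cost s ≤ (C + C' + 1) * p.cost s := Nat.mul_le_mul_right _ (by omega)
      rw [mul_add]; omega
    · obtain ⟨E₃, σ₃, p₃, s₃, r₃, e₃⟩ := hq h
      refine ⟨E₃, σ₃, p₃, (s₃.ifFalse (mt hiff.1 hxy)).mono ?_, by simpa only [ev, if_neg hxy],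
        e₃⟩
      simp only [cost, if_neg hxy]
      have : C' * q.cost s ≤ (C + C' + 1) * q.cost s := Nat.mul_le_mul_right _ (by omega)
      rw [mul_add]; omega
  | each x f ih =>
    obtain ⟨C, hC⟩ := exists_bound (α := Letter)
      (P := fun ℓ C => ∀ {E s σ}, Rep E s σ →
        Sim ((f ℓ).compile (d + 1)) (d + 1) E σ ((f ℓ).ev s) (C * (f ℓ).cost s))
      (fun o c c' h h' E s σ hr => (h' hr).mono (Nat.mul_le_mul_right _ h))
      (fun ℓ => ih ℓ (d + 1))
    exact ⟨_, fun h => Sim.each hC h⟩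

/-- After the free pointer has been set, the initial configuration of the random access machine
represents that of the word machine: only the empty word has a node. -/
theorem rep_init (l : List ℕ) :
    Rep [[]] (WState.init l) ((State.init l).set 4 width) := by
  have e : ∀ r', 5 ≤ r' → ((State.init l).set 4 width).reg r' = 0 := fun r' h' =>
    State.set_reg_ne _ _ (by omega)
  refine ⟨by simp, by simp, by simp, by simp, by simp [WState.init], by simp [WState.init],
    by simp [WState.init], by simp [WState.init],
    fun x => by rw [e _ (five_le_wr x)]; simp [WState.init, ptr],
    fun x => by rw [e _ (five_le_nr x)]; simp [WState.init], ?_, ?_, ?_, fun _ _ => rfl, rfl, rfl⟩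
  · rw [State.set_reg_ne _ _ (by omega)]; rfl
  · rw [State.set_reg_self]; simp
  · intro u hu φ
    rw [List.mem_singleton] at hu
    subst hu
    rcases φ with _ | _ | ℓ | a | b <;> simp [fieldVal, State.init, WState.init, ptr, headCode]

theorem WProg.one_le_cost (p : WProg) (s : WState) : 1 ≤ p.cost s := by
  induction p generalizing s with
  | skip => exact le_rfl
  | op o => exact le_rfl
  | seq p q hp _ => exact (hp s).trans (Nat.le_add_right _ _)
  | caseW x f _ => exact Nat.le_add_right _ _
  | caseN f m P _ => simp only [cost]; split_ifs <;> omega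
  | ifEq x y p q _ _ => simp only [cost]; split_ifs <;> omega
  | each x f _ => simp only [cost]; cases s.w x <;> simp only [loopCost] <;> omega

/-- For every parameter `a`, the program leads from states that satisfy `I a` to states that
satisfy `J a`, in time `O(N a)`. -/
def Reaches {α : Type} (N : α → ℕ) (P : Prog) (I J : α → WState → Prop) : Prop :=
  ∃ C, ∀ a {E s σ}, Rep E s σ → I a s →
    ∃ E' s' σ', Rep E' s' σ' ∧ J a s' ∧ Steps P σ σ' (C * N a)

variable {α : Type} {N : α → ℕ}

theorem Reaches.seq {P P' : Prog} {I J J' : α → WState → Prop} (h : Reaches N P I J)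
    (h' : Reaches N P' J J') : Reaches N (.seq P P') I J' := by
  obtain ⟨C, h⟩ := h
  obtain ⟨C', h'⟩ := h'
  refine ⟨C + C', fun a E s σ hr hI => ?_⟩
  obtain ⟨E₁, s₁, σ₁, r₁, j₁, t₁⟩ := h a hr hI
  obtain ⟨E₂, s₂, σ₂, r₂, j₂, t₂⟩ := h' a r₁ j₁
  exact ⟨E₂, s₂, σ₂, r₂, j₂, (t₁.seq t₂).mono (by rw [add_mul])⟩

theorem Reaches.of_ev {I J : α → WState → Prop} (p : WProg) (c : ℕ)
    (h : ∀ a s, I a s → J a (p.ev s) ∧ p.cost s ≤ c * N a) : Reaches N (p.compile 0) I J := by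
  obtain ⟨C, hC⟩ := p.compile_spec 0
  refine ⟨C * c, fun a E s σ hr hI => ?_⟩
  obtain ⟨E', σ', -, t, r, -⟩ := hC hr
  refine ⟨E', _, σ', r, (h a s hI).1, t.mono ?_⟩
  rw [mul_assoc]
  exact Nat.mul_le_mul_left _ (h a s hI).2

/-- Repeat a program while a number register is not `0`. -/
noncomputable def whileN (f : NReg) (p : WProg) : Prog := .whileNe (nr f) 3 (p.compile 0)

/-- Amortized analysis of a loop: in the invariant `L a k`, the number `k` bounds the time that is
still needed. -/
theorem Reaches.while {I J : α → WState → Prop} (L : α → ℕ → WState → Prop) {f : NReg}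
    {p : WProg} (c : ℕ) (hN : ∀ a, 1 ≤ N a)
    (hI : ∀ a s, I a s → ∃ k, L a k s ∧ k ≤ c * N a)
    (hL : ∀ a k s, L a k s → s.n f ≠ 0 → ∃ k', L a k' (p.ev s) ∧ p.cost s + k' ≤ k)
    (hJ : ∀ a k s, L a k s → s.n f = 0 → J a s) : Reaches N (whileN f p) I J := by
  obtain ⟨C, hC⟩ := p.compile_spec 0
  have key : ∀ a k, ∀ {E s σ}, Rep E s σ → L a k s →
      ∃ E' s' σ', Rep E' s' σ' ∧ J a s' ∧ Steps (whileN f p) σ σ' ((C + 1) * k + 1) := by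
    intro a k
    induction k using Nat.strong_induction_on with
    | _ k ih =>
      intro E s σ hr hl
      by_cases hf : s.n f = 0
      · refine ⟨E, s, σ, hr, hJ a k s hl hf, (Steps.whileDone ?_).mono (by omega)⟩
        rw [hr.reg_n, hr.zero, hf]
      · obtain ⟨k', hl', hk⟩ := hL a k s hl hf
        obtain ⟨E₁, σ₁, -, t₁, r₁, -⟩ := hC hr
        have h1 := p.one_le_cost s
        obtain ⟨E₂, s₂, σ₂, r₂, j₂, t₂⟩ := ih k' (by omega) r₁ hl'
        refine ⟨E₂, s₂, σ₂, r₂, j₂, (Steps.whileStep ?_ t₁ t₂).mono ?_⟩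
        · rw [hr.reg_n, hr.zero]; exact hf
        · have h2 := Nat.mul_le_mul_left (C + 1) hk
          rw [mul_add, add_mul, one_mul] at h2
          omega
  refine ⟨(C + 1) * c + 1, fun a E s σ hr hi => ?_⟩
  obtain ⟨k, hl, hk⟩ := hI a s hi
  obtain ⟨E', s', σ', r, j, t⟩ := key a k hr hl
  refine ⟨E', s', σ', r, j, t.mono ?_⟩
  have h1 := Nat.mul_le_mul_left (C + 1) hk
  have h2 := hN a
  have e : ((C + 1) * c + 1) * N a = (C + 1) * (c * N a) + N a := by ring
  rw [e]
  omega

end Compile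

end Grigorchuk


namespace Grigorchuk

open RAM

/-! ### Calculus for the word machine -/

namespace WState

variable (s : WState)

@[simp] theorem setW_w (x y : WReg) (u : Word) : (s.setW x u).w y = if y = x then u else s.w y := by
  simp [setW, Function.update_apply]

@[simp] theorem setW_n (x : WReg) (u : Word) : (s.setW x u).n = s.n := rfl

@[simp] theorem setW_wa (x : WReg) (u : Word) : (s.setW x u).wa = s.wa := rfl

@[simp] theorem setW_na (x : WReg) (u : Word) : (s.setW x u).na = s.na := rfl

@[simp] theorem setW_inp (x : WReg) (u : Word) : (s.setW x u).inp = s.inp := rfl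

@[simp] theorem setW_out (x : WReg) (u : Word) : (s.setW x u).out = s.out := rfl

@[simp] theorem setN_n (f g : NReg) (k : ℕ) : (s.setN f k).n g = if g = f then k else s.n g := by
  simp [setN, Function.update_apply]

@[simp] theorem setN_w (f : NReg) (k : ℕ) : (s.setN f k).w = s.w := rfl

@[simp] theorem setN_wa (f : NReg) (k : ℕ) : (s.setN f k).wa = s.wa := rfl

@[simp] theorem setN_na (f : NReg) (k : ℕ) : (s.setN f k).na = s.na := rfl

@[simp] theorem setN_inp (f : NReg) (k : ℕ) : (s.setN f k).inp = s.inp := rfl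

@[simp] theorem setN_out (f : NReg) (k : ℕ) : (s.setN f k).out = s.out := rfl

@[simp] theorem putW_wa_ne {a a' : WArr} (h : a' ≠ a) (u v : Word) :
    (s.putW a u v).wa a' = s.wa a' := by
  simp [putW, h]

@[simp] theorem putW_wa_self (a : WArr) (u v u' : Word) :
    (s.putW a u v).wa a u' = if u' = u then v else s.wa a u' := by
  simp [putW, Function.update_apply]

@[simp] theorem putW_w (a : WArr) (u v : Word) : (s.putW a u v).w = s.w := rfl

@[simp] theorem putW_n (a : WArr) (u v : Word) : (s.putW a u v).n = s.n := rfl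

@[simp] theorem putW_na (a : WArr) (u v : Word) : (s.putW a u v).na = s.na := rfl

@[simp] theorem putW_out (a : WArr) (u v : Word) : (s.putW a u v).out = s.out := rfl

@[simp] theorem putN_na_ne {b b' : NArr} (h : b' ≠ b) (u : Word) (k : ℕ) :
    (s.putN b u k).na b' = s.na b' := by
  simp [putN, h]

@[simp] theorem putN_na_self (b : NArr) (u u' : Word) (k : ℕ) :
    (s.putN b u k).na b u' = if u' = u then k else s.na b u' := by
  simp [putN, Function.update_apply]

@[simp] theorem putN_w (b : NArr) (u : Word) (k : ℕ) : (s.putN b u k).w = s.w := rfl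

@[simp] theorem putN_n (b : NArr) (u : Word) (k : ℕ) : (s.putN b u k).n = s.n := rfl

@[simp] theorem putN_wa (b : NArr) (u : Word) (k : ℕ) : (s.putN b u k).wa = s.wa := rfl

@[simp] theorem putN_out (b : NArr) (u : Word) (k : ℕ) : (s.putN b u k).out = s.out := rfl

@[simp] theorem setW_setW (x : WReg) (u v : Word) : (s.setW x u).setW x v = s.setW x v := by
  simp [setW]

@[simp] theorem setN_setN (f : NReg) (k l : ℕ) : (s.setN f k).setN f l = s.setN f l := by
  simp [setN]

@[simp] theorem setW_self (x : WReg) : s.setW x (s.w x) = s := by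
  simp [setW]

@[simp] theorem setN_self (f : NReg) : s.setN f (s.n f) = s := by
  simp [setN]

end WState

namespace WProg

/-- Sequential composition of a list of programs. -/
def block : List WProg → WProg
  | [] => .skip
  | p :: l => .seq p (block l)

@[simp] theorem ev_block_nil (s : WState) : (block []).ev s = s := rfl

@[simp] theorem ev_block_cons (p : WProg) (l : List WProg) (s : WState) :
    (block (p :: l)).ev s = (block l).ev (p.ev s) := rfl

@[simp] theorem cost_block_nil (s : WState) : (block []).cost s = 1 := rfl

@[simp] theorem cost_block_cons (p : WProg) (l : List WProg) (s : WState) :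
    (block (p :: l)).cost s = p.cost s + (block l).cost (p.ev s) := rfl

@[simp] theorem ev_op (o : WOp) (s : WState) : (op o).ev s = o.eval s := rfl

@[simp] theorem ev_skip (s : WState) : WProg.skip.ev s = s := rfl

@[simp] theorem ev_seq (p q : WProg) (s : WState) : (WProg.seq p q).ev s = q.ev (p.ev s) := rfl

@[simp] theorem ev_caseW (x : WReg) (f : Option Letter → WProg) (s : WState) :
    (caseW x f).ev s = (f (s.w x).head?).ev s := rfl

@[simp] theorem ev_caseN (f : NReg) (m : ℕ) (P : ℕ → WProg) (s : WState) :
    (caseN f m P).ev s = if s.n f < m then (P (s.n f)).ev s else s := rfl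

@[simp] theorem ev_ifEq (x y : WReg) (p q : WProg) (s : WState) :
    (WProg.ifEq x y p q).ev s = if s.w x = s.w y then p.ev s else q.ev s := rfl

theorem ev_each (x : WReg) (f : Letter → WProg) (s : WState) :
    (each x f).ev s = (s.w x).foldl (fun s ℓ => (f ℓ).ev s) s := rfl

@[simp] theorem cost_op (o : WOp) (s : WState) : (op o).cost s = 1 := rfl

/-- Programs without loops. -/
def Flat : WProg → Prop
  | .skip => True
  | .op _ => True
  | .seq p q => p.Flat ∧ q.Flat
  | .caseW _ f => ∀ o, (f o).Flat
  | .caseN _ _ P => ∀ k, (P k).Flat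
  | .ifEq _ _ p q => p.Flat ∧ q.Flat
  | .each _ _ => False

/-- A bound for the cost of a program without loops. -/
def maxCost : WProg → ℕ
  | .skip => 1
  | .op _ => 1
  | .seq p q => p.maxCost + q.maxCost
  | .caseW _ f => 1 + Finset.univ.sup fun o => (f o).maxCost
  | .caseN _ m P => 1 + (Finset.range m).sup fun k => (P k).maxCost
  | .ifEq _ _ p q => 1 + max p.maxCost q.maxCost
  | .each _ _ => 0

theorem Flat.cost_le {p : WProg} (h : p.Flat) (s : WState) : p.cost s ≤ p.maxCost := by
  induction p generalizing s with
  | skip => exact le_rfl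
  | op o => exact le_rfl
  | seq p q hp hq => exact add_le_add (hp h.1 s) (hq h.2 _)
  | caseW x f ih =>
    exact Nat.add_le_add_left ((ih _ (h _) s).trans
      (Finset.le_sup (f := fun o => (f o).maxCost) (Finset.mem_univ _))) 1
  | caseN f m P ih =>
    simp only [cost, maxCost]
    split_ifs with hm
    · exact Nat.add_le_add_left ((ih _ (h _) s).trans
        (Finset.le_sup (f := fun o => (P o).maxCost) (Finset.mem_range.2 hm))) 1
    · omega
  | ifEq x y p q hp hq =>
    simp only [cost, maxCost]
    have := hp h.1 s
    have := hq h.2 s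
    split_ifs <;> omega
  | each => exact h.elim

@[simp] theorem flat_block_nil : (block []).Flat := trivial

@[simp] theorem flat_block_cons {p : WProg} {l : List WProg} :
    (block (p :: l)).Flat ↔ p.Flat ∧ (block l).Flat := Iff.rfl

@[simp] theorem flat_op (o : WOp) : (op o).Flat := trivial

theorem loopCost_le {F : Letter → WState → WState} {c : Letter → WState → ℕ} {C : ℕ}
    (h : ∀ ℓ s, c ℓ s ≤ C) (l : Word) (s : WState) :
    loopCost F c l s ≤ (C + 1) * l.length + 1 := by
  induction l generalizing s with
  | nil => simp [loopCost]
  | cons ℓ l ih =>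
    have h1 := ih (F ℓ s)
    have h2 := h ℓ s
    simp only [loopCost, List.length_cons, mul_add, mul_one]
    omega

theorem cost_each_le {x : WReg} {f : Letter → WProg} {C : ℕ} (h : ∀ ℓ s, (f ℓ).cost s ≤ C)
    (s : WState) : (each x f).cost s ≤ (C + 1) * (s.w x).length + 1 :=
  loopCost_le h _ _

theorem exists_cost_each {x : WReg} {f : Letter → WProg} (h : ∀ ℓ, (f ℓ).Flat) :
    ∃ c, ∀ s, (each x f).cost s ≤ c * ((s.w x).length + 1) := by
  refine ⟨(Finset.univ.sup fun ℓ => (f ℓ).maxCost) + 1, fun s =>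
    (cost_each_le (fun ℓ s => ((h ℓ).cost_le s).trans
    (Finset.le_sup (f := fun ℓ => (f ℓ).maxCost) (Finset.mem_univ ℓ))) s).trans ?_⟩
  rw [mul_add]
  omega

theorem ev_each_setW {x y : WReg} {f : Letter → WProg} {g : Letter → Word → Word}
    (h : ∀ ℓ s, (f ℓ).ev s = s.setW x (g ℓ (s.w x))) (s : WState) :
    (each y f).ev s = s.setW x ((s.w y).foldl (fun u ℓ => g ℓ u) (s.w x)) := by
  have key : ∀ (l : Word) (s : WState), l.foldl (fun s ℓ => (f ℓ).ev s) s =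
      s.setW x (l.foldl (fun u ℓ => g ℓ u) (s.w x)) := by
    intro l
    induction l with
    | nil => simp
    | cons ℓ l ih => intro s; rw [List.foldl_cons, h, ih]; simp
  exact key _ s

/-- Repeat a program as many times as a word has letters. -/
def times (x : WReg) (p : WProg) : WProg := each x fun _ => p

/-- A loop invariant for counting loops, with the cost. -/
theorem times_spec {x : WReg} {p : WProg} (I : ℕ → WState → Prop) (c : ℕ → ℕ) {s : WState}
    (h0 : I 0 s) (hI : ∀ i < (s.w x).length, ∀ t, I i t → I (i + 1) (p.ev t) ∧ p.cost t ≤ c i) :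
    I (s.w x).length ((times x p).ev s) ∧
      (times x p).cost s ≤ ∑ i ∈ Finset.range (s.w x).length, (c i + 1) + 1 := by
  have key : ∀ (l : Word) (i : ℕ) (t : WState), I i t →
      (∀ j, i ≤ j → j < i + l.length → ∀ t, I j t → I (j + 1) (p.ev t) ∧ p.cost t ≤ c j) →
      I (i + l.length) (l.foldl (fun s _ => p.ev s) t) ∧
      loopCost (fun _ => p.ev) (fun _ => p.cost) l t ≤
        ∑ j ∈ Finset.range l.length, (c (i + j) + 1) + 1 := by
    intro l
    induction l with
    | nil => intro i t h _; exact ⟨h, by simp [loopCost]⟩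
    | cons ℓ l ih =>
      intro i t h hstep
      obtain ⟨h1, h2⟩ := hstep i le_rfl (by simp) t h
      obtain ⟨h3, h4⟩ := ih (i + 1) _ h1 fun j hj hj' => hstep j (by omega) (by simp; omega)
      refine ⟨by rw [List.length_cons, ← Nat.add_assoc, Nat.add_right_comm]; exact h3, ?_⟩
      rw [List.length_cons, Finset.sum_range_succ', loopCost]
      simp only [Nat.add_assoc, Nat.add_comm 1, Nat.add_zero] at h4 ⊢
      omega
  have := key (s.w x) 0 s h0 fun j _ hj => hI j (by omega)
  simp only [Nat.zero_add] at this
  exact this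

end WProg

open WProg hiding ev cost

/-! ### Subprograms -/

/-- Put a letter in front of a reduced word and reduce. -/
def redConsP (X : WReg) (x : Letter) : WProg :=
  .caseW X fun
    | none => .op (.push X x)
    | some y => if x = y then .op (.pop X) else
        match third x y with
        | some z => block [.op (.pop X), .op (.push X z)]
        | none => .op (.push X x)

theorem ev_redConsP (X : WReg) (x : Letter) (s : WState) :
    (redConsP X x).ev s = s.setW X (redCons x (s.w X)) := by
  rw [redConsP, ev_caseW]
  rcases h : s.w X with _ | ⟨y, w⟩
  · simp [WOp.eval, redCons, h]
  · simp only [List.head?_cons, redCons]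
    split_ifs
    · simp [WOp.eval, h]
    · cases third x y <;> simp [WOp.eval, h]

theorem flat_redConsP (X : WReg) (x : Letter) : (redConsP X x).Flat := by
  intro o
  rcases o with _ | y
  · trivial
  · dsimp only
    split_ifs
    · trivial
    · cases third x y <;> simp

/-- Multiply a reduced word from the left, letter by letter. -/
def redWordP (X Y : WReg) : WProg := .each Y (redConsP X)

theorem ev_redWordP (X Y : WReg) (s : WState) :
    (redWordP X Y).ev s = s.setW X ((s.w Y).reverse.foldr redCons (s.w X)) := by
  rw [redWordP, ev_each_setW (ev_redConsP X), List.foldr_reverse]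

theorem exists_cost_redWordP (X Y : WReg) :
    ∃ c, ∀ s, (redWordP X Y).cost s ≤ c * ((s.w Y).length + 1) :=
  exists_cost_each (flat_redConsP X)

/-- Reverse a word. -/
def revP (X Y : WReg) : WProg := block [.op (.nil X), .each Y fun ℓ => .op (.push X ℓ)]

theorem ev_revP {X Y : WReg} (h : Y ≠ X) (s : WState) :
    (revP X Y).ev s = s.setW X (s.w Y).reverse := by
  have : ∀ (l : Word) (u : Word), l.foldl (fun u ℓ => ℓ :: u) u = l.reverse ++ u := by
    intro l
    induction l with
    | nil => simp
    | cons ℓ l ih => simp [ih]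
  rw [revP, ev_block_cons, ev_block_cons, ev_each_setW (x := X) (g := fun ℓ u => ℓ :: u) (fun _ _ => rfl)]
  simp [WOp.eval, h, this]

theorem exists_cost_revP {X Y : WReg} (h : Y ≠ X) :
    ∃ c, ∀ s, (revP X Y).cost s ≤ c * ((s.w Y).length + 1) := by
  refine ⟨4, fun s => ?_⟩
  have := cost_each_le (x := Y) (f := fun ℓ => WProg.op (.push X ℓ)) (C := 1) (fun _ _ => le_rfl)
    (s.setW X [])
  simp only [WState.setW_w, h, if_false] at this
  simp [revP, WOp.eval]
  omega

/-- The parity of the number of letters `a`. -/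
def parity (w : Word) : ℕ := if EvenA w then 0 else 1

theorem parity_cons (x : Letter) (w : Word) :
    parity (x :: w) = if x = .a then 1 - parity w else parity w := by
  by_cases h : x = .a
  · by_cases h' : Even (w.count Letter.a) <;> simp [parity, EvenA, h, h', Nat.even_add_one]
  · have : x ≠ .a := h
    simp [parity, EvenA, h]
    rfl

theorem parity_lt (w : Word) : parity w < 2 := by
  unfold parity; split_ifs <;> omega

theorem parity_append_singleton (x : Letter) (w : Word) :
    parity (w ++ [x]) = if x = .a then 1 - parity w else parity w := by
  rw [← parity_cons]
  simp [parity, EvenA, List.count_cons]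

/-- Change a bit. -/
def toggleP (f : NReg) : WProg := .caseN f 2 fun k => .op (.const f (1 - k))

theorem ev_toggleP {f : NReg} {s : WState} (h : s.n f < 2) :
    (toggleP f).ev s = s.setN f (1 - s.n f) := by
  simp [toggleP, h, WOp.eval]

/-- The parity of a word. -/
def parP (f : NReg) (X : WReg) : WProg :=
  block [.op (.const f 0), .each X fun ℓ => if ℓ = .a then toggleP f else .skip]

theorem ev_parP (f : NReg) (X : WReg) (s : WState) :
    (parP f X).ev s = s.setN f (parity (s.w X)) := by
  have key : ∀ (l u : Word) (s : WState), s.n f = parity u →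
      l.foldl (fun s ℓ => WProg.ev (if ℓ = .a then toggleP f else .skip) s) s =
        s.setN f (parity (u ++ l)) := by
    intro l
    induction l with
    | nil => intro u s h; simp [← h]
    | cons ℓ l ih =>
      intro u s h
      have hs : WProg.ev (if ℓ = .a then toggleP f else .skip) s =
          s.setN f (parity (u ++ [ℓ])) := by
        rw [parity_append_singleton]
        split_ifs
        · rw [ev_toggleP (h ▸ parity_lt u), h]
        · rw [← h]; simp
      rw [List.foldl_cons, hs, ih (u ++ [ℓ]) _ (by simp)]
      simp
  simp [parP, ev_each, WOp.eval, key (s.w X) [] (s.setN f 0) (by simp [parity, EvenA])]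

theorem exists_cost_parP (f : NReg) (X : WReg) :
    ∃ c, ∀ s, (parP f X).cost s ≤ c * ((s.w X).length + 1) := by
  have hf : ∀ ℓ : Letter, (if ℓ = .a then toggleP f else .skip).Flat := fun ℓ => by
    split_ifs
    · exact fun k => trivial
    · trivial
  obtain ⟨c, hc⟩ := exists_cost_each (x := X) hf
  refine ⟨c + 2, fun s => ?_⟩
  have := hc ((WOp.const f 0).eval s)
  simp only [parP, cost_block_cons, cost_op, cost_block_nil, ev_op]
  rw [add_mul]
  change 1 + (_ + 1) ≤ _ + 2 * ((s.w X).length + 1)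
  simp only [WOp.eval, WState.setN_w] at this ⊢
  omega

/-- A numbering of the cosets of `K`. -/
noncomputable def cosetCode (x : Γ ⧸ K) : ℕ := Finite.equivFin (Γ ⧸ K) x

/-- A numbering of the sets of cosets of `K`. -/
noncomputable def setCode (x : Set (Γ ⧸ K)) : ℕ := Finite.equivFin (Set (Γ ⧸ K)) x

theorem cosetCode_injective : Function.Injective cosetCode := fun _ _ h =>
  (Finite.equivFin _).injective (Fin.ext h)

theorem setCode_injective : Function.Injective setCode := fun _ _ h =>
  (Finite.equivFin _).injective (Fin.ext h)

/-- The coset with a given number. -/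
noncomputable def cosetOf : ℕ → Γ ⧸ K := Function.invFun cosetCode

/-- The set of cosets with a given number. -/
noncomputable def setOf : ℕ → Set (Γ ⧸ K) := Function.invFun setCode

@[simp] theorem cosetOf_cosetCode (x : Γ ⧸ K) : cosetOf (cosetCode x) = x :=
  Function.leftInverse_invFun cosetCode_injective x

@[simp] theorem setOf_setCode (x : Set (Γ ⧸ K)) : setOf (setCode x) = x :=
  Function.leftInverse_invFun setCode_injective x

/-- A bound for all codes. -/
noncomputable def codeBound : ℕ := Nat.card (Γ ⧸ K) + Nat.card (Set (Γ ⧸ K))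

theorem cosetCode_lt (x : Γ ⧸ K) : cosetCode x < codeBound :=
  (Finite.equivFin (Γ ⧸ K) x).2.trans_le (Nat.le_add_right _ _)

theorem setCode_lt (x : Set (Γ ⧸ K)) : setCode x < codeBound :=
  (Finite.equivFin (Set (Γ ⧸ K)) x).2.trans_le (Nat.le_add_left _ _)

/-- Evaluate a function of codes by table lookup. -/
noncomputable def tab (h : NReg) : List NReg → (List ℕ → ℕ) → WProg
  | [], T => .op (.const h (T []))
  | f :: fs, T => .caseN f codeBound fun k => tab h fs fun l => T (k :: l)

theorem ev_tab (h : NReg) {fs : List NReg} (T : List ℕ → ℕ) {s : WState}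
    (hs : ∀ f ∈ fs, s.n f < codeBound) : (tab h fs T).ev s = s.setN h (T (fs.map s.n)) := by
  induction fs generalizing T with
  | nil => rfl
  | cons f fs ih =>
    rw [tab, ev_caseN, if_pos (hs f (by simp)), ih _ fun g hg => hs g (by simp [hg])]
    rfl

theorem flat_tab (h : NReg) (fs : List NReg) (T : List ℕ → ℕ) : (tab h fs T).Flat := by
  induction fs generalizing T with
  | nil => trivial
  | cons f fs ih => exact fun k => ih _

/-- The coset of a word. -/
noncomputable def cosetP (h : NReg) (X : WReg) : WProg :=
  block [.op (.const h (cosetCode 1)), .each X fun ℓ =>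
    tab h [h] fun l => cosetCode (cosetOf (l.headD 0) * coset [ℓ])]

theorem ev_cosetP (h : NReg) (X : WReg) (s : WState) :
    (cosetP h X).ev s = s.setN h (cosetCode (coset (s.w X))) := by
  have key : ∀ (l : Word) (g : Γ ⧸ K) (s : WState), s.n h = cosetCode g →
      l.foldl (fun s ℓ => WProg.ev
        (tab h [h] fun l => cosetCode (cosetOf (l.headD 0) * coset [ℓ])) s) s =
        s.setN h (cosetCode (g * coset l)) := by
    intro l
    induction l with
    | nil => 
      intro g s h
      have : coset [] = 1 := by simp [coset]
      rw [this, mul_one, ← h]; simp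
    | cons ℓ l ih =>
      intro g s hg
      have : coset (ℓ :: l) = coset [ℓ] * coset l := by simp [coset]
      rw [List.foldl_cons, ev_tab _ _ (by simp [hg, cosetCode_lt]),
        ih (g * coset [ℓ]) _ (by simp [hg])]
      simp [this, mul_assoc]
  rw [cosetP, ev_block_cons, ev_block_cons, ev_each, ev_block_nil]
  simp only [ev_op, WOp.eval, WState.setN_w]
  rw [key (s.w X) 1 (s.setN h (cosetCode 1)) (by simp)]
  simp

theorem exists_cost_cosetP (f : NReg) (X : WReg) :
    ∃ c, ∀ s, (cosetP f X).cost s ≤ c * ((s.w X).length + 1) := by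
  obtain ⟨c, hc⟩ := exists_cost_each (x := X) (fun ℓ => flat_tab f [f] fun l =>
    cosetCode (cosetOf (l.headD 0) * coset [ℓ]))
  refine ⟨c + 2, fun s => ?_⟩
  have := hc ((WOp.const f (cosetCode 1)).eval s)
  simp only [cosetP, cost_block_cons, cost_op, cost_block_nil, ev_op]
  rw [add_mul]
  change 1 + (_ + 1) ≤ _ + 2 * ((s.w X).length + 1)
  simp only [WOp.eval, WState.setN_w] at this ⊢
  omega

/-- Mark all final segments of the word in `rz`. -/
def markP : WProg :=
  block [.op (.copy .ry .rz),
    .each .rz fun _ => block [.op (.nput .pre .ry .ng), .op (.pop .ry)], .op (.nput .pre .ry .ng)]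

/-- The program marks all suffixes of the word in `rz`, going from the node to the root of the trie. -/
theorem ev_markP {s : WState} (h : s.n .ng = 1) :
    markP.ev s = { s.setW .ry [] with
      na := Function.update s.na .pre fun z => if z <:+ s.w .rz then 1 else s.na .pre z } := by
  have key : ∀ (l : Word) (s : WState), s.n .ng = 1 → s.w .ry = l →
      (WOp.nput .pre .ry .ng).eval (l.foldl (fun s _ => WProg.ev
        (block [.op (.nput .pre .ry .ng), .op (.pop .ry)]) s) s) = { s.setW .ry [] with
      na := Function.update s.na .pre fun z => if z <:+ l then 1 else s.na .pre z } := by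
    intro l
    induction l with
    | nil =>
      intro s h hl
      simp only [List.foldl_nil, WOp.eval, h, hl, List.suffix_nil]
      have : s.setW .ry [] = s := by rw [← hl]; simp
      rw [this]
      simp only [WState.putN]
      congr 2
      funext z
      simp [Function.update_apply]
    | cons ℓ l ih =>
      intro s h hl
      rw [List.foldl_cons, ih _ (by simp [WOp.eval, h]) (by simp [WOp.eval, hl])]
      simp only [ev_block_cons, ev_op, ev_block_nil, WOp.eval, WState.setW_setW, h, hl,
        WState.setW_na]
      simp only [WState.putN, WState.setW]
      congr 1
      rw [Function.update_idem]
      congr 1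
      funext z
      simp only [Function.update_self, Function.update_apply, List.suffix_cons_iff]
      split_ifs <;> simp_all
  have := key (s.w .rz) (s.setW .ry (s.w .rz)) h (by simp)
  rw [WState.setW_setW] at this
  exact this

theorem exists_cost_markP : ∃ c, ∀ s, markP.cost s ≤ c * ((s.w .rz).length + 1) := by
  obtain ⟨c, hc⟩ := exists_cost_each (x := .rz)
    (f := fun _ => block [.op (.nput .pre .ry .ng), .op (.pop .ry)]) (by simp)
  refine ⟨c + 3, fun s => ?_⟩
  have := hc ((WOp.copy .ry .rz).eval s)
  simp only [markP, cost_block_cons, cost_op, cost_block_nil, ev_op]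
  rw [add_mul]
  simp only [WOp.eval, WState.setW_w, reduceCtorEq, if_false] at this ⊢
  omega

/-- Multiply a reduced word from the left by a given word. -/
def mulP (X : WReg) : Word → WProg
  | [] => .skip
  | x :: u => .seq (mulP X u) (redConsP X x)

theorem ev_mulP (X : WReg) (u : Word) (s : WState) :
    (mulP X u).ev s = s.setW X (u.foldr redCons (s.w X)) := by
  induction u with
  | nil => simp [mulP]
  | cons x u ih => simp [mulP, ih, ev_redConsP]

theorem flat_mulP (X : WReg) (u : Word) : (mulP X u).Flat := by
  induction u with
  | nil => trivial
  | cons x u ih => exact ⟨ih, flat_redConsP X x⟩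

/-- Put the components of a letter in front of `c₀` and `c₁`; the bit `nf` tells whether the number
of letters `a` in front of it is odd. -/
def secP (ℓ : Letter) : WProg :=
  if ℓ = .a then toggleP .nf else
    .caseN .nf 2 fun k =>
      block [mulP .c₀ (if k = 0 then (sec ℓ).1 else (sec ℓ).2),
        mulP .c₁ (if k = 0 then (sec ℓ).2 else (sec ℓ).1)]

theorem flat_secP (ℓ : Letter) : (secP ℓ).Flat := by
  unfold secP
  split_ifs
  · exact fun k => trivial
  · exact fun k => ⟨flat_mulP _ _, flat_mulP _ _, trivial⟩

/-- The word in `rz` is read from its end, so that the number `nf` counts the letters `a` that are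
in front of the present one. -/
theorem foldl_secP (w : Word) (p : Bool) (s : WState)
    (h : s.n .nf = if (p ^^ !decide (EvenA w)) then 1 else 0) (h₀ : s.w .c₀ = [])
    (h₁ : s.w .c₁ = []) :
    w.reverse.foldl (fun s ℓ => (secP ℓ).ev s) s =
      ((s.setN .nf (if p then 1 else 0)).setW .c₀ (red (phi p w).1)).setW .c₁
        (red (phi p w).2) := by
  induction w generalizing p with
  | nil =>
    have e1 : s.setN .nf (if p then 1 else 0) = s := by
      have : (if p then 1 else 0) = s.n .nf := by rw [h]; simp [EvenA]
      rw [this]; simp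
    have e0 : s.setW .c₀ [] = s := by rw [← h₀]; simp
    have e2 : s.setW .c₁ [] = s := by rw [← h₁]; simp
    simp [phi, red, e1, e0, e2]
  | cons x w ih =>
    rw [List.reverse_cons, List.foldl_append, List.foldl_cons, List.foldl_nil]
    by_cases hx : x = .a
    · subst hx
      have he : EvenA (.a :: w) ↔ ¬ EvenA w := by
        simp [EvenA, Nat.even_add_one]
      rw [ih (!p) (by rw [h]; simp [he])]
      rw [secP, if_pos rfl, ev_toggleP]
      · cases p <;> simp [phi, WState.setN, WState.setW]
      · cases p <;> simp
    · have he : EvenA (x :: w) ↔ EvenA w := by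
        simp [EvenA, hx]
      rw [ih p (by rw [h]; simp [he])]
      have hphi : phi p (x :: w) = ((if p then (sec x).2 else (sec x).1) ++ (phi p w).1,
          (if p then (sec x).1 else (sec x).2) ++ (phi p w).2) := by
        cases x <;> first | exact absurd rfl hx | rfl
      rw [hphi, secP, if_neg hx]
      have e : ∀ u v : Word, red (u ++ v) = u.foldr redCons (red v) := fun u v => by
        simp [red]
      have hc : ∀ (t : WState) (u v v' : Word), ((t.setW .c₀ u).setW .c₁ v).setW .c₀ v' =
          (t.setW .c₀ v').setW .c₁ v := fun t u v v' => by
        simp only [WState.setW]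
        congr 1
        rw [Function.update_comm (by decide), Function.update_idem]
      cases p <;> simp [ev_mulP, e, hc]

end Grigorchuk


namespace Grigorchuk

open RAM
open WProg hiding ev cost

attribute [local irreducible] WProg.ev WProg.cost

/-! ### Splitting a word -/

/-- The first child of a word. -/
def child₀ (w : Word) : Word := if EvenA w then comp₀ w else comp₀₁ w

/-- The last child of a word. -/
def child₁ (w : Word) : Word := if EvenA w then comp₁ w else comp₀₁ w

theorem mem_children {w c : Word} : c ∈ children w ↔ c = child₀ w ∨ c = child₁ w := by
  unfold children child₀ child₁
  split_ifs <;> simp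

theorem weight_isB_le (w : Word) : weight isB w ≤ w.length := by
  have := weight_isA_add_isB w
  omega

theorem length_comp₀_le' (w : Word) : (comp₀ w).length ≤ w.length :=
  (length_comp₀_le w).trans (weight_isB_le w)

theorem length_comp₁_le' (w : Word) : (comp₁ w).length ≤ w.length :=
  (length_comp₁_le w).trans (weight_isB_le w)

theorem Reduced.length_child_le {w : Word} (h : Reduced w) {c : Word} (hc : c ∈ children w) :
    c.length ≤ w.length := by
  by_cases he : EvenA w
  · rw [children_even he] at hc
    rcases List.mem_pair.1 hc with rfl | rfl
    · exact length_comp₀_le' w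
    · exact length_comp₁_le' w
  · rw [children_odd he, List.mem_singleton] at hc
    exact hc ▸ (h.length_comp₀₁_le he).1

/-- Compute the components of the word in `rw`, given its reverse in `rz` and its parity. -/
def compP : WProg :=
  block [.op (.ncopy .nf .par), .op (.nil .c₀), .op (.nil .c₁), .each .rz secP]

theorem ev_compP {s : WState} {w : Word} (hz : s.w .rz = w.reverse) (hp : s.n .par = parity w) :
    compP.ev s = ((s.setN .nf 0).setW .c₀ (comp₀ w)).setW .c₁ (comp₁ w) := by
  rw [compP, ev_block_cons, ev_block_cons, ev_block_cons, ev_block_cons, ev_block_nil, ev_each]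
  simp only [ev_op, WOp.eval, WState.setW_w, WState.setN_w, hz, reduceCtorEq, if_false]
  rw [foldl_secP w false _ (by simp [hp, parity]) (by simp) (by simp)]
  simp only [comp₀, comp₁, WState.setN, WState.setW, if_false, Bool.false_eq_true]
  congr 1
  · rw [Function.update_comm (by decide : WReg.c₀ ≠ .c₁), Function.update_idem,
      Function.update_comm (by decide : WReg.c₁ ≠ .c₀), Function.update_idem]
  · exact Function.update_idem _ _ _

theorem exists_cost_compP : ∃ c, ∀ s, compP.cost s ≤ c * ((s.w .rz).length + 1) := by
  obtain ⟨c, hc⟩ := exists_cost_each (x := .rz) flat_secP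
  refine ⟨c + 4, fun s => ?_⟩
  have := hc ((WOp.nil .c₁).eval ((WOp.nil .c₀).eval ((WOp.ncopy .nf .par).eval s)))
  simp only [compP, cost_block_cons, cost_op, cost_block_nil, ev_op]
  rw [add_mul]
  simp only [WOp.eval, WState.setW_w, WState.setN_w, reduceCtorEq, if_false] at this ⊢
  omega

/-- Compute the data of the word in `rw` and store them in the arrays. -/
noncomputable def dataP : WProg :=
  block [revP .rz .rw, parP .par .rw, cosetP .ne .rw, .op (.const .ng 1), markP,
    .op (.nput .lab .rz .ng), .op (.put .fwd .rz .rw), .op (.nput .par .rw .par),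
    .op (.nput .kap .rw .ne), compP, cosetP .nh .c₀, .op (.nput .k₀ .rw .nh), cosetP .nh .c₁,
    .op (.nput .k₁ .rw .nh),
    .caseN .par 2 fun k => if k = 0 then .skip else
      block [revP .rx .c₀, redWordP .c₁ .rx, .op (.copy .c₀ .c₁)],
    .op (.put .ch₀ .rw .c₀), .op (.put .ch₁ .rw .c₁)]

/-- The effect of `dataP`. -/
structure DataStep (s t : WState) : Prop where
  w : ∀ x, x ≠ .rx → x ≠ .ry → x ≠ .rz → x ≠ .c₀ → x ≠ .c₁ → t.w x = s.w x
  c₀ : t.w .c₀ = child₀ (s.w .rw)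
  c₁ : t.w .c₁ = child₁ (s.w .rw)
  out : t.out = s.out
  wa : ∀ a, a ≠ .fwd → a ≠ .ch₀ → a ≠ .ch₁ → t.wa a = s.wa a
  fwd : ∀ z, t.wa .fwd z = if z = (s.w .rw).reverse then s.w .rw else s.wa .fwd z
  ch₀ : ∀ z, t.wa .ch₀ z = if z = s.w .rw then child₀ z else s.wa .ch₀ z
  ch₁ : ∀ z, t.wa .ch₁ z = if z = s.w .rw then child₁ z else s.wa .ch₁ z
  na : ∀ b, b ≠ .pre → b ≠ .lab → b ≠ .par → b ≠ .kap → b ≠ .k₀ → b ≠ .k₁ → t.na b = s.na b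
  pre : ∀ z, t.na .pre z = if z <:+ (s.w .rw).reverse then 1 else s.na .pre z
  lab : ∀ z, t.na .lab z = if z = (s.w .rw).reverse then 1 else s.na .lab z
  par : ∀ z, t.na .par z = if z = s.w .rw then parity z else s.na .par z
  kap : ∀ z, t.na .kap z = if z = s.w .rw then cosetCode (coset z) else s.na .kap z
  k₀ : ∀ z, t.na .k₀ z = if z = s.w .rw then cosetCode (coset (comp₀ z)) else s.na .k₀ z
  k₁ : ∀ z, t.na .k₁ z = if z = s.w .rw then cosetCode (coset (comp₁ z)) else s.na .k₁ z

theorem dataP_spec (s : WState) : DataStep s (dataP.ev s) := by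
  obtain ⟨t, ht⟩ : ∃ t, t = (block [revP .rz .rw, parP .par .rw, cosetP .ne .rw,
    .op (.const .ng 1)]).ev s := ⟨_, rfl⟩
  have e : dataP.ev s = (block [markP,
    .op (.nput .lab .rz .ng), .op (.put .fwd .rz .rw), .op (.nput .par .rw .par),
    .op (.nput .kap .rw .ne), compP, cosetP .nh .c₀, .op (.nput .k₀ .rw .nh), cosetP .nh .c₁,
    .op (.nput .k₁ .rw .nh),
    .caseN .par 2 fun k => if k = 0 then .skip else
      block [revP .rx .c₀, redWordP .c₁ .rx, .op (.copy .c₀ .c₁)],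
    .op (.put .ch₀ .rw .c₀), .op (.put .ch₁ .rw .c₁)]).ev t := by
    rw [ht]; simp only [dataP, ev_block_cons, ev_block_nil]
  rw [e]; clear e
  simp only [ev_block_cons, ev_block_nil, ev_revP (show WReg.rw ≠ .rz by decide), ev_parP, ev_cosetP,
    ev_op, WOp.eval, WState.setW_w, WState.setN_w, reduceCtorEq, if_false] at ht
  have hng : t.n .ng = 1 := by simp [ht]
  obtain ⟨t', ht'⟩ : ∃ t', t' = (block [markP, .op (.nput .lab .rz .ng), .op (.put .fwd .rz .rw),
    .op (.nput .par .rw .par), .op (.nput .kap .rw .ne)]).ev t := ⟨_, rfl⟩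
  have e : (block [markP,
    .op (.nput .lab .rz .ng), .op (.put .fwd .rz .rw), .op (.nput .par .rw .par),
    .op (.nput .kap .rw .ne), compP, cosetP .nh .c₀, .op (.nput .k₀ .rw .nh), cosetP .nh .c₁,
    .op (.nput .k₁ .rw .nh),
    .caseN .par 2 fun k => if k = 0 then .skip else
      block [revP .rx .c₀, redWordP .c₁ .rx, .op (.copy .c₀ .c₁)],
    .op (.put .ch₀ .rw .c₀), .op (.put .ch₁ .rw .c₁)]).ev t = (block [compP, cosetP .nh .c₀,
    .op (.nput .k₀ .rw .nh), cosetP .nh .c₁, .op (.nput .k₁ .rw .nh),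
    .caseN .par 2 fun k => if k = 0 then .skip else
      block [revP .rx .c₀, redWordP .c₁ .rx, .op (.copy .c₀ .c₁)],
    .op (.put .ch₀ .rw .c₀), .op (.put .ch₁ .rw .c₁)]).ev t' := by
    rw [ht']; simp only [ev_block_cons, ev_block_nil]
  rw [e]; clear e
  rw [ev_block_cons, ev_markP hng] at ht'
  simp only [ev_block_cons, ev_block_nil, ev_op, WOp.eval] at ht'
  have hz : t'.w .rz = (s.w .rw).reverse := by simp [ht', ht]
  have hp : t'.n .par = parity (s.w .rw) := by simp [ht', ht]
  have hw : t'.w .rw = s.w .rw := by simp [ht', ht]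
  rw [ev_block_cons, ev_compP hz hp]
  simp only [ev_block_cons, ev_block_nil, ev_op, ev_cosetP, ev_caseN, WOp.eval, WState.setW_w,
    WState.setN_w, WState.setN_n, WState.setW_n, WState.putN_w, WState.putN_n, reduceCtorEq,
    if_true, if_false, hp, hw, parity_lt]
  by_cases he : EvenA (s.w .rw)
  · have hp' : parity (s.w .rw) = 0 := by simp [parity, he]
    rw [hp', if_pos rfl]
    constructor <;> simp +contextual [ht, ht', child₀, child₁, he]
  · have hp' : parity (s.w .rw) = 1 := by simp [parity, he]
    rw [hp', if_neg one_ne_zero]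
    simp only [ev_block_cons, ev_block_nil, ev_op, ev_revP (show WReg.c₀ ≠ .rx by decide),
      ev_redWordP, WOp.eval, WState.setW_w, WState.setN_w, WState.putN_w, reduceCtorEq,
      if_true, if_false, List.reverse_reverse, ← comp₀₁_eq]
    constructor <;> simp +contextual [ht, ht', child₀, child₁, he]

theorem exists_cost_dataP : ∃ c, ∀ s, dataP.cost s ≤ c * ((s.w .rw).length + 1) := by
  obtain ⟨c₁, h₁⟩ := exists_cost_revP (show WReg.rw ≠ .rz by decide)
  obtain ⟨c₂, h₂⟩ := exists_cost_parP .par .rw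
  obtain ⟨c₃, h₃⟩ := exists_cost_cosetP .ne .rw
  obtain ⟨c₄, h₄⟩ := exists_cost_markP
  obtain ⟨c₅, h₅⟩ := exists_cost_compP
  obtain ⟨c₆, h₆⟩ := exists_cost_cosetP .nh .c₀
  obtain ⟨c₇, h₇⟩ := exists_cost_cosetP .nh .c₁
  obtain ⟨c₈, h₈⟩ := exists_cost_revP (show WReg.c₀ ≠ .rx by decide)
  obtain ⟨c₉, h₉⟩ := exists_cost_redWordP .c₁ .rx
  refine ⟨c₁ + c₂ + c₃ + c₄ + c₅ + c₆ + c₇ + c₈ + c₉ + 14, fun s => ?_⟩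
  obtain ⟨t₁, e₁⟩ : ∃ t, t = (revP .rz .rw).ev s := ⟨_, rfl⟩
  obtain ⟨t₂, e₂⟩ : ∃ t, t = (parP .par .rw).ev t₁ := ⟨_, rfl⟩
  obtain ⟨t₃, e₃⟩ : ∃ t, t = (WOp.const .ng 1).eval ((cosetP .ne .rw).ev t₂) := ⟨_, rfl⟩
  obtain ⟨t₄, e₄⟩ : ∃ t, t = (WOp.nput .kap .rw .ne).eval ((WOp.nput .par .rw .par).eval
    ((WOp.put .fwd .rz .rw).eval ((WOp.nput .lab .rz .ng).eval (markP.ev t₃)))) := ⟨_, rfl⟩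
  obtain ⟨t₅, e₅⟩ : ∃ t, t = compP.ev t₄ := ⟨_, rfl⟩
  obtain ⟨t₆, e₆⟩ : ∃ t, t = (WOp.nput .k₀ .rw .nh).eval ((cosetP .nh .c₀).ev t₅) := ⟨_, rfl⟩
  obtain ⟨t₇, e₇⟩ : ∃ t, t = (WOp.nput .k₁ .rw .nh).eval ((cosetP .nh .c₁).ev t₆) := ⟨_, rfl⟩
  have e : dataP.cost s = (revP .rz .rw).cost s + ((parP .par .rw).cost t₁ +
      ((cosetP .ne .rw).cost t₂ + (1 + (markP.cost t₃ + (1 + (1 + (1 + (1 + (compP.cost t₄ +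
      ((cosetP .nh .c₀).cost t₅ + (1 + ((cosetP .nh .c₁).cost t₆ + (1 + ((caseN .par 2 fun k =>
        if k = 0 then .skip else block [revP .rx .c₀, redWordP .c₁ .rx,
          .op (.copy .c₀ .c₁)]).cost t₇ + (1 + (1 + 1)))))))))))))))) := by
    subst e₁ e₂ e₃ e₄ e₅ e₆ e₇
    simp only [dataP, cost_block_cons, cost_op, cost_block_nil, ev_op]
  have l₁ := h₁ s
  have l₂ := h₂ t₁
  have l₃ := h₃ t₂
  have l₄ := h₄ t₃
  have l₅ := h₅ t₄
  have l₆ := h₆ t₅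
  have l₇ := h₇ t₆
  have l₈ := h₈ t₇
  have l₉ := h₉ ((revP .rx .c₀).ev t₇)
  rw [ev_revP (by decide)] at e₁
  rw [ev_parP] at e₂
  rw [ev_cosetP] at e₃
  have hng : t₃.n .ng = 1 := by simp [e₃, WOp.eval]
  rw [ev_markP hng] at e₄
  have hz : t₄.w .rz = (s.w .rw).reverse := by simp [e₄, e₃, e₂, e₁, WOp.eval]
  have hp : t₄.n .par = parity (s.w .rw) := by simp [e₄, e₃, e₂, e₁, WOp.eval]
  rw [ev_compP hz hp] at e₅
  rw [ev_cosetP] at e₆ e₇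
  rw [ev_revP (by decide)] at l₉
  have x₂ : t₁.w .rw = s.w .rw := by simp [e₁]
  have x₃ : t₂.w .rw = s.w .rw := by simp [e₂, x₂]
  have x₄ : t₃.w .rz = (s.w .rw).reverse := by simp [e₃, e₂, e₁, WOp.eval]
  have x₆ : t₅.w .c₀ = comp₀ (s.w .rw) := by simp [e₅]
  have x₇ : t₆.w .c₁ = comp₁ (s.w .rw) := by simp [e₆, e₅, WOp.eval]
  have x₈ : t₇.w .c₀ = comp₀ (s.w .rw) := by simp [e₇, e₆, e₅, WOp.eval]
  have y₀ := length_comp₀_le' (s.w .rw)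
  have y₁ := length_comp₁_le' (s.w .rw)
  rw [x₂] at l₂
  rw [x₃] at l₃
  rw [x₄, List.length_reverse] at l₄
  rw [hz, List.length_reverse] at l₅
  rw [x₆] at l₆
  rw [x₇] at l₇
  rw [x₈] at l₈
  simp only [WState.setW_w, if_true, List.length_reverse, x₈] at l₉
  replace l₆ := l₆.trans (Nat.mul_le_mul_left c₆ (Nat.succ_le_succ y₀))
  replace l₇ := l₇.trans (Nat.mul_le_mul_left c₇ (Nat.succ_le_succ y₁))
  replace l₈ := l₈.trans (Nat.mul_le_mul_left c₈ (Nat.succ_le_succ y₀))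
  replace l₉ := l₉.trans (Nat.mul_le_mul_left c₉ (Nat.succ_le_succ y₀))
  have l₁₀ : (caseN .par 2 fun k => if k = 0 then .skip else
      block [revP .rx .c₀, redWordP .c₁ .rx, .op (.copy .c₀ .c₁)]).cost t₇ ≤
      c₈ * ((s.w .rw).length + 1) + c₉ * ((s.w .rw).length + 1) + 4 := by
    simp only [WProg.cost]
    split_ifs
    · simp only [WProg.cost]; omega
    · simp only [cost_block_cons, cost_block_nil, cost_op, ev_revP (show WReg.c₀ ≠ .rx by decide)]
      rw [x₈]
      simp only [Nat.succ_eq_add_one] at l₈ l₉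
      omega
    · omega
  rw [e]
  clear e e₁ e₂ e₃ e₄ e₅ e₆ e₇ h₁ h₂ h₃ h₄ h₅ h₆ h₇ h₈ h₉
  simp only [Nat.succ_eq_add_one] at l₆ l₇ l₈ l₉
  have hn : 1 ≤ (s.w .rw).length + 1 := Nat.le_add_left _ _
  generalize (s.w .rw).length + 1 = n at *
  simp only [Nat.add_mul]
  linarith only [l₁, l₂, l₃, l₄, l₅, l₆, l₇, l₁₀, hn]

/-! ### The list of labels -/

/-- Mark a word and put it into the queue, unless it is marked already. -/
def addP (Y : WReg) : WProg :=
  block [.op (.nget .ng .seen Y), .caseN .ng 1 fun _ =>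
    block [.op (.const .ng 1), .op (.nput .seen Y .ng), .op (.put .queue .rt Y), .op (.push .rt .a)]]

theorem flat_addP (Y : WReg) : (addP Y).Flat := by
  simp [addP, Flat]

/-- Numbers are represented by powers of `a`. -/
def num (n : ℕ) : Word := List.replicate n .a

@[simp] theorem num_inj {m n : ℕ} : num m = num n ↔ m = n :=
  ⟨fun h => by simpa [num] using congrArg List.length h, fun h => h ▸ rfl⟩

@[simp] theorem length_num (n : ℕ) : (num n).length = n := List.length_replicate

theorem num_succ (n : ℕ) : num (n + 1) = .a :: num n := rfl

/-- The words of a list have been put into the queue. -/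
structure Queue (l : List Word) (s : WState) : Prop where
  nodup : l.Nodup
  tail : s.w .rt = num l.length
  get : ∀ i (h : i < l.length), s.wa .queue (num i) = l[i]
  seen : ∀ x, s.na .seen x = if x ∈ l then 1 else 0

/-- `t` agrees with `s` except for the queue. -/
structure SameData (s t : WState) : Prop where
  w : ∀ x, x ≠ .rt → t.w x = s.w x
  wa : ∀ a, a ≠ .queue → t.wa a = s.wa a
  na : ∀ b, b ≠ .seen → t.na b = s.na b
  out : t.out = s.out

theorem SameData.trans {s t t' : WState} (h : SameData s t) (h' : SameData t t') :
    SameData s t' :=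
  ⟨fun x hx => (h'.w x hx).trans (h.w x hx), fun x hx => (h'.wa x hx).trans (h.wa x hx),
    fun x hx => (h'.na x hx).trans (h.na x hx), h'.out.trans h.out⟩

/-- The array `seen` keeps the queue free of duplicates. -/
theorem Queue.add {l : List Word} {s : WState} (h : Queue l s) (Y : WReg) :
    ∃ l', Queue l' ((addP Y).ev s) ∧ l <+: l' ∧ (∀ x, x ∈ l' ↔ x ∈ l ∨ x = s.w Y) ∧
      SameData s ((addP Y).ev s) := by
  by_cases hy : s.w Y ∈ l
  · have e : (addP Y).ev s = s.setN .ng 1 := by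
      simp [addP, WOp.eval, h.seen, hy]
    rw [e]
    refine ⟨l, ⟨h.nodup, h.tail, h.get, h.seen⟩, List.prefix_rfl, fun x => ?_,
      ⟨by simp, by simp, by simp, by simp⟩⟩
    exact ⟨.inl, fun hx => hx.elim id fun hx => hx ▸ hy⟩
  · have e : (addP Y).ev s = (((s.setN .ng 1).putN .seen (s.w Y) 1).putW .queue (s.w .rt)
        (s.w Y)).setW .rt (.a :: s.w .rt) := by
      simp [addP, WOp.eval, h.seen, hy]
    rw [e]
    refine ⟨l ++ [s.w Y], ⟨?_, ?_, ?_, ?_⟩, List.prefix_append _ _, by simp, ⟨?_, ?_, ?_, ?_⟩⟩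
    · exact h.nodup.append (List.nodup_singleton _) (by simpa using hy)
    · simp [h.tail, num_succ]
    · intro i hi
      rw [List.length_append, List.length_singleton] at hi
      simp only [WState.setW_wa, WState.putW_wa_self, h.tail, num_inj, WState.putN_wa,
        WState.setN_wa]
      rcases Nat.lt_succ_iff_lt_or_eq.1 hi with hi | rfl
      · rw [if_neg hi.ne, h.get i hi, List.getElem_append_left]
      · simp
    · intro x
      simp only [WState.setW_na, WState.putW_na, WState.putN_na_self, WState.setN_na, h.seen,
        List.mem_append, List.mem_singleton]
      split_ifs <;> simp_all
    · simp +contextual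
    · simp +contextual
    · simp +contextual
    · simp

end Grigorchuk


namespace Grigorchuk

open RAM
open WProg hiding ev cost

attribute [local irreducible] WProg.ev WProg.cost

/-! ### Reading the input -/

theorem Reaches.of_imp {α : Type} {N : α → ℕ} {P : Prog} {I I' J : α → WState → Prop}
    (h : Reaches N P I J) (hI : ∀ a s, I' a s → I a s) : Reaches N P I' J := by
  obtain ⟨C, h⟩ := h
  exact ⟨C, fun a _ _ _ hr hs => h a hr (hI a _ hs)⟩

/-- The size of an input. -/
def inputSize (a : Word × Word) : ℕ := a.1.length + a.2.length + 1

theorem one_le_inputSize (a : Word × Word) : 1 ≤ inputSize a := Nat.le_add_left _ _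

/-- Put the letter with code `nf` in front of a word and read the next code. -/
def readP (X : WReg) : WProg :=
  block [.caseN .nf 5 fun k => (match ofCode k with | some ℓ => .op (.push X ℓ) | none => .skip),
    .op (.read .nf)]

theorem flat_readP (X : WReg) : (readP X).Flat := by
  refine ⟨fun k => ?_, trivial, trivial⟩
  dsimp only
  cases ofCode k <;> trivial

theorem ofCode_code (ℓ : Letter) : ofCode ℓ.code = some ℓ := by cases ℓ <;> rfl

theorem code_lt (ℓ : Letter) : ℓ.code < 5 := by cases ℓ <;> decide

theorem code_ne_zero (ℓ : Letter) : ℓ.code ≠ 0 := by cases ℓ <;> decide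

/-- Reading a word; it is stored in reverse order. `F` is a property that does not depend on the
registers used. -/
theorem reaches_read {α : Type} {N : α → ℕ} (hN : ∀ a, 1 ≤ N a) (X : WReg) (src : α → Word)
    (tl : α → List ℕ) (hsrc : ∀ a, (src a).length ≤ N a) (htl : ∀ a, (tl a).headD 0 = 0)
    (F : α → WState → Prop)
    (hF : ∀ a s u k i, F a s → F a { (s.setW X u).setN .nf k with inp := i }) :
    Reaches N (.seq ((block [.op (.nil X), .op (.read .nf)]).compile 0) (whileN .nf (readP X)))
      (fun a s => F a s ∧ s.inp = (src a).map Letter.code ++ tl a)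
      (fun a s => F a s ∧ s.inp = (tl a).tail ∧ s.w X = (src a).reverse) := by
  let l : α → Word → List ℕ := fun a r => r.map Letter.code ++ tl a
  let J : α → WState → Prop := fun a s => F a s ∧ s.w X = [] ∧
    s.n .nf = (l a (src a)).headD 0 ∧ s.inp = (l a (src a)).tail
  refine Reaches.seq (J := J) (Reaches.of_ev _ 3 fun a s h => ⟨⟨?_, ?_, ?_, ?_⟩, ?_⟩) ?_
  · have := hF a s [] (s.inp.headD 0) s.inp.tail h.1
    simp only [ev_block_cons, ev_block_nil, ev_op, WOp.eval]
    exact this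
  · simp [WOp.eval]
  · simp [WOp.eval, h.2, l]
  · simp [WOp.eval, h.2, l]
  · have := hN a
    simp only [cost_block_cons, cost_block_nil, cost_op]
    omega
  · refine Reaches.while (fun a k s => ∃ p r, src a = p ++ r ∧ F a s ∧ s.w X = p.reverse ∧
      s.n .nf = (l a r).headD 0 ∧ s.inp = (l a r).tail ∧
      k = (readP X).maxCost * r.length) (readP X).maxCost hN ?_ ?_ ?_
    · rintro a s ⟨h1, h2, h3, h4⟩
      exact ⟨_, ⟨[], src a, rfl, h1, h2, h3, h4, rfl⟩, Nat.mul_le_mul_left _ (hsrc a)⟩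
    · rintro a k s ⟨p, r, hpr, h1, h2, h3, h4, rfl⟩ h0
      rcases r with _ | ⟨ℓ, r⟩
      · exact absurd (h3.trans (htl a)) h0
      · have h3' : s.n .nf = ℓ.code := h3
        have h4' : s.inp = l a r := h4
        have e : (readP X).ev s = { (s.setW X (ℓ :: p.reverse)).setN .nf ((l a r).headD 0) with
            inp := (l a r).tail } := by
          simp [readP, h3', code_lt, ofCode_code, WOp.eval, h2, h4']
        refine ⟨_, ⟨p ++ [ℓ], r, by simp [hpr], ?_, ?_, ?_, ?_, rfl⟩, ?_⟩
        · rw [e]; exact hF a s _ _ _ h1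
        · simp [e]
        · simp [e]
        · simp [e]
        · have := (flat_readP X).cost_le s
          rw [List.length_cons, Nat.mul_succ]
          omega
    · rintro a k s ⟨p, r, hpr, h1, h2, h3, h4, rfl⟩ h0
      rcases r with _ | ⟨ℓ, r⟩
      · simp only [List.append_nil] at hpr
        exact ⟨h1, h4, hpr ▸ h2⟩
      · exact absurd (h3.symm.trans h0) (code_ne_zero ℓ)

/-- The arrays of numbers and the output tape are empty. -/
def Blank (s : WState) : Prop := (∀ b x, s.na b x = 0) ∧ s.out = []

/-- Read the two words and reduce them. -/
noncomputable def inputP : Prog :=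
  .seq (.seq ((block [.op (.nil .rx), .op (.read .nf)]).compile 0) (whileN .nf (readP .rx))) <|
  .seq ((block [.op (.nil .ru), redWordP .ru .rx]).compile 0) <|
  .seq (.seq ((block [.op (.nil .rx), .op (.read .nf)]).compile 0) (whileN .nf (readP .rx))) <|
  (block [.op (.nil .rv), redWordP .rv .rx]).compile 0

/-- The words have been read. -/
def HasInput (a : Word × Word) (s : WState) : Prop := s.w .ru = red a.1 ∧ s.w .rv = red a.2

theorem reaches_inputP : Reaches inputSize inputP (fun a s => s = WState.init (encodePair a))
    (fun a s => Blank s ∧ HasInput a s) := by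
  have h1 := reaches_read one_le_inputSize .rx Prod.fst
    (fun a => 0 :: a.2.map Letter.code) (fun a => by unfold inputSize; omega) (fun _ => rfl)
    (fun _ s => Blank s) (fun _ _ _ _ _ h => h)
  have h2 := reaches_read one_le_inputSize .rx Prod.snd
    (fun a => []) (fun a => by unfold inputSize; omega) (fun _ => rfl)
    (fun a s => Blank s ∧ s.w .ru = red a.1) (fun _ _ _ _ _ h => ⟨h.1, by simpa using h.2⟩)
  have hred : ∀ Y, Y ≠ .rx → ∃ c, ∀ s, (block [.op (.nil Y), redWordP Y .rx]).cost s ≤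
      c * ((s.w .rx).length + 1) := fun Y hY => by
    obtain ⟨c, hc⟩ := exists_cost_redWordP Y .rx
    refine ⟨c + 2, fun s => ?_⟩
    have := hc (s.setW Y [])
    rw [WState.setW_w, if_neg hY.symm] at this
    simp only [cost_block_cons, cost_block_nil, cost_op, ev_op, WOp.eval, add_mul]
    omega
  have hev : ∀ Y, Y ≠ .rx → ∀ s w, s.w .rx = w.reverse →
      (block [.op (.nil Y), redWordP Y .rx]).ev s = s.setW Y (red w) := fun Y hY s w h => by
    simp [WOp.eval, ev_redWordP, hY.symm, h, red]
  obtain ⟨c₁, hc₁⟩ := hred .ru (by decide)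
  obtain ⟨c₂, hc₂⟩ := hred .rv (by decide)
  have hlen : ∀ c n (a : Word × Word), n + 1 ≤ inputSize a → c * (n + 1) ≤ c * inputSize a :=
    fun c n a h => Nat.mul_le_mul_left _ h
  refine (h1.seq (Reaches.seq
    (Reaches.of_ev (J := fun a s => (Blank s ∧ s.w .ru = red a.1) ∧
      s.inp = a.2.map Letter.code ++ []) _ c₁ ?_)
    (h2.seq (Reaches.of_ev _ c₂ ?_)))).of_imp ?_
  rotate_right
  · rintro a s rfl
    exact ⟨⟨fun _ _ => rfl, rfl⟩, by simp [WState.init, encodePair, encodeWord]⟩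
  · rintro a s ⟨h, hi, hx⟩
    refine ⟨?_, (hc₁ s).trans ?_⟩
    · rw [hev _ (by decide) s a.1 hx]
      exact ⟨⟨h, by simp⟩, by simp [hi]⟩
    · rw [hx, List.length_reverse]
      exact hlen _ _ _ (by unfold inputSize; omega)
  · rintro a s ⟨h, hi, hx⟩
    refine ⟨?_, (hc₂ s).trans ?_⟩
    · rw [hev _ (by decide) s a.2 hx]
      exact ⟨h.1, by simpa using h.2, by simp⟩
    · rw [hx, List.length_reverse]
      exact hlen _ _ _ (by unfold inputSize; omega)

/-! ### The labels of the two trees -/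

/-- A splitting tree of linear size for the reduced form of a word. -/
noncomputable def tree (w : Word) : SplittingTree (red w) :=
  (exists_splittingTree_cells_le.choose_spec (red w) (reduced_red w)).choose

/-- The list of all labels of the splitting trees of two words and of the words of length at most
one. -/
noncomputable def labelList (a : Word × Word) : List Word :=
  (tree a.1).nodes ++ ((tree a.2).nodes ++ [[], [.a], [.b], [.c], [.d]])

theorem cells_labelList : ∃ C, ∀ a, cells (labelList a) ≤ C * inputSize a := by
  refine ⟨2 * exists_splittingTree_cells_le.choose + 9, fun a => ?_⟩
  have h : ∀ w, cells (tree w).nodes ≤ exists_splittingTree_cells_le.choose * (w.length + 1) :=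
    fun w => ((exists_splittingTree_cells_le.choose_spec (red w) (reduced_red w)).choose_spec).trans
      (Nat.mul_le_mul_left _ (Nat.succ_le_succ (length_red_le w)))
  have h1 := h a.1
  have h2 := h a.2
  generalize exists_splittingTree_cells_le.choose = C at *
  have e : cells (labelList a) = cells (tree a.1).nodes + (cells (tree a.2).nodes + 9) := by
    simp [labelList, cells_append]
  have e1 : C * (a.1.length + 1) ≤ C * inputSize a :=
    Nat.mul_le_mul_left _ (by unfold inputSize; omega)
  have e2 : C * (a.2.length + 1) ≤ C * inputSize a :=
    Nat.mul_le_mul_left _ (by unfold inputSize; omega)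
  have := one_le_inputSize a
  rw [e, add_mul, mul_assoc]
  omega

theorem mem_labelList {a : Word × Word} {x : Word} :
    x ∈ labelList a ↔ x ∈ (tree a.1).labels ∨ x ∈ (tree a.2).labels ∨ x.length ≤ 1 := by
  have : x ∈ [[], [Letter.a], [.b], [.c], [.d]] ↔ x.length ≤ 1 := by
    refine ⟨fun h => ?_, fun h => ?_⟩
    · simp only [List.mem_cons, List.not_mem_nil, or_false] at h
      rcases h with rfl | rfl | rfl | rfl | rfl <;> simp
    · rcases length_le_one_cases h with rfl | rfl | rfl | rfl | rfl <;> simp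
  rw [labelList, List.mem_append, List.mem_append, this, SplittingTree.mem_nodes,
    SplittingTree.mem_nodes]

theorem children_mem_labelList {a : Word × Word} {x : Word} (hx : x ∈ labelList a) :
    ∀ c ∈ children x, c ∈ labelList a := by
  intro c hc
  rw [mem_labelList] at hx ⊢
  rcases hx with hx | hx | hx
  · exact ((tree a.1).children_mem hx c hc).imp_right .inr
  · exact .inr ((tree a.2).children_mem hx c hc)
  · exact .inr (.inr (length_children_of_length_le_one hx c hc))

theorem reduced_of_length_le_one {x : Word} (h : x.length ≤ 1) : Reduced x := by
  rcases length_le_one_cases h with rfl | rfl | rfl | rfl | rfl <;> trivial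

theorem reduced_of_mem_labelList {a : Word × Word} {x : Word} (hx : x ∈ labelList a) :
    Reduced x := by
  rcases mem_labelList.1 hx with h | h | h
  · exact (tree a.1).reduced (reduced_red _) x h
  · exact (tree a.2).reduced (reduced_red _) x h
  · exact reduced_of_length_le_one h

/-- A set of words that is closed under children and contains the starting words contains all
labels. -/
theorem labelList_subset {a : Word × Word} {R : Word → Prop}
    (hR : ∀ x, R x → ∀ c ∈ children x, R c) (h1 : R (red a.1)) (h2 : R (red a.2))
    (h : ∀ x, x.length ≤ 1 → R x) : ∀ x ∈ labelList a, R x := by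
  intro x hx
  rcases mem_labelList.1 hx with hx | hx | hx
  · exact (tree a.1).labels_subset hR h1 x hx
  · exact (tree a.2).labels_subset hR h2 x hx
  · exact h x hx

/-- The arrays contain the data of the words of a list. -/
structure Data (l : List Word) (s : WState) : Prop where
  fwd : ∀ x ∈ l, s.wa .fwd x.reverse = x
  ch₀ : ∀ x ∈ l, s.wa .ch₀ x = child₀ x
  ch₁ : ∀ x ∈ l, s.wa .ch₁ x = child₁ x
  pre : ∀ z, s.na .pre z = if ∃ x ∈ l, z <:+ x.reverse then 1 else 0
  lab : ∀ z, s.na .lab z = if z.reverse ∈ l then 1 else 0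
  par : ∀ x ∈ l, s.na .par x = parity x
  kap : ∀ x ∈ l, s.na .kap x = cosetCode (coset x)
  k₀ : ∀ x ∈ l, s.na .k₀ x = cosetCode (coset (comp₀ x))
  k₁ : ∀ x ∈ l, s.na .k₁ x = cosetCode (coset (comp₁ x))

theorem Data.step {l : List Word} {s t : WState} (h : Data l s) (hst : DataStep s t) :
    Data (l ++ [s.w .rw]) t := by
  have key : ∀ {β : Type} {f g : Word → β} {v : Word → β},
      (∀ z, g z = if z = s.w .rw then v z else f z) → (∀ x ∈ l, f x = v x) →
      ∀ x ∈ l ++ [s.w .rw], g x = v x := by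
    intro β f g v hg hf x hx
    rw [hg]
    split_ifs with h
    · rfl
    · rcases List.mem_append.1 hx with hx | hx
      · exact hf x hx
      · exact absurd (List.mem_singleton.1 hx) h
  refine ⟨fun x hx => ?_, key hst.ch₀ h.ch₀, key hst.ch₁ h.ch₁, fun z => ?_, fun z => ?_,
    key hst.par h.par, key hst.kap h.kap, key hst.k₀ h.k₀, key hst.k₁ h.k₁⟩
  · rw [hst.fwd]
    split_ifs with h'
    · exact (List.reverse_inj.1 h').symm
    · rcases List.mem_append.1 hx with hx | hx
      · exact h.fwd x hx
      · exact absurd (congrArg List.reverse (List.mem_singleton.1 hx)) h'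
  · rw [hst.pre, h.pre]
    simp only [List.mem_append, List.mem_singleton, or_and_right, exists_or, exists_eq_left]
    by_cases h1 : z <:+ (s.w .rw).reverse <;> simp [h1]
  · rw [hst.lab, h.lab]
    have : z = (s.w .rw).reverse ↔ z.reverse = s.w .rw := by
      rw [← List.reverse_inj, List.reverse_reverse]
    simp only [List.mem_append, List.mem_singleton, this]
    by_cases h1 : z.reverse = s.w .rw <;> simp [h1]

theorem Data.of_sameData {l : List Word} {s t : WState} (h : Data l s) (hst : SameData s t) :
    Data l t := by
  constructor
  · rw [hst.wa _ (by decide)]; exact h.fwd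
  · rw [hst.wa _ (by decide)]; exact h.ch₀
  · rw [hst.wa _ (by decide)]; exact h.ch₁
  · rw [hst.na _ (by decide)]; exact h.pre
  · rw [hst.na _ (by decide)]; exact h.lab
  · rw [hst.na _ (by decide)]; exact h.par
  · rw [hst.na _ (by decide)]; exact h.kap
  · rw [hst.na _ (by decide)]; exact h.k₀
  · rw [hst.na _ (by decide)]; exact h.k₁

/-- Take a word from the queue, compute its data, and put its children into the queue. -/
noncomputable def splitP : WProg :=
  block [.op (.get .rw .queue .ri), .op (.push .ri .a), dataP, addP .c₀, addP .c₁,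
    .ifEq .ri .rt (.op (.const .flag 0)) (.op (.const .flag 1))]

theorem exists_cost_splitP :
    ∃ c, ∀ s, splitP.cost s ≤ c * ((s.wa .queue (s.w .ri)).length + 1) := by
  obtain ⟨c, hc⟩ := exists_cost_dataP
  refine ⟨c + (addP .c₀).maxCost + (addP .c₁).maxCost + 5, fun s => ?_⟩
  have h1 := hc ((WOp.push .ri .a).eval ((WOp.get .rw .queue .ri).eval s))
  have h2 : (WProg.ifEq .ri .rt (.op (.const .flag 0)) (.op (.const .flag 1))).Flat :=
    ⟨trivial, trivial⟩
  simp only [splitP, cost_block_cons, cost_block_nil, cost_op, ev_op]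
  have h3 := (flat_addP .c₀).cost_le
    (dataP.ev ((WOp.push .ri .a).eval ((WOp.get .rw .queue .ri).eval s)))
  have h4 := (flat_addP .c₁).cost_le ((addP .c₀).ev
    (dataP.ev ((WOp.push .ri .a).eval ((WOp.get .rw .queue .ri).eval s))))
  have h5 := h2.cost_le ((addP .c₁).ev ((addP .c₀).ev
    (dataP.ev ((WOp.push .ri .a).eval ((WOp.get .rw .queue .ri).eval s)))))
  have h6 : (WProg.ifEq .ri .rt (.op (.const .flag 0)) (.op (.const .flag 1))).maxCost = 2 := rfl
  rw [h6] at h5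
  have e1 : ((WOp.push .ri .a).eval ((WOp.get .rw .queue .ri).eval s)).w .rw =
      s.wa .queue (s.w .ri) := by simp [WOp.eval]
  rw [e1] at h1
  generalize hn : (s.wa .queue (s.w .ri)).length + 1 = n at *
  have hn' : 1 ≤ n := by omega
  have e3 := Nat.mul_le_mul_left (addP .c₀).maxCost hn'
  have e4 := Nat.mul_le_mul_left (addP .c₁).maxCost hn'
  simp only [Nat.add_mul]
  linarith only [h1, h3, h4, h5, e3, e4, hn']

end Grigorchuk


namespace Grigorchuk

open RAM
open WProg hiding ev cost

attribute [local irreducible] WProg.ev WProg.cost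

/-! ### Collecting the labels -/

/-- The part of the memory that later stages rely on is still empty. -/
structure Fresh (s : WState) : Prop where
  done : ∀ x, s.na .done x = 0
  entF : ∀ x, s.na .entF x = 0
  out : s.out = []

/-- The words of `l` have been put into the queue, and the first `n` of them have been split. -/
structure Worklist (a : Word × Word) (l : List Word) (n : ℕ) (s : WState) : Prop where
  queue : Queue l s
  le : n ≤ l.length
  head : s.w .ri = num n
  sub : ∀ x ∈ l, x ∈ labelList a
  mem₁ : red a.1 ∈ l
  mem₂ : red a.2 ∈ l
  small : ∀ x, x.length ≤ 1 → x ∈ l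
  closed : ∀ x ∈ l.take n, ∀ c ∈ children x, c ∈ l
  data : Data (l.take n) s
  input : HasInput a s
  fresh : Fresh s

/-- The flag tells whether there are words left to split. -/
theorem Worklist.step {a : Word × Word} {l : List Word} {n : ℕ} {s : WState}
    (h : Worklist a l n s) (hn : n < l.length) :
    s.wa .queue (s.w .ri) = l[n] ∧ ∃ l', l'.take (n + 1) = l.take n ++ [l[n]] ∧
      Worklist a l' (n + 1) (splitP.ev s) ∧ ((splitP.ev s).n .flag = 0 ↔ n + 1 = l'.length) := by
  have hw : s.wa .queue (s.w .ri) = l[n] := by rw [h.head, h.queue.get n hn]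
  refine ⟨hw, ?_⟩
  obtain ⟨s₁, e₁⟩ : ∃ t, t = (s.setW .rw l[n]).setW .ri (.a :: s.w .ri) := ⟨_, rfl⟩
  obtain ⟨s₂, e₂⟩ : ∃ t, t = dataP.ev s₁ := ⟨_, rfl⟩
  have d := dataP_spec s₁
  rw [← e₂] at d
  have hw₁ : s₁.w .rw = l[n] := by simp [e₁]
  have q₂ : Queue l s₂ := by
    refine ⟨h.queue.nodup, ?_, ?_, ?_⟩
    · rw [d.w _ (by decide) (by decide) (by decide) (by decide) (by decide), e₁]
      simpa using h.queue.tail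
    · rw [d.wa _ (by decide) (by decide) (by decide), e₁]
      exact h.queue.get
    · rw [d.na _ (by decide) (by decide) (by decide) (by decide) (by decide) (by decide), e₁]
      exact h.queue.seen
  have D₁ : Data (l.take n) s₁ := by
    have := h.data
    rw [e₁]
    exact ⟨this.fwd, this.ch₀, this.ch₁, this.pre, this.lab, this.par, this.kap, this.k₀, this.k₁⟩
  have D₂ := D₁.step d
  rw [hw₁] at D₂
  obtain ⟨l₃, q₃, p₃, m₃, d₃⟩ := q₂.add .c₀
  obtain ⟨l₄, q₄, p₄, m₄, d₄⟩ := q₃.add .c₁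
  have d₅ := d₃.trans d₄
  obtain ⟨s₄, e₄⟩ : ∃ t, t = (addP .c₁).ev ((addP .c₀).ev s₂) := ⟨_, rfl⟩
  rw [← e₄] at q₄ d₅
  have p₅ := p₃.trans p₄
  have hlen : l.length ≤ l₄.length := p₅.length_le
  have htake : l₄.take (n + 1) = l.take n ++ [l[n]] := by
    obtain ⟨r, rfl⟩ := p₅
    rw [List.take_append_of_le_length (by omega), List.take_concat_get' l n hn]
  have hri : s₄.w .ri = num (n + 1) := by
    rw [d₅.w _ (by decide), d.w _ (by decide) (by decide) (by decide) (by decide) (by decide), e₁]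
    simp [h.head, num_succ]
  have ev₁ : splitP.ev s = (WProg.ifEq .ri .rt (.op (.const .flag 0))
      (.op (.const .flag 1))).ev s₄ := by
    rw [e₄, e₂, e₁, ← hw]
    simp only [splitP, ev_block_cons, ev_block_nil, ev_op, WOp.eval, WState.setW_w, reduceCtorEq,
      if_false]
  have ev₂ : splitP.ev s = s₄.setN .flag (if n + 1 = l₄.length then 0 else 1) := by
    rw [ev₁, ev_ifEq, hri, q₄.tail]
    simp only [num_inj]
    split_ifs <;> rw [ev_op, WOp.eval]
  have hc₀ : s₂.w .c₀ = child₀ l[n] := by rw [d.c₀, hw₁]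
  have hc₁ : ((addP .c₀).ev s₂).w .c₁ = child₁ l[n] := by rw [d₃.w _ (by decide), d.c₁, hw₁]
  have hmem : ∀ x, x ∈ l₄ ↔ (x ∈ l ∨ x = child₀ l[n]) ∨ x = child₁ l[n] := fun x => by
    rw [m₄, m₃, hc₀, hc₁]
  refine ⟨l₄, htake, ?_, ?_⟩
  · have hreg : ∀ x, x ≠ .ri → x ≠ .rw → x ≠ .rt → x ≠ .rx → x ≠ .ry → x ≠ .rz → x ≠ .c₀ →
        x ≠ .c₁ → (splitP.ev s).w x = s.w x := by
      intro x h1 h2 h3 h4 h5 h6 h7 h8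
      rw [ev₂, WState.setN_w, d₅.w x h3, d.w x h4 h5 h6 h7 h8, e₁]
      simp [h1, h2]
    have hna : ∀ b, b ≠ .seen → b ≠ .pre → b ≠ .lab → b ≠ .par → b ≠ .kap → b ≠ .k₀ → b ≠ .k₁ →
        (splitP.ev s).na b = s.na b := by
      intro b h0 h1 h2 h3 h4 h5 h6
      rw [ev₂, WState.setN_na, d₅.na b h0, d.na b h1 h2 h3 h4 h5 h6, e₁]
      rfl
    refine ⟨?_, ?_, ?_, ?_, ?_, ?_, ?_, ?_, ?_, ?_, ?_⟩
    · rw [ev₂]; exact ⟨q₄.nodup, q₄.tail, q₄.get, q₄.seen⟩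
    · omega
    · rw [ev₂]; exact hri
    · intro x hx
      have hl := h.sub l[n] (List.getElem_mem hn)
      rcases (hmem x).1 hx with (hx | hx) | hx
      · exact h.sub x hx
      · exact children_mem_labelList hl x (mem_children.2 (.inl hx))
      · exact children_mem_labelList hl x (mem_children.2 (.inr hx))
    · exact p₅.subset h.mem₁
    · exact p₅.subset h.mem₂
    · exact fun x hx => p₅.subset (h.small x hx)
    · rw [htake]
      intro x hx c hc
      rcases List.mem_append.1 hx with hx | hx
      · exact p₅.subset (h.closed x hx c hc)
      · rw [List.mem_singleton.1 hx, mem_children] at hc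
        exact (hmem c).2 (hc.elim (fun h => .inl (.inr h)) .inr)
    · rw [htake, ev₂]
      have := D₂.of_sameData d₅
      exact ⟨this.fwd, this.ch₀, this.ch₁, this.pre, this.lab, this.par, this.kap, this.k₀, this.k₁⟩
    · have := h.input
      unfold HasInput at this ⊢
      rwa [hreg _ (by decide) (by decide) (by decide) (by decide) (by decide) (by decide)
        (by decide) (by decide), hreg _ (by decide) (by decide) (by decide) (by decide) (by decide)
        (by decide) (by decide) (by decide)]
    · refine ⟨?_, ?_, ?_⟩
      · rw [hna _ (by decide) (by decide) (by decide) (by decide) (by decide) (by decide)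
          (by decide)]
        exact h.fresh.done
      · rw [hna _ (by decide) (by decide) (by decide) (by decide) (by decide) (by decide)
          (by decide)]
        exact h.fresh.entF
      · rw [ev₂, WState.setN_out, d₅.out, d.out, e₁]
        exact h.fresh.out
  · rw [ev₂]
    by_cases hl : n + 1 = l₄.length <;> simp [hl]

/-- Put the words of length at most one and the two input words into the queue. -/
def startP : WProg :=
  block [.op (.nil .ri), .op (.nil .rt), .op (.nil .rx), addP .rx,
    .op (.push .rx .a), addP .rx, .op (.nil .rx), .op (.push .rx .b), addP .rx,
    .op (.nil .rx), .op (.push .rx .c), addP .rx, .op (.nil .rx), .op (.push .rx .d), addP .rx,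
    addP .ru, addP .rv, .op (.const .flag 1)]

theorem flat_startP : startP.Flat := by
  simp [startP, flat_addP]

/-- The queue starts with the reduced input words and the words of length at most one. -/
theorem startP_spec {a : Word × Word} {s : WState} (hb : Blank s) (hi : HasInput a s) :
    (∃ l, Worklist a l 0 (startP.ev s)) ∧ (startP.ev s).n .flag = 1 := by
  let P : List Word → WState → Prop := fun l t => Queue l t ∧ (∀ b, b ≠ .seen → t.na b = s.na b) ∧
    t.out = s.out ∧ t.w .ru = s.w .ru ∧ t.w .rv = s.w .rv ∧ t.w .ri = []
  have hx : ∀ {l t}, P l t → ∀ u, P l (t.setW .rx u) := fun {l t} h u =>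
    ⟨⟨h.1.nodup, by simpa using h.1.tail, h.1.get, h.1.seen⟩, h.2.1, h.2.2.1,
      by simpa using h.2.2.2.1, by simpa using h.2.2.2.2.1, by simpa using h.2.2.2.2.2⟩
  have ha : ∀ {l t}, P l t → ∀ Y, ∃ l', P l' ((addP Y).ev t) ∧
      (∀ x, x ∈ l' ↔ x ∈ l ∨ x = t.w Y) ∧ ∀ x, x ≠ .rt → ((addP Y).ev t).w x = t.w x := by
    intro l t h Y
    obtain ⟨l', q, -, m, d⟩ := h.1.add Y
    exact ⟨l', ⟨q, fun b hb => (d.na b hb).trans (h.2.1 b hb), d.out.trans h.2.2.1,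
      (d.w _ (by decide)).trans h.2.2.2.1, (d.w _ (by decide)).trans h.2.2.2.2.1,
      (d.w _ (by decide)).trans h.2.2.2.2.2⟩, m, d.w⟩
  have h0 : P [] ((s.setW .ri []).setW .rt []) :=
    ⟨⟨List.nodup_nil, by simp [num], by simp, by simp [hb.1]⟩, by simp, by simp, by simp, by simp,
      by simp⟩
  have h1 := hx h0 []
  obtain ⟨l₁, h2, m₁, r₁⟩ := ha h1 .rx
  obtain ⟨l₂, h3, m₂, r₂⟩ := ha (hx h2 [.a]) .rx
  obtain ⟨l₃, h4, m₃, r₃⟩ := ha (hx h3 [.b]) .rx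
  obtain ⟨l₄, h5, m₄, r₄⟩ := ha (hx h4 [.c]) .rx
  obtain ⟨l₅, h6, m₅, r₅⟩ := ha (hx h5 [.d]) .rx
  obtain ⟨l₆, h7, m₆, r₆⟩ := ha h6 .ru
  obtain ⟨l₇, h8, m₇, r₇⟩ := ha h7 .rv
  obtain ⟨t, et⟩ : ∃ t, t = (startP.ev s) := ⟨_, rfl⟩
  have e : t = ((addP .rv).ev ((addP .ru).ev ((addP .rx).ev (((addP .rx).ev (((addP .rx).ev
      (((addP .rx).ev (((addP .rx).ev (((s.setW .ri []).setW .rt []).setW .rx [])).setW .rx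
      [.a])).setW .rx [.b])).setW .rx [.c])).setW .rx [.d])))).setN .flag 1 := by
    rw [et]
    simp only [startP, ev_block_cons, ev_block_nil, ev_op, WOp.eval, WState.setW_w, if_true,
      WState.setW_setW, r₁ .rx (by decide)]
  rw [← et, e]
  have hm : ∀ x, x ∈ l₇ ↔ x.length ≤ 1 ∨ x = red a.1 ∨ x = red a.2 := by
    intro x
    have hs : x.length ≤ 1 ↔ x = [] ∨ x = [.a] ∨ x = [.b] ∨ x = [.c] ∨ x = [.d] :=
      ⟨length_le_one_cases, by rintro (rfl | rfl | rfl | rfl | rfl) <;> simp⟩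
    rw [m₇, m₆, m₅, m₄, m₃, m₂, m₁, hs, h7.2.2.2.2.1, h6.2.2.2.1, hi.1, hi.2]
    simp only [WState.setW_w, if_true, List.not_mem_nil, false_or, or_assoc]
  refine ⟨⟨l₇, ⟨h8.1.nodup, h8.1.tail, h8.1.get, h8.1.seen⟩, Nat.zero_le _, h8.2.2.2.2.2, ?_, ?_, ?_,
    ?_, ?_, ?_, ⟨h8.2.2.2.1.trans hi.1, h8.2.2.2.2.1.trans hi.2⟩, ⟨?_, ?_, ?_⟩⟩, by simp⟩
  · intro x hx
    rw [mem_labelList]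
    rcases (hm x).1 hx with hx | rfl | rfl
    · exact .inr (.inr hx)
    · exact .inl (tree a.1).root_mem
    · exact .inr (.inl (tree a.2).root_mem)
  · exact (hm _).2 (.inr (.inl rfl))
  · exact (hm _).2 (.inr (.inr rfl))
  · exact fun x hx => (hm _).2 (.inl hx)
  · simp
  · have hz : ∀ b, b ≠ .seen → ∀ x, ((addP .rv).ev ((addP .ru).ev ((addP .rx).ev (((addP .rx).ev
      (((addP .rx).ev (((addP .rx).ev (((addP .rx).ev (((s.setW .ri []).setW .rt []).setW .rx
      [])).setW .rx [.a])).setW .rx [.b])).setW .rx [.c])).setW .rx [.d])))).na b x = 0 :=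
      fun b h x => by rw [h8.2.1 b h, hb.1]
    refine ⟨by simp, by simp, by simp, ?_, ?_, by simp, by simp, by simp, by simp⟩
    · intro z; rw [WState.setN_na, hz _ (by decide)]; simp
    · intro z; rw [WState.setN_na, hz _ (by decide)]; simp
  · intro x; rw [WState.setN_na, h8.2.1 _ (by decide), hb.1]
  · intro x; rw [WState.setN_na, h8.2.1 _ (by decide), hb.1]
  · rw [WState.setN_out, h8.2.2.1, hb.2]

/-- The data of all labels have been computed. -/
structure Collected (a : Word × Word) (l : List Word) (s : WState) : Prop where
  nodup : l.Nodup
  mem : ∀ x, x ∈ l ↔ x ∈ labelList a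
  data : Data l s
  input : HasInput a s
  fresh : Fresh s

/-- Collect all labels. -/
noncomputable def collectP : Prog := .seq (startP.compile 0) (whileN .flag splitP)

theorem reaches_collectP : Reaches inputSize collectP (fun a s => Blank s ∧ HasInput a s)
    (fun a s => ∃ l, Collected a l s) := by
  obtain ⟨c, hc⟩ := exists_cost_splitP
  obtain ⟨C, hC⟩ := cells_labelList
  refine (Reaches.of_ev (J := fun a s => (∃ l, Worklist a l 0 s) ∧ s.n .flag = 1) startP
    startP.maxCost fun a s h => ⟨startP_spec h.1 h.2, (flat_startP.cost_le s).trans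
      (Nat.le_mul_of_pos_right _ (one_le_inputSize a))⟩).seq ?_
  refine Reaches.while (fun a k s => ∃ l n, Worklist a l n s ∧ (s.n .flag = 0 ↔ n = l.length) ∧
    k + c * cells (l.take n) = c * cells (labelList a)) (c * C) one_le_inputSize ?_ ?_ ?_
  · rintro a s ⟨⟨l, h⟩, hf⟩
    refine ⟨_, ⟨l, 0, h, ?_, by simp; rfl⟩, ?_⟩
    · rw [hf]
      have := List.length_pos_of_mem h.mem₁
      omega
    · rw [mul_assoc]
      exact Nat.mul_le_mul_left _ (hC a)
  · rintro a k s ⟨l, n, h, hf, hk⟩ h0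
    have hn : n < l.length := lt_of_le_of_ne h.le (fun e => h0 (hf.2 e))
    obtain ⟨hq, l', ht, h', hf'⟩ := h.step hn
    have hle : cells (l'.take (n + 1)) ≤ cells (labelList a) :=
      cells_le_of_nodup (h'.queue.nodup.sublist (List.take_sublist _ _))
        fun x hx => h'.sub x (List.mem_of_mem_take hx)
    have hcost := hc s
    rw [hq] at hcost
    have e : cells (l'.take (n + 1)) = cells (l.take n) + (l[n].length + 1) := by
      rw [ht, cells_append]; simp
    refine ⟨c * (cells (labelList a) - cells (l'.take (n + 1))), ⟨l', n + 1, h', hf', ?_⟩, ?_⟩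
    · rw [← mul_add, Nat.sub_add_cancel hle]
    · have h1 : c * cells (labelList a) = c * (cells (labelList a) - cells (l'.take (n + 1))) +
          (c * cells (l.take n) + c * (l[n].length + 1)) := by
        rw [← mul_add, ← mul_add, ← e, Nat.sub_add_cancel hle]
      linarith only [h1, hk, hcost]
  · rintro a k s ⟨l, n, h, hf, hk⟩ h0
    obtain rfl := hf.1 h0
    have hd := h.data
    have hcl := h.closed
    rw [List.take_length] at hd hcl
    exact ⟨l, h.queue.nodup, fun x => ⟨h.sub x, labelList_subset (R := (· ∈ l)) hcl h.mem₁ h.mem₂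
      h.small x⟩, hd, h.input, h.fresh⟩

end Grigorchuk


namespace Grigorchuk

open RAM
open WProg hiding ev cost

attribute [local irreducible] WProg.ev WProg.cost

/-! ### Breadth-first search -/

theorem ShortlexLT.length_le {x y : Word} (h : ShortlexLT x y) : x.length ≤ y.length := by
  rcases List.shortlex_def.1 h with h | h <;> omega

theorem ShortlexLT.ne {x y : Word} (h : ShortlexLT x y) : x ≠ y := by
  rintro rfl
  have : Std.Asymm fun x y : Letter => x.code < y.code := ⟨fun _ _ h => lt_asymm h⟩
  exact Std.Asymm.asymm (r := List.Shortlex fun x y : Letter => x.code < y.code) _ _ h h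

theorem shortlexLT_nil {x : Word} (h : x ≠ []) : ShortlexLT [] x :=
  List.Shortlex.of_length_lt (List.length_pos_iff.2 h)

theorem ShortlexLT.append {x y : Word} (h : ShortlexLT x y) (ℓ ℓ' : Letter) :
    ShortlexLT (x ++ [ℓ]) (y ++ [ℓ']) := by
  rcases List.shortlex_def.1 h with h | ⟨hl, h⟩
  · exact List.Shortlex.of_length_lt (by simpa using h)
  · refine List.Shortlex.of_lex (by simp [hl]) ?_
    clear * - h hl
    induction h with
    | nil => simp at hl
    | cons _ ih => exact .cons (ih (by simpa using hl))
    | rel h => exact .rel h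

theorem shortlexLT_append_singleton (x : Word) {ℓ ℓ' : Letter} (h : ℓ.code < ℓ'.code) :
    ShortlexLT (x ++ [ℓ]) (x ++ [ℓ']) := by
  refine List.Shortlex.of_lex (by simp) ?_
  induction x with
  | nil => exact .rel h
  | cons _ x ih => exact .cons ih

section Bfs

variable (p : Word → Bool)

/-- The words `ℓz` for which `p` holds. -/
def kids (z : Word) : List Word :=
  ([Letter.a, .b, .c, .d].filter fun ℓ => p (ℓ :: z)).map (· :: z)

theorem mem_kids {z x : Word} : x ∈ kids p z ↔ ∃ ℓ, x = ℓ :: z ∧ p x := by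
  simp only [kids, List.mem_map, List.mem_filter]
  constructor
  · rintro ⟨ℓ, ⟨-, h⟩, rfl⟩
    exact ⟨ℓ, rfl, h⟩
  · rintro ⟨ℓ, rfl, h⟩
    exact ⟨ℓ, ⟨by cases ℓ <;> simp, h⟩, rfl⟩

/-- The state of a breadth-first search in the tree of words that satisfy `p`: the words in `Z` have
been found, and the first `n` of them have been examined. -/
structure Bfs (Z : List Word) (n : ℕ) : Prop where
  eq : Z = [] :: (Z.take n).flatMap (kids p)
  le : n ≤ Z.length
  sorted : Z.Pairwise fun x y => ShortlexLT x.reverse y.reverse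

variable {p}

theorem Bfs.init : Bfs p [[]] 0 := ⟨by simp, by simp, by simp⟩

theorem kids_sorted (z : Word) :
    (kids p z).Pairwise fun x y => ShortlexLT x.reverse y.reverse := by
  rw [kids, List.pairwise_map]
  refine List.Pairwise.filter _ (List.Pairwise.imp (R := fun x y => Letter.code x < Letter.code y)
    (fun h => ?_) (by decide))
  simpa using shortlexLT_append_singleton z.reverse h

theorem Bfs.step {Z : List Word} {n : ℕ} (h : Bfs p Z n) (hn : n < Z.length) :
    Bfs p (Z ++ kids p Z[n]) (n + 1) := by
  have ht : (Z ++ kids p Z[n]).take (n + 1) = Z.take n ++ [Z[n]] := by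
    rw [List.take_append_of_le_length (by omega), List.take_concat_get' Z n hn]
  refine ⟨?_, by simp; omega, ?_⟩
  · rw [ht]
    rw [List.flatMap_append, ← List.cons_append, ← h.eq]
    simp
  · rw [List.pairwise_append]
    refine ⟨h.sorted, kids_sorted _, fun x hx y hy => ?_⟩
    obtain ⟨ℓ, rfl, -⟩ := (mem_kids p).1 hy
    rw [h.eq, List.mem_cons, List.mem_flatMap] at hx
    rcases hx with rfl | ⟨z, hz, hx⟩
    · exact shortlexLT_nil (by simp)
    · obtain ⟨ℓ', rfl, -⟩ := (mem_kids p).1 hx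
      -- Words found earlier were appended to words that come before `Z[n]`.
      have hd : Z[n] ∈ Z.drop n := by
        rw [List.drop_eq_getElem_cons hn]
        exact List.mem_cons_self
      have hs : ShortlexLT z.reverse Z[n].reverse := by
        have h1 := h.sorted
        rw [← List.take_append_drop n Z, List.pairwise_append] at h1
        exact h1.2.2 z hz _ hd
      simpa using hs.append ℓ' ℓ

theorem Bfs.mem {Z : List Word} {n : ℕ} (h : Bfs p Z n) (h0 : p []) : ∀ z ∈ Z, p z := by
  intro z hz
  rw [h.eq, List.mem_cons, List.mem_flatMap] at hz
  rcases hz with rfl | ⟨x, -, hx⟩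
  · exact h0
  · obtain ⟨ℓ, -, hx⟩ := (mem_kids p).1 hx
    exact hx

/-- When all words found have been examined, the search has reached every word with property `p`. -/
theorem Bfs.mem_of {Z : List Word} (h : Bfs p Z Z.length)
    (hp : ∀ ℓ z, p (ℓ :: z) → p z) (z : Word) (hz : p z) : z ∈ Z := by
  have he := h.eq
  rw [List.take_length] at he
  induction z with
  | nil => rw [he]; simp
  | cons ℓ z ih =>
    rw [he, List.mem_cons, List.mem_flatMap]
    exact .inr ⟨z, ih (hp ℓ z hz), (mem_kids p).2 ⟨ℓ, rfl, hz⟩⟩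

theorem Bfs.nodup {Z : List Word} {n : ℕ} (h : Bfs p Z n) : Z.Nodup :=
  h.sorted.imp fun h e => h.ne (congrArg List.reverse e)

end Bfs

/-- Is `z` the reverse of an initial segment of a word in `l`? -/
def isPre (l : List Word) (z : Word) : Bool := decide (∃ x ∈ l, z <:+ x.reverse)

/-- The search visits at most as many words as the labels have initial segments. -/
theorem length_le_cells {l Z : List Word} (hZ : Z.Nodup) (h : ∀ z ∈ Z, isPre l z) :
    Z.length ≤ cells l := by
  have hs : Z ⊆ l.flatMap fun x => x.reverse.tails := by
    intro z hz
    obtain ⟨x, hx, hzx⟩ := of_decide_eq_true (h z hz)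
    exact List.mem_flatMap.2 ⟨x, hx, (List.mem_tails _ _).2 hzx⟩
  refine (hZ.subperm hs).length_le.trans ?_
  rw [List.length_flatMap]
  simp [cells]

/-- If `ℓz` is marked, then put it into the queue of the search. -/
def kidP (ℓ : Letter) : WProg :=
  block [.op (.push .rz ℓ), .op (.nget .ng .pre .rz),
    .caseN .ng 2 fun k => if k = 0 then .skip else block [.op (.put .bfs .rt .rz), .op (.push .rt .a)],
    .op (.pop .rz)]

theorem flat_kidP (ℓ : Letter) : (kidP ℓ).Flat := by
  refine ⟨trivial, trivial, fun k => ?_, trivial, trivial⟩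
  dsimp only
  split_ifs
  · trivial
  · simp

/-- The queue of the search contains the words of `Z`. -/
structure Found (Z : List Word) (s : WState) : Prop where
  tail : s.w .rt = num Z.length
  get : ∀ i (h : i < Z.length), s.wa .bfs (num i) = Z[i]

/-- `t` agrees with `s` except for the queue of the search. -/
structure SameBut (s t : WState) : Prop where
  w : ∀ x, x ≠ .rt → t.w x = s.w x
  wa : ∀ a, a ≠ .bfs → t.wa a = s.wa a
  na : t.na = s.na
  out : t.out = s.out

theorem SameBut.trans {s t t' : WState} (h : SameBut s t) (h' : SameBut t t') : SameBut s t' :=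
  ⟨fun x hx => (h'.w x hx).trans (h.w x hx), fun x hx => (h'.wa x hx).trans (h.wa x hx),
    h'.na.trans h.na, h'.out.trans h.out⟩

theorem Found.put {Z : List Word} {s : WState} (h : Found Z s) (z : Word) {t : WState}
    (ht : t.w .rt = num (Z.length + 1))
    (hg : ∀ u, t.wa .bfs u = if u = s.w .rt then z else s.wa .bfs u) : Found (Z ++ [z]) t := by
  refine ⟨by rw [ht]; simp, fun i hi => ?_⟩
  rw [List.length_append, List.length_singleton] at hi
  simp only [hg, h.tail, num_inj]
  rcases Nat.lt_succ_iff_lt_or_eq.1 hi with hi | rfl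
  · rw [if_neg hi.ne, h.get i hi, List.getElem_append_left]
  · simp

theorem Found.kid {l Z : List Word} {s : WState} (h : Found Z s)
    (hp : ∀ z, s.na .pre z = if isPre l z then 1 else 0) (ℓ : Letter) :
    Found (Z ++ if isPre l (ℓ :: s.w .rz) then [ℓ :: s.w .rz] else []) ((kidP ℓ).ev s) ∧
      SameBut s ((kidP ℓ).ev s) := by
  by_cases hz : isPre l (ℓ :: s.w .rz)
  · rw [if_pos hz]
    obtain ⟨t, e⟩ : ∃ t, t = (kidP ℓ).ev s := ⟨_, rfl⟩
    rw [← e]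
    simp [kidP, WOp.eval, hp, hz] at e
    refine ⟨h.put _ ?_ ?_, ⟨?_, ?_, ?_, ?_⟩⟩
    · simp [e, h.tail, num_succ]
    · simp [e]
    · intro x hx
      by_cases hx' : x = .rz <;> simp [e, hx, hx']
    · simp +contextual [e]
    · simp [e]
    · simp [e]
  · rw [if_neg hz, List.append_nil]
    obtain ⟨t, e⟩ : ∃ t, t = (kidP ℓ).ev s := ⟨_, rfl⟩
    rw [← e]
    simp [kidP, WOp.eval, hp, hz] at e
    refine ⟨⟨?_, ?_⟩, ⟨?_, ?_, ?_, ?_⟩⟩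
    · simp [e, h.tail]
    · simpa [e] using h.get
    · intro x hx
      by_cases hx' : x = .rz <;> simp [e, hx']
    · simp [e]
    · simp [e]
    · simp [e]

/-- Append the word in `rz`, if it is the reverse of a label, to the sorted list of labels. -/
def emitP : WProg :=
  block [.op (.nget .ng .lab .rz), .caseN .ng 2 fun k => if k = 0 then .skip else
    block [.op (.get .rx .fwd .rz), .op (.put .queue .rk .rx), .op (.push .rk .a)]]

theorem flat_emitP : emitP.Flat := by
  refine ⟨trivial, fun k => ?_, trivial⟩
  dsimp only
  split_ifs
  · trivial
  · simp

/-- Examine a word in the queue of the search. -/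
def searchP : WProg :=
  block [.op (.get .rz .bfs .ri), .op (.push .ri .a), emitP, kidP .a, kidP .b, kidP .c, kidP .d,
    .ifEq .ri .rt (.op (.const .flag 0)) (.op (.const .flag 1))]

theorem flat_searchP : searchP.Flat :=
  ⟨trivial, trivial, flat_emitP, flat_kidP _, flat_kidP _, flat_kidP _, flat_kidP _,
    ⟨trivial, trivial⟩, trivial⟩

/-- The words in `M` have been written to an array. -/
structure Listed (M : List Word) (s : WState) : Prop where
  size : s.w .rk = num M.length
  get : ∀ i (h : i < M.length), s.wa .queue (num i) = M[i]

theorem emitP_spec {l M : List Word} {s : WState} (h : Listed M s) (hd : Data l s) :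
    Listed (M ++ if (s.w .rz).reverse ∈ l then [(s.w .rz).reverse] else []) (emitP.ev s) ∧
      (∀ x, x ≠ .rk → x ≠ .rx → (emitP.ev s).w x = s.w x) ∧
      (∀ a, a ≠ .queue → (emitP.ev s).wa a = s.wa a) ∧ (emitP.ev s).na = s.na ∧
      (emitP.ev s).out = s.out := by
  obtain ⟨t, e⟩ : ∃ t, t = emitP.ev s := ⟨_, rfl⟩
  rw [← e]
  by_cases hz : (s.w .rz).reverse ∈ l
  · have hf : s.wa .fwd (s.w .rz) = (s.w .rz).reverse := by
      simpa using hd.fwd _ hz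
    simp [emitP, WOp.eval, hd.lab, hz, hf] at e
    rw [if_pos hz]
    refine ⟨⟨?_, fun i hi => ?_⟩, ?_, ?_, ?_, ?_⟩
    · simp [e, h.size, num_succ]
    · rw [List.length_append, List.length_singleton] at hi
      simp only [e, WState.setW_wa, WState.putW_wa_self, h.size, num_inj, WState.setN_wa]
      rcases Nat.lt_succ_iff_lt_or_eq.1 hi with hi | rfl
      · rw [if_neg hi.ne, h.get i hi, List.getElem_append_left]
      · simp
    · simp +contextual [e]
    · simp +contextual [e]
    · simp [e]
    · simp [e]
  · simp [emitP, WOp.eval, hd.lab, hz] at e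
    rw [if_neg hz, List.append_nil]
    exact ⟨⟨by simp [e, h.size], by simpa [e] using h.get⟩, by simp [e], by simp [e], by simp [e],
      by simp [e]⟩

theorem Data.congr {l : List Word} {s t : WState} (h : Data l s)
    (hwa : ∀ a, a ≠ .queue → a ≠ .bfs → t.wa a = s.wa a) (hna : t.na = s.na) : Data l t := by
  constructor
  · rw [hwa _ (by decide) (by decide)]; exact h.fwd
  · rw [hwa _ (by decide) (by decide)]; exact h.ch₀
  · rw [hwa _ (by decide) (by decide)]; exact h.ch₁
  · rw [hna]; exact h.pre
  · rw [hna]; exact h.lab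
  · rw [hna]; exact h.par
  · rw [hna]; exact h.kap
  · rw [hna]; exact h.k₀
  · rw [hna]; exact h.k₁

theorem Data.congr_mem {l l' : List Word} {s : WState} (h : Data l s)
    (hl : ∀ x, x ∈ l' ↔ x ∈ l) : Data l' s := by
  constructor <;> simp only [hl]
  exacts [h.fwd, h.ch₀, h.ch₁, h.pre, h.lab, h.par, h.kap, h.k₀, h.k₁]

/-- The state of the search for the labels in `l`. -/
structure Searching (a : Word × Word) (l Z : List Word) (n : ℕ) (s : WState) : Prop where
  collected : Collected a l s
  bfs : Bfs (isPre l) Z n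
  found : Found Z s
  head : s.w .ri = num n
  listed : Listed (((Z.take n).filter fun z => z.reverse ∈ l).map List.reverse) s

theorem Collected.congr {a : Word × Word} {l : List Word} {s t : WState} (h : Collected a l s)
    (hwa : ∀ a, a ≠ .queue → a ≠ .bfs → t.wa a = s.wa a) (hna : t.na = s.na)
    (hu : t.w .ru = s.w .ru) (hv : t.w .rv = s.w .rv) (hout : t.out = s.out) :
    Collected a l t :=
  ⟨h.nodup, h.mem, h.data.congr hwa hna, ⟨hu.trans h.input.1, hv.trans h.input.2⟩,
    ⟨fun x => by rw [hna]; exact h.fresh.done x, fun x => by rw [hna]; exact h.fresh.entF x,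
      hout.trans h.fresh.out⟩⟩

/-- The words examined are reversed initial segments of labels. Those that are labels themselves are
listed, in the order of the search, which is the shortlex order of the reverses. -/
theorem Searching.step {a : Word × Word} {l Z : List Word} {n : ℕ} {s : WState}
    (h : Searching a l Z n s) (hn : n < Z.length) :
    ∃ Z', Searching a l Z' (n + 1) (searchP.ev s) ∧
      ((searchP.ev s).n .flag = 0 ↔ n + 1 = Z'.length) := by
  obtain ⟨s₁, e₁⟩ : ∃ t, t = (s.setW .rz Z[n]).setW .ri (num (n + 1)) := ⟨_, rfl⟩
  have hz₁ : s₁.w .rz = Z[n] := by simp [e₁]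
  have C₁ : Collected a l s₁ := by
    refine h.collected.congr ?_ ?_ ?_ ?_ ?_ <;> simp [e₁]
  have L₁ : Listed (((Z.take n).filter fun z => z.reverse ∈ l).map List.reverse) s₁ :=
    ⟨by simpa [e₁] using h.listed.size, by simpa [e₁] using h.listed.get⟩
  obtain ⟨L₂, w₂, wa₂, na₂, out₂⟩ := emitP_spec L₁ C₁.data
  obtain ⟨s₂, e₂⟩ : ∃ t, t = emitP.ev s₁ := ⟨_, rfl⟩
  rw [← e₂] at L₂ w₂ wa₂ na₂ out₂
  have hz₂ : s₂.w .rz = Z[n] := by rw [w₂ _ (by decide) (by decide), hz₁]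
  have F₂ : Found Z s₂ := by
    refine ⟨?_, ?_⟩
    · rw [w₂ _ (by decide) (by decide), e₁]; simpa using h.found.tail
    · rw [wa₂ _ (by decide), e₁]; exact h.found.get
  have hp : ∀ z, s₂.na .pre z = if isPre l z then 1 else 0 := by
    intro z
    rw [na₂, C₁.data.pre]
    simp [isPre]
  obtain ⟨F₃, S₃⟩ := F₂.kid hp .a
  have hp₃ : ∀ z, ((kidP .a).ev s₂).na .pre z = if isPre l z then 1 else 0 := by
    rw [S₃.na]; exact hp
  obtain ⟨F₄, S₄⟩ := F₃.kid hp₃ .b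
  have hp₄ : ∀ z, ((kidP .b).ev ((kidP .a).ev s₂)).na .pre z = if isPre l z then 1 else 0 := by
    rw [S₄.na]; exact hp₃
  obtain ⟨F₅, S₅⟩ := F₄.kid hp₄ .c
  have hp₅ : ∀ z, ((kidP .c).ev ((kidP .b).ev ((kidP .a).ev s₂))).na .pre z =
      if isPre l z then 1 else 0 := by
    rw [S₅.na]; exact hp₄
  obtain ⟨F₆, S₆⟩ := F₅.kid hp₅ .d
  have S := ((S₃.trans S₄).trans S₅).trans S₆
  rw [S₅.w _ (by decide), S₄.w _ (by decide), S₃.w _ (by decide), hz₂] at F₆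
  obtain ⟨s₆, e₆⟩ : ∃ t, t = (kidP .d).ev ((kidP .c).ev ((kidP .b).ev ((kidP .a).ev s₂))) :=
    ⟨_, rfl⟩
  rw [← e₆] at F₆ S
  have hk : Z ++ kids (isPre l) Z[n] = Z ++ (if isPre l (.a :: Z[n]) then [.a :: Z[n]] else []) ++
      (if isPre l (.b :: Z[n]) then [.b :: Z[n]] else []) ++
      (if isPre l (.c :: Z[n]) then [.c :: Z[n]] else []) ++
      (if isPre l (.d :: Z[n]) then [.d :: Z[n]] else []) := by
    simp only [kids, List.filter_cons, List.filter_nil]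
    split_ifs <;> simp
  rw [← hk] at F₆
  obtain ⟨Z', hZ'⟩ : ∃ Z', Z' = Z ++ kids (isPre l) Z[n] := ⟨_, rfl⟩
  have B := h.bfs.step hn
  rw [← hZ'] at F₆ B
  have hri : s₆.w .ri = num (n + 1) := by
    rw [S.w _ (by decide), w₂ _ (by decide) (by decide), e₁]; simp
  have ev₁ : searchP.ev s = s₆.setN .flag (if n + 1 = Z'.length then 0 else 1) := by
    have : searchP.ev s = (WProg.ifEq .ri .rt (.op (.const .flag 0))
        (.op (.const .flag 1))).ev s₆ := by
      have hq : s.wa .bfs (s.w .ri) = Z[n] := by rw [h.head, h.found.get n hn]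
      rw [e₆, e₂, e₁, num_succ, ← h.head]
      simp only [searchP, ev_block_cons, ev_block_nil, ev_op, WOp.eval, WState.setW_w, reduceCtorEq,
        if_false, hq]
    rw [this, ev_ifEq, hri, F₆.tail]
    simp only [num_inj]
    split_ifs <;> rw [ev_op, WOp.eval]
  refine ⟨Z', ⟨?_, B, ?_, ?_, ?_⟩, ?_⟩
  · rw [ev₁]
    refine C₁.congr (fun b h h' => ?_) ?_ ?_ ?_ ?_
    · rw [WState.setN_wa, S.wa b h', wa₂ b h]
    · rw [WState.setN_na, S.na, na₂]
    · rw [WState.setN_w, S.w _ (by decide), w₂ _ (by decide) (by decide)]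
    · rw [WState.setN_w, S.w _ (by decide), w₂ _ (by decide) (by decide)]
    · rw [WState.setN_out, S.out, out₂]
  · rw [ev₁]; exact ⟨F₆.tail, F₆.get⟩
  · rw [ev₁]; exact hri
  · have ht : Z'.take (n + 1) = Z.take n ++ [Z[n]] := by
      rw [hZ', List.take_append_of_le_length (by omega), List.take_concat_get' Z n hn]
    have hf : (((Z'.take (n + 1)).filter fun z => z.reverse ∈ l).map List.reverse) =
        ((Z.take n).filter fun z => z.reverse ∈ l).map List.reverse ++
          if (s₁.w .rz).reverse ∈ l then [(s₁.w .rz).reverse] else [] := by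
      rw [ht, List.filter_append, List.map_append, hz₁]
      congr 1
      simp only [List.filter_cons, List.filter_nil, decide_eq_true_eq]
      split_ifs <;> rfl
    rw [hf, ev₁]
    refine ⟨?_, ?_⟩
    · rw [WState.setN_w, S.w _ (by decide)]; exact L₂.size
    · rw [WState.setN_wa, S.wa _ (by decide)]; exact L₂.get
  · rw [ev₁]
    by_cases hl : n + 1 = Z'.length <;> simp [hl]

/-- The labels have been sorted. -/
structure Sorted (a : Word × Word) (L : List Word) (s : WState) : Prop where
  sorted : L.Pairwise ShortlexLT
  collected : Collected a L s
  listed : Listed L s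

/-- Sort the labels by a breadth-first search in the tree of their initial segments. -/
noncomputable def sortP : Prog :=
  .seq ((block [.op (.nil .ri), .op (.nil .rt), .op (.nil .rz), .op (.put .bfs .rt .rz),
    .op (.push .rt .a), .op (.nil .rk), .op (.const .flag 1)]).compile 0) (whileN .flag searchP)

/-- The time is proportional to the number of initial segments of the labels. -/
theorem reaches_sortP : Reaches inputSize sortP (fun a s => ∃ l, Collected a l s)
    (fun a s => ∃ L, Sorted a L s) := by
  obtain ⟨C, hC⟩ := cells_labelList
  refine (Reaches.of_ev (J := fun a s => (∃ l, Searching a l [[]] 0 s) ∧ s.n .flag = 1) _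
    8 ?_).seq ?_
  · rintro a s ⟨l, h⟩
    refine ⟨⟨⟨l, ?_, Bfs.init, ⟨?_, ?_⟩, ?_, ⟨?_, ?_⟩⟩, ?_⟩, ?_⟩
    · refine h.congr ?_ ?_ ?_ ?_ ?_ <;> simp +contextual [WOp.eval]
    · simp [WOp.eval, num]
    · intro i hi
      obtain rfl : i = 0 := by simpa using hi
      simp [WOp.eval, num]
    · simp [WOp.eval, num]
    · simp [WOp.eval, num]
    · simp
    · simp [WOp.eval]
    · simp only [cost_block_cons, cost_block_nil, cost_op]
      have := one_le_inputSize a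
      omega
  refine Reaches.while (fun a k s => ∃ l Z n, Searching a l Z n s ∧
    (s.n .flag = 0 ↔ n = Z.length) ∧ k + searchP.maxCost * n = searchP.maxCost * cells l)
    (searchP.maxCost * C) one_le_inputSize ?_ ?_ ?_
  · rintro a s ⟨⟨l, h⟩, hf⟩
    refine ⟨_, ⟨l, [[]], 0, h, by simp [hf], rfl⟩, ?_⟩
    rw [mul_assoc]
    exact Nat.mul_le_mul_left _ ((cells_le_of_nodup h.collected.nodup
      fun x hx => (h.collected.mem x).1 hx).trans (hC a))
  · rintro a k s ⟨l, Z, n, h, hf, hk⟩ h0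
    have hn : n < Z.length := lt_of_le_of_ne h.bfs.le (fun e => h0 (hf.2 e))
    obtain ⟨Z', h', hf'⟩ := h.step hn
    have hcost := flat_searchP.cost_le s
    have h0 : isPre l [] := by
      refine decide_eq_true ⟨[], (h.collected.mem []).2 (mem_labelList.2 ?_), List.nil_suffix⟩
      exact .inr (.inr (by simp))
    have hle : n + 1 ≤ cells l :=
      h'.bfs.le.trans (length_le_cells h'.bfs.nodup (h'.bfs.mem h0))
    refine ⟨searchP.maxCost * (cells l - (n + 1)), ⟨l, Z', n + 1, h', hf', ?_⟩, ?_⟩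
    · rw [← mul_add, Nat.sub_add_cancel hle]
    · have h1 : searchP.maxCost * cells l = searchP.maxCost * (cells l - (n + 1)) +
          (searchP.maxCost * n + searchP.maxCost) := by
        rw [← Nat.mul_succ, ← mul_add, Nat.sub_add_cancel hle]
      linarith only [h1, hk, hcost]
  · rintro a k s ⟨l, Z, n, h, hf, hk⟩ h0
    obtain rfl := hf.1 h0
    have hL := h.listed
    rw [List.take_length] at hL
    have hp : ∀ ℓ z, isPre l (ℓ :: z) → isPre l z := by
      intro ℓ z hz
      obtain ⟨x, hx, hzx⟩ := of_decide_eq_true hz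
      exact decide_eq_true ⟨x, hx, (List.suffix_cons ℓ z).trans hzx⟩
    have hm : ∀ x, x ∈ (Z.filter fun z => z.reverse ∈ l).map List.reverse ↔ x ∈ l := by
      intro x
      simp only [List.mem_map, List.mem_filter, decide_eq_true_eq]
      constructor
      · rintro ⟨z, ⟨-, hz⟩, rfl⟩
        exact hz
      · intro hx
        refine ⟨x.reverse, ⟨h.bfs.mem_of hp _ ?_, by simpa using hx⟩, by simp⟩
        exact decide_eq_true ⟨x, hx, List.suffix_rfl⟩
    have hs : ((Z.filter fun z => z.reverse ∈ l).map List.reverse).Pairwise ShortlexLT := by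
      rw [List.pairwise_map]
      exact h.bfs.sorted.filter _
    exact ⟨_, hs, ⟨hs.imp ShortlexLT.ne, fun x => (hm x).trans (h.collected.mem x),
      h.collected.data.congr_mem hm, h.collected.input, h.collected.fresh⟩, hL⟩

end Grigorchuk


namespace Grigorchuk

open RAM
open WProg hiding ev cost

attribute [local irreducible] WProg.ev WProg.cost

/-! ### Addressing the rows of the table -/

/-- Put the letters of `l` in front of a word, each preceded by the letter `t`. -/
def tagged (t : Letter) (l u : Word) : Word := l.foldl (fun u ℓ => t :: ℓ :: u) u

/-- The word under which a row is stored. -/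
def key : RowLabel → Word
  | .pair r₀ r₁ => .b :: tagged .c r₁ (tagged .b r₀ [])
  | .single r => .c :: tagged .b r []

theorem tagged_append_singleton (t ℓ : Letter) (l u : Word) :
    tagged t (l ++ [ℓ]) u = t :: ℓ :: tagged t l u := by
  simp [tagged]

/-- The tags `t` mark the end of the list: what follows does not start with `t`. -/
theorem tagged_inj {t : Letter} {l l' u u' : Word} (hu : u.head? ≠ some t)
    (hu' : u'.head? ≠ some t) (h : tagged t l u = tagged t l' u') : l = l' ∧ u = u' := by
  induction l using List.reverseRecOn generalizing l' with
  | nil =>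
    induction l' using List.reverseRecOn with
    | nil => exact ⟨rfl, h⟩
    | append_singleton l' ℓ' =>
      rw [tagged_append_singleton] at h
      exact absurd (by rw [show u = _ from h]; rfl) hu
  | append_singleton l ℓ ih =>
    induction l' using List.reverseRecOn with
    | nil =>
      rw [tagged_append_singleton] at h
      exact absurd (by rw [← show t :: ℓ :: tagged t l u = u' from h]; rfl) hu'
    | append_singleton l' ℓ' =>
      rw [tagged_append_singleton, tagged_append_singleton] at h
      injection h with _ h
      injection h with h1 h
      obtain ⟨rfl, rfl⟩ := ih h
      exact ⟨by rw [h1], rfl⟩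

theorem head_tagged_b (l : Word) : (tagged .b l []).head? ≠ some .c := by
  induction l using List.reverseRecOn with
  | nil => simp [tagged]
  | append_singleton l ℓ _ => rw [tagged_append_singleton]; simp

theorem key_injective : Function.Injective key := by
  intro ℓ ℓ' h
  rcases ℓ with ⟨r₀, r₁⟩ | r <;> rcases ℓ' with ⟨r₀', r₁'⟩ | r' <;>
    simp only [key, List.cons.injEq, true_and, reduceCtorEq, false_and] at h
  · obtain ⟨rfl, h'⟩ := tagged_inj (head_tagged_b _) (head_tagged_b _) h
    obtain ⟨rfl, -⟩ := tagged_inj (by simp) (by simp) h'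
    rfl
  · obtain ⟨rfl, -⟩ := tagged_inj (by simp) (by simp) h
    rfl

/-- The words `num i ++ key ℓ` address disjoint families of cells, since no key starts with `a`, the
letter that counts. -/
theorem num_key_inj {i j : ℕ} {ℓ ℓ' : RowLabel} :
    num i ++ key ℓ = num j ++ key ℓ' ↔ i = j ∧ ℓ = ℓ' := by
  refine ⟨fun h => ?_, fun ⟨h, h'⟩ => h ▸ h' ▸ rfl⟩
  have hk : ∀ ℓ, ∃ x u, key ℓ = x :: u ∧ x ≠ .a := fun ℓ => by
    cases ℓ
    · exact ⟨_, _, rfl, by decide⟩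
    · exact ⟨_, _, rfl, by decide⟩
  obtain ⟨x, u, hx, hxa⟩ := hk ℓ
  obtain ⟨x', u', hx', hxa'⟩ := hk ℓ'
  have hij : i = j := by
    rw [hx, hx'] at h
    clear hx hx'
    induction i generalizing j with
    | zero =>
      cases j with
      | zero => rfl
      | succ j =>
        rw [num_succ] at h
        injection h with h
        exact absurd h hxa
    | succ i ih =>
      cases j with
      | zero =>
        rw [num_succ] at h
        injection h with h
        exact absurd h.symm hxa'
      | succ j =>
        rw [num_succ, num_succ] at h
        injection h with _ h
        rw [ih h]
  subst hij
  exact ⟨rfl, key_injective (List.append_cancel_left h)⟩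

theorem key_eq_num_key {ℓ ℓ' : RowLabel} {i : ℕ} : num i ++ key ℓ = key ℓ' ↔ i = 0 ∧ ℓ = ℓ' :=
  num_key_inj (j := 0)

/-- Put tagged letters in front of the word in `X`. -/
def tagP (t : Letter) (X Y : WReg) : WProg :=
  .each Y fun ℓ => block [.op (.push X ℓ), .op (.push X t)]

theorem ev_tagP (t : Letter) (X Y : WReg) (s : WState) :
    (tagP t X Y).ev s = s.setW X (tagged t (s.w Y) (s.w X)) := by
  rw [tagP, ev_each_setW (x := X) (g := fun ℓ u => t :: ℓ :: u)]
  · rfl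
  · intro ℓ s
    simp [WOp.eval]

theorem exists_cost_tagP (t : Letter) (X Y : WReg) :
    ∃ c, ∀ s, (tagP t X Y).cost s ≤ c * ((s.w Y).length + 1) :=
  exists_cost_each (by simp)

/-- The address of a row that is labelled by two words. -/
def pairKeyP (X Y Z : WReg) : WProg :=
  block [.op (.nil X), tagP .b X Y, tagP .c X Z, .op (.push X .b)]

theorem ev_pairKeyP {X Y Z : WReg} (hY : Y ≠ X) (hZ : Z ≠ X) (s : WState) :
    (pairKeyP X Y Z).ev s = s.setW X (key (.pair (s.w Y) (s.w Z))) := by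
  simp [pairKeyP, ev_tagP, WOp.eval, hY, hZ, key]

theorem exists_cost_pairKeyP {X Y Z : WReg} (hY : Y ≠ X) (hZ : Z ≠ X) :
    ∃ c, ∀ s, (pairKeyP X Y Z).cost s ≤ c * ((s.w Y).length + (s.w Z).length + 1) := by
  obtain ⟨c₁, h₁⟩ := exists_cost_tagP .b X Y
  obtain ⟨c₂, h₂⟩ := exists_cost_tagP .c X Z
  refine ⟨c₁ + c₂ + 3, fun s => ?_⟩
  have l₁ := h₁ (s.setW X [])
  have l₂ := h₂ ((s.setW X []).setW X (tagged .b (s.w Y) []))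
  simp only [pairKeyP, cost_block_cons, cost_block_nil, cost_op, ev_op, WOp.eval, ev_tagP]
  simp only [WState.setW_setW, WState.setW_w, hY, hZ, if_false, if_true] at l₁ l₂ ⊢
  have e₁ : c₁ * ((s.w Y).length + 1) ≤ c₁ * ((s.w Y).length + (s.w Z).length + 1) :=
    Nat.mul_le_mul_left _ (by omega)
  have e₂ : c₂ * ((s.w Z).length + 1) ≤ c₂ * ((s.w Y).length + (s.w Z).length + 1) :=
    Nat.mul_le_mul_left _ (by omega)
  have hn : 1 ≤ (s.w Y).length + (s.w Z).length + 1 := Nat.le_add_left _ _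
  simp only [Nat.add_mul _ _ ((s.w Y).length + (s.w Z).length + 1)]
  linarith only [l₁, l₂, e₁, e₂, hn]

/-- The address of a row that is labelled by one word. -/
def singleKeyP (X Y : WReg) : WProg :=
  block [.op (.nil X), tagP .b X Y, .op (.push X .c)]

theorem ev_singleKeyP {X Y : WReg} (hY : Y ≠ X) (s : WState) :
    (singleKeyP X Y).ev s = s.setW X (key (.single (s.w Y))) := by
  simp [singleKeyP, ev_tagP, WOp.eval, hY, key]

theorem exists_cost_singleKeyP {X Y : WReg} (hY : Y ≠ X) :
    ∃ c, ∀ s, (singleKeyP X Y).cost s ≤ c * ((s.w Y).length + 1) := by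
  obtain ⟨c₁, h₁⟩ := exists_cost_tagP .b X Y
  refine ⟨c₁ + 3, fun s => ?_⟩
  have l₁ := h₁ (s.setW X [])
  simp only [singleKeyP, cost_block_cons, cost_block_nil, cost_op, ev_op, WOp.eval]
  simp only [WState.setW_w, hY, if_false] at l₁
  have hn : 1 ≤ (s.w Y).length + 1 := Nat.le_add_left _ _
  rw [Nat.add_mul]
  linarith only [l₁, hn]

/-! ### One step of the algorithm -/

/-- The arrays contain the table. -/
structure Models (S : Table) (s : WState) : Prop where
  done : ∀ x, s.na .done x = if (S.rep x).isSome then 1 else 0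
  rep : ∀ {x}, S.Done x → s.wa .rep x = S.repD x
  q : ∀ {x}, S.Done x → s.na .q x = setCode (S.q x)
  ent : ∀ ℓ i (h : i < (S.rows ℓ).length), s.wa .ent (num i ++ key ℓ) = (S.rows ℓ)[i]
  entF : ∀ ℓ i, s.na .entF (num i ++ key ℓ) = if i < (S.rows ℓ).length then 1 else 0

theorem Models.congr {S : Table} {s t : WState} (h : Models S s) (hwa : t.wa = s.wa)
    (hna : t.na = s.na) : Models S t :=
  ⟨by rw [hna]; exact h.done, by rw [hwa]; exact h.rep, by rw [hna]; exact h.q,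
    by rw [hwa]; exact h.ent, by rw [hna]; exact h.entF⟩

theorem Models.entF_key {S : Table} {s : WState} (h : Models S s) (ℓ : RowLabel) :
    s.na .entF (key ℓ) = if S.rows ℓ = [] then 0 else 1 := by
  have := h.entF ℓ 0
  simp only [num, List.replicate_zero, List.nil_append] at this
  rw [this]
  rcases S.rows ℓ with _ | ⟨r, l⟩ <;> simp

/-- Compute `Q(x, y)` for processed words. -/
noncomputable def qOfP (f : NReg) (A B : WReg) : WProg :=
  block [.op (.get .rx .rep A), .op (.get .ry .rep B), .op (.nget .ng .q A), .op (.nget .nh .q B),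
    .ifEq .rx .ry
      (tab f [.ng, .nh] fun l => setCode ((setOf (l.getD 1 0))⁻¹ * setOf (l.getD 0 0)))
      (.op (.const f (setCode ∅)))]

theorem flat_qOfP (f : NReg) (A B : WReg) : (qOfP f A B).Flat :=
  ⟨trivial, trivial, trivial, trivial, ⟨flat_tab _ _ _, trivial⟩, trivial⟩

theorem ev_qOfP {S : Table} {s : WState} (h : Models S s) (f : NReg) {A B : WReg} (hA : A ≠ .rx)
    (hA' : A ≠ .ry) (hB : B ≠ .rx) (hB' : B ≠ .ry) {x y : Word} (hx : s.w A = x) (hy : s.w B = y)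
    (dx : S.Done x) (dy : S.Done y) :
    (qOfP f A B).ev s = ((((s.setW .rx (S.repD x)).setW .ry (S.repD y)).setN .ng
      (setCode (S.q x))).setN .nh (setCode (S.q y))).setN f (setCode (S.qOf x y)) := by
  have e : S.rep x = S.rep y ↔ S.repD x = S.repD y := by
    rw [dx.rep_eq, dy.rep_eq, Option.some_inj]
  simp only [qOfP, ev_block_cons, ev_block_nil, ev_op, WOp.eval, WState.setW_w, WState.setW_na,
    WState.setN_w, WState.setN_na, WState.setW_wa, hA, hA', hB, hB', if_false, hx,
    hy, h.rep dx, h.rep dy, h.q dx, h.q dy, ev_ifEq, reduceCtorEq, if_true]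
  unfold Table.qOf
  simp only [e]
  split_ifs
  · rw [ev_tab]
    · simp
    · simp [setCode_lt]
  · rfl

/-- Compute `Q(w, w')` from the children of the words `w` in `X` and `w'` in `Z`. -/
noncomputable def liftP (X Z : WReg) : WProg :=
  block [.op (.get .c₀ .ch₀ X), .op (.get .c₁ .ch₁ X), .op (.get .d₀ .ch₀ Z), .op (.get .d₁ .ch₁ Z),
    .op (.nget .par .par X), .caseN .par 2 fun k => if k = 0 then
      block [qOfP .q₀ .c₀ .d₀, qOfP .q₁ .c₁ .d₁, qOfP .q₂ .c₁ .d₀, qOfP .q₃ .c₀ .d₁,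
        tab .res [.q₀, .q₁, .q₂, .q₃] fun l =>
          setCode (lift (setOf (l.getD 0 0) ×ˢ setOf (l.getD 1 0)) ∪
            lift (setOf (l.getD 2 0) ×ˢ setOf (l.getD 3 0)) * {coset [.a]})]
    else
      block [qOfP .q₀ .c₀ .d₀, .op (.nget .q₁ .k₁ X), .op (.nget .q₂ .k₁ Z), .op (.nget .q₃ .k₀ Z),
        tab .res [.q₀, .q₁, .q₂, .q₃] fun l =>
          setCode (lift ((fun g => (g, cosetOf (l.getD 2 0) * g * (cosetOf (l.getD 1 0))⁻¹)) ''
              setOf (l.getD 0 0)) ∪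
            lift ((fun g => (g * (cosetOf (l.getD 1 0))⁻¹, (cosetOf (l.getD 3 0))⁻¹ * g)) ''
              setOf (l.getD 0 0)) * {coset [.a]})]]

theorem flat_liftP (X Z : WReg) : (liftP X Z).Flat := by
  refine ⟨trivial, trivial, trivial, trivial, trivial, fun k => ?_, trivial⟩
  dsimp only
  split_ifs
  · exact ⟨flat_qOfP _ _ _, flat_qOfP _ _ _, flat_qOfP _ _ _, flat_qOfP _ _ _, flat_tab _ _ _,
      trivial⟩
  · exact ⟨flat_qOfP _ _ _, trivial, trivial, trivial, flat_tab _ _ _, trivial⟩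

/-- Registers for temporary use. -/
def isTemp : WReg → Bool
  | .rx | .ry | .rz | .c₀ | .c₁ | .v₃ | .rs | .d₀ | .d₁ => true
  | _ => false

/-- The program has computed `k`, using registers for temporary use only. -/
structure Computed (k : ℕ) (s t : WState) : Prop where
  res : t.n .res = k
  w : ∀ x, x ≠ .rx → x ≠ .ry → x ≠ .c₀ → x ≠ .c₁ → x ≠ .d₀ → x ≠ .d₁ → t.w x = s.w x
  wa : t.wa = s.wa
  na : t.na = s.na
  out : t.out = s.out

/-- The formula for `Q(w, w')` is evaluated by means of stored tables of finite functions. -/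
theorem liftP_spec {S : Table} {s : WState} {L : List Word} (h : Models S s) (hd : Data L s)
    {X Z : WReg} (hX : X = .rs ∨ isTemp X = false) (hZ : Z = .rs ∨ isTemp Z = false) {w w' : Word}
    (hw : s.w X = w) (hw' : s.w Z = w') (hL : w ∈ L) (hL' : w' ∈ L) (hp : EvenA w ↔ EvenA w')
    (hc : ∀ c ∈ children w, S.Done c) (hc' : ∀ c ∈ children w', S.Done c) :
    Computed (setCode (S.qLift w w')) s ((liftP X Z).ev s) := by
  have hX' : X ≠ .rx ∧ X ≠ .ry ∧ X ≠ .c₀ ∧ X ≠ .c₁ ∧ X ≠ .d₀ ∧ X ≠ .d₁ := by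
    refine ⟨?_, ?_, ?_, ?_, ?_, ?_⟩ <;> rintro rfl <;> simp [isTemp] at hX
  have hZ' : Z ≠ .rx ∧ Z ≠ .ry ∧ Z ≠ .c₀ ∧ Z ≠ .c₁ ∧ Z ≠ .d₀ ∧ Z ≠ .d₁ := by
    refine ⟨?_, ?_, ?_, ?_, ?_, ?_⟩ <;> rintro rfl <;> simp [isTemp] at hZ
  obtain ⟨x1, x2, x3, x4, x5, x6⟩ := hX'
  obtain ⟨z1, z2, z3, z4, z5, z6⟩ := hZ'
  obtain ⟨t, ht⟩ : ∃ t, t = (block [.op (.get .c₀ .ch₀ X), .op (.get .c₁ .ch₁ X),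
    .op (.get .d₀ .ch₀ Z), .op (.get .d₁ .ch₁ Z), .op (.nget .par .par X)]).ev s := ⟨_, rfl⟩
  simp only [ev_block_cons, ev_block_nil, ev_op, WOp.eval, WState.setW_w, WState.setW_wa,
    WState.setW_na, x3, x4, x5, x6, z3, z4, z5, if_false, hw, hw', hd.ch₀ w hL, hd.ch₁ w hL,
    hd.ch₀ w' hL', hd.ch₁ w' hL', hd.par w hL] at ht
  have hM : Models S t := h.congr (by simp [ht]) (by simp [ht])
  have t0 : t.w .c₀ = child₀ w := by simp [ht]
  have t1 : t.w .c₁ = child₁ w := by simp [ht]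
  have t2 : t.w .d₀ = child₀ w' := by simp [ht]
  have t3 : t.w .d₁ = child₁ w' := by simp [ht]
  have c0 := hc _ (mem_children.2 (.inl rfl))
  have c1 := hc _ (mem_children.2 (.inr rfl))
  have d0 := hc' _ (mem_children.2 (.inl rfl))
  have d1 := hc' _ (mem_children.2 (.inr rfl))
  by_cases he : EvenA w
  · have he' := hp.1 he
    have e : (liftP X Z).ev s = (block [qOfP .q₀ .c₀ .d₀, qOfP .q₁ .c₁ .d₁, qOfP .q₂ .c₁ .d₀,
        qOfP .q₃ .c₀ .d₁, tab .res [.q₀, .q₁, .q₂, .q₃] fun l =>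
          setCode (lift (setOf (l.getD 0 0) ×ˢ setOf (l.getD 1 0)) ∪
            lift (setOf (l.getD 2 0) ×ˢ setOf (l.getD 3 0)) * {coset [.a]})]).ev t := by
      rw [ht]
      simp only [liftP, ev_block_cons, ev_block_nil, ev_op, WOp.eval, WState.setW_w, WState.setW_wa,
        WState.setW_na, x3, x4, x5, x6, z3, z4, z5, if_false, hw, hw', hd.ch₀ w hL,
        hd.ch₁ w hL, hd.ch₀ w' hL', hd.ch₁ w' hL', hd.par w hL, ev_caseN, WState.setN_n, if_true,
        parity_lt]
      rw [if_pos (by simp [parity, he])]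
      simp only [ev_block_cons, ev_block_nil]
    have hM₁ := fun f => ev_qOfP hM f (A := .c₀) (B := .d₀) (by decide) (by decide) (by decide)
      (by decide) t0 t2 c0 d0
    obtain ⟨t₁, e₁⟩ : ∃ t', t' = (qOfP .q₀ .c₀ .d₀).ev t := ⟨_, rfl⟩
    rw [ev_block_cons, ← e₁] at e
    rw [hM₁] at e₁
    obtain ⟨t₂, e₂⟩ : ∃ t', t' = (qOfP .q₁ .c₁ .d₁).ev t₁ := ⟨_, rfl⟩
    rw [ev_block_cons, ← e₂] at e
    rw [ev_qOfP (hM.congr (by simp [e₁]) (by simp [e₁])) _ (by decide) (by decide) (by decide)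
      (by decide) (x := child₁ w) (y := child₁ w') (by simp [e₁, t1]) (by simp [e₁, t3]) c1 d1]
      at e₂
    obtain ⟨t₃, e₃⟩ : ∃ t', t' = (qOfP .q₂ .c₁ .d₀).ev t₂ := ⟨_, rfl⟩
    rw [ev_block_cons, ← e₃] at e
    rw [ev_qOfP (hM.congr (by simp [e₂, e₁]) (by simp [e₂, e₁])) _ (by decide) (by decide)
      (by decide) (by decide) (x := child₁ w) (y := child₀ w') (by simp [e₂, e₁, t1])
      (by simp [e₂, e₁, t2]) c1 d0] at e₃
    obtain ⟨t₄, e₄⟩ : ∃ t', t' = (qOfP .q₃ .c₀ .d₁).ev t₃ := ⟨_, rfl⟩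
    rw [ev_block_cons, ← e₄] at e
    rw [ev_qOfP (hM.congr (by simp [e₃, e₂, e₁]) (by simp [e₃, e₂, e₁])) _ (by decide) (by decide)
      (by decide) (by decide) (x := child₀ w) (y := child₁ w') (by simp [e₃, e₂, e₁, t0])
      (by simp [e₃, e₂, e₁, t3]) c0 d1] at e₄
    rw [ev_block_cons, ev_block_nil, ev_tab _ _ (by simp [e₄, e₃, e₂, e₁, setCode_lt])] at e
    have hq : S.qLift w w' = lift (S.qOf (child₀ w) (child₀ w') ×ˢ S.qOf (child₁ w) (child₁ w')) ∪
        lift (S.qOf (child₁ w) (child₀ w') ×ˢ S.qOf (child₀ w) (child₁ w')) * {coset [.a]} := by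
      simp only [Table.qLift, child₀, child₁, if_pos he, if_pos he']
    rw [e, hq]
    refine ⟨by simp [e₄, e₃, e₂, e₁], ?_, ?_, ?_, ?_⟩
    · simp +contextual [e₄, e₃, e₂, e₁, ht]
    · simp [e₄, e₃, e₂, e₁, ht]
    · simp [e₄, e₃, e₂, e₁, ht]
    · simp [e₄, e₃, e₂, e₁, ht]
  · have he' := fun h => he (hp.2 h)
    have e : (liftP X Z).ev s = (block [qOfP .q₀ .c₀ .d₀, .op (.nget .q₁ .k₁ X),
        .op (.nget .q₂ .k₁ Z), .op (.nget .q₃ .k₀ Z), tab .res [.q₀, .q₁, .q₂, .q₃] fun l =>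
          setCode (lift ((fun g => (g, cosetOf (l.getD 2 0) * g * (cosetOf (l.getD 1 0))⁻¹)) ''
              setOf (l.getD 0 0)) ∪
            lift ((fun g => (g * (cosetOf (l.getD 1 0))⁻¹, (cosetOf (l.getD 3 0))⁻¹ * g)) ''
              setOf (l.getD 0 0)) * {coset [.a]})]).ev t := by
      rw [ht]
      simp only [liftP, ev_block_cons, ev_block_nil, ev_op, WOp.eval, WState.setW_w, WState.setW_wa,
        WState.setW_na, x3, x4, x5, x6, z3, z4, z5, if_false, hw, hw', hd.ch₀ w hL,
        hd.ch₁ w hL, hd.ch₀ w' hL', hd.ch₁ w' hL', hd.par w hL, ev_caseN, WState.setN_n, if_true,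
        parity_lt]
      rw [if_neg (by simp [parity, he])]
      simp only [ev_block_cons, ev_block_nil, ev_op, WOp.eval]
    obtain ⟨t₁, e₁⟩ : ∃ t', t' = (qOfP .q₀ .c₀ .d₀).ev t := ⟨_, rfl⟩
    rw [ev_block_cons, ← e₁] at e
    rw [ev_qOfP hM _ (by decide) (by decide) (by decide) (by decide) t0 t2 c0 d0] at e₁
    have u1 : t₁.na .k₁ (t₁.w X) = cosetCode (coset (comp₁ w)) := by
      rw [← hd.k₁ w hL]
      simp [e₁, x1, x2, x3, x4, x5, x6, hw, ht]
    have u2 : t₁.na .k₁ (t₁.w Z) = cosetCode (coset (comp₁ w')) := by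
      rw [← hd.k₁ w' hL']
      simp [e₁, z1, z2, z3, z4, z5, z6, hw', ht]
    have u3 : t₁.na .k₀ (t₁.w Z) = cosetCode (coset (comp₀ w')) := by
      rw [← hd.k₀ w' hL']
      simp [e₁, z1, z2, z3, z4, z5, z6, hw', ht]
    simp only [ev_block_cons, ev_block_nil, ev_op, WOp.eval, WState.setN_w, WState.setN_na, u1, u2,
      u3] at e
    rw [ev_tab _ _ (by simp [e₁, setCode_lt, cosetCode_lt])] at e
    have hq : S.qLift w w' =
        lift ((fun g => (g, coset (comp₁ w') * g * (coset (comp₁ w))⁻¹)) ''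
          S.qOf (child₀ w) (child₀ w')) ∪
        lift ((fun g => (g * (coset (comp₁ w))⁻¹, (coset (comp₀ w'))⁻¹ * g)) ''
          S.qOf (child₀ w) (child₀ w')) * {coset [.a]} := by
      simp only [Table.qLift, child₀, if_neg he, if_neg he']
    rw [e, hq]
    refine ⟨by simp [e₁], ?_, ?_, ?_, ?_⟩
    · simp +contextual [e₁, ht]
    · simp [e₁, ht]
    · simp [e₁, ht]
    · simp [e₁, ht]

end Grigorchuk


namespace Grigorchuk

open RAM
open WProg hiding ev cost

theorem WProg.cost_caseN_le {f : NReg} {m : ℕ} {P : ℕ → WProg} {s : WState} {C : ℕ}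
    (h : ∀ k, (P k).cost s ≤ C) : (caseN f m P).cost s ≤ C + 1 := by
  have := h (s.n f)
  simp only [WProg.cost]
  split_ifs <;> omega

theorem WProg.cost_caseN (f : NReg) (m : ℕ) (P : ℕ → WProg) (s : WState) :
    (caseN f m P).cost s = if s.n f < m then 1 + (P (s.n f)).cost s else 1 := rfl

attribute [local irreducible] WProg.ev WProg.cost

/-- A program that processes words leaves everything else unchanged; it may use the registers
in `T`. -/
structure Frame (T : List WReg) (s t : WState) : Prop where
  w : ∀ x, isTemp x = false → x ∉ T → t.w x = s.w x
  wa : ∀ a, a ≠ .rep → a ≠ .ent → t.wa a = s.wa a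
  na : ∀ a, a ≠ .done → a ≠ .q → a ≠ .entF → t.na a = s.na a
  out : t.out = s.out

theorem Frame.refl (T : List WReg) (s : WState) : Frame T s s :=
  ⟨fun _ _ _ => rfl, fun _ _ _ => rfl, fun _ _ _ _ => rfl, rfl⟩

theorem Frame.trans {T T' : List WReg} {s t t' : WState} (h : Frame T s t) (h' : Frame T' t t')
    (hT : ∀ x ∈ T, x ∈ T') : Frame T' s t' :=
  ⟨fun x hx hx' => (h'.w x hx hx').trans (h.w x hx (mt (hT x) hx')),
    fun a h₁ h₂ => (h'.wa a h₁ h₂).trans (h.wa a h₁ h₂),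
    fun a h₁ h₂ h₃ => (h'.na a h₁ h₂ h₃).trans (h.na a h₁ h₂ h₃), h'.out.trans h.out⟩

theorem Frame.data {T : List WReg} {s t : WState} {L : List Word} (h : Frame T s t)
    (hd : Data L s) : Data L t := by
  constructor
  · rw [h.wa _ (by decide) (by decide)]; exact hd.fwd
  · rw [h.wa _ (by decide) (by decide)]; exact hd.ch₀
  · rw [h.wa _ (by decide) (by decide)]; exact hd.ch₁
  · rw [h.na _ (by decide) (by decide) (by decide)]; exact hd.pre
  · rw [h.na _ (by decide) (by decide) (by decide)]; exact hd.lab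
  · rw [h.na _ (by decide) (by decide) (by decide)]; exact hd.par
  · rw [h.na _ (by decide) (by decide) (by decide)]; exact hd.kap
  · rw [h.na _ (by decide) (by decide) (by decide)]; exact hd.k₀
  · rw [h.na _ (by decide) (by decide) (by decide)]; exact hd.k₁

theorem Frame.setW (s : WState) {x : WReg} (hx : isTemp x = true) (u : Word) :
    Frame [] s (s.setW x u) := by
  refine ⟨fun y hy _ => ?_, fun _ _ _ => rfl, fun _ _ _ _ => rfl, rfl⟩
  rw [WState.setW_w, if_neg]
  rintro rfl
  rw [hx] at hy
  cases hy

theorem Computed.frame {k : ℕ} {s t : WState} (h : Computed k s t) : Frame [] s t :=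
  ⟨fun x hx _ => h.w x (by rintro rfl; cases hx) (by rintro rfl; cases hx)
    (by rintro rfl; cases hx) (by rintro rfl; cases hx) (by rintro rfl; cases hx)
    (by rintro rfl; cases hx), fun a _ _ => by rw [h.wa], fun a _ _ _ => by rw [h.na], h.out⟩

/-- Find the address of the row for the word in `X`. -/
def rowP (X : WReg) : WProg :=
  block [.op (.get .c₀ .ch₀ X), .op (.get .c₁ .ch₁ X), .op (.get .rx .rep .c₀),
    .op (.get .ry .rep .c₁), .op (.nget .par .par X), .caseN .par 2 fun k => if k = 0 then
      block [pairKeyP .v₃ .rx .ry, .op (.nget .ng .entF .v₃), .caseN .ng 1 fun _ =>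
        block [pairKeyP .rz .ry .rx, .op (.nget .nh .entF .rz), .caseN .nh 2 fun k =>
          if k = 0 then .skip else .op (.copy .v₃ .rz)]]
    else singleKeyP .v₃ .rx]

/-- The program tries the pair of representatives in both orders, as the table does. -/
theorem rowP_spec {S : Table} {s : WState} {L : List Word} (h : Models S s) (hd : Data L s)
    {X : WReg} (hX : isTemp X = false) {w : Word} (hw : s.w X = w) (hL : w ∈ L)
    (hc : ∀ c ∈ children w, S.Done c) :
    ((rowP X).ev s).w .v₃ = key (S.rowOf w) ∧
      (∀ x, isTemp x = false → ((rowP X).ev s).w x = s.w x) ∧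
      ((rowP X).ev s).wa = s.wa ∧ ((rowP X).ev s).na = s.na ∧ ((rowP X).ev s).out = s.out := by
  have x3 : X ≠ .c₀ := by rintro rfl; cases hX
  have x4 : X ≠ .c₁ := by rintro rfl; cases hX
  have x1 : X ≠ .rx := by rintro rfl; cases hX
  have x2 : X ≠ .ry := by rintro rfl; cases hX
  have c0 := hc _ (mem_children.2 (.inl rfl))
  have c1 := hc _ (mem_children.2 (.inr rfl))
  have T : ∀ x y, isTemp x = false → isTemp y = true → x ≠ y := by
    rintro x _ h₁ h₂ rfl
    rw [h₁] at h₂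
    cases h₂
  have T₁ : ∀ x, isTemp x = false → x ≠ .rx ∧ x ≠ .ry ∧ x ≠ .rz ∧ x ≠ .c₀ ∧ x ≠ .c₁ ∧ x ≠ .v₃ :=
    fun x hx => ⟨T x _ hx rfl, T x _ hx rfl, T x _ hx rfl, T x _ hx rfl, T x _ hx rfl,
      T x _ hx rfl⟩
  simp only [rowP, ev_block_cons, ev_block_nil, ev_op, WOp.eval, WState.setW_w, WState.setW_wa,
    WState.setW_na, x1, x2, x3, x4, if_false, hw, hd.ch₀ w hL, hd.ch₁ w hL, hd.par w hL, ev_caseN,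
    WState.setN_n, if_true, parity_lt, reduceCtorEq, h.rep c0, h.rep c1]
  by_cases he : EvenA w
  · rw [if_pos (by simp [parity, he])]
    simp only [ev_block_cons, ev_block_nil, ev_pairKeyP, ev_op, WOp.eval, WState.setW_w,
      WState.setN_w, WState.setW_na, WState.setN_na, reduceCtorEq, if_false, if_true, ne_eq,
      not_false_eq_true, ev_caseN, WState.setN_n, h.entF_key, Nat.lt_one_iff]
    have e : S.rowOf w = if S.rows (.pair (S.repD (child₀ w)) (S.repD (child₁ w))) = [] ∧
        S.rows (.pair (S.repD (child₁ w)) (S.repD (child₀ w))) ≠ [] then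
        .pair (S.repD (child₁ w)) (S.repD (child₀ w))
        else .pair (S.repD (child₀ w)) (S.repD (child₁ w)) := by
      simp only [Table.rowOf, child₀, child₁, if_pos he]
    rw [e]
    by_cases h₁ : S.rows (.pair (S.repD (child₀ w)) (S.repD (child₁ w))) = []
    · by_cases h₂ : S.rows (.pair (S.repD (child₁ w)) (S.repD (child₀ w))) = []
      · simp +contextual [h₁, h₂, T₁]
      · simp +contextual [h₁, h₂, T₁, WOp.eval]
    · simp +contextual [h₁, T₁]
  · rw [if_neg (by simp [parity, he])]
    have e : S.rowOf w = .single (S.repD (child₀ w)) := by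
      simp only [Table.rowOf, child₀, if_neg he]
    rw [ev_singleKeyP (by decide), e]
    simp +contextual [T₁]

theorem exists_cost_rowP {X : WReg} (hX : isTemp X = false) : ∃ c, ∀ s, (rowP X).cost s ≤
    c * ((s.wa .rep (s.wa .ch₀ (s.w X))).length + (s.wa .rep (s.wa .ch₁ (s.w X))).length + 1) := by
  have x3 : X ≠ .c₀ := by rintro rfl; cases hX
  obtain ⟨c₁, h₁⟩ := exists_cost_pairKeyP (X := .v₃) (Y := .rx) (Z := .ry) (by decide) (by decide)
  obtain ⟨c₂, h₂⟩ := exists_cost_pairKeyP (X := .rz) (Y := .ry) (Z := .rx) (by decide) (by decide)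
  obtain ⟨c₃, h₃⟩ := exists_cost_singleKeyP (X := .v₃) (Y := .rx) (by decide)
  obtain ⟨c₄, h₄⟩ : ∃ c, ∀ s, (caseN .nh 2 fun k => if k = 0 then WProg.skip else
      .op (.copy .v₃ .rz)).cost s ≤ c :=
    ⟨_, Flat.cost_le fun k => by dsimp only; split_ifs <;> trivial⟩
  refine ⟨c₁ + c₂ + c₃ + c₄ + 13, fun s => ?_⟩
  obtain ⟨t, ht⟩ : ∃ t, t = (block [.op (.get .c₀ .ch₀ X), .op (.get .c₁ .ch₁ X),
    .op (.get .rx .rep .c₀), .op (.get .ry .rep .c₁), .op (.nget .par .par X)]).ev s := ⟨_, rfl⟩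
  simp only [ev_block_cons, ev_block_nil, ev_op] at ht
  simp only [rowP, cost_block_cons, cost_block_nil, cost_op, ev_op]
  rw [← ht]
  set N := (s.wa .rep (s.wa .ch₀ (s.w X))).length + (s.wa .rep (s.wa .ch₁ (s.w X))).length + 1
    with hN
  have e : (t.w .rx).length + (t.w .ry).length + 1 = N := by
    simp [ht, WOp.eval, x3, hN]
  have l₁ := h₁ t
  have l₃ := h₃ t
  have l₃' : c₃ * ((t.w .rx).length + 1) ≤ c₃ * N := Nat.mul_le_mul_left _ (by omega)
  rw [e] at l₁
  have hn : 1 ≤ N := Nat.le_add_left _ _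
  have hc₄ : c₄ ≤ c₄ * N := Nat.le_mul_of_pos_right _ hn
  have main : (caseN .par 2 fun k => if k = 0 then
      block [pairKeyP .v₃ .rx .ry, .op (.nget .ng .entF .v₃), .caseN .ng 1 fun _ =>
        block [pairKeyP .rz .ry .rx, .op (.nget .nh .entF .rz), .caseN .nh 2 fun k =>
          if k = 0 then .skip else .op (.copy .v₃ .rz)]]
    else singleKeyP .v₃ .rx).cost t ≤ (c₁ * N + c₂ * N + c₃ * N + c₄ * N + 6) + 1 := by
    refine cost_caseN_le fun k => ?_
    split_ifs
    · simp only [cost_block_cons, cost_block_nil, cost_op, ev_op, WOp.eval]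
      rw [ev_pairKeyP (by decide) (by decide)]
      have : (caseN .ng 1 fun _ =>
        block [pairKeyP .rz .ry .rx, .op (.nget .nh .entF .rz), .caseN .nh 2 fun k =>
          if k = 0 then .skip else .op (.copy .v₃ .rz)]).cost
          (((t.setW .v₃ (key (.pair (t.w .rx) (t.w .ry)))).setN .ng ((t.setW .v₃ (key (.pair
          (t.w .rx) (t.w .ry)))).na .entF ((t.setW .v₃ (key (.pair
          (t.w .rx) (t.w .ry)))).w .v₃)))) ≤ (c₂ * N + 1 + c₄ + 1) + 1 := by
        refine cost_caseN_le fun _ => ?_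
        simp only [cost_block_cons, cost_block_nil, cost_op, ev_op]
        refine (Nat.add_le_add (h₂ _) (Nat.add_le_add_left (Nat.add_le_add_right (h₄ _) _) _)).trans
          ?_
        simp only [WState.setN_w, WState.setW_w, reduceCtorEq, if_false]
        rw [← e, Nat.add_comm (t.w .ry).length]
        omega
      refine (Nat.add_le_add l₁ (Nat.add_le_add_left (Nat.add_le_add_right this _) _)).trans ?_
      linarith only [hc₄, Nat.zero_le (c₃ * N)]
    · linarith only [l₃, l₃', Nat.zero_le (c₁ * N), Nat.zero_le (c₂ * N), Nat.zero_le (c₄ * N)]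
  simp only [Nat.add_mul]
  linarith only [main, hn]

theorem Table.step_of_find_eq_some {S : Table} {w r : Word} {l l' : List Word}
    (h : S.rows (S.rowOf w) = l ++ r :: l') (hl : ∀ x ∈ l, ¬ (S.qLift w x).Nonempty)
    (hr : (S.qLift w r).Nonempty) : S.step w = { S with
      rep := Function.update S.rep w (some r)
      q := Function.update S.q w (S.qLift w r) } := by
  classical
  have : (S.rows (S.rowOf w)).find? (fun w' => decide (S.qLift w w').Nonempty) = some r := by
    rw [List.find?_eq_some_iff_append]
    exact ⟨by simpa using hr, l, l', h, fun x hx => by simpa using hl x hx⟩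
  unfold Table.step
  split
  · rename_i w' h'
    have e : some w' = some r := by rw [← this, ← h']
    rw [Option.some_inj.1 e]
  · rename_i h'
    have e : none = some r := by rw [← this, ← h']
    cases e

theorem Table.step_of_find_eq_none {S : Table} {w : Word}
    (h : ∀ x ∈ S.rows (S.rowOf w), ¬ (S.qLift w x).Nonempty) : S.step w =
      { rep := Function.update S.rep w (some w)
        q := Function.update S.q w (S.qLift w w)
        rows := Function.update S.rows (S.rowOf w) (S.rows (S.rowOf w) ++ [w]) } := by
  classical
  have : (S.rows (S.rowOf w)).find? (fun w' => decide (S.qLift w w').Nonempty) = none := by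
    rw [List.find?_eq_none]
    exact fun x hx => by simpa using h x hx
  unfold Table.step
  split
  · rename_i w' h'
    have e : some w' = none := by rw [← this, ← h']
    cases e
  · rfl

/-- Record that the word in `X` has the representative in `Z` and the set in `res`. -/
def foundP (X Z : WReg) : WProg :=
  block [.op (.nput .q X .res), .op (.const .ng 1), .op (.nput .done X .ng), .op (.put .rep X Z)]

/-- Make the word in `X` a new representative. -/
noncomputable def newP (X : WReg) : WProg :=
  block [liftP X X, foundP X X, .op (.put .ent .v₃ X), .op (.nput .entF .v₃ .ng)]

/-- Look for the representative of the word in `X` in its row, from the entry with the address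
`v₃` on. -/
noncomputable def scanP (X : WReg) : ℕ → WProg
  | 0 => .skip
  | m + 1 => block [.op (.nget .ng .entF .v₃), .caseN .ng 2 fun k => if k = 0 then newP X else
      block [.op (.get .rs .ent .v₃), liftP X .rs, .caseN .res codeBound fun k =>
        if k = setCode ∅ then block [.op (.push .v₃ .a), scanP X m] else foundP X .rs]]

theorem flat_scanP (X : WReg) (m : ℕ) : (scanP X m).Flat := by
  have hf : ∀ Z, (foundP X Z).Flat := fun _ => ⟨trivial, trivial, trivial, trivial, trivial⟩
  induction m with
  | zero => trivial
  | succ m ih =>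
    refine ⟨trivial, fun k => ?_, trivial⟩
    dsimp only
    split_ifs
    · exact ⟨flat_liftP _ _, hf _, trivial, trivial, trivial⟩
    · refine ⟨trivial, flat_liftP _ _, fun k => ?_, trivial⟩
      dsimp only
      split_ifs
      · exact ⟨trivial, ih, trivial⟩
      · exact hf _

theorem foundP_spec {S : Table} {s t : WState} (h : Models S s) (hst : s.wa = t.wa ∧ s.na = t.na)
    {X Z : WReg} {w r : Word} (hX : t.w X = w) (hZ : t.w Z = r) {q : Set (Γ ⧸ K)}
    (hq : t.n .res = setCode q) : Models { S with
      rep := Function.update S.rep w (some r)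
      q := Function.update S.q w q } ((foundP X Z).ev t) := by
  have h' : Models S t := h.congr hst.1.symm hst.2.symm
  have e : (foundP X Z).ev t =
      (((t.putN .q w (setCode q)).setN .ng 1).putN .done w 1).putW .rep w r := by
    simp [foundP, WOp.eval, hX, hZ, hq]
  rw [e]
  constructor
  · intro x
    by_cases hx : x = w <;> simp [hx, h'.done]
  · intro x hx
    by_cases hxw : x = w
    · simp [hxw, Table.repD]
    · have : S.Done x := by simpa [Table.Done, hxw] using hx
      simp [hxw, Table.repD, h'.rep this]
  · intro x hx
    by_cases hxw : x = w
    · simp [hxw]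
    · have : S.Done x := by simpa [Table.Done, hxw] using hx
      simp [hxw, h'.q this]
  · intro ℓ i hi
    simpa using h'.ent ℓ i hi
  · intro ℓ i
    simpa using h'.entF ℓ i

theorem foundP_frame (X Z : WReg) (t : WState) : Frame [] t ((foundP X Z).ev t) ∧
    ((foundP X Z).ev t).w = t.w := by
  refine ⟨⟨?_, ?_, ?_, ?_⟩, ?_⟩
  · simp [foundP, WOp.eval]
  · intro a h₁ h₂
    simp [foundP, WOp.eval, h₁]
  · intro a h₁ h₂ h₃
    simp [foundP, WOp.eval, h₁, h₂]
  · simp [foundP, WOp.eval]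
  · simp [foundP, WOp.eval]

/-- The first `i` entries of the row have been tried without success. As fewer than `m` entries
are left, the unrolled loop comes to the end of the row. -/
theorem scanP_spec {S : Table} {L : List Word} {X : WReg} (hX : isTemp X = false) {w : Word}
    (hL : w ∈ L) (hc : ∀ c ∈ children w, S.Done c)
    (hr : ∀ r ∈ S.rows (S.rowOf w), r ∈ L ∧ (EvenA w ↔ EvenA r) ∧ ∀ c ∈ children r, S.Done c)
    {m i : ℕ} (hi : (S.rows (S.rowOf w)).length < i + m) {s : WState} (h : Models S s)
    (hd : Data L s) (hw : s.w X = w) (hv : s.w .v₃ = num i ++ key (S.rowOf w))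
    (hs : ∀ x ∈ (S.rows (S.rowOf w)).take i, ¬ (S.qLift w x).Nonempty)
    (hi' : i ≤ (S.rows (S.rowOf w)).length) :
    Models (S.step w) ((scanP X m).ev s) ∧ Frame [] s ((scanP X m).ev s) := by
  induction m generalizing i s with
  | zero => omega
  | succ m ih =>
    obtain ⟨s', hs'⟩ : ∃ s', s' = s.setN .ng (if i < (S.rows (S.rowOf w)).length then 1 else 0) :=
      ⟨_, rfl⟩
    have h' : Models S s' := h.congr (by simp [hs']) (by simp [hs'])
    have f₁ : Frame [] s s' := ⟨by simp [hs'], by simp [hs'], by simp [hs'], by simp [hs']⟩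
    have hw' : s'.w X = w := by simp [hs', hw]
    have hv' : s'.w .v₃ = num i ++ key (S.rowOf w) := by simp [hs', hv]
    have hng : s'.n .ng = if i < (S.rows (S.rowOf w)).length then 1 else 0 := by simp [hs']
    have e : (scanP X (m + 1)).ev s = if s'.n .ng < 2 then
        (if s'.n .ng = 0 then newP X else
      block [.op (.get .rs .ent .v₃), liftP X .rs, .caseN .res codeBound fun k =>
        if k = setCode ∅ then block [.op (.push .v₃ .a), scanP X m] else foundP X .rs]).ev s'
        else s' := by
      rw [scanP, ev_block_cons, ev_op, WOp.eval, hv, h.entF, ← hs', ev_block_cons, ev_block_nil, ev_caseN]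
    rw [e, if_pos (by rw [hng]; split_ifs <;> omega)]
    have tX : X ≠ .rx ∧ X ≠ .ry ∧ X ≠ .c₀ ∧ X ≠ .c₁ ∧ X ≠ .d₀ ∧ X ≠ .d₁ ∧ X ≠ .rs ∧ X ≠ .v₃ := by
      refine ⟨?_, ?_, ?_, ?_, ?_, ?_, ?_, ?_⟩ <;> rintro rfl <;> cases hX
    by_cases hil : i < (S.rows (S.rowOf w)).length
    · rw [if_neg (by rw [hng, if_pos hil]; decide)]
      obtain ⟨r, hrow⟩ : ∃ r, r = (S.rows (S.rowOf w))[i] := ⟨_, rfl⟩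
      have hr' := hr r (hrow ▸ List.getElem_mem hil)
      have eget : (WOp.get .rs .ent .v₃).eval s' = s'.setW .rs r := by
        rw [WOp.eval, hv', h'.ent _ _ hil, hrow]
      rw [ev_block_cons, ev_op, eget, ev_block_cons]
      have hC := liftP_spec (s := s'.setW .rs r) (L := L) (X := X) (Z := .rs) (w := w) (w' := r)
        (h'.congr rfl rfl) ((f₁.data hd).congr (fun _ _ _ => rfl) rfl) (.inr hX) (.inl rfl)
        (by simp [hw', tX]) (by simp) hL hr'.1 hr'.2.1 hc hr'.2.2
      obtain ⟨t, ht⟩ : ∃ t, t = (liftP X .rs).ev (s'.setW .rs r) := ⟨_, rfl⟩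
      rw [← ht] at hC ⊢
      have f₂ : Frame [] s' (s'.setW .rs r) := .setW _ rfl _
      have f₃ : Frame [] s t := (f₁.trans f₂ (by simp)).trans hC.frame (by simp)
      have hwt : t.w X = w := by rw [f₃.w X hX (by simp), hw]
      have hvt : t.w .v₃ = num i ++ key (S.rowOf w) := by
        rw [hC.w _ (by decide) (by decide) (by decide) (by decide) (by decide) (by decide),
          WState.setW_w, if_neg (by decide), hv']
      have hrt : t.w .rs = r := by
        rw [hC.w _ (by decide) (by decide) (by decide) (by decide) (by decide) (by decide)]
        simp
      have hMt : Models S t := h'.congr (by rw [hC.wa]; rfl) (by rw [hC.na]; rfl)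
      rw [ev_block_cons, ev_block_nil, ev_caseN, if_pos (by rw [hC.res]; exact setCode_lt _)]
      by_cases hq : (S.qLift w r).Nonempty
      · rw [if_neg (by rw [hC.res]; exact fun e => hq.ne_empty (setCode_injective e))]
        rw [Table.step_of_find_eq_some (l := (S.rows (S.rowOf w)).take i) (r := r)
          (l' := (S.rows (S.rowOf w)).drop (i + 1))
          (by rw [hrow, List.cons_getElem_drop_succ, List.take_append_drop]) hs hq]
        exact ⟨foundP_spec hMt ⟨rfl, rfl⟩ hwt hrt hC.res, f₃.trans (foundP_frame _ _ _).1 (by simp)⟩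
      · rw [if_pos (by rw [hC.res, Set.not_nonempty_iff_eq_empty.1 hq])]
        rw [ev_block_cons, ev_op, WOp.eval, hvt, ev_block_cons, ev_block_nil]
        have f₄ : Frame [] t (t.setW .v₃ (.a :: (num i ++ key (S.rowOf w)))) :=
          .setW _ rfl _
        have f₅ := f₃.trans f₄ (by simp)
        obtain ⟨a₁, a₂⟩ := ih (i := i + 1) (by omega)
          (s := t.setW .v₃ (.a :: (num i ++ key (S.rowOf w)))) (hMt.congr rfl rfl) (f₅.data hd)
          (by rw [f₅.w X hX (by simp), hw])
          (by simp [num_succ]) (by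
            intro x hx
            rw [List.take_succ_eq_append_getElem hil, List.mem_append, List.mem_singleton] at hx
            rcases hx with hx | rfl
            · exact hs x hx
            · rwa [← hrow]) hil
        exact ⟨a₁, f₅.trans a₂ (by simp)⟩
    · rw [if_pos (by rw [hng, if_neg hil])]
      have hil' : (S.rows (S.rowOf w)).length = i := by omega
      rw [List.take_of_length_le hil'.le] at hs
      have hC := liftP_spec (s := s') (L := L) (X := X) (Z := X) (w := w) (w' := w)
        h' (f₁.data hd) (.inr hX) (.inr hX) hw' hw' hL hL Iff.rfl hc hc
      obtain ⟨t, ht⟩ : ∃ t, t = (liftP X X).ev s' := ⟨_, rfl⟩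
      rw [← ht] at hC
      have f₃ : Frame [] s t := f₁.trans hC.frame (by simp)
      have hwt : t.w X = w := by rw [f₃.w X hX (by simp), hw]
      have hvt : t.w .v₃ = num i ++ key (S.rowOf w) := by
        rw [hC.w _ (by decide) (by decide) (by decide) (by decide) (by decide) (by decide), hv']
      have hMt : Models S t := h'.congr hC.wa hC.na
      have hF := foundP_spec hMt ⟨rfl, rfl⟩ hwt hwt hC.res
      obtain ⟨f₄, hw₄⟩ := foundP_frame X X t
      have hn₄ : ((foundP X X).ev t).n .ng = 1 := by simp [foundP, WOp.eval]
      obtain ⟨t', ht'⟩ : ∃ t', t' = (foundP X X).ev t := ⟨_, rfl⟩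
      rw [← ht'] at hF f₄ hw₄ hn₄
      have e : (newP X).ev s' = (t'.putW .ent (num i ++ key (S.rowOf w)) w).putN .entF
          (num i ++ key (S.rowOf w)) 1 := by
        simp only [newP, ev_block_cons, ev_block_nil, ev_op]
        rw [← ht, ← ht']
        simp [WOp.eval, hw₄, hvt, hwt, hn₄]
      rw [e, Table.step_of_find_eq_none hs]
      refine ⟨⟨?_, ?_, ?_, ?_, ?_⟩, ?_⟩
      · intro x
        simpa using hF.done x
      · intro x hx
        simpa [Table.repD] using hF.rep hx
      · intro x hx
        simpa using hF.q hx
      · intro ℓ j hj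
        simp only [WState.putN_wa, WState.putW_wa_self, num_key_inj]
        by_cases hℓ : ℓ = S.rowOf w
        · subst hℓ
          simp only [Function.update_self, List.length_append, List.length_singleton] at hj ⊢
          by_cases hj' : j = i
          · rw [if_pos ⟨hj', trivial⟩, List.getElem_append_right (by omega)]
            simp
          · rw [if_neg (fun h => hj' h.1), List.getElem_append_left (by omega)]
            exact hF.ent _ _ (by dsimp only; omega)
        · rw [if_neg (fun h => hℓ h.2)]
          simp only [Function.update_of_ne hℓ] at hj ⊢
          exact hF.ent _ _ hj
      · intro ℓ j
        simp only [WState.putN_na_self, WState.putW_na, num_key_inj]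
        rw [hF.entF]
        by_cases hℓ : ℓ = S.rowOf w
        · subst hℓ
          simp only [Function.update_self, List.length_append, List.length_singleton, and_true]
          split_ifs <;> omega
        · simp only [hℓ, and_false, if_false, Function.update_of_ne hℓ]
      · refine f₃.trans (f₄.trans ⟨by simp, ?_, ?_, by simp⟩ (by simp)) (by simp)
        · intro a _ h₂
          simp [h₂]
        · intro a _ _ h₃
          simp [h₃]

/-! ### Visiting a word -/

/-- Run `p` if the word in `x` has not been processed. -/
def onceP (x : WReg) (p : WProg) : WProg :=
  block [.op (.nget .ng .done x), .caseN .ng 1 fun _ => p]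

theorem onceP_of_done {S : Table} {s : WState} (h : Models S s) {x : WReg}
    (hd : S.Done (s.w x)) (p : WProg) :
    (onceP x p).ev s = s.setN .ng 1 ∧ (onceP x p).cost s ≤ 3 := by
  have e : s.na .done (s.w x) = 1 := (h.done _).trans (if_pos hd)
  simp [onceP, WOp.eval, e, cost_caseN]

theorem onceP_of_not_done {S : Table} {s : WState} (h : Models S s) {x : WReg}
    (hd : ¬ S.Done (s.w x)) (p : WProg) : (onceP x p).ev s = p.ev (s.setN .ng 0) ∧
      (onceP x p).cost s = p.cost (s.setN .ng 0) + 3 := by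
  have e : s.na .done (s.w x) = 0 := (h.done _).trans (if_neg hd)
  simp only [onceP, ev_block_cons, ev_block_nil, ev_op, WOp.eval, e, ev_caseN, WState.setN_n,
    if_true, Nat.lt_one_iff, cost_block_cons, cost_block_nil, cost_op, cost_caseN, true_and]
  omega

/-- Process the word in `x`, after its children. The registers `ys` hold the words that wait. -/
noncomputable def visitP : List WReg → WReg → WProg
  | [], x => onceP x (block [rowP x, scanP x (rowBound + 1)])
  | y :: ys, x => onceP x (block [.op (.get y .ch₀ x), visitP ys y, .op (.get y .ch₁ x),
      visitP ys y, block [rowP x, scanP x (rowBound + 1)]])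

/-- `L` consists of reduced words and is closed under splitting. -/
structure SplitClosed (L : List Word) : Prop where
  reduced : ∀ w ∈ L, Reduced w
  children : ∀ w ∈ L, ∀ c ∈ children w, c ∈ L

theorem stepP_spec {x : WReg} (hx : isTemp x = false) : ∃ c, ∀ {L : List Word} {m : ℕ} {S : Table}
    {s : WState} {w : Word}, SplitClosed L → Models S s → Data L s → Stage (· ∈ L) m S → w ∈ L →
    s.w x = w → (∀ c ∈ children w, S.Done c) →
    Models (S.step w) ((block [rowP x, scanP x (rowBound + 1)]).ev s) ∧
      Frame [] s ((block [rowP x, scanP x (rowBound + 1)]).ev s) ∧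
      (block [rowP x, scanP x (rowBound + 1)]).cost s ≤ c * (w.length + 1) := by
  obtain ⟨c, hc⟩ := exists_cost_rowP hx
  refine ⟨2 * c + (scanP x (rowBound + 1)).maxCost + 1, ?_⟩
  intro L m S s w hcl h hd hS hL hw hch
  obtain ⟨r₁, r₂, r₃, r₄, r₅⟩ := rowP_spec h hd hx hw hL hch
  have f : Frame [] s ((rowP x).ev s) :=
    ⟨fun y hy _ => r₂ y hy, fun _ _ _ => by rw [r₃], fun _ _ _ _ => by rw [r₄], r₅⟩
  have hrow : ∀ r ∈ S.rows (S.rowOf w),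
      r ∈ L ∧ (EvenA w ↔ EvenA r) ∧ ∀ c ∈ children r, S.Done c := by
    intro r hr
    obtain ⟨h₁, h₂⟩ := hS.good.row_spec hr
    exact ⟨hS.sub r (Table.done_of_rep h₁), (S.labelled_rowOf w).evenA_iff h₂,
      hS.good.children_done (Table.done_of_rep h₁)⟩
  have hlen := hS.good.length_row_le (S.rowOf w)
  obtain ⟨a₁, a₂⟩ := scanP_spec hx hL hch hrow (m := rowBound + 1) (i := 0) (by omega)
    (h.congr r₃ r₄) (f.data hd) ((r₂ x hx).trans hw) r₁ (by simp) (Nat.zero_le _)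
  simp only [ev_block_cons, ev_block_nil]
  refine ⟨a₁, f.trans a₂ (by simp), ?_⟩
  simp only [cost_block_cons, cost_block_nil]
  have l₁ := hc s
  have l₂ := (flat_scanP x (rowBound + 1)).cost_le ((rowP x).ev s)
  have hle : ∀ v ∈ children w, (S.repD v).length ≤ w.length := fun v hv =>
    (hS.good.rep_spec (hch v hv).rep_eq).2.2.2.trans ((hcl.reduced w hL).length_child_le hv)
  have m₀ := mem_children.2 (.inl rfl : child₀ w = child₀ w ∨ child₀ w = child₁ w)
  have m₁ := mem_children.2 (.inr rfl : child₁ w = child₀ w ∨ child₁ w = child₁ w)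
  have k₀ := hle _ m₀
  have k₁ := hle _ m₁
  rw [hw, hd.ch₀ w hL, hd.ch₁ w hL, h.rep (hch _ m₀), h.rep (hch _ m₁)] at l₁
  have l₃ : c * ((S.repD (child₀ w)).length + (S.repD (child₁ w)).length + 1) ≤
      c * (2 * (w.length + 1)) := Nat.mul_le_mul_left _ (by omega)
  have l₄ : (scanP x (rowBound + 1)).maxCost ≤
      (scanP x (rowBound + 1)).maxCost * (w.length + 1) := Nat.le_mul_of_pos_right _ (by omega)
  have l₅ : c * (2 * (w.length + 1)) = 2 * c * (w.length + 1) := by ring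
  rw [Nat.add_mul, Nat.add_mul]
  linarith only [l₁, l₂, l₃, l₄, l₅, Nat.zero_le w.length]

theorem visit_succ {S : Table} {w : Word} (h : ¬ S.Done w) (n : ℕ) : Table.visit (n + 1) w S =
    ((children w).foldl (fun S' x => Table.visit n x S') S).step w :=
  if_neg h

theorem Frame.setN (T : List WReg) (s : WState) (f : NReg) (k : ℕ) : Frame T s (s.setN f k) :=
  ⟨fun _ _ _ => rfl, fun _ _ _ => rfl, fun _ _ _ _ => rfl, rfl⟩

/-- The recursion of depth `ys.length + 1` needs a register for each level. Each of its calls takes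
time proportional to the length of the representatives of the children, which are not longer than
`w`. -/
theorem visitP_spec (ys : List WReg) : ∀ x : WReg, (x :: ys).Nodup →
    (∀ y ∈ x :: ys, isTemp y = false) → ∃ c, ∀ {L : List Word} {m d : ℕ} {S : Table}
    {s : WState} {w : Word}, SplitClosed L → Models S s → Data L s → Stage (· ∈ L) m S → w ∈ L →
    s.w x = w → Depth m d w → d ≤ ys.length + 1 →
    Models (Table.visit (ys.length + 1) w S) ((visitP ys x).ev s) ∧
      Frame ys s ((visitP ys x).ev s) ∧ (visitP ys x).cost s ≤ c * (w.length + 1) := by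
  induction ys with
  | nil =>
    intro x _ hx
    obtain ⟨c, hc⟩ := stepP_spec (hx x (by simp))
    refine ⟨c + 3, ?_⟩
    intro L m d S s w hcl h hd hS hL hw hm hdn
    rw [Nat.add_mul]
    by_cases hdone : S.Done w
    · obtain ⟨e₁, e₂⟩ := onceP_of_done h (x := x) (by rwa [hw])
        (block [rowP x, scanP x (rowBound + 1)])
      rw [Table.visit_of_done hdone, visitP, e₁]
      refine ⟨h.congr rfl rfl, .setN _ _ _ _, e₂.trans ?_⟩
      linarith only [Nat.zero_le (c * (w.length + 1)), Nat.zero_le w.length]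
    · obtain ⟨e₁, e₂⟩ := onceP_of_not_done h (x := x) (by rwa [hw])
        (block [rowP x, scanP x (rowBound + 1)])
      have hch : ∀ c ∈ children w, S.Done c := by
        have hsh : ∀ v ∈ L, v.length < m ∨ v.length ≤ 1 → S.Done v := fun v hv hvm =>
          hvm.elim (hS.short v hv) (hS.small v)
        match d, hdn, hm with
        | 0, _, hm => exact absurd (hsh w hL hm) hdone
        | 1, _, .inl hm => exact absurd (hsh w hL hm) hdone
        | 1, _, .inr ⟨_, hm⟩ => exact fun c hc => hsh c (hcl.children w hL c hc) (hm c hc)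
      have f := Frame.setN [] s .ng 0
      obtain ⟨a₁, a₂, a₃⟩ := hc (s := s.setN .ng 0) hcl (h.congr rfl rfl) (f.data hd) hS hL
        hw hch
      rw [visitP, e₁, e₂, List.length_nil, visit_succ hdone]
      refine ⟨?_, f.trans a₂ (by simp), ?_⟩
      · convert a₁ using 2
        generalize children w = l
        induction l with
        | nil => rfl
        | cons _ _ ih => exact ih
      · linarith only [a₃, Nat.zero_le w.length]
  | cons y ys ih =>
    intro x hn hx
    obtain ⟨c, hc⟩ := stepP_spec (hx x (by simp))
    obtain ⟨hxy, hn'⟩ := List.nodup_cons.1 hn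
    obtain ⟨c', hc'⟩ := ih y hn' fun z hz => hx z (by simp at hz ⊢; tauto)
    refine ⟨c + 2 * c' + 6, ?_⟩
    intro L m d S s w hcl h hd hS hL hw hm hdn
    have hx' := hx x (by simp)
    have hp₁ := Nat.zero_le (c * (w.length + 1))
    have hp₂ := Nat.zero_le (c' * (w.length + 1))
    have hp₃ := Nat.zero_le w.length
    by_cases hdone : S.Done w
    · obtain ⟨e₁, e₂⟩ := onceP_of_done h (x := x) (by rwa [hw])
        (block [.op (.get y .ch₀ x), visitP ys y, .op (.get y .ch₁ x),
          visitP ys y, block [rowP x, scanP x (rowBound + 1)]])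
      rw [Table.visit_of_done hdone, visitP, e₁]
      refine ⟨h.congr rfl rfl, .setN _ _ _ _, e₂.trans ?_⟩
      simp only [Nat.add_mul, Nat.mul_assoc]
      linarith only [hp₁, hp₂, hp₃]
    obtain ⟨e₁, e₂⟩ := onceP_of_not_done h (x := x) (by rwa [hw])
      (block [.op (.get y .ch₀ x), visitP ys y, .op (.get y .ch₁ x),
        visitP ys y, block [rowP x, scanP x (rowBound + 1)]])
    obtain ⟨d, hdn, hm⟩ : ∃ d', d' ≤ ys.length + 1 ∧ ∀ c ∈ children w, Depth m d' c := by
      have hsh : ¬ (w.length < m ∨ w.length ≤ 1) := fun hwm =>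
        hdone (hwm.elim (hS.short w hL) (hS.small w))
      match d, hdn, hm with
      | 0, _, hm => exact absurd hm hsh
      | d + 1, hdn, .inl hm => exact absurd hm hsh
      | d + 1, hdn, .inr ⟨_, hm⟩ => exact ⟨d, Nat.le_of_succ_le_succ hdn, hm⟩
    have m₀ := mem_children.2 (.inl rfl : child₀ w = child₀ w ∨ child₀ w = child₁ w)
    have m₁ := mem_children.2 (.inr rfl : child₁ w = child₀ w ∨ child₁ w = child₁ w)
    have L₀ := hcl.children w hL _ m₀
    have L₁ := hcl.children w hL _ m₁
    obtain ⟨S₁, hS₁⟩ : ∃ S', S' = Table.visit (ys.length + 1) (child₀ w) S := ⟨_, rfl⟩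
    obtain ⟨S₂, hS₂⟩ : ∃ S', S' = Table.visit (ys.length + 1) (child₁ w) S₁ := ⟨_, rfl⟩
    have g₁ := hS.visit hcl.children hdn L₀ (hm _ m₀)
    rw [← hS₁] at g₁
    have g₂ := g₁.1.visit hcl.children hdn L₁ (hm _ m₁)
    rw [← hS₂] at g₂
    have efold : (children w).foldl (fun S' x => Table.visit (ys.length + 1) x S') S = S₂ := by
      by_cases he : EvenA w
      · simp only [children_even he, List.foldl_cons, List.foldl_nil, hS₂, hS₁, child₀, child₁,
          if_pos he]
      · have e : child₁ w = child₀ w := by simp only [child₀, child₁, if_neg he]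
        rw [hS₂, e, Table.visit_of_done g₁.2.1, hS₁]
        simp only [children_odd he, List.foldl_cons, List.foldl_nil, child₀, if_neg he]
    -- The states after each part of the program.
    obtain ⟨s₁, hs₁⟩ : ∃ t, t = (s.setN .ng 0).setW y (child₀ w) := ⟨_, rfl⟩
    obtain ⟨s₂, hs₂⟩ : ∃ t, t = (visitP ys y).ev s₁ := ⟨_, rfl⟩
    obtain ⟨s₃, hs₃⟩ : ∃ t, t = s₂.setW y (child₁ w) := ⟨_, rfl⟩
    obtain ⟨s₄, hs₄⟩ : ∃ t, t = (visitP ys y).ev s₃ := ⟨_, rfl⟩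
    have fset : ∀ (t : WState) u, Frame (y :: ys) t (t.setW y u) := fun t u =>
      ⟨fun z _ hz => by rw [WState.setW_w, if_neg]; rintro rfl; simp at hz, fun _ _ _ => rfl,
        fun _ _ _ _ => rfl, rfl⟩
    have f₁ : Frame (y :: ys) s s₁ :=
      (Frame.setN (y :: ys) s .ng 0).trans (hs₁ ▸ fset _ _) fun _ => id
    obtain ⟨a₁, a₂, a₃⟩ := hc' hcl (h.congr (by rw [hs₁]; rfl) (by rw [hs₁]; rfl)) (f₁.data hd) hS
      L₀ (by simp [hs₁]) (hm _ m₀) hdn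
    rw [← hs₂] at a₁ a₂
    rw [← hS₁] at a₁
    have f₂ : Frame (y :: ys) s s₂ := f₁.trans ⟨fun z hz hz' => a₂.w z hz (by simp at hz'; tauto),
      a₂.wa, a₂.na, a₂.out⟩ fun _ => id
    have f₃ : Frame (y :: ys) s s₃ := f₂.trans (hs₃ ▸ fset _ _) fun _ => id
    obtain ⟨b₁, b₂, b₃⟩ := hc' hcl (a₁.congr (by rw [hs₃]; rfl) (by rw [hs₃]; rfl)) (f₃.data hd)
      g₁.1 L₁ (by simp [hs₃]) (hm _ m₁) hdn
    rw [← hs₄] at b₁ b₂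
    rw [← hS₂] at b₁
    have f₄ : Frame (y :: ys) s s₄ := f₃.trans ⟨fun z hz hz' => b₂.w z hz (by simp at hz'; tauto),
      b₂.wa, b₂.na, b₂.out⟩ fun _ => id
    have hdone₂ : ∀ c ∈ children w, S₂.Done c := by
      intro c hc
      rcases mem_children.1 hc with rfl | rfl
      · exact g₂.2.2.done g₁.2.1
      · exact g₂.2.1
    obtain ⟨z₁, z₂, z₃⟩ := hc hcl b₁ (f₄.data hd) g₂.1 hL ((f₄.w x hx' hxy).trans hw) hdone₂
    have es₁ : (WOp.get y .ch₀ x).eval (s.setN .ng 0) = s₁ := by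
      rw [WOp.eval, hs₁, WState.setN_wa, WState.setN_w, hw, hd.ch₀ w hL]
    have es₃ : (WOp.get y .ch₁ x).eval s₂ = s₃ := by
      rw [WOp.eval, hs₃, f₂.w x hx' hxy, hw, (f₂.data hd).ch₁ w hL]
    rw [visitP, e₁, e₂, List.length_cons, visit_succ hdone, efold]
    simp only [ev_block_cons (.op _), ev_block_cons (visitP _ _), ev_op, es₁, ← hs₂, es₃, ← hs₄,
      cost_block_cons (.op _), cost_block_cons (visitP _ _), cost_op]
    rw [ev_block_cons, ev_block_nil, cost_block_cons (block _), cost_block_nil]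
    refine ⟨z₁, f₄.trans ⟨fun z hz _ => z₂.w z hz (by simp), z₂.wa, z₂.na, z₂.out⟩ fun _ => id, ?_⟩
    have k₀ : c' * ((child₀ w).length + 1) ≤ c' * (w.length + 1) := Nat.mul_le_mul_left _
      (Nat.add_le_add_right ((hcl.reduced w hL).length_child_le m₀) 1)
    have k₁ : c' * ((child₁ w).length + 1) ≤ c' * (w.length + 1) := Nat.mul_le_mul_left _
      (Nat.add_le_add_right ((hcl.reduced w hL).length_child_le m₁) 1)
    simp only [Nat.add_mul, Nat.mul_assoc 2]
    linarith only [a₃, b₃, z₃, k₀, k₁, hp₃]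

end Grigorchuk


namespace Grigorchuk

open RAM
open WProg hiding ev cost

attribute [local irreducible] WProg.ev WProg.cost

/-! ### The initial table -/

/-- Load a fixed word. -/
def wordP (X : WReg) : Word → WProg
  | [] => .op (.nil X)
  | ℓ :: u => .seq (wordP X u) (.op (.push X ℓ))

theorem ev_wordP (X : WReg) (u : Word) (s : WState) : (wordP X u).ev s = s.setW X u := by
  induction u with
  | nil => rw [wordP, ev_op, WOp.eval]
  | cons ℓ u ih => simp [wordP, ih, WOp.eval]

theorem flat_wordP (X : WReg) (u : Word) : (wordP X u).Flat := by
  induction u with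
  | nil => trivial
  | cons ℓ u ih => exact ⟨ih, trivial⟩

/-- Enter a word that represents itself. -/
noncomputable def entryP (e : RowLabel × Word) : WProg :=
  block [wordP .rx e.2, wordP .ry (key e.1), .op (.const .ng 1), .op (.nput .done .rx .ng),
    .op (.put .rep .rx .rx), .op (.const .nh (setCode (Q (Grigorchuk.ev e.2) (Grigorchuk.ev e.2)))),
    .op (.nput .q .rx .nh), .op (.put .ent .ry .rx), .op (.nput .entF .ry .ng)]

/-- Enter several words that represent themselves. -/
noncomputable def entriesP : List (RowLabel × Word) → WProg
  | [] => .skip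
  | e :: l => .seq (entriesP l) (entryP e)

theorem flat_entriesP (l : List (RowLabel × Word)) : (entriesP l).Flat := by
  induction l with
  | nil => trivial
  | cons e l ih =>
    exact ⟨ih, flat_wordP _ _, flat_wordP _ _, trivial, trivial, trivial, trivial, trivial, trivial,
      trivial, trivial⟩

theorem entriesP_spec {s : WState} (h : Fresh s) {l : List (RowLabel × Word)}
    (hl : (l.map Prod.fst).Nodup) :
    (∀ x, ((entriesP l).ev s).na .done x = if x ∈ l.map Prod.snd then 1 else 0) ∧
    (∀ x ∈ l.map Prod.snd, ((entriesP l).ev s).wa .rep x = x) ∧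
    (∀ x ∈ l.map Prod.snd, ((entriesP l).ev s).na .q x =
      setCode (Q (Grigorchuk.ev x) (Grigorchuk.ev x))) ∧
    (∀ e ∈ l, ((entriesP l).ev s).wa .ent (key e.1) = e.2) ∧
    (∀ z, ((entriesP l).ev s).na .entF z = if z ∈ l.map (fun e => key e.1) then 1 else 0) ∧
    Frame [] s ((entriesP l).ev s) := by
  induction l with
  | nil =>
    rw [entriesP, ev_skip]
    exact ⟨fun x => by simp [h.done], by simp, by simp, by simp, fun z => by simp [h.entF],
      Frame.refl _ _⟩
  | cons e l ih =>
    obtain ⟨hn, hl⟩ := List.nodup_cons.1 hl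
    obtain ⟨h₁, h₂, h₃, h₄, h₅, h₆⟩ := ih hl
    obtain ⟨t, ht⟩ : ∃ t, t = (entriesP l).ev s := ⟨_, rfl⟩
    have e₁ : (entriesP (e :: l)).ev s = (entryP e).ev t := by rw [entriesP, ev_seq, ht]
    rw [← ht] at h₁ h₂ h₃ h₄ h₅ h₆
    rw [e₁]
    refine ⟨?_, ?_, ?_, ?_, ?_, h₆.trans ⟨?_, ?_, ?_, ?_⟩ (by simp)⟩
    · intro x
      have hm : x ∈ (e :: l).map Prod.snd ↔ x = e.2 ∨ x ∈ l.map Prod.snd := by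
        rw [List.map_cons, List.mem_cons]
      rw [if_congr hm rfl rfl]
      by_cases hx : x = e.2
      · simp [entryP, ev_wordP, WOp.eval, hx]
      · rw [if_congr (or_iff_right hx) rfl rfl, ← h₁]
        simp [entryP, ev_wordP, WOp.eval, hx]
    · intro x hx
      by_cases hxe : x = e.2
      · simp [entryP, ev_wordP, WOp.eval, hxe]
      · have := h₂ x (by simpa [hxe] using hx)
        simp [entryP, ev_wordP, WOp.eval, hxe, this]
    · intro x hx
      by_cases hxe : x = e.2
      · simp [entryP, ev_wordP, WOp.eval, hxe]
      · have := h₃ x (by simpa [hxe] using hx)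
        simp [entryP, ev_wordP, WOp.eval, hxe, this]
    · intro e' he'
      rcases List.mem_cons.1 he' with rfl | he'
      · simp [entryP, ev_wordP, WOp.eval]
      · have hne : key e'.1 ≠ key e.1 := fun h => hn (key_injective h ▸ List.mem_map_of_mem he')
        simp [entryP, ev_wordP, WOp.eval, hne, h₄ e' he']
    · intro z
      have hm : z ∈ (e :: l).map (fun e => key e.1) ↔
          z = key e.1 ∨ z ∈ l.map (fun e => key e.1) := by
        rw [List.map_cons, List.mem_cons]
      rw [if_congr hm rfl rfl]
      by_cases hz : z = key e.1
      · simp [entryP, ev_wordP, WOp.eval, hz]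
      · rw [if_congr (or_iff_right hz) rfl rfl, ← h₅]
        simp [entryP, ev_wordP, WOp.eval, hz]
    · intro x hx _
      have n₁ : x ≠ .rx := by rintro rfl; cases hx
      have n₂ : x ≠ .ry := by rintro rfl; cases hx
      simp [entryP, ev_wordP, WOp.eval, n₁, n₂]
    · intro a n₁ n₂
      simp [entryP, ev_wordP, WOp.eval, n₁, n₂]
    · intro a n₁ n₂ n₃
      simp [entryP, ev_wordP, WOp.eval, n₁, n₂, n₃]
    · simp [entryP, ev_wordP, WOp.eval]

theorem initialP_spec {s : WState} (h : Fresh s) :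
    Models Table.initial ((entriesP initialRows).ev s) ∧
      Frame [] s ((entriesP initialRows).ev s) := by
  obtain ⟨h₁, h₂, h₃, h₄, h₅, h₆⟩ := entriesP_spec h (l := initialRows) (by decide)
  have hm : ∀ x, x ∈ initialRows.map Prod.snd ↔ x.length ≤ 1 := by
    refine fun x => ⟨fun h => ?_, fun h => ?_⟩
    · simp only [initialRows, List.map_cons, List.map_nil, List.mem_cons, List.not_mem_nil,
        or_false] at h
      rcases h with rfl | rfl | rfl | rfl | rfl <;> simp
    · rcases length_le_one_cases h with rfl | rfl | rfl | rfl | rfl <;> decide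
  simp only [hm] at h₁ h₂ h₃
  have hrow : ∀ ℓ r, (ℓ, r) ∈ initialRows → Table.initial.rows ℓ = [r] := by
    intro ℓ r hr
    simp only [initialRows, List.mem_cons, List.not_mem_nil, or_false, Prod.mk.injEq] at hr
    rcases hr with ⟨rfl, rfl⟩ | ⟨rfl, rfl⟩ | ⟨rfl, rfl⟩ | ⟨rfl, rfl⟩ | ⟨rfl, rfl⟩ <;> rfl
  refine ⟨⟨?_, ?_, ?_, ?_, ?_⟩, h₆⟩
  · intro x
    rw [h₁]
    exact if_congr Table.done_initial.symm rfl rfl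
  · intro x hx
    have hx' := Table.done_initial.1 hx
    rw [h₂ x hx', Table.repD_eq (Table.rep_initial.2 ⟨hx', rfl⟩)]
  · intro x hx
    have hx' := Table.done_initial.1 hx
    rw [h₃ x hx']
    exact congrArg setCode (if_pos hx').symm
  · intro ℓ i hi
    rcases Table.rows_initial ℓ with hℓ | ⟨r, hℓ, hr⟩
    · simp [hℓ] at hi
    · simp only [hℓ] at hi ⊢
      obtain rfl : i = 0 := by simpa using hi
      exact h₄ _ hr
  · intro ℓ i
    rw [h₅]
    refine if_congr ⟨fun hz => ?_, fun hi => ?_⟩ rfl rfl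
    · obtain ⟨⟨ℓ', r⟩, he, hz⟩ := List.mem_map.1 hz
      obtain ⟨rfl, rfl⟩ := key_eq_num_key.1 hz.symm
      rw [hrow _ r he]
      simp
    · rcases Table.rows_initial ℓ with hℓ | ⟨r, hℓ, hr⟩
      · simp [hℓ] at hi
      · rw [hℓ] at hi
        obtain rfl : i = 0 := by simpa using hi
        exact List.mem_map.2 ⟨_, hr, rfl⟩

/-! ### Filling the table -/

/-- The first `i` words have been processed. -/
structure Filling (a : Word × Word) (L : List Word) (i : ℕ) (s : WState) : Prop where
  sorted : L.Pairwise ShortlexLT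
  mem : ∀ x, x ∈ L ↔ x ∈ labelList a
  data : Data L s
  input : HasInput a s
  listed : Listed L s
  out : s.out = []
  head : s.w .ri = num i
  models : Models ((L.take i).foldl (fun S w => Table.visit 3 w S) Table.initial) s
  table : Prefix (· ∈ L) (L.take i) ((L.take i).foldl (fun S w => Table.visit 3 w S) Table.initial)

theorem Frame.listed {T : List WReg} {s t : WState} {M : List Word} (h : Frame T s t)
    (hT : .rk ∉ T) (hl : Listed M s) : Listed M t :=
  ⟨(h.w _ rfl hT).trans hl.size, by rw [h.wa _ (by decide) (by decide)]; exact hl.get⟩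

theorem Frame.hasInput {T : List WReg} {s t : WState} {a : Word × Word} (h : Frame T s t)
    (hT : .ru ∉ T ∧ .rv ∉ T) (hi : HasInput a s) : HasInput a t :=
  ⟨(h.w _ rfl hT.1).trans hi.1, (h.w _ rfl hT.2).trans hi.2⟩

/-- Process the next word of the list. -/
noncomputable def nextP : WProg :=
  block [.op (.get .rw .queue .ri), .op (.push .ri .a), visitP [.v₁, .v₂] .rw]

theorem exists_filling_step : ∃ c, ∀ {a L i s}, Filling a L i s → ∀ hi : i < L.length,
    Filling a L (i + 1) (nextP.ev s) ∧ nextP.cost s ≤ c * (L[i].length + 1) := by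
  obtain ⟨c, hc⟩ := visitP_spec [.v₁, .v₂] .rw (by decide) (by decide)
  refine ⟨c + 3, fun {a L i s} h hi => ?_⟩
  have hcl : SplitClosed L := ⟨fun w hw => reduced_of_mem_labelList ((h.mem w).1 hw),
    fun w hw c hc => (h.mem c).2 (children_mem_labelList ((h.mem w).1 hw) c hc)⟩
  obtain ⟨S, hS⟩ : ∃ S, S = (L.take i).foldl (fun S w => Table.visit 3 w S) Table.initial :=
    ⟨_, rfl⟩
  have hM := h.models
  have hP := h.table
  rw [← hS] at hM hP
  obtain ⟨t, ht⟩ : ∃ t, t = (s.setW .rw L[i]).setW .ri (num (i + 1)) := ⟨_, rfl⟩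
  have f : Frame [.rw, .ri] s t := by
    refine ⟨fun x _ hx => ?_, fun _ _ _ => by rw [ht]; rfl, fun _ _ _ _ => by rw [ht]; rfl,
      by rw [ht]; rfl⟩
    simp only [List.mem_cons, List.not_mem_nil, or_false, not_or] at hx
    simp [ht, hx]
  have eL : L = L.take i ++ L[i] :: L.drop (i + 1) := by
    rw [List.cons_getElem_drop_succ, List.take_append_drop]
  have hR : ∀ x, x ∈ L ↔ x ∈ L.take i ++ L[i] :: L.drop (i + 1) := fun x => by rw [← eL]
  have hs : (L.take i ++ L[i] :: L.drop (i + 1)).Pairwise fun x y => x.length ≤ y.length := by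
    rw [← eL]
    exact h.sorted.imp ShortlexLT.length_le
  have hL : L[i] ∈ L := List.getElem_mem hi
  have hdepth := (hcl.reduced _ hL).depth
  obtain ⟨a₁, a₂, a₃⟩ := hc hcl (s := t) (hM.congr (by rw [ht]; rfl) (by rw [ht]; rfl))
    (f.data h.data) (hP.stage hR hs) hL (by simp [ht]) hdepth (by decide)
  have e₁ : (WOp.get .rw .queue .ri).eval s = s.setW .rw L[i] := by
    rw [WOp.eval, h.head, h.listed.get i hi]
  have e₂ : (WOp.push .ri .a).eval (s.setW .rw L[i]) = t := by
    simp [WOp.eval, ht, h.head, num_succ]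
  have e₃ : (L.take (i + 1)).foldl (fun S w => Table.visit 3 w S) Table.initial =
      Table.visit 3 L[i] S := by
    rw [List.take_succ_eq_append_getElem hi, List.foldl_append, ← hS]
    rfl
  have f' : Frame [.rw, .ri, .v₁, .v₂] s ((visitP [.v₁, .v₂] .rw).ev t) := by
    refine (f.trans (Frame.refl [.rw, .ri, .v₁, .v₂] t) (by simp)).trans
      ⟨fun x hx hx' => a₂.w x hx ?_, a₂.wa, a₂.na, a₂.out⟩ fun _ => id
    simp at hx' ⊢
    tauto
  constructor
  · simp only [nextP, ev_block_cons, ev_block_nil, ev_op, e₁, e₂]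
    refine ⟨h.sorted, h.mem, f'.data h.data, f'.hasInput (by decide) h.input,
      f'.listed (by decide) h.listed, f'.out.trans h.out, ?_, ?_, ?_⟩
    · rw [a₂.w _ rfl (by decide), ht]
      simp
    · rw [e₃]
      exact a₁
    · rw [e₃, List.take_succ_eq_append_getElem hi]
      exact (hP.visit hcl.children hR hs hdepth).1
  · simp only [nextP, cost_block_cons, cost_block_nil, cost_op, ev_op, e₁, e₂]
    rw [Nat.add_mul]
    linarith only [a₃, Nat.zero_le L[i].length]

theorem sum_range_cells (c : ℕ) (L : List Word) :
    ∑ i ∈ Finset.range L.length, (c * ((L.getD i []).length + 1) + 1) + 1 ≤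
      (c + 1) * cells L + 1 := by
  induction L with
  | nil => simp
  | cons w L ih =>
    rw [List.length_cons, Finset.sum_range_succ', cells_cons]
    simp only [List.getD_cons_succ, List.getD_cons_zero]
    rw [Nat.mul_add (c + 1)]
    have : c * (w.length + 1) + 1 ≤ (c + 1) * (w.length + 1) := by
      rw [Nat.add_mul]
      omega
    omega

/-- Make the table. -/
noncomputable def fillP : WProg :=
  block [entriesP initialRows, .op (.nil .ri), times .rk nextP]

/-- Each word takes time proportional to its length, so that the total time is `O(cells L)`. -/
theorem reaches_fillP : Reaches inputSize (fillP.compile 0) (fun a s => ∃ L, Sorted a L s)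
    (fun a s => ∃ L, Filling a L L.length s) := by
  obtain ⟨c, hc⟩ := exists_filling_step
  obtain ⟨C, hC⟩ := cells_labelList
  refine Reaches.of_ev _ ((entriesP initialRows).maxCost + (c + 1) * C + 3) ?_
  rintro a s ⟨L, h⟩
  obtain ⟨h₁, h₂⟩ := initialP_spec h.collected.fresh
  obtain ⟨t, ht⟩ : ∃ t, t = ((entriesP initialRows).ev s).setW .ri [] := ⟨_, rfl⟩
  have f : Frame [.ri] s t := by
    refine h₂.trans ⟨fun x _ hx => ?_, fun _ _ _ => by rw [ht]; rfl,
      fun _ _ _ _ => by rw [ht]; rfl, by rw [ht]; rfl⟩ (by simp)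
    rw [ht, WState.setW_w, if_neg (by simpa using hx)]
  have h0 : Filling a L 0 t := ⟨h.sorted, h.collected.mem, f.data h.collected.data,
    f.hasInput (by decide) h.collected.input, f.listed (by decide) h.listed,
    f.out.trans h.collected.fresh.out, by simp [ht, num], by
      rw [List.take_zero]
      exact h₁.congr (by rw [ht]; rfl) (by rw [ht]; rfl), by
      rw [List.take_zero]
      exact Prefix.initial fun x hx => (h.collected.mem x).2 (mem_labelList.2 (.inr (.inr hx)))⟩
  have hk : (t.w .rk).length = L.length := by rw [h0.listed.size, length_num]
  obtain ⟨r₁, r₂⟩ := times_spec (x := .rk) (p := nextP) (Filling a L)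
    (fun i => c * ((L.getD i []).length + 1)) h0 fun i hi t' ht' => by
      have hi' : i < L.length := hk ▸ hi
      rw [List.getD_eq_getElem _ _ hi']
      exact hc ht' hi'
  rw [hk] at r₁ r₂
  simp only [fillP, ev_block_cons, ev_block_nil, ev_op, WOp.eval, cost_block_cons, cost_block_nil,
    cost_op, ← ht]
  refine ⟨⟨L, r₁⟩, ?_⟩
  have l₁ := (flat_entriesP initialRows).cost_le s
  have l₂ := sum_range_cells c L
  have l₃ : cells L ≤ C * inputSize a :=
    (cells_le_of_nodup h.collected.nodup fun x hx => (h.collected.mem x).1 hx).trans (hC a)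
  have l₄ := Nat.mul_le_mul_left (c + 1) l₃
  have l₅ := one_le_inputSize a
  have l₆ := Nat.le_mul_of_pos_right (entriesP initialRows).maxCost l₅
  rw [← Nat.mul_assoc] at l₄
  rw [Nat.add_mul, Nat.add_mul]
  linarith only [r₂, l₁, l₂, l₄, l₅, l₆]

end Grigorchuk


namespace Grigorchuk

open RAM
open WProg hiding ev cost

attribute [local irreducible] WProg.ev WProg.cost

/-! ### Writing the output -/

/-- The program writes `l`, using registers for temporary use and the register `rw` only. -/
structure Emits (l : List ℕ) (s t : WState) : Prop where
  out : t.out = s.out ++ l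
  w : ∀ x, isTemp x = false → t.w x = s.w x
  wa : t.wa = s.wa
  na : t.na = s.na

theorem Emits.trans {l l' : List ℕ} {s t t' : WState} (h : Emits l s t) (h' : Emits l' t t') :
    Emits (l ++ l') s t' :=
  ⟨by rw [h'.out, h.out, List.append_assoc], fun x hx => (h'.w x hx).trans (h.w x hx),
    h'.wa.trans h.wa, h'.na.trans h.na⟩

theorem Emits.setW (s : WState) {x : WReg} (hx : isTemp x = true) (u : Word) :
    Emits [] s (s.setW x u) := by
  refine ⟨by simp, fun y hy => ?_, rfl, rfl⟩
  rw [WState.setW_w, if_neg]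
  rintro rfl
  rw [hx] at hy
  cases hy

/-- Write the code of a word. -/
def writeP (X : WReg) : WProg :=
  block [.each X fun ℓ => block [.op (.const .nf ℓ.code), .op (.write .nf)], .op (.const .nf 0),
    .op (.write .nf)]

theorem writeP_spec (X : WReg) (s : WState) : Emits (encodeWord (s.w X)) s ((writeP X).ev s) ∧
    ((writeP X).ev s).w = s.w := by
  have key : ∀ (l : Word) (s : WState), Emits (l.map Letter.code) s
      (l.foldl (fun s ℓ => (block [.op (.const .nf ℓ.code), .op (.write .nf)]).ev s) s) ∧
      (l.foldl (fun s ℓ => (block [.op (.const .nf ℓ.code), .op (.write .nf)]).ev s) s).w =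
        s.w := by
    intro l
    induction l with
    | nil => exact fun s => ⟨⟨by simp, fun _ _ => rfl, rfl, rfl⟩, rfl⟩
    | cons ℓ l ih =>
      intro s
      obtain ⟨h₁, h₂⟩ := ih ((block [.op (.const .nf ℓ.code), .op (.write .nf)]).ev s)
      have h : Emits [ℓ.code] s ((block [.op (.const .nf ℓ.code), .op (.write .nf)]).ev s) ∧
          ((block [.op (.const .nf ℓ.code), .op (.write .nf)]).ev s).w = s.w := by
        simp only [ev_block_cons, ev_block_nil, ev_op, WOp.eval]
        exact ⟨⟨by simp, fun _ _ => rfl, rfl, rfl⟩, rfl⟩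
      exact ⟨h.1.trans h₁, h₂.trans h.2⟩
  obtain ⟨h₁, h₂⟩ := key (s.w X) s
  rw [← ev_each] at h₁ h₂
  rw [writeP, ev_block_cons]
  obtain ⟨t, ht⟩ : ∃ t, t = (each X fun ℓ =>
    block [.op (.const .nf ℓ.code), .op (.write .nf)]).ev s := ⟨_, rfl⟩
  rw [← ht] at h₁ h₂ ⊢
  have h : Emits [0] t ((block [.op (.const .nf 0), .op (.write .nf)]).ev t) := by
    simp only [ev_block_cons, ev_block_nil, ev_op, WOp.eval]
    exact ⟨by simp, fun _ _ => rfl, rfl, rfl⟩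
  refine ⟨h₁.trans h, ?_⟩
  simp only [ev_block_cons, ev_block_nil, ev_op, WOp.eval]
  exact h₂

theorem exists_cost_writeP (X : WReg) :
    ∃ c, ∀ s, (writeP X).cost s ≤ c * ((s.w X).length + 1) := by
  obtain ⟨c, hc⟩ := exists_cost_each (x := X)
    (f := fun ℓ => block [.op (.const .nf ℓ.code), .op (.write .nf)])
    fun _ => ⟨trivial, trivial, trivial⟩
  refine ⟨c + 3, fun s => ?_⟩
  have := hc s
  simp only [writeP, cost_block_cons, cost_block_nil, cost_op]
  rw [Nat.add_mul]
  linarith only [this, Nat.zero_le (s.w X).length]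

/-- Write a number that is stored at the address in `X`. -/
def writeNP (b : NArr) (X : WReg) : WProg := block [.op (.nget .nf b X), .op (.write .nf)]

theorem writeNP_spec (b : NArr) (X : WReg) (s : WState) :
    Emits [s.na b (s.w X)] s ((writeNP b X).ev s) ∧ ((writeNP b X).ev s).w = s.w := by
  simp only [writeNP, ev_block_cons, ev_block_nil, ev_op, WOp.eval]
  exact ⟨⟨by simp, fun _ _ => rfl, rfl, rfl⟩, rfl⟩

/-- Write a word that is stored at the address in `rw`. -/
def writeWP (a : WArr) : WProg := block [.op (.get .rx a .rw), writeP .rx]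

theorem writeWP_spec (a : WArr) (s : WState) :
    Emits (encodeWord (s.wa a (s.w .rw))) s ((writeWP a).ev s) := by
  have h := (writeP_spec .rx (s.setW .rx (s.wa a (s.w .rw)))).1
  rw [WState.setW_w, if_pos rfl] at h
  simp only [writeWP, ev_block_cons, ev_block_nil, ev_op, WOp.eval]
  exact (Emits.setW s rfl _).trans h

theorem exists_cost_writeWP (a : WArr) :
    ∃ c, ∀ s, (writeWP a).cost s ≤ c * ((s.wa a (s.w .rw)).length + 1) := by
  obtain ⟨c, hc⟩ := exists_cost_writeP .rx
  refine ⟨c + 2, fun s => ?_⟩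
  have := hc (s.setW .rx (s.wa a (s.w .rw)))
  rw [WState.setW_w, if_pos rfl] at this
  simp only [writeWP, cost_block_cons, cost_block_nil, cost_op, ev_op, WOp.eval]
  rw [Nat.add_mul]
  linarith only [this, Nat.zero_le (s.wa a (s.w .rw)).length]

/-- Write the data for the word in `rw`. -/
def recordP : WProg :=
  block [writeP .rw, writeNP .kap .rw, writeWP .ch₀, .op (.nget .par .par .rw),
    .caseN .par 1 fun _ => writeWP .ch₁, writeWP .rep, writeNP .q .rw]

theorem exists_recordP_spec : ∃ c, ∀ {L : List Word} {S : Table} {s : WState} {w : Word},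
    S.Good → Models S s → Data L s → w ∈ L → Reduced w → S.Done w → s.w .rw = w →
    Emits (recordOf cosetCode setCode S w) s (recordP.ev s) ∧
      recordP.cost s ≤ c * (w.length + 1) := by
  obtain ⟨c₁, h₁⟩ := exists_cost_writeP .rw
  obtain ⟨c₂, h₂⟩ := exists_cost_writeWP .ch₀
  obtain ⟨c₃, h₃⟩ := exists_cost_writeWP .ch₁
  obtain ⟨c₄, h₄⟩ := exists_cost_writeWP .rep
  refine ⟨c₁ + c₂ + c₃ + c₄ + 20, fun {L S s w} hS hM hd hL hred hdone hw => ?_⟩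
  have emits_get : ∀ {l t}, Emits l s t → Emits l s ((WOp.nget .par .par .rw).eval t) :=
    fun h => ⟨h.out, h.w, h.wa, h.na⟩
  obtain ⟨t₁, e₁⟩ : ∃ t, t = (writeP .rw).ev s := ⟨_, rfl⟩
  have g₁ := (writeP_spec .rw s).1
  rw [← e₁, hw] at g₁
  obtain ⟨t₂, e₂⟩ : ∃ t, t = (writeNP .kap .rw).ev t₁ := ⟨_, rfl⟩
  have g₂ := (writeNP_spec .kap .rw t₁).1
  rw [← e₂, g₁.w _ rfl, g₁.na, hw, hd.kap w hL] at g₂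
  have g₂ := g₁.trans g₂
  obtain ⟨t₃, e₃⟩ : ∃ t, t = (writeWP .ch₀).ev t₂ := ⟨_, rfl⟩
  have g₃ := writeWP_spec .ch₀ t₂
  have l₃ := h₂ t₂
  rw [← e₃, g₂.w _ rfl, g₂.wa, hw, hd.ch₀ w hL] at g₃
  rw [g₂.w _ rfl, g₂.wa, hw, hd.ch₀ w hL] at l₃
  have g₃ := g₂.trans g₃
  obtain ⟨t₄, e₄⟩ : ∃ t, t = (WOp.nget .par .par .rw).eval t₃ := ⟨_, rfl⟩
  have g₄ := emits_get g₃
  rw [← e₄] at g₄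
  have hpar : t₄.n .par = parity w := by
    rw [e₄, WOp.eval, WState.setN_n, if_pos rfl, g₃.na, g₃.w _ rfl, hw, hd.par w hL]
  obtain ⟨t₅, e₅⟩ : ∃ t, t = (caseN .par 1 fun _ => writeWP .ch₁).ev t₄ := ⟨_, rfl⟩
  have hl : ∀ c ∈ children w, c.length ≤ w.length := fun c hc => hred.length_child_le hc
  have g₅ : Emits (encodeWord w ++ [cosetCode (coset w)] ++ (children w).flatMap encodeWord) s t₅ ∧
      (caseN .par 1 fun _ => writeWP .ch₁).cost t₄ ≤ c₃ * (w.length + 1) + 1 := by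
    rw [e₅, ev_caseN, hpar, cost_caseN, hpar]
    by_cases he : EvenA w
    · have h := writeWP_spec .ch₁ t₄
      have l := h₃ t₄
      rw [g₄.w _ rfl, g₄.wa, hw, hd.ch₁ w hL] at h l
      rw [parity, if_pos he, if_pos (by decide), if_pos (by decide)]
      constructor
      · have := g₄.trans h
        simpa [children_even he, child₀, child₁, he] using this
      · have := Nat.mul_le_mul_left c₃ (Nat.add_le_add_right
          (hl _ (mem_children.2 (.inr (rfl : child₁ w = child₁ w)))) 1)
        omega
    · rw [parity, if_neg he, if_neg (by decide), if_neg (by decide)]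
      constructor
      · simpa [children_odd he, child₀, he] using g₄
      · omega
  obtain ⟨g₅, l₅⟩ := g₅
  obtain ⟨t₆, e₆⟩ : ∃ t, t = (writeWP .rep).ev t₅ := ⟨_, rfl⟩
  have g₆ := writeWP_spec .rep t₅
  have l₆ := h₄ t₅
  rw [← e₆, g₅.w _ rfl, g₅.wa, hw, hM.rep hdone] at g₆
  rw [g₅.w _ rfl, g₅.wa, hw, hM.rep hdone] at l₆
  have g₆ := g₅.trans g₆
  have g₇ := (writeNP_spec .q .rw t₆).1
  rw [g₆.w _ rfl, g₆.na, hw, hM.q hdone] at g₇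
  simp only [recordP, ev_block_cons, ev_block_nil, ev_op, cost_block_cons, cost_block_nil, cost_op]
  rw [← e₁, ← e₂, ← e₃, ← e₄, ← e₅, ← e₆]
  refine ⟨g₆.trans g₇, ?_⟩
  have l₁ := h₁ s
  rw [hw] at l₁
  have k₃ := Nat.mul_le_mul_left c₂ (Nat.add_le_add_right
    (hl _ (mem_children.2 (.inl (rfl : child₀ w = child₀ w)))) 1)
  have k₆ := Nat.mul_le_mul_left c₄ (Nat.add_le_add_right
    (hS.rep_spec hdone.rep_eq).2.2.2 1)
  have n₁ : ∀ b t, (writeNP b .rw).cost t = 3 := fun b t => by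
    simp [writeNP]
  rw [n₁, n₁]
  simp only [Nat.add_mul _ _ (w.length + 1)]
  linarith only [l₁, l₃, l₅, l₆, k₃, k₆, Nat.zero_le w.length]

/-- The table has been filled and the data for the first `i` words have been written. -/
structure Printing (a : Word × Word) (L : List Word) (i : ℕ) (s : WState) : Prop where
  sorted : L.Pairwise ShortlexLT
  mem : ∀ x, x ∈ L ↔ x ∈ labelList a
  data : Data L s
  input : HasInput a s
  listed : Listed L s
  head : s.w .ri = num i
  models : Models (fillTable L) s
  table : Prefix (· ∈ L) L (fillTable L)
  out : s.out = record cosetCode setCode (fillTable L) (L.take i)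

theorem Filling.printing {a : Word × Word} {L : List Word} {s : WState}
    (h : Filling a L L.length s) : Printing a L 0 (s.setW .ri []) := by
  have hM := h.models
  have hT := h.table
  rw [List.take_length] at hM hT
  exact ⟨h.sorted, h.mem, h.data.congr (fun _ _ _ => rfl) rfl,
    ⟨by simpa using h.input.1, by simpa using h.input.2⟩, ⟨by simpa using h.listed.size,
    h.listed.get⟩, by simp [num], hM.congr rfl rfl, hT, h.out⟩

/-- Write the data for the next word of the list. -/
def printP : WProg := block [.op (.get .rw .queue .ri), .op (.push .ri .a), recordP]

theorem exists_printing_step : ∃ c, ∀ {a L i s}, Printing a L i s → ∀ hi : i < L.length,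
    Printing a L (i + 1) (printP.ev s) ∧ printP.cost s ≤ c * (L[i].length + 1) := by
  obtain ⟨c, hc⟩ := exists_recordP_spec
  refine ⟨c + 3, fun {a L i s} h hi => ?_⟩
  obtain ⟨t, ht⟩ : ∃ t, t = (s.setW .rw L[i]).setW .ri (num (i + 1)) := ⟨_, rfl⟩
  have hwa : t.wa = s.wa := by rw [ht]; rfl
  have hna : t.na = s.na := by rw [ht]; rfl
  have hL : L[i] ∈ L := List.getElem_mem hi
  obtain ⟨a₁, a₂⟩ := hc h.table.good (s := t) (h.models.congr hwa hna)
    (h.data.congr (fun _ _ _ => by rw [hwa]) hna) hL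
    (reduced_of_mem_labelList ((h.mem _).1 hL)) (h.table.mem _ hL) (by simp [ht])
  have e₁ : (WOp.get .rw .queue .ri).eval s = s.setW .rw L[i] := by
    rw [WOp.eval, h.head, h.listed.get i hi]
  have e₂ : (WOp.push .ri .a).eval (s.setW .rw L[i]) = t := by
    simp [WOp.eval, ht, h.head, num_succ]
  have ew : ∀ x, isTemp x = false → x ≠ .rw → x ≠ .ri → (recordP.ev t).w x = s.w x :=
    fun x hx n₁ n₂ => by rw [a₁.w x hx]; simp [ht, n₁, n₂]
  have ewa := a₁.wa.trans hwa
  have ena := a₁.na.trans hna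
  constructor
  · simp only [printP, ev_block_cons, ev_block_nil, ev_op, e₁, e₂]
    refine ⟨h.sorted, h.mem, h.data.congr (fun _ _ _ => by rw [ewa]) ena,
      ⟨(ew _ rfl (by decide) (by decide)).trans h.input.1,
        (ew _ rfl (by decide) (by decide)).trans h.input.2⟩,
      ⟨(ew _ rfl (by decide) (by decide)).trans h.listed.size, by rw [ewa]; exact h.listed.get⟩,
      ?_, h.models.congr ewa ena, h.table, ?_⟩
    · rw [a₁.w _ rfl, ht]
      simp
    · have eo : t.out = s.out := by rw [ht]; rfl
      rw [a₁.out, eo, h.out, List.take_succ_eq_append_getElem hi, record, record,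
        List.flatMap_append, List.flatMap_singleton]
  · simp only [printP, cost_block_cons, cost_block_nil, cost_op, ev_op, e₁, e₂]
    rw [Nat.add_mul]
    linarith only [a₂, Nat.zero_le L[i].length]

/-- Write the data and compute the answer. -/
def outputP : WProg :=
  block [.op (.nil .ri), times .rk printP, .op (.get .rx .rep .ru), .op (.get .ry .rep .rv),
    .ifEq .rx .ry (.op (.const .res 1)) (.op (.const .res 0))]

/-- The result of the computation. -/
structure Answered (a : Word × Word) (L : List Word) (s : WState) : Prop where
  sorted : L.Pairwise ShortlexLT
  mem : ∀ x, x ∈ L ↔ x ∈ labelList a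
  table : Prefix (· ∈ L) L (fillTable L)
  out : s.out = record cosetCode setCode (fillTable L) L
  yes : (fillTable L).rep (red a.1) = (fillTable L).rep (red a.2) → s.n .res = 1
  no : (fillTable L).rep (red a.1) ≠ (fillTable L).rep (red a.2) → s.n .res = 0

theorem red_mem_labelList (a : Word × Word) : red a.1 ∈ labelList a ∧ red a.2 ∈ labelList a :=
  ⟨mem_labelList.2 (.inl (tree a.1).root_mem), mem_labelList.2 (.inr (.inl (tree a.2).root_mem))⟩

theorem reaches_outputP : Reaches inputSize (outputP.compile 0)
    (fun a s => ∃ L, Filling a L L.length s) (fun a s => ∃ L, Answered a L s) := by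
  obtain ⟨c, hc⟩ := exists_printing_step
  obtain ⟨C, hC⟩ := cells_labelList
  refine Reaches.of_ev _ ((c + 1) * C + 8) ?_
  rintro a s ⟨L, h⟩
  have h0 := h.printing
  have hk : ((s.setW .ri []).w .rk).length = L.length := by rw [h0.listed.size, length_num]
  obtain ⟨r₁, r₂⟩ := times_spec (x := .rk) (p := printP) (Printing a L)
    (fun i => c * ((L.getD i []).length + 1)) h0 fun i hi t' ht' => by
      have hi' : i < L.length := hk ▸ hi
      rw [List.getD_eq_getElem _ _ hi']
      exact hc ht' hi'
  rw [hk] at r₁ r₂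
  obtain ⟨t, ht⟩ : ∃ t, t = (times .rk printP).ev (s.setW .ri []) := ⟨_, rfl⟩
  rw [← ht] at r₁
  have hu := r₁.table.mem _ ((r₁.mem _).2 (red_mem_labelList a).1)
  have hv := r₁.table.mem _ ((r₁.mem _).2 (red_mem_labelList a).2)
  have er : (fillTable L).rep (red a.1) = (fillTable L).rep (red a.2) ↔
      (fillTable L).repD (red a.1) = (fillTable L).repD (red a.2) := by
    rw [hu.rep_eq, hv.rep_eq, Option.some_inj]
  have eo := r₁.out
  rw [List.take_length] at eo
  constructor
  · refine ⟨L, ?_⟩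
    simp only [outputP, ev_block_cons, ev_block_nil, ev_op, WOp.eval, ← ht, ev_ifEq]
    simp only [WState.setW_w, WState.setW_wa, r₁.input.1, r₁.input.2, r₁.models.rep hu,
      r₁.models.rep hv, reduceCtorEq, if_false, if_true, ← er]
    by_cases hr : (fillTable L).rep (red a.1) = (fillTable L).rep (red a.2)
    · rw [if_pos hr]
      exact ⟨r₁.sorted, r₁.mem, r₁.table, eo, fun _ => by simp, fun h => absurd hr h⟩
    · rw [if_neg hr]
      exact ⟨r₁.sorted, r₁.mem, r₁.table, eo, fun h => absurd h hr, fun _ => by simp⟩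
  · have l₀ : ∀ t, (WProg.ifEq .rx .ry (.op (.const .res 1)) (.op (.const .res 0))).cost t ≤ 2 :=
      Flat.cost_le (p := WProg.ifEq .rx .ry (.op (.const .res 1)) (.op (.const .res 0)))
        ⟨trivial, trivial⟩
    simp only [outputP, cost_block_cons, cost_block_nil, cost_op, ev_op]
    have l₁ := l₀ ((WOp.get .ry .rep .rv).eval ((WOp.get .rx .rep .ru).eval
      ((times .rk printP).ev ((WOp.nil .ri).eval s))))
    rw [WOp.eval] at l₁ ⊢
    have l₂ := sum_range_cells c L
    have l₃ : cells L ≤ C * inputSize a := (cells_le_of_nodup (h.sorted.imp ShortlexLT.ne)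
      fun x hx => (h.mem x).1 hx).trans (hC a)
    have l₄ := Nat.mul_le_mul_left (c + 1) l₃
    have l₅ := one_le_inputSize a
    rw [← Nat.mul_assoc] at l₄
    rw [Nat.add_mul]
    linarith only [r₂, l₁, l₂, l₄, l₅]

end Grigorchuk


namespace Grigorchuk

open RAM

/-! ### The conjugacy problem -/

/-- The whole algorithm on the random access machine. Register `4` is set to the first free
address of the memory. -/
noncomputable def conjugacyP : Prog :=
  .seq (.const 4 width) <| .seq
    (.seq inputP <| .seq collectP <| .seq sortP <| .seq (fillP.compile 0) (outputP.compile 0))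
    (.move 0 (nr .res))

theorem exists_exec_conjugacyP : ∃ C, ∀ a : Word × Word, ∃ (L : List Word) (σ : State) (t : ℕ),
    Exec conjugacyP (State.init (encodePair a)) σ t ∧ t ≤ C * inputSize a ∧
      L.Pairwise ShortlexLT ∧ (∀ x, x ∈ L ↔ x ∈ labelList a) ∧ Prefix (· ∈ L) L (fillTable L) ∧
      σ.out = record cosetCode setCode (fillTable L) L ∧
      ((fillTable L).rep (red a.1) = (fillTable L).rep (red a.2) → σ.reg 0 = 1) ∧
      ((fillTable L).rep (red a.1) ≠ (fillTable L).rep (red a.2) → σ.reg 0 = 0) := by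
  obtain ⟨C, hC⟩ := reaches_inputP.seq (reaches_collectP.seq (reaches_sortP.seq
    (reaches_fillP.seq reaches_outputP)))
  refine ⟨C + 2, fun a => ?_⟩
  obtain ⟨E, s, σ, hr, ⟨L, h⟩, t, ht, hx⟩ := hC a (rep_init (encodePair a)) rfl
  refine ⟨L, _, _, .seq (.const _ _ _) (.seq hx (.move _ _ _)), ?_, h.sorted, h.mem, h.table,
    hr.out.trans h.out, fun hy => ?_, fun hn => ?_⟩
  · have := one_le_inputSize a
    rw [Nat.add_mul]
    omega
  · rw [State.set_reg_self, hr.reg_n, h.yes hy]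
  · rw [State.set_reg_self, hr.reg_n, h.no hn]

/-- The program computes the table in linear time, and the table is correct. -/
theorem exec_conjugacyP_spec : ∃ C, ∀ u v : Word,
    ∃ (Tu : SplittingTree (red u)) (Tv : SplittingTree (red v)) (L : List Word)
      (σ : State) (t : ℕ),
      IsSortedLabelList Tu Tv L ∧
      Exec conjugacyP (State.init (encodePair (u, v))) σ t ∧
      t ≤ C * (u.length + v.length + 1) ∧
      σ.out = record cosetCode setCode (fillTable L) L ∧
      ((fillTable L).rep (red u) = (fillTable L).rep (red v) → σ.reg 0 = 1) ∧
      ((fillTable L).rep (red u) ≠ (fillTable L).rep (red v) → σ.reg 0 = 0) ∧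
      (∀ w ∈ L, ∃ r ∈ L, (fillTable L).rep w = some r ∧ IsConj (ev w) (ev r) ∧
        (fillTable L).q w = Q (ev w) (ev r)) ∧
      (∀ w ∈ L, ∀ w' ∈ L,
        (fillTable L).rep w = (fillTable L).rep w' ↔ IsConj (ev w) (ev w')) ∧
      ((fillTable L).rep (red u) = (fillTable L).rep (red v) ↔ IsConj (ev u) (ev v)) := by
  obtain ⟨C, hC⟩ := exists_exec_conjugacyP
  refine ⟨C, fun u v => ?_⟩
  obtain ⟨L, σ, t, hx, ht, hs, hm, hT, hout, hy, hn⟩ := hC (u, v)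
  have hconj : ∀ w ∈ L, ∀ w' ∈ L,
      ((fillTable L).rep w = (fillTable L).rep w' ↔ IsConj (ev w) (ev w')) :=
    fun w hw w' hw' => hT.good.rep_eq_iff (hT.mem w hw) (hT.mem w' hw')
  refine ⟨tree u, tree v, L, σ, t, ⟨hs, fun w => (hm w).trans mem_labelList⟩, hx, ht, hout, hy,
    hn, fun w hw => ?_, hconj, ?_⟩
  · have hr := (hT.mem w hw).rep_eq
    obtain ⟨h₁, h₂, h₃, -⟩ := hT.good.rep_spec hr
    exact ⟨_, hT.sub _ (Table.done_of_rep h₁), hr, h₂, h₃⟩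
  · have := hconj _ ((hm _).2 (red_mem_labelList (u, v)).1) _
      ((hm _).2 (red_mem_labelList (u, v)).2)
    rwa [ev_red, ev_red] at this

end Grigorchuk

open Grigorchuk RAM in
theorem mainTheorem2 :
    (∃ (κ : Γ ⧸ K → ℕ) (χ : Set (Γ ⧸ K) → ℕ) (P : Prog) (C : ℕ),
      Function.Injective κ ∧ Function.Injective χ ∧
      ∀ u v : Word,
        ∃ (Tu : SplittingTree (red u)) (Tv : SplittingTree (red v)) (L : List Word)
          (σ : State) (t : ℕ),
          IsSortedLabelList Tu Tv L ∧
          Exec P (State.init (encodePair (u, v))) σ t ∧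
          t ≤ C * (u.length + v.length + 1) ∧
          σ.out = record κ χ (fillTable L) L ∧
          ((fillTable L).rep (red u) = (fillTable L).rep (red v) → σ.reg 0 = 1) ∧
          ((fillTable L).rep (red u) ≠ (fillTable L).rep (red v) → σ.reg 0 = 0) ∧
          (∀ w ∈ L, ∃ r ∈ L, (fillTable L).rep w = some r ∧ IsConj (ev w) (ev r) ∧
            (fillTable L).q w = Q (ev w) (ev r)) ∧
          (∀ w ∈ L, ∀ w' ∈ L,
            (fillTable L).rep w = (fillTable L).rep w' ↔ IsConj (ev w) (ev w')) ∧
          ((fillTable L).rep (red u) = (fillTable L).rep (red v) ↔ IsConj (ev u) (ev v))) ∧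
    LinearTimeDecidable encodePair (fun p => p.1.length + p.2.length)
      (fun p => IsConj (ev p.1) (ev p.2)) ∧
    LinearTimeDecidable encodeWord List.length (fun w => ev w = 1) := by
  obtain ⟨C, hC⟩ := exec_conjugacyP_spec
  have hdec : ∀ u v : Word, ∃ (σ : State) (t : ℕ),
      Exec conjugacyP (State.init (encodePair (u, v))) σ t ∧ t ≤ C * (u.length + v.length + 1) ∧
        (IsConj (ev u) (ev v) → σ.reg 0 = 1) ∧ (¬ IsConj (ev u) (ev v) → σ.reg 0 = 0) := by
    intro u v
    obtain ⟨_, _, L, σ, t, -, hx, ht, -, hy, hn, -, -, h⟩ := hC u v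
    exact ⟨σ, t, hx, ht, fun hc => hy (h.2 hc), fun hc => hn (mt h.1 hc)⟩
  refine ⟨⟨cosetCode, setCode, conjugacyP, C, cosetCode_injective, setCode_injective, hC⟩,
    ⟨conjugacyP, C, fun p => hdec p.1 p.2⟩, ⟨conjugacyP, C, fun w => ?_⟩⟩
  -- The code of the word `w` is also the code of the pair `(w, ε)`.
  obtain ⟨σ, t, hx, ht, hy, hn⟩ := hdec w []
  have hw : IsConj (ev w) (ev []) ↔ ev w = 1 := by
    rw [show ev [] = 1 from rfl]
    exact isConj_comm.trans isConj_one_right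
  rw [hw] at hy hn
  rw [encodePair, List.map_nil, List.append_nil] at hx
  exact ⟨σ, t, hx, ht, hy, hn⟩
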